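/- Let $(Q,\mathfrak n,k)$ be a regular local ring, $I\subseteq \mathfrak n^2$ an ideal, $R=Q/I$ with maximal ideal $\mathfrak m$, and let $A\xrightarrow{\simeq}R$ be the minimal free resolution of $R$ over $Q$, with $A_0=Q$. Definitions. For $S\in\{Q,R\}$ and a finitely generated $R$-module $M$ put $P^S_M(t)=\sum_{n\ge 0}\dim_k\operatorname{Tor}^S_n(M,k)\,t^n$. The *Golod bound* for $M$ is the coefficientwise inequality $$P^R_M(t)\preccurlyeq \frac{P^Q_M(t)}{1-t\,(P^Q_R(t)-1)} .\qquad(\ast)$$ A finitely generated $R$-module $M$ is *Golod* if $(\ast)$ is an equality, and $R$ is *Golod* if $k$ is a Golod module. Let $A_+=A_{\ge 1}$, let $A_+[1]$ be its shift ($A_+[1]_n=(A_+)_{n-1}$, with differential $-d^A$), and let $\otimes=\otimes_Q$. An *$A_\infty$-algebra structure* on $A$ is a sequence of $Q$-linear maps $m_n\colon A_+[1]^{\otimes n}\to A_+[1]$, $n\ge 1$, of degree $-1$, such that $m_1=d^{A[1]}|_{A_+[1]}$, $$m_1m_2+m_2(m_1\otimes 1+1\otimes m_1)=d_1^A\otimes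 1-1\otimes d_1^A,$$ where $d_1^A$ is viewed as a degree $-2$ map $A_+[1]\to A_0=Q$, and for all $n\ge 3$ $$\sum_{i=1}^{n}\sum_{j=0}^{n-i}m_{n-i+1}\,(1^{\otimes j}\otimes m_i\otimes 1^{\otimes n-i-j})=0,$$ with the sign convention $(f\otimes g)(x\otimes y)=(-1)^{|g||x|}f(x)\otimes g(y)$. It is *minimal* if $m_n(A_+[1]^{\otimes n})\subseteq \mathfrak n\,A_+[1]$ for all $n\ge 2$. Theorem. The following are equivalent: 1. $R$ is Golod; 2. there exists a non-zero (finitely generated) Golod $R$-module; 3. there exists a minimal $A_\infty$-algebra structure on $A$; 4. every $A_\infty$-algebra structure on $A$ is minimal; 5. the change of rings map $\operatorname{Tor}^Q_n(\mathfrak m,k)\to\operatorname{Tor}^R_n(\mathfrak m,k)$ is injective for all $n\ge 0$; 6. for $M=k$, the two sides of $(\ast)$ have the same coefficient of $t^n$ for all $n\le \dim Q+1$. -/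

import Mathlib

open CategoryTheory DirectSum

universe u

noncomputable section

namespace GolodRing

/-! ### Tor with coefficients in a field, and the change of rings map -/

section Tor

variable {S k : Type u} [CommRing S] [Field k] (g : S →+* k)

instance : (ModuleCat.extendScalars.{u, u, u} g).Additive :=
  (ModuleCat.extendRestrictScalarsAdj.{u, u, u} g).left_adjoint_additive

/-- `Tor_n^S(M, k)` as a `k`-vector space, for a field `k` that is an `S`-algebra through `g`:
the `n`-th left derived functor of `M ↦ k ⊗_S M`. -/
def torField (n : ℕ) : ModuleCat.{u} S ⥤ ModuleCat.{u} k :=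
  (ModuleCat.extendScalars.{u, u, u} g).leftDerived n

/-- The Poincaré series `∑ dim_k Tor_n^S(M, k) t^n`. -/
def poincareSeries (M : ModuleCat.{u} S) : PowerSeries ℚ :=
  PowerSeries.mk fun n ↦ (Module.finrank k ((torField g n).obj M) : ℚ)

end Tor

section ChangeOfRings

variable {Q R k : Type u} [CommRing Q] [CommRing R] [Field k]

/-- A projective resolution over `R`, regarded as a complex of `Q`-modules along `φ : Q → R`. -/
abbrev restrictComplex (φ : Q →+* R) {M : ModuleCat.{u} R} (F : ProjectiveResolution M) :
    ChainComplex (ModuleCat.{u} Q) ℕ :=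
  ((ModuleCat.restrictScalars.{u} φ).mapHomologicalComplex _).obj F.complex

/-- Let `M` be an `R`-module, `G → M` a projective resolution over `Q` and `F → M` a projective
resolution over `R`. There is a morphism of complexes of `Q`-modules `G → F` that lifts the
identity of `M`. -/
theorem exists_comparison (φ : Q →+* R) {M : ModuleCat.{u} R}
    (G : ProjectiveResolution ((ModuleCat.restrictScalars.{u} φ).obj M))
    (F : ProjectiveResolution M) :
    ∃ τ : G.complex ⟶ restrictComplex φ F,
      τ.f 0 ≫ (ModuleCat.restrictScalars.{u} φ).map (F.π.f 0) = G.π.f 0 := by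
  let D := restrictComplex φ F
  let p : D.X 0 ⟶ (ModuleCat.restrictScalars.{u} φ).obj M :=
    (ModuleCat.restrictScalars.{u} φ).map (F.π.f 0)
  let q : G.complex.X 0 ⟶ (ModuleCat.restrictScalars.{u} φ).obj M := G.π.f 0
  have epi_p : Epi p := by
    have h : Epi (F.π.f 0) := inferInstance
    rw [ModuleCat.epi_iff_surjective] at h ⊢
    exact h
  have zero_p : D.d 1 0 ≫ p = 0 :=
    (ShortComplex.mk _ _ F.complex_d_comp_π_f_zero).map (ModuleCat.restrictScalars.{u} φ) |>.zero
  have ex0 : (ShortComplex.mk (D.d 1 0) p zero_p).Exact :=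
    ModuleCat.restrictScalars_map_exact φ _ F.exact₀
  have exs (n : ℕ) : (ShortComplex.mk _ _ (D.d_comp_d (n + 2) (n + 1) n)).Exact :=
    ModuleCat.restrictScalars_map_exact φ _ (F.exact_succ n)
  have zero_q : G.complex.d 1 0 ≫ q = 0 := G.complex_d_comp_π_f_zero
  let f0 : G.complex.X 0 ⟶ D.X 0 := Projective.factorThru q p
  have h0 : f0 ≫ p = q := Projective.factorThru_comp q p
  have h01 : (G.complex.d 1 0 ≫ f0) ≫ p = 0 := by rw [Category.assoc, h0, zero_q]
  refine ⟨ChainComplex.mkHom _ D f0 (ex0.liftFromProjective (G.complex.d 1 0 ≫ f0) h01)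
    (ex0.liftFromProjective_comp _ _)
    fun n t ↦ ⟨(exs n).liftFromProjective (G.complex.d (n + 2) (n + 1) ≫ t.2.1) ?_,
      (exs n).liftFromProjective_comp _ _⟩, ?_⟩
  · have h := t.2.2
    change (_ ≫ t.2.1) ≫ D.d (n + 1) n = 0
    rw [Category.assoc, h, ← Category.assoc, G.complex.d_comp_d, Limits.zero_comp]
  · exact (congrArg (· ≫ p) (ChainComplex.mkHom_f_0 _ D f0 _ _ _)).trans h0

/-- The comparison morphism `G → F` lifting the identity of `M` (unique up to homotopy). -/
def comparison (φ : Q →+* R) {M : ModuleCat.{u} R}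
    (G : ProjectiveResolution ((ModuleCat.restrictScalars.{u} φ).obj M))
    (F : ProjectiveResolution M) : G.complex ⟶ restrictComplex φ F :=
  (exists_comparison φ G F).choose

/-- The natural `k`-linear map `k ⊗_Q M → k ⊗_R M`, `a ⊗ x ↦ a ⊗ x`, for `R`-modules `M`. -/
def tensorChange (φ : Q →+* R) (g : R →+* k) :
    ModuleCat.restrictScalars.{u} φ ⋙ ModuleCat.extendScalars.{u, u, u} (g.comp φ) ⟶
      ModuleCat.extendScalars.{u, u, u} g :=
  Functor.whiskerLeft (ModuleCat.restrictScalars.{u} φ) (ModuleCat.extendScalarsComp φ g).hom ≫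
    (Functor.associator _ _ _).inv ≫
    Functor.whiskerRight (ModuleCat.extendRestrictScalarsAdj.{u, u, u} φ).counit
      (ModuleCat.extendScalars.{u, u, u} g) ≫
    (Functor.leftUnitor _).hom

/-- The change of rings map `Tor_n^Q(M, k) → Tor_n^R(M, k)` for an `R`-module `M`: it is induced
by `k ⊗_Q G → k ⊗_Q F → k ⊗_R F`, where `G` and `F` are projective resolutions of `M` over `Q` and
over `R`, and `G → F` is a morphism of complexes of `Q`-modules that lifts the identity of `M`. -/
def changeOfRings (φ : Q →+* R) (g : R →+* k) (M : ModuleCat.{u} R) (n : ℕ) :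
    (torField (g.comp φ) n).obj ((ModuleCat.restrictScalars.{u} φ).obj M) ⟶
      (torField g n).obj M :=
  let G := projectiveResolution ((ModuleCat.restrictScalars.{u} φ).obj M)
  let F := projectiveResolution M
  (G.isoLeftDerivedObj (ModuleCat.extendScalars.{u, u, u} (g.comp φ)) n).hom ≫
    (HomologicalComplex.homologyFunctor _ _ n).map
      (((ModuleCat.extendScalars.{u, u, u} (g.comp φ)).mapHomologicalComplex _).map
          (comparison φ G F) ≫
        (NatTrans.mapHomologicalComplex (tensorChange φ g) (ComplexShape.down ℕ)).app F.complex) ≫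
    (F.isoLeftDerivedObj (ModuleCat.extendScalars.{u, u, u} g) n).inv

end ChangeOfRings

/-! ### Golod modules and Golod rings -/

section Golod

open IsLocalRing

variable {Q R : Type u} [CommRing Q] [CommRing R] [IsLocalRing R] (φ : Q →+* R)

/-- The Poincaré series `P^R_M = ∑ dim_k Tor_n^R(M, k) t^n`, `k` the residue field of `R`. -/
def poincareOver (M : ModuleCat.{u} R) : PowerSeries ℚ :=
  poincareSeries (residue R) M

/-- The Poincaré series `P^Q_M = ∑ dim_k Tor_n^Q(M, k) t^n` of an `R`-module `M` over `Q`, where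
`k` is the residue field of `R` (which is that of `Q` if `φ` is surjective and `Q` is local). -/
def poincareUnder (M : ModuleCat.{u} R) : PowerSeries ℚ :=
  poincareSeries ((residue R).comp φ) ((ModuleCat.restrictScalars.{u} φ).obj M)

/-- The Golod bound `P^Q_M / (1 - t (P^Q_R - 1))`. The constant coefficient of the denominator
is `1`. -/
def golodBound (M : ModuleCat.{u} R) : PowerSeries ℚ :=
  poincareUnder φ M * (1 - PowerSeries.X * (poincareUnder φ (ModuleCat.of R R) - 1))⁻¹

/-- A finitely generated `R`-module is `φ`-Golod if its Poincaré series equals the Golod bound. -/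
def IsGolodModule (M : ModuleCat.{u} R) : Prop :=
  Module.Finite R M ∧ poincareOver M = golodBound φ M

/-- `R` is Golod (with respect to `φ : Q → R`) if its residue field is a Golod module. -/
def IsGolodRing : Prop :=
  IsGolodModule φ (ModuleCat.of R (ResidueField R))

/-- `A → R` is a minimal `Q`-free resolution, with `A_0 = Q` and augmentation `φ : Q → R`. -/
structure MinimalFreeResolution [IsLocalRing Q] extends
    ProjectiveResolution ((ModuleCat.restrictScalars.{u} φ).obj (ModuleCat.of R R)) where
  free : ∀ n, Module.Free Q (complex.X n)
  /-- the identification `A_0 = Q` -/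
  zeroEquiv : complex.X 0 ≃ₗ[Q] Q
  augmentation : ∀ a : complex.X 0, (π.f 0).hom a = φ (zeroEquiv a)
  minimal : ∀ n, LinearMap.range (complex.d (n + 1) n).hom ≤
    maximalIdeal Q • (⊤ : Submodule Q (complex.X n))

end Golod

/-! ### A-infinity structures -/

section AInfinity

variable {Q : Type u} [CommRing Q] (A : ChainComplex (ModuleCat.{u} Q) ℕ) (e : A.X 0 ≃ₗ[Q] Q)

/-- The graded module `A_+[1]`, where `A_+ = A_{≥ 1}`. The summand with index `i` is `A_{i+1}`,
and it sits in degree `i + 2` of `A_+[1]`. -/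
abbrev Aplus : Type u := ⨁ i : ℕ, A.X (i + 1)

/-- The differential of `A_+[1]`, which is minus the differential of `A`. -/
def dPlus : Aplus A →ₗ[Q] Aplus A :=
  DirectSum.toModule Q ℕ (Aplus A) fun i ↦
    match i with
    | 0 => 0
    | i + 1 => -(DirectSum.lof Q ℕ (fun i ↦ A.X (i + 1)) i ∘ₗ (A.d (i + 1 + 1) (i + 1)).hom)

/-- `d_1 : A_1 → A_0 = Q`, extended by zero to `A_+[1]`. -/
def dOne : Aplus A →ₗ[Q] Q :=
  DirectSum.toModule Q ℕ Q fun i ↦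
    match i with
    | 0 => e.toLinearMap ∘ₗ (A.d 1 0).hom
    | _ + 1 => 0

/-- `x ↦ (-1)^{|x|} x` on `A_+[1]`. -/
def signMap : Aplus A →ₗ[Q] Aplus A :=
  DirectSum.toModule Q ℕ (Aplus A) fun i ↦
    ((-1 : Q) ^ (i + 2)) • DirectSum.lof Q ℕ (fun i ↦ A.X (i + 1)) i

variable {A}

/-- For maps `m_n : A_+[1]^{⊗ n} → A_+[1]` of degree `-1`, the value of
`∑_{i = 1}^n ∑_{j = 0}^{n - i} m_{n-i+1} (1^{⊗ j} ⊗ m_i ⊗ 1^{⊗ n-i-j})` at `x_0 ⊗ ⋯ ⊗ x_{n-1}`.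
By the Koszul sign rule, moving `m_i` past `x_0, …, x_{j-1}` multiplies these by
`(-1)^{|x_0| + ⋯ + |x_{j-1}|}`. -/
def stasheffSum (m : (n : ℕ) → MultilinearMap Q (fun _ : Fin n ↦ Aplus A) (Aplus A))
    (n : ℕ) (x : ℕ → Aplus A) : Aplus A :=
  ∑ i ∈ Finset.Icc 1 n, ∑ j ∈ Finset.range (n - i + 1),
    m (n - i + 1) fun t ↦
      if (t : ℕ) < j then signMap A (x t)
      else if (t : ℕ) = j then m i fun s ↦ x (j + s)
      else x (t + i - 1)

variable (A)

/-- An A-infinity algebra structure on a complex `A` with `A_0 = Q` (the identification being `e`):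
a sequence of `Q`-linear maps `m_n : A_+[1]^{⊗ n} → A_+[1]`, `n ≥ 1`, of degree `-1`. -/
structure AInfinityStructure where
  m : (n : ℕ) → MultilinearMap Q (fun _ : Fin n ↦ Aplus A) (Aplus A)
  /-- the sequence starts with `m_1`; the term with index `0` is only a placeholder -/
  m_zero : m 0 = 0
  /-- `m_n` has degree `-1`: on the summand of degrees `d_j + 2` it has no component in a degree
  `p + 2` that differs from `(∑ (d_j + 2)) - 1` -/
  degree : ∀ (n : ℕ) (d : Fin n → ℕ) (a : (j : Fin n) → A.X (d j + 1)) (p : ℕ),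
    (p + 2) + 1 ≠ ∑ j, (d j + 2) →
      m n (fun j ↦ DirectSum.lof Q ℕ (fun i ↦ A.X (i + 1)) (d j) (a j)) p = 0
  /-- `m_1 = d^{A[1]}` on `A_+[1]` -/
  rel_one : ∀ x, m 1 x = dPlus A (x 0)
  /-- `m_1 m_2 + m_2 (m_1 ⊗ 1 + 1 ⊗ m_1) = d_1 ⊗ 1 - 1 ⊗ d_1` -/
  rel_two : ∀ x : ℕ → Aplus A, stasheffSum m 2 x = dOne A e (x 0) • x 1 - dOne A e (x 1) • x 0
  /-- the relations for `n ≥ 3` -/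
  rel : ∀ n, 3 ≤ n → ∀ x : ℕ → Aplus A, stasheffSum m n x = 0

variable {A e}

/-- An A-infinity structure is minimal if the image of `m_n` lies in `𝔫 A_+[1]` for `n ≥ 2`. -/
def AInfinityStructure.IsMinimal [IsLocalRing Q] (s : AInfinityStructure A e) : Prop :=
  ∀ n, 2 ≤ n → ∀ x, s.m n x ∈ IsLocalRing.maximalIdeal Q • (⊤ : Submodule Q (Aplus A))

end AInfinity

end GolodRing

end

namespace GolodRing

/-! ### Sums over factorizations of words. -/

section Split

variable {L : Type*} {Y Z : Type*} [AddCommMonoid Y] [AddCommMonoid Z]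

/-! Fix homogeneous bases of A_+[1] (the open letters) and of the shift of a Q-free resolution G of
an R-module M (the closed letters). In coordinates an A-infinity structure on A is a function `m`
from open words to combinations of open letters that satisfies `Rel`. Extending `m` and `Rel` to the
words in which the last letter may be closed (the `Good` words) amounts to an A-infinity module
structure on G. Both exist by obstruction theory (`exists_extension`): the defect of the relation at
a word is a cycle (`ext_obstruction`), and A and G are acyclic in positive degrees.

Let D be the coderivation `coder` that extends `m`. By `ext_coder_coder` and `splitSum_ins_curv` the
relations say that D² contracts the first letter with d_1, minus the same contraction of the last
letter. On words that end in a closed letter only the first contraction survives, and it multiplies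
by elements of I. Over R these words therefore span a complex, and a filtration by the first letter
shows that it resolves M (`ExactSystem.exists_of_cycle`, `ExactSystem.isBasedRes`). Such a word is
an arbitrary sequence of open letters followed by one closed letter, so for minimal G the ranks have
the right-hand side of (∗) as generating series (`mk_card_Words`, `golodBound_eq`). Hence (∗) is an
equality in degree n exactly when D has coefficients in 𝔫 into and out of degree n (`coeff_eq_iff`).

Let c₀ be a basis element of G_0. The coefficient of the word x c₀ in D(v c₀) is the coefficient of
x in m(v) (`ExactSystem.coder_concat_apply`), so minimality of D forces minimality of `m`: this is 2
⇒ 4. For M = k it suffices to know D in a bounded range of degrees, because a nonzero m(v) has a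
component in some A_p, and A_p = 0 for p > dim Q (`IsBasedRes.isEmpty_of_minimal`): this is 6 ⇒ 4.
For 3 ⇒ 1 let G be the Koszul complex K. In positive degrees dv ∈ 𝔫²K implies v ∈ 𝔫K. Solving the
relation at w for the term with m(w), by induction on the weight and with I ⊆ 𝔫², carries minimality
from the algebra operations to the module operations (`ExactSystem.mem_CoeffIn_of_closed`).

For condition 5, the maximal ideal 𝔪 is resolved over R by the bar resolution of k without its
degree 0 part, and over Q by the cone of a comparison A → K with A_0 and K_0 removed
(`isBasedRes_twist`). The second complex maps to the first by sending its basis to the words c and b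
c₀ (`coder_twistWord`). If D is minimal, this inclusion of bases stays injective on Tor. Conversely,
suppose that m(u) is minimal for all u of smaller weight than v. Modulo 𝔫 the boundary D(v c₀) then
comes from the smaller complex and contains m(v) c₀ as a component
(`ExactSystem.coder_concat_sub_mem`). Injectivity makes it vanish modulo 𝔫, so m(v) is minimal. -/

/-- The sum of `F b c` over all factorizations `w = b ++ c` of a word. -/
def splitSum : (List L → List L → Y) → List L → Y
  | F, [] => F [] []
  | F, x :: w => F [] (x :: w) + splitSum (fun b c ↦ F (x :: b) c) w

theorem splitSum_nil (F : List L → List L → Y) : splitSum F [] = F [] [] := rfl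

theorem splitSum_cons (F : List L → List L → Y) (x : L) (w : List L) :
    splitSum F (x :: w) = F [] (x :: w) + splitSum (fun b c ↦ F (x :: b) c) w := rfl

theorem splitSum_congr {F G : List L → List L → Y} {w : List L}
    (h : ∀ b c, b ++ c = w → F b c = G b c) : splitSum F w = splitSum G w := by
  induction w generalizing F G with
  | nil => exact h _ _ rfl
  | cons x w ih =>
    rw [splitSum_cons, splitSum_cons, h [] (x :: w) rfl]
    congr 1
    exact ih fun b c hbc ↦ h _ _ (by simp [hbc])

theorem splitSum_zero (w : List L) : splitSum (fun _ _ ↦ (0 : Y)) w = 0 := by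
  induction w with
  | nil => rfl
  | cons x w ih => rw [splitSum_cons, ih, add_zero]

theorem splitSum_add (F G : List L → List L → Y) (w : List L) :
    splitSum (fun b c ↦ F b c + G b c) w = splitSum F w + splitSum G w := by
  induction w generalizing F G with
  | nil => rfl
  | cons x w ih => rw [splitSum_cons, splitSum_cons, splitSum_cons, ih, add_add_add_comm]

theorem map_splitSum {E : Type*} [FunLike E Y Z] [AddMonoidHomClass E Y Z] (f : E)
    (F : List L → List L → Y) (w : List L) :
    f (splitSum F w) = splitSum (fun b c ↦ f (F b c)) w := by
  induction w generalizing F with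
  | nil => rfl
  | cons x w ih => rw [splitSum_cons, splitSum_cons, map_add, ih]

theorem smul_splitSum {E : Type*} [DistribSMul E Y] (r : E) (F : List L → List L → Y) (w : List L) :
    r • splitSum F w = splitSum (fun b c ↦ r • F b c) w :=
  map_splitSum (DistribSMul.toAddMonoidHom Y r) F w

theorem neg_splitSum {Y : Type*} [AddCommGroup Y] (F : List L → List L → Y) (w : List L) :
    splitSum (fun b c ↦ -F b c) w = -splitSum F w :=
  (map_splitSum (negAddMonoidHom (α := Y)) F w).symm

/-- Coassociativity of deconcatenation: both sides run over the factorizations into three words. -/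
theorem splitSum_assoc (F : List L → List L → List L → Y) (w : List L) :
    splitSum (fun p c ↦ splitSum (fun a b ↦ F a b c) p) w =
      splitSum (fun a q ↦ splitSum (fun b c ↦ F a b c) q) w := by
  induction w generalizing F with
  | nil => rfl
  | cons x w ih =>
    simp only [splitSum_cons, splitSum_nil]
    rw [splitSum_add, ih fun a b c ↦ F (x :: a) b c, ← add_assoc]

theorem splitSum_comm (F : List L → List L → List L → List L → Y) (v w : List L) :
    splitSum (fun a b ↦ splitSum (fun c d ↦ F a b c d) v) w =
      splitSum (fun c d ↦ splitSum (fun a b ↦ F a b c d) w) v := by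
  induction w generalizing F with
  | nil => rfl
  | cons x w ih =>
    simp only [splitSum_cons]
    rw [splitSum_add, ih fun a b c d ↦ F (x :: a) b c d]

/-- A cut falls either before the letter `x` or after it. This records the position of a cut
relative to an inserted letter. -/
theorem splitSum_append_cons (F : List L → List L → Y) (a : List L) (x : L) (c : List L) :
    splitSum F (a ++ x :: c) =
      splitSum (fun a₁ a₂ ↦ F a₁ (a₂ ++ x :: c)) a +
        splitSum (fun c₁ c₂ ↦ F (a ++ x :: c₁) c₂) c := by
  induction a generalizing F with
  | nil => rfl
  | cons y a ih => simp only [List.cons_append, splitSum_cons, ih, add_assoc]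

end Split

/-! ### Coderivations on words and their squares. -/

section Words

variable {L : Type*} {Q : Type*} [CommRing Q] {Y : Type*} [AddCommGroup Y] [Module Q Y]

/-- The linear extension of a function on a basis. -/
noncomputable abbrev ext {X : Type*} (f : X → Y) : (X →₀ Q) →ₗ[Q] Y := Finsupp.linearCombination Q f

theorem ext_add {X : Type*} (f g : X → Y) (t : X →₀ Q) :
    ext (fun x ↦ f x + g x) t = ext f t + ext g t := by
  simp [ext, Finsupp.linearCombination_apply, Finsupp.sum_add]

theorem ext_sub {X : Type*} (f g : X → Y) (t : X →₀ Q) :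
    ext (fun x ↦ f x - g x) t = ext f t - ext g t := by
  simp [ext, Finsupp.linearCombination_apply, smul_sub, Finsupp.sum_sub]

theorem ext_smul {X : Type*} (r : Q) (f : X → Y) (t : X →₀ Q) :
    ext (fun x ↦ r • f x) t = r • ext f t := by
  simp [ext, Finsupp.linearCombination_apply, Finsupp.smul_sum, smul_comm r]

theorem ext_congr {X : Type*} {f g : X → Y} {t : X →₀ Q} (h : ∀ x ∈ t.support, f x = g x) :
    ext f t = ext g t := by
  simp only [ext, Finsupp.linearCombination_apply]
  exact Finsupp.sum_congr fun x hx ↦ by rw [h x hx]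

theorem ext_eq_zero {X : Type*} {f : X → Y} {t : X →₀ Q} (h : ∀ x ∈ t.support, f x = 0) :
    ext f t = 0 := by
  simp only [ext, Finsupp.linearCombination_apply]
  exact Finset.sum_eq_zero fun x hx ↦ by simp [h x hx]

theorem map_ext {X : Type*} {Z : Type*} [AddCommGroup Z] [Module Q Z] (g : Y →ₗ[Q] Z) (f : X → Y)
    (t : X →₀ Q) : g (ext f t) = ext (fun x ↦ g (f x)) t := by
  simp [ext, Finsupp.linearCombination_apply, Finsupp.sum, map_sum]

theorem ext_splitSum {X : Type*} (F : X → List L → List L → Y) (w : List L) (t : X →₀ Q) :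
    ext (fun x ↦ splitSum (F x) w) t = splitSum (fun b c ↦ ext (fun x ↦ F x b c) t) w := by
  induction w generalizing F with
  | nil => rfl
  | cons x w ih => simp only [splitSum_cons]; rw [ext_add, ih]

variable (wt : L → ℕ)

/-- The weight of a word. -/
def wordWt (w : List L) : ℕ := (w.map wt).sum

@[simp] theorem wordWt_nil : wordWt wt ([] : List L) = 0 := rfl

@[simp] theorem wordWt_cons (x : L) (w : List L) : wordWt wt (x :: w) = wt x + wordWt wt w := by
  simp [wordWt]

@[simp] theorem wordWt_append (v w : List L) : wordWt wt (v ++ w) = wordWt wt v + wordWt wt w := by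
  simp [wordWt]

variable (Q) in
/-- The Koszul sign of a word. -/
def sgn (w : List L) : Q := (-1) ^ wordWt wt w

@[simp] theorem sgn_nil : sgn Q wt ([] : List L) = 1 := by simp [sgn]

theorem sgn_cons (x : L) (w : List L) : sgn Q wt (x :: w) = (-1) ^ wt x * sgn Q wt w := by
  simp [sgn, pow_add]

theorem sgn_append (v w : List L) : sgn Q wt (v ++ w) = sgn Q wt v * sgn Q wt w := by
  simp [sgn, pow_add]

theorem sgn_mul_self (w : List L) : sgn Q wt w * sgn Q wt w = 1 := by
  rw [sgn, ← pow_add, ← two_mul, pow_mul]; simp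

variable (Q) in
/-- Insertion of a vector between two words. -/
noncomputable def ins (a c : List L) : (L →₀ Q) →ₗ[Q] (List L →₀ Q) :=
  Finsupp.lmapDomain Q Q fun x ↦ a ++ x :: c

@[simp] theorem ins_single (a c : List L) (x : L) (r : Q) :
    ins Q a c (Finsupp.single x r) = Finsupp.single (a ++ x :: c) r := by
  simp [ins]

@[simp] theorem ext_ins (f : List L → Y) (a c : List L) (v : L →₀ Q) :
    ext f (ins Q a c v) = ext (fun x ↦ f (a ++ x :: c)) v := by
  simp [ins, ext, Finsupp.lmapDomain_apply, Finsupp.linearCombination_mapDomain,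
    Function.comp_def]

theorem ins_ext {X : Type*} (a c : List L) (f : X → (L →₀ Q)) (t : X →₀ Q) :
    ins Q a c (ext f t) = ext (fun x ↦ ins Q a c (f x)) t := map_ext _ _ _

/-- `m` lowers the weight by one. -/
def LowersWt (m : List L → (L →₀ Q)) : Prop :=
  ∀ w, ∀ x ∈ (m w).support, wt x + 1 = wordWt wt w

/-- The coderivation that extends `m`, on words. -/
noncomputable def coder (m : List L → (L →₀ Q)) (w : List L) : List L →₀ Q :=
  splitSum (fun a q ↦ splitSum (fun b c ↦ sgn Q wt a • ins Q a c (m b)) q) w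

variable {wt}

theorem ext_splitSum_ins (F : List L → List L → Y) (a c : List L) (v : L →₀ Q) :
    ext (splitSum F) (ins Q a c v) =
      splitSum (fun a₁ a₂ ↦ ext (F a₁) (ins Q a₂ c v)) a +
        splitSum (fun c₁ c₂ ↦ ext (fun b ↦ F b c₂) (ins Q a c₁ v)) c := by
  simp only [ext_ins, splitSum_append_cons]
  rw [ext_add, ext_splitSum, ext_splitSum]

/-- The coderivation property. The letter produced by `m` lies on one side of every cut, so cutting
after the coderivation is the same as cutting before and acting on one of the two pieces. Passing an
operation of odd degree across the left piece `p` costs `sgn Q wt p`. -/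
theorem ext_splitSum_coder (m : List L → (L →₀ Q)) (F : List L → List L → Y) (w : List L) :
    ext (splitSum F) (coder wt m w) =
      splitSum (fun p q ↦ ext (fun b ↦ F b q) (coder wt m p) +
        sgn Q wt p • ext (F p) (coder wt m q)) w := by
  rw [splitSum_add]
  simp only [coder, map_splitSum, map_smul, ext_splitSum_ins, smul_add]
  simp only [splitSum_add]
  rw [add_comm]
  congr 1
  · rw [splitSum_assoc]
    refine splitSum_congr fun a q _ ↦ ?_
    rw [splitSum_assoc]
    refine splitSum_congr fun b c _ ↦ ?_
    rw [← DistribSMul.toAddMonoidHom_apply, map_splitSum]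
    rfl
  · have h : ∀ a q : List L, splitSum (fun b c ↦ sgn Q wt a • splitSum (fun a₁ a₂ ↦
        ext (F a₁) (ins Q a₂ c (m b))) a) q = splitSum (fun a₁ a₂ ↦ splitSum (fun b c ↦
          (sgn Q wt a₁ * sgn Q wt a₂) • ext (F a₁) (ins Q a₂ c (m b))) q) a := by
      intro a q
      rw [splitSum_comm]
      refine splitSum_congr fun b c _ ↦ ?_
      rw [smul_splitSum]
      refine splitSum_congr fun a₁ a₂ ha ↦ ?_
      rw [← ha, sgn_append]
    refine (splitSum_congr fun a q _ ↦ h a q).trans ?_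
    rw [splitSum_assoc (fun a₁ a₂ q ↦ splitSum (fun b c ↦
          (sgn Q wt a₁ * sgn Q wt a₂) • ext (F a₁) (ins Q a₂ c (m b))) q)]
    refine splitSum_congr fun p q _ ↦ ?_
    rw [smul_splitSum]
    refine splitSum_congr fun a r _ ↦ ?_
    rw [smul_splitSum]
    simp [mul_smul]

theorem exists_of_mem_support_ins {a c v : List L} {t : L →₀ Q} (hv : ins Q a c t v ≠ 0) :
    ∃ x ∈ t.support, v = a ++ x :: c := by
  classical
  rw [ins, Finsupp.lmapDomain_apply, ← Finsupp.mem_support_iff] at hv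
  obtain ⟨x, hx, rfl⟩ := Finset.mem_image.1 (Finsupp.mapDomain_support hv)
  exact ⟨x, hx, rfl⟩

theorem exists_of_splitSum_ne_zero {Y : Type*} [AddCommMonoid Y] {F : List L → List L → Y}
    {w : List L} (h : splitSum F w ≠ 0) : ∃ b c, b ++ c = w ∧ F b c ≠ 0 := by
  by_contra! hF
  exact h ((splitSum_congr hF).trans (splitSum_zero w))

/-- The words that occur in the value of the coderivation. -/
theorem exists_of_mem_coder {m : List L → (L →₀ Q)} {w v : List L}
    (hv : v ∈ (coder wt m w).support) :
    ∃ a b c x, w = a ++ b ++ c ∧ x ∈ (m b).support ∧ v = a ++ x :: c := by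
  rw [Finsupp.mem_support_iff, coder, ← Finsupp.lapply_apply (R := Q), map_splitSum] at hv
  obtain ⟨a, q, rfl, hq⟩ := exists_of_splitSum_ne_zero hv
  rw [map_splitSum] at hq
  obtain ⟨b, c, rfl, hb⟩ := exists_of_splitSum_ne_zero hq
  rw [map_smul, Finsupp.lapply_apply] at hb
  obtain ⟨x, hx, rfl⟩ := exists_of_mem_support_ins (right_ne_zero_of_smul hb)
  exact ⟨a, b, c, x, by simp, hx, rfl⟩

theorem wordWt_of_mem_coder {m : List L → (L →₀ Q)} (hm : LowersWt wt m) {w v : List L}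
    (hv : v ∈ (coder wt m w).support) : wordWt wt v + 1 = wordWt wt w := by
  obtain ⟨a, b, c, x, rfl, hx, rfl⟩ := exists_of_mem_coder hv
  have := hm b x hx
  simp
  omega

/-- Substitutions at two disjoint places can be done in either order. This lets the cross terms in
the square of the coderivation be compared. -/
theorem ext_ins_ins (a c c' : List L) (v v' : L →₀ Q) :
    ext (fun x ↦ ins Q (a ++ x :: c) c' v') v = ext (fun y ↦ ins Q a (c ++ y :: c') v) v' := by
  induction v using Finsupp.induction_linear with
  | zero => simp [ext_eq_zero]
  | add v₁ v₂ h₁ h₂ => simp only [map_add, ext_add, h₁, h₂]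
  | single x r =>
    induction v' using Finsupp.induction_linear with
    | zero => simp
    | add v₁ v₂ h₁ h₂ => simp only [map_add, ext_add, h₁, h₂]
    | single y s => simp [mul_comm]

/-- The square of the coderivation that extends `m`. -/
theorem ext_coder_coder {m : List L → (L →₀ Q)} (hm : LowersWt wt m) (w : List L) :
    ext (coder wt m) (coder wt m w) = splitSum (fun a q ↦ splitSum (fun b c ↦
      ins Q a c (ext m (coder wt m b))) q) w := by
  set P : List L → List L → (List L →₀ Q) := fun a q ↦ splitSum (fun b c ↦ ins Q a c (m b)) q
    with hP
  have hcoder : coder wt m = splitSum (fun a q ↦ sgn Q wt a • P a q) := by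
    funext w
    refine splitSum_congr fun a q _ ↦ ?_
    rw [hP]
    dsimp only
    rw [← DistribSMul.toAddMonoidHom_apply, map_splitSum]
    rfl
  -- Here the first application of `m` takes place inside the prefix and the second one to its
  -- right. The prefix has lost one unit of weight in between, which is the origin of the minus
  -- sign.
  have h1 : ∀ p q, ext (fun b ↦ sgn Q wt b • P b q) (coder wt m p) =
      - splitSum (fun a r ↦ splitSum (fun b c ↦ splitSum (fun b' c' ↦
        (sgn Q wt b * sgn Q wt c) • ext (fun x ↦ ins Q (a ++ x :: c) c' (m b')) (m b)) q) r) p := by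
    intro p q
    have : ext (fun b ↦ sgn Q wt b • P b q) (coder wt m p) =
        - (sgn Q wt p • ext (fun b ↦ P b q) (coder wt m p)) := by
      rw [← ext_smul, ← neg_one_smul Q, ← ext_smul]
      refine ext_congr fun b hb ↦ ?_
      rw [sgn, sgn, ← wordWt_of_mem_coder hm hb, pow_succ]
      simp
    rw [this, coder, map_splitSum, smul_splitSum]
    congr 1
    refine splitSum_congr fun a r har ↦ ?_
    rw [map_splitSum, smul_splitSum]
    refine splitSum_congr fun b c hbc ↦ ?_
    rw [map_smul, ext_ins, ext_splitSum, smul_splitSum, smul_splitSum]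
    refine splitSum_congr fun b' c' _ ↦ ?_
    rw [← har, ← hbc, sgn_append, sgn_append, smul_smul]
    congr 1
    linear_combination (sgn Q wt b * sgn Q wt c) * sgn_mul_self (Q := Q) wt a
  -- Here the first application lies inside the block consumed by the second one, or to the right of
  -- it. The terms of the latter kind are those of `h1` without the minus sign, so only the nested
  -- terms remain.
  have h2 : ∀ p q, sgn Q wt p • ext (fun q ↦ sgn Q wt p • P p q) (coder wt m q) =
      splitSum (fun b c ↦ ins Q p c (ext m (coder wt m b))) q +
      splitSum (fun b r ↦ splitSum (fun c s ↦ splitSum (fun b' c' ↦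
        (sgn Q wt b * sgn Q wt c) • ext (fun x ↦ ins Q (p ++ x :: c) c' (m b')) (m b)) s) r) q := by
    intro p q
    rw [ext_smul, smul_smul, sgn_mul_self, one_smul, hP, ext_splitSum_coder, splitSum_add]
    congr 1
    · simp only [ins_ext]
    · refine splitSum_congr fun b r _ ↦ ?_
      rw [coder, map_splitSum, smul_splitSum]
      refine splitSum_congr fun c s _ ↦ ?_
      rw [map_splitSum, smul_splitSum]
      refine splitSum_congr fun b' c' _ ↦ ?_
      rw [map_smul, ext_ins, ext_ins_ins, smul_smul]
  trans ext (splitSum (fun a q ↦ sgn Q wt a • P a q)) (coder wt m w)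
  · rw [hcoder]
  rw [ext_splitSum_coder]
  simp only [h1, h2]
  rw [splitSum_add, splitSum_add, ← add_assoc, add_right_comm]
  convert zero_add _
  rw [neg_splitSum, neg_add_eq_zero]
  rw [splitSum_assoc (fun a r q ↦ splitSum (fun b c ↦ splitSum (fun b' c' ↦
        (sgn Q wt b * sgn Q wt c) • ext (fun x ↦ ins Q (a ++ x :: c) c' (m b')) (m b)) q) r)]
  refine splitSum_congr fun a q _ ↦ ?_
  rw [splitSum_assoc (fun b c q ↦ splitSum (fun b' c' ↦
        (sgn Q wt b * sgn Q wt c) • ext (fun x ↦ ins Q (a ++ x :: c) c' (m b')) (m b)) q)]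

end Words

/-! ### Curvature, contractions, and the obstruction cycle. -/

section Contraction

variable {L : Type*} {Q : Type*} [CommRing Q]

theorem splitSum_eq_first {Y : Type*} [AddCommMonoid Y] {F : List L → List L → Y} {w : List L}
    (h : ∀ a q, a ++ q = w → a ≠ [] → F a q = 0) : splitSum F w = F [] w := by
  cases w with
  | nil => rfl
  | cons x w =>
    rw [splitSum_cons, splitSum_congr (G := fun _ _ ↦ 0), splitSum_zero, add_zero]
    exact fun b c hbc ↦ h _ _ (by simp [hbc]) (by simp)

theorem splitSum_eq_last {Y : Type*} [AddCommMonoid Y] {F : List L → List L → Y} {w : List L}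
    (h : ∀ b c, b ++ c = w → c ≠ [] → F b c = 0) : splitSum F w = F w [] := by
  induction w generalizing F with
  | nil => rfl
  | cons x w ih =>
    rw [splitSum_cons, h [] (x :: w) rfl (by simp), zero_add]
    exact ih fun b c hbc hc ↦ h _ _ (by simp [hbc]) hc

theorem splitSum_splitSum_eq {Y : Type*} [AddCommMonoid Y] {F : List L → List L → List L → Y}
    {w : List L} (h : ∀ a b c, a ++ b ++ c = w → b ≠ w → F a b c = 0) :
    splitSum (fun a q ↦ splitSum (fun b c ↦ F a b c) q) w = F [] w [] := by
  rw [splitSum_eq_first, splitSum_eq_last]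
  · exact fun b c hbc hc ↦ h _ _ _ (by simpa using hbc) fun hb ↦ hc (by simpa [hb] using hbc)
  · intro a q haq ha
    refine (splitSum_congr fun b c hbc ↦ h a b c ?_ ?_).trans (splitSum_zero q)
    · rw [List.append_assoc, hbc, haq]
    · rintro rfl
      have := congrArg List.length haq
      have h2 := congrArg List.length hbc
      have := List.length_pos_of_ne_nil ha
      simp at *
      omega

theorem splitSum_concat {Y : Type*} [AddCommMonoid Y] (F : List L → List L → Y) (w : List L)
    (x : L) : splitSum F (w ++ [x]) =
      splitSum (fun a b ↦ F a (b ++ [x])) w + F (w ++ [x]) [] :=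
  splitSum_append_cons F w x []

variable (δ : L → Q)

/-- Contraction of the first letter of a word. -/
noncomputable def headContr : List L → (List L →₀ Q)
  | [] => 0
  | x :: w => Finsupp.single w (δ x)

/-- Contraction of the last letter of a word. -/
noncomputable def lastContr (w : List L) : List L →₀ Q :=
  match w.getLast? with
  | none => 0
  | some x => Finsupp.single w.dropLast (δ x)

@[simp] theorem headContr_nil : headContr δ [] = 0 := rfl
@[simp] theorem headContr_cons (x : L) (w : List L) :
    headContr δ (x :: w) = Finsupp.single w (δ x) := rfl
@[simp] theorem lastContr_nil : lastContr δ [] = 0 := rfl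
@[simp] theorem lastContr_concat (w : List L) (x : L) :
    lastContr δ (w ++ [x]) = Finsupp.single w (δ x) := by
  simp [lastContr]

@[simp] theorem lastContr_append_cons_concat (a : List L) (y : L) (c : List L) (x : L) :
    lastContr δ (a ++ y :: (c ++ [x])) = Finsupp.single (a ++ y :: c) (δ x) := by
  rw [← lastContr_concat]; simp

/-- The component in words of length one. -/
noncomputable def toLetters : (List L →₀ Q) →ₗ[Q] (L →₀ Q) :=
  Finsupp.lcomapDomain (fun x ↦ [x]) (fun _ _ h ↦ by simpa using h)

@[simp] theorem toLetters_apply (t : List L →₀ Q) (x : L) : toLetters t x = t [x] := rfl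

/-- The curvature `[x, y] ↦ δ(x) y - δ(y) x`. -/
noncomputable def curv (w : List L) : L →₀ Q := toLetters (headContr δ w - lastContr δ w)

theorem toLetters_single_of_ne {w : List L} (hw : w.length ≠ 1) (r : Q) :
    toLetters (Finsupp.single w r) = 0 := by
  ext x
  rw [toLetters_apply, Finsupp.single_eq_of_ne]
  · rfl
  · rintro rfl; simp at hw

@[simp] theorem toLetters_single_singleton (x : L) (r : Q) :
    toLetters (Finsupp.single [x] r) = Finsupp.single x r := by
  classical
  ext y
  simp [Finsupp.single_apply]

theorem toLetters_ins (a c : List L) (v : L →₀ Q) (h : a ≠ [] ∨ c ≠ []) :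
    toLetters (ins Q a c v) = 0 := by
  induction v using Finsupp.induction_linear with
  | zero => simp
  | add v₁ v₂ h₁ h₂ => rw [map_add, map_add, h₁, h₂, add_zero]
  | single x r =>
    rw [ins_single, toLetters_single_of_ne]
    rcases h with h | h
    · have := List.length_pos_of_ne_nil h; simp; omega
    · have := List.length_pos_of_ne_nil h; simp; omega

@[simp] theorem toLetters_ins_nil (v : L →₀ Q) : toLetters (ins Q [] [] v) = v := by
  induction v using Finsupp.induction_linear with
  | zero => simp
  | add v₁ v₂ h₁ h₂ => rw [map_add, map_add, h₁, h₂]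
  | single x r => simp

theorem curv_pair (x y : L) :
    curv δ [x, y] = Finsupp.single y (δ x) - Finsupp.single x (δ y) := by
  have := lastContr_concat δ [x] y
  simp only [List.cons_append, List.nil_append] at this
  rw [curv, this]; simp

theorem curv_of_length_ne {w : List L} (hw : w.length ≠ 2) : curv δ w = 0 := by
  rcases List.eq_nil_or_concat' w with rfl | ⟨l, x, rfl⟩
  · simp [curv]
  · rw [curv, map_sub, lastContr_concat, toLetters_single_of_ne (by simpa using hw), sub_zero]
    cases l with
    | nil => rw [List.nil_append, headContr_cons, toLetters_single_of_ne (by simp)]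
    | cons y l =>
      rw [List.cons_append, headContr_cons, toLetters_single_of_ne (by simpa using hw)]

theorem exists_pair_of_curv_ne {w : List L} (hw : curv δ w ≠ 0) : ∃ x y, w = [x, y] := by
  by_contra h
  exact hw (curv_of_length_ne δ fun hl ↦ h (List.length_eq_two.1 hl))

theorem ext_curv (w : List L) : ext δ (curv δ w) = 0 := by
  by_contra h
  obtain ⟨x, y, rfl⟩ := exists_pair_of_curv_ne δ fun h0 ↦ h (by rw [h0, map_zero])
  apply h
  rw [curv_pair]
  simp [mul_comm]

/-- A telescoping sum. Each pair of neighbours contributes the word with its left letter contracted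
minus the word with its right letter contracted, so everything cancels except the first and the last
letter of the whole word. -/
theorem splitSum_ins_curv (w : List L) :
    splitSum (fun a q ↦ splitSum (fun b c ↦ ins Q a c (curv δ b)) q) w =
      headContr δ w - lastContr δ w := by
  induction w with
  | nil => simp [splitSum_nil, curv_of_length_ne]
  | cons x w ih =>
    rw [splitSum_cons]
    have h1 : splitSum (fun a q ↦ splitSum (fun b c ↦ ins Q (x :: a) c (curv δ b)) q) w =
        Finsupp.lmapDomain Q Q (List.cons x) (headContr δ w - lastContr δ w) := by
      rw [← ih, map_splitSum]
      refine splitSum_congr fun a q _ ↦ ?_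
      rw [map_splitSum]
      refine splitSum_congr fun b c _ ↦ ?_
      rw [ins, ins, ← LinearMap.comp_apply, ← Finsupp.lmapDomain_comp]
      rfl
    rw [h1]
    rcases w with _ | ⟨y, w⟩
    · have := lastContr_concat δ [] x
      rw [List.nil_append] at this
      simp [splitSum_cons, splitSum_nil, curv_of_length_ne, this]
    · have h2 : splitSum (fun b c ↦ ins Q [] c (curv δ b)) (x :: y :: w) =
          ins Q [] w (curv δ [x, y]) := by
        rw [splitSum_cons, splitSum_cons, curv_of_length_ne δ (by simp),
          curv_of_length_ne δ (by simp), map_zero, map_zero, zero_add, zero_add,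
          splitSum_eq_first]
        intro a q _ ha
        have := List.length_pos_of_ne_nil ha
        rw [curv_of_length_ne δ (by simp; omega), map_zero]
      have h3 : lastContr δ (x :: y :: w) =
          Finsupp.lmapDomain Q Q (List.cons x) (lastContr δ (y :: w)) := by
        rcases List.eq_nil_or_concat' (y :: w) with h | ⟨l, z, h⟩
        · simp at h
        · rw [h, lastContr_concat, ← List.cons_append, lastContr_concat]; simp
      rw [h2, h3, curv_pair]
      simp only [map_sub, headContr_cons, ins_single, List.nil_append, Finsupp.lmapDomain_apply,
        Finsupp.mapDomain_single]
      abel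

variable {δ} {wt : L → ℕ} {m : List L → (L →₀ Q)}

theorem LowersWt.nil (hm : LowersWt wt m) : m [] = 0 := by
  ext x
  by_contra h
  have := hm [] x (by simpa using h)
  simp at this

/-- A single letter is left only if `m` consumes the whole word, so `m` is recovered from its
coderivation by projection to letters. -/
theorem toLetters_coder (w : List L) : toLetters (coder wt m w) = m w := by
  rw [coder, map_splitSum]
  simp only [map_splitSum]
  rw [splitSum_splitSum_eq (F := fun a b c ↦ toLetters (sgn Q wt a • ins Q a c (m b)))]
  · simp
  · intro a b c habc hb
    rw [map_smul, toLetters_ins, smul_zero]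
    by_contra! h
    rw [h.1, h.2] at habc
    exact hb (by simpa using habc)

theorem toLetters_ext_coder (t : List L →₀ Q) : toLetters (ext (coder wt m) t) = ext m t := by
  rw [map_ext]
  simp only [toLetters_coder]

/-- Operations that consume the first letter disappear because δ ∘ m = 0. The others keep it, and
the sign does not change when it is removed: a letter with δ ≠ 0 has weight 2, which is even. -/
theorem ext_headContr_coder (hδ : ∀ x, δ x ≠ 0 → wt x = 2) (hδm : ∀ w, ext δ (m w) = 0)
    (hm : m [] = 0) (w : List L) :
    ext (headContr δ) (coder wt m w) = ext (coder wt m) (headContr δ w) := by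
  cases w with
  | nil => simp [coder, splitSum_nil, hm]
  | cons x w =>
    have h0 : ∀ (c : List L) (v : L →₀ Q), ext (headContr δ) (ins Q [] c v) =
        Finsupp.single c (ext δ v) := by
      intro c v
      rw [ext_ins, ← Finsupp.lsingle_apply (R := Q), map_ext]
      rfl
    have h1 : ∀ (a c : List L) (v : L →₀ Q), ext (headContr δ) (ins Q (x :: a) c v) =
        δ x • ins Q a c v := by
      intro a c v
      induction v using Finsupp.induction_linear with
      | zero => simp
      | add v₁ v₂ h₁ h₂ => simp only [map_add, smul_add, h₁, h₂]
      | single x r => simp [mul_comm]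
    rw [coder, splitSum_cons, map_add, map_splitSum, map_splitSum]
    simp only [map_splitSum, map_smul, h0, h1, hδm, Finsupp.single_zero, smul_zero]
    rw [splitSum_zero, zero_add, headContr_cons]
    simp only [ext, Finsupp.linearCombination_single]
    rw [coder, smul_splitSum]
    refine splitSum_congr fun a q _ ↦ ?_
    rw [smul_splitSum]
    refine splitSum_congr fun b c _ ↦ ?_
    rw [sgn_cons]
    by_cases hx : δ x = 0
    · simp [hx]
    · rw [hδ x hx, smul_comm]; simp

/-- As for the first letter, but without a condition on weights: the last letter never belongs to
the prefix that determines a sign. -/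
theorem ext_lastContr_coder (hδm : ∀ w, ext δ (m w) = 0) (hm : m [] = 0) (w : List L) :
    ext (lastContr δ) (coder wt m w) = ext (coder wt m) (lastContr δ w) := by
  rcases List.eq_nil_or_concat' w with rfl | ⟨w, x, rfl⟩
  · simp [coder, splitSum_nil, hm]
  have h0 : ∀ (a : List L) (v : L →₀ Q), ext (lastContr δ) (ins Q a [] v) =
      Finsupp.single a (ext δ v) := by
    intro a v
    rw [ext_ins, ← Finsupp.lsingle_apply (R := Q), map_ext]
    simp
  have h1 : ∀ (a c : List L) (v : L →₀ Q), ext (lastContr δ) (ins Q a (c ++ [x]) v) =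
      δ x • ins Q a c v := by
    intro a c v
    induction v using Finsupp.induction_linear with
    | zero => simp
    | add v₁ v₂ h₁ h₂ => simp only [map_add, smul_add, h₁, h₂]
    | single x r => simp [mul_comm]
  rw [coder, splitSum_concat]
  simp only [splitSum_concat, splitSum_nil, hm, map_zero, smul_zero, add_zero, map_splitSum,
    map_add, map_smul, h0, h1, hδm, Finsupp.single_zero]
  rw [lastContr_concat]
  simp only [ext, Finsupp.linearCombination_single]
  rw [coder, smul_splitSum]
  refine splitSum_congr fun a q _ ↦ ?_
  rw [smul_splitSum]
  refine splitSum_congr fun b c _ ↦ ?_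
  rw [smul_comm]

variable (wt δ) in
/-- The Stasheff relation for a word. -/
def Rel (m : List L → (L →₀ Q)) (w : List L) : Prop := ext m (coder wt m w) = curv δ w

/-- The square of the coderivation is assembled from the values of m ∘ D on subwords. If the
relation is known for the proper ones, the curvature accounts for the two contractions, and the
defect at the full word is the only correction. -/
theorem ext_coder_coder_of_rel (hm : LowersWt wt m) {w : List L}
    (h : ∀ a b c, a ++ b ++ c = w → b ≠ w → Rel δ wt m b) :
    ext (coder wt m) (coder wt m w) = headContr δ w - lastContr δ w +
      ins Q [] [] (ext m (coder wt m w) - curv δ w) := by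
  rw [ext_coder_coder hm, ← splitSum_ins_curv, ← splitSum_splitSum_eq
    (F := fun a b c ↦ ins Q a c (ext m (coder wt m b) - curv δ b)), ← splitSum_add]
  · refine splitSum_congr fun a q _ ↦ ?_
    rw [← splitSum_add]
    refine splitSum_congr fun b c _ ↦ ?_
    rw [← map_add, add_sub_cancel]
  · intro a b c habc hb
    rw [h a b c habc hb, sub_self, map_zero]

/-- The obstruction to the Stasheff relation for a word is a cycle. -/
theorem ext_obstruction (hδ : ∀ x, δ x ≠ 0 → wt x = 2) (hδm : ∀ w, ext δ (m w) = 0)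
    (hm : LowersWt wt m) {w : List L}
    (h : ∀ a b c, a ++ b ++ c = w → b ≠ w → Rel δ wt m b)
    (h' : ∀ v ∈ (coder wt m w).support, Rel δ wt m v) :
    ext (fun x ↦ m [x]) (ext m (coder wt m w) - curv δ w) = 0 := by
  -- Compute m ∘ D ∘ D on `w` in two ways. Squaring D first gives `m` of the two contractions plus
  -- m₁ of the defect. Applying the relation to the words of D(w) and moving the contractions past D
  -- gives `m` of the two contractions alone.
  have h1 := congrArg (ext m) (ext_coder_coder_of_rel hm h)
  have h2 : ext m (ext (coder wt m) (coder wt m w)) = ext m (headContr δ w - lastContr δ w) := by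
    rw [map_ext, ext_congr h',
      ← toLetters_ext_coder (wt := wt) (t := headContr δ w - lastContr δ w), map_sub (ext (coder wt m)),
      ← ext_headContr_coder hδ hδm hm.nil, ← ext_lastContr_coder hδm hm.nil,
      map_sub toLetters, map_ext, map_ext, ← ext_sub]
    refine ext_congr fun v _ ↦ ?_
    rw [curv, map_sub]
  rw [h2, map_add, left_eq_add, ext_ins] at h1
  exact h1

end Contraction

/-! ### Obstruction theory for words with at most one closed letter, in last position. -/

section Extension

variable {L : Type*} {Q : Type*} [CommRing Q]

/-- A word in which at most the last letter is closed. -/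
def Good (cl : L → Prop) (w : List L) : Prop := ∀ a x c, w = a ++ x :: c → cl x → c = []

/-- A word contains a closed letter. -/
def HasClosed (cl : L → Prop) (w : List L) : Prop := ∃ y ∈ w, cl y

variable {cl : L → Prop}

@[simp] theorem hasClosed_nil : ¬ HasClosed cl [] := by simp [HasClosed]
@[simp] theorem hasClosed_cons (x : L) (w : List L) :
    HasClosed cl (x :: w) ↔ cl x ∨ HasClosed cl w := by simp [HasClosed]
@[simp] theorem hasClosed_append (v w : List L) :
    HasClosed cl (v ++ w) ↔ HasClosed cl v ∨ HasClosed cl w := by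
  simp [HasClosed, or_and_right, exists_or]

theorem Good.sub {a b c : List L} (h : Good cl (a ++ b ++ c)) : Good cl b := by
  rintro a' x c' rfl hx
  have := h (a ++ a') x (c' ++ c) (by simp) hx
  simpa using (List.append_eq_nil_iff.1 this).1

theorem Good.eq_nil {a b c : List L} (h : Good cl (a ++ b ++ c)) (hb : HasClosed cl b) :
    c = [] := by
  obtain ⟨y, hy, hcl⟩ := hb
  obtain ⟨s, t, rfl⟩ := List.append_of_mem hy
  have := h (a ++ s) y (t ++ c) (by simp) hcl
  exact (List.append_eq_nil_iff.1 this).2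

theorem good_of_not_hasClosed {w : List L} (h : ¬ HasClosed cl w) : Good cl w := by
  rintro a x c rfl hx
  simp [hx] at h

theorem good_of_length_le {w : List L} (h : w.length ≤ 1) : Good cl w := by
  rintro a x c rfl hx
  simp at h
  exact List.eq_nil_of_length_eq_zero (by omega)

theorem good_append_singleton {v : List L} (hv : ¬ HasClosed cl v) (x : L) :
    Good cl (v ++ [x]) := by
  intro a y c h hy
  rcases List.eq_nil_or_concat' c with rfl | ⟨c, z, rfl⟩
  · rfl
  · rw [← List.cons_append, ← List.append_assoc] at h
    have := (List.append_inj' h rfl).1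
    rw [this] at hv
    simp [hy] at hv

theorem Good.not_hasClosed {v : List L} {x : L} {c : List L} (h : Good cl (v ++ x :: c)) :
    ¬ HasClosed cl v := fun hv ↦ by
  have := Good.eq_nil (a := []) (b := v) (c := x :: c) (by simpa using h) hv
  simp at this

theorem Good.insert {a b c : List L} {x : L} (h : Good cl (a ++ b ++ c))
    (hx : cl x ↔ HasClosed cl b) (hb : b ≠ []) : Good cl (a ++ x :: c) := by
  intro a' y c' hy hcl
  rcases List.append_eq_append_iff.1 hy with ⟨d, rfl, hd⟩ | ⟨d, rfl, hd⟩
  · rcases d with _ | ⟨z, d⟩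
    · simp only [List.nil_append, List.cons.injEq] at hd
      obtain ⟨rfl, rfl⟩ := hd
      exact h.eq_nil (hx.1 hcl)
    · simp only [List.cons_append, List.cons.injEq] at hd
      obtain ⟨rfl, rfl⟩ := hd
      exact h (a ++ b ++ d) y c' (by simp) hcl
  · rcases d with _ | ⟨z, d⟩
    · simp only [List.nil_append, List.cons.injEq] at hd
      obtain ⟨rfl, rfl⟩ := hd
      exact h.eq_nil (hx.1 hcl)
    · simp only [List.cons_append, List.cons.injEq] at hd
      obtain ⟨rfl, rfl⟩ := hd
      have := h a' y (d ++ b ++ c) (by simp) hcl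
      simp [hb] at this

variable (cl) in
/-- `v` is homogeneous, of weight one less than `w`, and of the same type. -/
def Adm (wt : L → ℕ) (w : List L) (v : L →₀ Q) : Prop :=
  ∀ x ∈ v.support, wt x + 1 = wordWt wt w ∧ (cl x ↔ HasClosed cl w)

variable {wt : L → ℕ} {δ : L → Q}

theorem Adm.nil {v : L →₀ Q} (h : Adm cl wt [] v) : v = 0 := by
  ext x
  by_contra hx
  have := (h x (by simpa using hx)).1
  simp at this

theorem Adm.good_insert {a b c : List L} {x : L} {v : L →₀ Q} (h : Good cl (a ++ b ++ c))
    (hv : Adm cl wt b v) (hx : x ∈ v.support) : Good cl (a ++ x :: c) := by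
  refine h.insert (hv x hx).2 ?_
  rintro rfl
  have := (hv x hx).1
  simp at this

theorem coder_congr {m m' : List L → (L →₀ Q)} {w : List L}
    (h : ∀ a b c, a ++ b ++ c = w → m b = m' b) : coder wt m w = coder wt m' w := by
  refine splitSum_congr fun a q haq ↦ splitSum_congr fun b c hbc ↦ ?_
  rw [h a b c (by rw [List.append_assoc, hbc, haq])]

theorem coder_eq_add {m m' : List L → (L →₀ Q)} {w : List L}
    (h : ∀ a b c, a ++ b ++ c = w → b ≠ w → m b = m' b) :
    coder wt m w = coder wt m' w + ins Q [] [] (m w - m' w) := by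
  rw [← sub_eq_iff_eq_add', eq_comm]
  trans splitSum (fun a q ↦ splitSum (fun b c ↦ sgn Q wt a • ins Q a c (m b - m' b)) q) w
  · rw [splitSum_splitSum_eq (F := fun a b c ↦ sgn Q wt a • ins Q a c (m b - m' b))]
    · simp
    · intro a b c habc hb
      rw [h a b c habc hb, sub_self, map_zero, smul_zero]
  · rw [coder, coder, sub_eq_add_neg, ← neg_splitSum, ← splitSum_add]
    refine splitSum_congr fun a q _ ↦ ?_
    rw [← neg_splitSum, ← splitSum_add]
    refine splitSum_congr fun b c _ ↦ ?_
    rw [map_sub, smul_sub, sub_eq_add_neg]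

theorem wordWt_pos (hwt : ∀ x, 1 ≤ wt x) {w : List L} (hw : w ≠ []) : 1 ≤ wordWt wt w := by
  cases w with
  | nil => simp at hw
  | cons x w => have := hwt x; simp; omega

theorem wordWt_lt (hwt : ∀ x, 1 ≤ wt x) {a b c w : List L} (h : a ++ b ++ c = w) (hb : b ≠ w) :
    wordWt wt b < wordWt wt w := by
  subst h
  simp only [wordWt_append]
  by_cases ha : a = []
  · by_cases hc : c = []
    · simp [ha, hc] at hb
    · have := wordWt_pos hwt hc; omega
  · have := wordWt_pos hwt ha; omega

theorem wordWt_le {a b c w : List L} (h : a ++ b ++ c = w) : wordWt wt b ≤ wordWt wt w := by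
  subst h; simp; omega

theorem mem_support_curv (hδ : ∀ x, δ x ≠ 0 → wt x = 2 ∧ ¬ cl x) {w : List L} {z : L}
    (hz : z ∈ (curv δ w).support) : wt z + 2 = wordWt wt w ∧ (cl z ↔ HasClosed cl w) := by
  obtain ⟨x, y, rfl⟩ := exists_pair_of_curv_ne δ (w := w) (by rintro h; simp [h] at hz)
  rw [curv_pair, Finsupp.mem_support_iff, Finsupp.sub_apply] at hz
  classical
  simp only [Finsupp.single_apply] at hz
  by_cases h1 : δ x ≠ 0 ∧ y = z
  · obtain ⟨h, rfl⟩ := h1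
    have := hδ x h
    simp [this, add_comm]
  · by_cases h2 : δ y ≠ 0 ∧ x = z
    · obtain ⟨h, rfl⟩ := h2
      have := hδ y h
      simp [this]
    · exfalso
      apply hz
      rw [ite_eq_right_iff.2, ite_eq_right_iff.2, sub_zero]
      · intro h; by_contra h'; exact h2 ⟨h', h⟩
      · intro h; by_contra h'; exact h1 ⟨h', h⟩

theorem mem_support_ext {X Y : Type*} {f : X → (Y →₀ Q)} {t : X →₀ Q} {y : Y}
    (h : y ∈ (ext f t).support) : ∃ x ∈ t.support, y ∈ (f x).support := by
  by_contra! hx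
  rw [Finsupp.mem_support_iff, ← Finsupp.lapply_apply (R := Q), map_ext] at h
  exact h (ext_eq_zero fun x hxt ↦ by simpa using hx x hxt)

theorem Adm.ext_coder {m : List L → (L →₀ Q)} (hm : ∀ w, Adm cl wt w (m w)) {w : List L} {z : L}
    (hz : z ∈ (ext m (coder wt m w)).support) :
    wt z + 2 = wordWt wt w ∧ (cl z ↔ HasClosed cl w) := by
  obtain ⟨v, hv, hz⟩ := mem_support_ext hz
  obtain ⟨a, b, c, x, rfl, hx, rfl⟩ := exists_of_mem_coder hv
  have h1 := hm _ z hz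
  have h2 := hm _ x hx
  simp [h2.2] at h1 ⊢
  constructor
  · omega
  · tauto

open Classical in
/-- A solution of the equation `m₁ y = v` of the type of `w`, if there is one. -/
noncomputable def solve {N : Type*} [AddCommGroup N] [Module Q N] (cl : L → Prop) (wt : L → ℕ)
    (δ : L → Q) (θ : (L →₀ Q) →ₗ[Q] N) (m₀ : List L → (L →₀ Q)) (w : List L) (v : L →₀ Q) : L →₀ Q :=
  if h : ∃ y, Adm cl wt w y ∧ ext δ y = 0 ∧ θ y = 0 ∧ ext (fun x ↦ m₀ [x]) y = v
    then h.choose else 0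

/-- Obstruction theory: a system of maps that satisfies the Stasheff relations on a class `S` of
words extends to all good words. -/
theorem exists_extension {N : Type*} [AddCommGroup N] [Module Q N] (hwt : ∀ x, 1 ≤ wt x)
    (hδ : ∀ x, δ x ≠ 0 → wt x = 2 ∧ ¬ cl x) (θ : (L →₀ Q) →ₗ[Q] N)
    (hθ : ∀ w, θ (curv δ w) = 0) (S : List L → Prop) (m₀ : List L → (L →₀ Q))
    (hS_len : ∀ w, w.length ≤ 1 → S w) (hS_sub : ∀ a b c, S (a ++ b ++ c) → S b)
    (hS_ins : ∀ a b c x, S (a ++ b ++ c) → x ∈ (m₀ b).support → S (a ++ x :: c))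
    (hadm₀ : ∀ w, S w → Adm cl wt w (m₀ w) ∧ ext δ (m₀ w) = 0 ∧ θ (m₀ w) = 0)
    (hrel₀ : ∀ w, S w → Rel δ wt m₀ w)
    (hstep : ∀ w, ¬ S w → Good cl w → ∀ v : L →₀ Q,
      (∀ z ∈ v.support, wt z + 2 = wordWt wt w ∧ (cl z ↔ HasClosed cl w)) →
      ext (fun x ↦ m₀ [x]) v = 0 → ext δ v = 0 → θ v = 0 →
      ∃ y, Adm cl wt w y ∧ ext δ y = 0 ∧ θ y = 0 ∧ ext (fun x ↦ m₀ [x]) y = v) :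
    ∃ m : List L → (L →₀ Q), (∀ w, S w → m w = m₀ w) ∧ (∀ w, Adm cl wt w (m w)) ∧
      (∀ w, ext δ (m w) = 0) ∧ ∀ w, Good cl w → Rel δ wt m w := by
  classical
  let trunc (w : List L) (m : List L → (L →₀ Q)) : List L → (L →₀ Q) :=
    fun w' ↦ if wordWt wt w' < wordWt wt w then m w' else 0
  -- Recursion on the weight. Outside `S` the value at `w` is a chosen solution of m₁ y = -(defect),
  -- where the defect is computed from the values in smaller weight only; `trunc` sets the other
  -- values to zero. Whether a solution exists is settled afterwards.
  obtain ⟨m, hm⟩ : ∃ m : List L → (L →₀ Q), ∀ w, m w = if S w then m₀ w else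
      solve cl wt δ θ m₀ w (curv δ w - ext (trunc w m) (coder wt (trunc w m) w)) := by
    let F : (w : List L) → ((w' : List L) → wordWt wt w' < wordWt wt w → (L →₀ Q)) → (L →₀ Q) :=
      fun w rec ↦
        let t : List L → (L →₀ Q) := fun w' ↦
          if h : wordWt wt w' < wordWt wt w then rec w' h else 0
        if S w then m₀ w else solve cl wt δ θ m₀ w (curv δ w - ext t (coder wt t w))
    refine ⟨(measure (wordWt wt)).wf.fix F, fun w ↦ ?_⟩
    rw [WellFounded.fix_eq]
    rfl
  have hmS : ∀ w, S w → m w = m₀ w := fun w hw ↦ by rw [hm, if_pos hw]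
  have hadm : ∀ w, Adm cl wt w (m w) ∧ ext δ (m w) = 0 ∧ θ (m w) = 0 := by
    intro w
    by_cases hw : S w
    · rw [hmS w hw]; exact hadm₀ w hw
    · rw [hm, if_neg hw, solve]
      split_ifs with h
      · exact ⟨h.choose_spec.1, h.choose_spec.2.1, h.choose_spec.2.2.1⟩
      · simp [Adm]
  refine ⟨m, hmS, fun w ↦ (hadm w).1, fun w ↦ (hadm w).2.1, fun w ↦ ?_⟩
  induction hn : wordWt wt w using Nat.strong_induction_on generalizing w with
  | _ n ih =>
  subst hn
  intro hgood
  by_cases hw : S w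
  · have h1 : coder wt m w = coder wt m₀ w :=
      coder_congr fun a b c habc ↦ hmS b (hS_sub a b c (habc ▸ hw))
    rw [Rel, h1, ← hrel₀ w hw]
    refine ext_congr fun v hv ↦ ?_
    obtain ⟨a, b, c, x, rfl, hx, rfl⟩ := exists_of_mem_coder hv
    exact hmS _ (hS_ins a b c x hw hx)
  set m' := trunc w m with hm'
  have hm'_lt : ∀ w', wordWt wt w' < wordWt wt w → m' w' = m w' := fun w' h ↦ if_pos h
  have hadm' : ∀ w', Adm cl wt w' (m' w') ∧ ext δ (m' w') = 0 ∧ θ (m' w') = 0 := by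
    intro w'
    by_cases h : wordWt wt w' < wordWt wt w
    · rw [hm'_lt w' h]; exact hadm w'
    · rw [hm']; simp [trunc, h, Adm]
  have hlow : LowersWt wt m' := fun w' x hx ↦ ((hadm' w').1 x hx).1
  have hcoder_lt : ∀ {b}, wordWt wt b < wordWt wt w → coder wt m b = coder wt m' b :=
    fun {b} hb ↦ coder_congr fun a b' c h ↦ (hm'_lt _ ((wordWt_le h).trans_lt hb)).symm
  have hext_lt : ∀ {b}, wordWt wt b ≤ wordWt wt w →
      ext m (coder wt m' b) = ext m' (coder wt m' b) := by
    intro b hb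
    refine ext_congr fun v hv ↦ (hm'_lt v ?_).symm
    have := wordWt_of_mem_coder hlow hv
    omega
  have hrel' : ∀ b, wordWt wt b < wordWt wt w → Good cl b → Rel δ wt m' b := by
    intro b hb hg
    have := ih _ hb b rfl hg
    rw [Rel, hcoder_lt hb, hext_lt hb.le] at this
    exact this
  -- The defect at `w` caused by words of smaller weight. It is a cycle since the relation holds at
  -- all proper subwords of `w` and at all words of D(w).
  set e := ext m' (coder wt m' w) - curv δ w with he
  have hcyc : ext (fun x ↦ m' [x]) e = 0 := by
    refine ext_obstruction (fun x hx ↦ (hδ x hx).1) (fun w ↦ (hadm' w).2.1) hlow ?_ ?_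
    · intro a b c habc hb
      exact hrel' b (wordWt_lt hwt habc hb) (Good.sub (habc ▸ hgood))
    · intro v hv
      have := wordWt_of_mem_coder hlow hv
      refine hrel' v (by omega) ?_
      obtain ⟨a, b, c, x, rfl, hx, rfl⟩ := exists_of_mem_coder hv
      exact (hadm' b).1.good_insert hgood hx
  have hsupp : ∀ z ∈ (-e).support, wt z + 2 = wordWt wt w ∧ (cl z ↔ HasClosed cl w) := by
    intro z hz
    rw [Finsupp.support_neg] at hz
    rcases Finset.mem_union.1 (Finsupp.support_sub hz) with h | h
    · exact Adm.ext_coder (fun w ↦ (hadm' w).1) h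
    · exact mem_support_curv hδ h
  -- The letters that occur in the defect weigh less than `w`, so on them the truncation agrees with
  -- `m₀`.
  have hcyc' : ext (fun x ↦ m₀ [x]) (-e) = 0 := by
    rw [map_neg, neg_eq_zero, ← hcyc]
    refine ext_congr fun x hx ↦ ?_
    have := (hsupp x (by simpa using hx)).1
    rw [hm'_lt [x] (by simp; omega), hmS _ (hS_len _ (by simp))]
  have hδe : ext δ (-e) = 0 := by
    rw [map_neg, he, map_sub, ext_curv, map_ext, ext_eq_zero fun v _ ↦ (hadm' v).2.1]; simp
  have hθe : θ (-e) = 0 := by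
    rw [map_neg, he, map_sub, hθ, map_ext, ext_eq_zero fun v _ ↦ (hadm' v).2.2]; simp
  have hex := hstep w hw hgood (-e) hsupp hcyc' hδe hθe
  have hmw : ext (fun x ↦ m₀ [x]) (m w) = -e := by
    have : curv δ w - ext m' (coder wt m' w) = -e := by rw [he, neg_sub]
    rw [hm, if_neg hw, this, solve, dif_pos hex]
    exact hex.choose_spec.2.2.2
  have hm'w : m' w = 0 := if_neg (lt_irrefl _)
  -- Restoring the value at `w` changes D(w) only by the one-letter words of `m w`. Thus the left
  -- side of the relation changes by m₁(m w), which was chosen to be minus the defect.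
  rw [Rel, coder_eq_add (m' := m') fun a b c habc hb ↦ (hm'_lt b (wordWt_lt hwt habc hb)).symm,
    hm'w, sub_zero, map_add, hext_lt le_rfl, ext_ins]
  have : ext (fun x ↦ m ([] ++ [x])) (m w) = -e :=
    (ext_congr fun x _ ↦ hmS _ (hS_len _ (by simp))).trans hmw
  rw [this, he]
  abel

end Extension

/-! ### The bar construction and its exactness. -/

section Bar

variable {L : Type*} {Q : Type*} [CommRing Q] {cl : L → Prop} {wt : L → ℕ} {δ : L → Q}

variable (Q cl wt) in
/-- The bar construction in weight `N`: combinations of good words that end in a closed letter. -/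
def Bar (N : ℕ) : Submodule Q (List L →₀ Q) :=
  Finsupp.supported Q Q {w | Good cl w ∧ HasClosed cl w ∧ wordWt wt w = N}

variable (Q cl wt) in
/-- Combinations of open letters of weight `p`. -/
def OpenLetters (p : ℕ) : Submodule Q (L →₀ Q) := Finsupp.supported Q Q {x | wt x = p ∧ ¬ cl x}

variable (Q cl wt) in
/-- Combinations of closed letters of weight `p`. -/
def ClosedLetters (p : ℕ) : Submodule Q (L →₀ Q) := Finsupp.supported Q Q {x | wt x = p ∧ cl x}

theorem mem_Bar {N : ℕ} {t : List L →₀ Q} : t ∈ Bar Q cl wt N ↔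
    ∀ w ∈ t.support, Good cl w ∧ HasClosed cl w ∧ wordWt wt w = N := Iff.rfl

theorem ext_mem {X Y : Type*} [AddCommGroup Y] [Module Q Y] {f : X → Y} {t : X →₀ Q}
    {P : Submodule Q Y} (h : ∀ x ∈ t.support, f x ∈ P) : ext f t ∈ P := by
  rw [ext, Finsupp.linearCombination_apply]
  exact Submodule.sum_mem _ fun x hx ↦ P.smul_mem _ (h x hx)

/-- The coefficients of the words with given tail. -/
noncomputable def slice (w : List L) : (List L →₀ Q) →ₗ[Q] (L →₀ Q) :=
  Finsupp.lcomapDomain (fun x ↦ x :: w) (fun _ _ h ↦ by simpa using h)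

@[simp] theorem slice_apply (w : List L) (t : List L →₀ Q) (x : L) : slice w t x = t (x :: w) := rfl

theorem slice_ins_self (w : List L) (v : L →₀ Q) : slice w (ins Q [] w v) = v := by
  classical
  induction v using Finsupp.induction_linear with
  | zero => simp
  | add v₁ v₂ h₁ h₂ => rw [map_add, map_add, h₁, h₂]
  | single x r => ext y; simp [Finsupp.single_apply]

theorem slice_ins_of_ne {w w' : List L} (h : w' ≠ w) (v : L →₀ Q) :
    slice w (ins Q [] w' v) = 0 := by
  classical
  induction v using Finsupp.induction_linear with
  | zero => simp
  | add v₁ v₂ h₁ h₂ => rw [map_add, map_add, h₁, h₂, add_zero]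
  | single x r => ext y; simp [h]

theorem linearMap_ext_on {X Y : Type*} [AddCommGroup Y] [Module Q Y] {A B : (X →₀ Q) →ₗ[Q] Y}
    {t : X →₀ Q} (h : ∀ x ∈ t.support, A (Finsupp.single x 1) = B (Finsupp.single x 1)) :
    A t = B t := by
  have key : ∀ A : (X →₀ Q) →ₗ[Q] Y, A t = ext (fun x ↦ A (Finsupp.single x 1)) t := by
    intro A
    conv_lhs => rw [← Finsupp.sum_single t, Finsupp.sum, map_sum]
    rw [ext, Finsupp.linearCombination_apply, Finsupp.sum]
    refine Finset.sum_congr rfl fun x _ ↦ ?_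
    rw [← map_smul]; simp
  rw [key A, key B, ext_congr h]

theorem ext_headContr_apply (t : List L →₀ Q) (w : List L) :
    ext (headContr δ) t w = ext δ (slice w t) := by
  classical
  have := linearMap_ext_on (A := Finsupp.lapply w ∘ₗ ext (headContr δ)) (B := ext δ ∘ₗ slice w)
    (t := t) fun v _ ↦ ?_
  · exact this
  · cases v with
    | nil =>
      have : slice w (Finsupp.single ([] : List L) (1 : Q)) = 0 := by ext; simp
      simp [this]
    | cons x v =>
      have h1 := ins_single (Q := Q) [] v x 1
      simp only [List.nil_append] at h1
      by_cases h : v = w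
      · subst h
        simp only [LinearMap.comp_apply]
        nth_rw 2 [← h1]
        rw [slice_ins_self]; simp
      · simp only [LinearMap.comp_apply]
        nth_rw 2 [← h1]
        rw [slice_ins_of_ne h]; simp [h]

variable {m : List L → (L →₀ Q)}

theorem coder_mem_Bar (hadm : ∀ w, Adm cl wt w (m w)) {N : ℕ} {w : List L} (hw : Good cl w)
    (hc : HasClosed cl w) (hN : wordWt wt w = N + 1) : coder wt m w ∈ Bar Q cl wt N := by
  rw [mem_Bar]
  intro v hv
  have h := wordWt_of_mem_coder (fun w x hx ↦ (hadm w x hx).1) hv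
  obtain ⟨a, b, c, x, rfl, hx, rfl⟩ := exists_of_mem_coder hv
  refine ⟨(hadm b).good_insert hw hx, ?_, by omega⟩
  have := (hadm b x hx).2
  simp [this] at hc ⊢
  tauto

theorem ext_coder_mem_Bar (hadm : ∀ w, Adm cl wt w (m w)) {N : ℕ} {t : List L →₀ Q}
    (ht : t ∈ Bar Q cl wt (N + 1)) : ext (coder wt m) t ∈ Bar Q cl wt N :=
  ext_mem fun _ hw ↦ coder_mem_Bar hadm (ht hw).1 (ht hw).2.1 (ht hw).2.2

theorem lastContr_eq_zero (hδ : ∀ x, δ x ≠ 0 → wt x = 2 ∧ ¬ cl x) {w : List L} (hw : Good cl w)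
    (hc : HasClosed cl w) : lastContr δ w = 0 := by
  rcases List.eq_nil_or_concat' w with rfl | ⟨w, x, rfl⟩
  · simp
  have h1 : ¬ HasClosed cl w := Good.not_hasClosed (c := []) hw
  have h2 : cl x := by simpa [h1] using hc
  have h3 : δ x = 0 := by
    by_contra h
    exact (hδ x h).2 h2
  simp [h3]

/-- The last letter of a word in the bar construction is closed and δ vanishes on it, so one of the
two contractions drops out. What is left has coefficients among the values of δ and dies over the
quotient ring. -/
theorem ext_coder_ext_coder (hδ : ∀ x, δ x ≠ 0 → wt x = 2 ∧ ¬ cl x)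
    (hadm : ∀ w, Adm cl wt w (m w)) (hrel : ∀ w, Good cl w → Rel δ wt m w) {N : ℕ}
    {t : List L →₀ Q} (ht : t ∈ Bar Q cl wt N) :
    ext (coder wt m) (ext (coder wt m) t) = ext (headContr δ) t := by
  rw [map_ext]
  refine ext_congr fun w hw ↦ ?_
  have hg := (ht hw).1
  rw [ext_coder_coder_of_rel (δ := δ) (fun w x hx ↦ (hadm w x hx).1)
    fun a b c habc _ ↦ hrel b (Good.sub (habc ▸ hg)), lastContr_eq_zero hδ hg (ht hw).2.1,
    (hrel w hg : _ = _)]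
  simp

theorem coder_singleton (hm : m [] = 0) (x : L) : coder wt m [x] = ins Q [] [] (m [x]) := by
  simp [coder, splitSum_cons, splitSum_nil, hm]

/-- An operation to the right of `x` leaves `x` in front, and one that consumes `x` together with
further letters produces a letter at least as heavy as `x`. A lighter first letter can only come
from m₁ applied to `x`. -/
theorem coder_cons_apply (hwt : ∀ x, 1 ≤ wt x) (hm : LowersWt wt m) (x : L) (w w' : List L) (y : L)
    (h : w ≠ [] → wt y < wt x) :
    coder wt m (x :: w) (y :: w') = ins Q [] w (m [x]) (y :: w') := by
  have h1 : splitSum (fun a q ↦ splitSum (fun b c ↦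
      sgn Q wt (x :: a) • ins Q (x :: a) c (m b)) q) w (y :: w') = 0 := by
    rw [← Finsupp.lapply_apply (R := Q), map_splitSum]
    refine (splitSum_congr fun a q haq ↦ ?_).trans (splitSum_zero w)
    rw [map_splitSum]
    refine (splitSum_congr fun b c hbc ↦ ?_).trans (splitSum_zero q)
    by_cases hw : w = []
    · subst hw
      obtain rfl : b = [] := by
        simp only [List.append_eq_nil_iff] at haq
        rw [haq.2] at hbc
        exact (List.append_eq_nil_iff.1 hbc).1
      simp [hm.nil]
    · rw [map_smul, Finsupp.lapply_apply]
      convert smul_zero _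
      by_contra h0
      obtain ⟨z, -, hz⟩ := exists_of_mem_support_ins h0
      simp only [List.cons_append, List.cons.injEq] at hz
      have := h hw
      rw [hz.1] at this
      omega
  have h2 : splitSum (fun b c ↦ sgn Q wt [] • ins Q [] c (m (x :: b))) w (y :: w') =
      ins Q [] w (m [x]) (y :: w') := by
    rw [← Finsupp.lapply_apply (R := Q), map_splitSum, splitSum_eq_first]
    · simp
    · intro b c hbc hb
      rw [sgn_nil, one_smul, Finsupp.lapply_apply]
      by_contra h0
      obtain ⟨z, hz, hz'⟩ := exists_of_mem_support_ins h0
      simp only [List.nil_append, List.cons.injEq] at hz'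
      obtain ⟨rfl, -⟩ := hz'
      have h3 := hm _ _ hz
      have h4 := wordWt_pos hwt hb
      have h5 := h (by rintro rfl; simp at hbc; exact hb hbc.1)
      simp at h3
      omega
  rw [coder, splitSum_cons, Finsupp.add_apply, h1, add_zero, splitSum_cons, hm.nil, map_zero,
    smul_zero, zero_add, h2]

theorem ext_coder_apply_cons (hwt : ∀ x, 1 ≤ wt x) (hm : LowersWt wt m) {t : List L →₀ Q}
    (ht : ∀ w ∈ t.support, w ≠ []) {q : ℕ}
    (hq : ∀ x w, x :: w ∈ t.support → w ≠ [] → q ≤ wt x) {y : L} (hy : wt y < q) (w : List L) :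
    ext (coder wt m) t (y :: w) = ext (fun x ↦ m [x]) (slice w t) y := by
  refine linearMap_ext_on (A := Finsupp.lapply (y :: w) ∘ₗ ext (coder wt m))
    (B := Finsupp.lapply y ∘ₗ ext (fun x ↦ m [x]) ∘ₗ slice w) (t := t) fun v hv ↦ ?_
  rcases v with _ | ⟨x, v⟩
  · exact absurd rfl (ht _ hv)
  · have h1 := ins_single (Q := Q) [] v x 1
    simp only [List.nil_append] at h1
    simp only [LinearMap.comp_apply, Finsupp.lapply_apply, ext, Finsupp.linearCombination_single,
      one_smul]
    rw [coder_cons_apply hwt hm _ _ _ _ fun hv' ↦ hy.trans_le (hq x v hv hv'), ← h1]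
    by_cases h : v = w
    · subst h
      rw [slice_ins_self, Finsupp.linearCombination_single, one_smul, ← slice_apply, slice_ins_self]
    · rw [slice_ins_of_ne h, ← slice_apply, slice_ins_of_ne h]; simp

theorem bar_tail {N : ℕ} {t : List L →₀ Q} (ht : t ∈ Bar Q cl wt N) {x : L} {w : List L}
    (h : x :: w ∈ t.support) (hw : w ≠ []) : ¬ cl x ∧ Good cl w ∧ HasClosed cl w := by
  have h1 := ht h
  have h2 : ¬ cl x := fun hx ↦ hw (h1.1 [] x w rfl hx)
  refine ⟨h2, ?_, ?_⟩
  · exact Good.sub (a := [x]) (c := []) (by simpa using h1.1)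
  · simpa [h2] using h1.2.1

theorem good_cons {x : L} {w : List L} (hx : ¬ cl x) (hw : Good cl w) : Good cl (x :: w) := by
  rintro (_ | ⟨y, a⟩) z c h hz
  · simp only [List.nil_append, List.cons.injEq] at h
    rw [h.1] at hx
    exact absurd hz hx
  · simp only [List.cons_append, List.cons.injEq] at h
    exact hw a z c h.2 hz

theorem ins_mem_Bar {p N : ℕ} {w : List L} {v : L →₀ Q} (hv : v ∈ OpenLetters Q cl wt p)
    (hg : Good cl w) (hc : HasClosed cl w) (hN : p + wordWt wt w = N) :
    ins Q [] w v ∈ Bar Q cl wt N := by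
  intro u hu
  obtain ⟨x, hx, rfl⟩ := exists_of_mem_support_ins (by simpa using hu)
  have := hv hx
  refine ⟨good_cons this.2 hg, by simp [hc], ?_⟩
  rw [← hN, ← this.1]; simp

theorem ext_singleton_support (hadm : ∀ w, Adm cl wt w (m w)) {v : L →₀ Q} {z : L}
    (hz : z ∈ (ext (fun x ↦ m [x]) v).support) :
    ∃ x ∈ v.support, wt z + 1 = wt x ∧ (cl z ↔ cl x) := by
  obtain ⟨x, hx, hz⟩ := mem_support_ext hz
  exact ⟨x, hx, by simpa using hadm [x] z hz⟩

variable (cl wt δ) in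
/-- The Stasheff relations for all good words, and exactness of the complexes of letters. -/
structure ExactSystem (m : List L → (L →₀ Q)) : Prop where
  one_le : ∀ x, 1 ≤ wt x
  two_le : ∀ x, ¬ cl x → 2 ≤ wt x
  delta : ∀ x, δ x ≠ 0 → wt x = 2 ∧ ¬ cl x
  adm : ∀ w, Adm cl wt w (m w)
  ext_delta : ∀ w, ext δ (m w) = 0
  rel : ∀ w, Good cl w → Rel δ wt m w
  exact_open : ∀ p, 2 ≤ p → ∀ v ∈ OpenLetters Q cl wt p, ext (fun x ↦ m [x]) v = 0 →
    ext δ v = 0 → ∃ y ∈ OpenLetters Q cl wt (p + 1), ext (fun x ↦ m [x]) y = v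
  exact_closed : ∀ p, 2 ≤ p → ∀ v ∈ ClosedLetters Q cl wt p, ext (fun x ↦ m [x]) v = 0 →
    ∃ y ∈ ClosedLetters Q cl wt (p + 1), ext (fun x ↦ m [x]) y = v

namespace ExactSystem

variable (H : ExactSystem cl wt δ m)
include H

theorem lowersWt : LowersWt wt m := fun w x hx ↦ (H.adm w x hx).1

/-- Filter by the weight `q` of the first letter of the words with at least two letters. In the
lowest step D acts as m₁ on that first letter, so exactness of the open letters removes this step up
to a boundary. The bound `k` on the number of remaining steps is the induction variable. -/
theorem exists_of_cycle_aux (N : ℕ) (hN : 2 ≤ N) (k q : ℕ) (hk : N ≤ q + k) (hq2 : 2 ≤ q)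
    (e : List L →₀ Q) (he : e ∈ Bar Q cl wt N) (hcyc : ext (coder wt m) e = 0)
    (hq : ∀ x w, x :: w ∈ e.support → w ≠ [] → q ≤ wt x) :
    ∃ u ∈ Bar Q cl wt (N + 1), ext (coder wt m) u = e := by
  classical
  induction k generalizing q e with
  | zero =>
    -- A longer word would have a first letter of weight at least `q ≥ N` and a nonempty tail, which
    -- exceeds the total weight `N`. So only single closed letters remain.
    have h1 : ∀ w ∈ e.support, ∃ x, w = [x] := by
      rintro (_ | ⟨x, w⟩) hw
      · simpa using (he hw).2.1
      · by_cases h : w = []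
        · exact ⟨x, by rw [h]⟩
        · have := hq x w hw h
          have := (he hw).2.2
          have := wordWt_pos H.one_le h
          simp at *
          omega
    have h2 : ins Q [] [] (toLetters e) = e := by
      have := linearMap_ext_on (A := ins Q [] [] ∘ₗ toLetters) (B := LinearMap.id) (t := e)
        fun w hw ↦ by
          obtain ⟨x, rfl⟩ := h1 w hw
          simp
      exact this
    have h3 : toLetters e ∈ ClosedLetters Q cl wt N := by
      intro x hx
      have := he (by simpa using hx : [x] ∈ e.support)
      simpa [and_comm] using this.2
    have h4 : ∀ v, ext (coder wt m) (ins Q [] [] v) = ins Q [] [] (ext (fun x ↦ m [x]) v) := by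
      intro v
      rw [ext_ins, map_ext]
      exact ext_congr fun x _ ↦ coder_singleton H.lowersWt.nil x
    obtain ⟨y, hy, hy'⟩ := H.exact_closed N hN _ h3 (by
      rw [← h2, h4] at hcyc
      rw [← toLetters_ins_nil (ext _ _), hcyc, map_zero])
    refine ⟨ins Q [] [] y, ?_, by rw [h4, hy', h2]⟩
    intro w hw
    obtain ⟨x, hx, rfl⟩ := exists_of_mem_support_ins (by simpa using hw)
    have := hy hx
    exact ⟨good_of_length_le (by simp), by simp [this.2], by simp [this.1]⟩
  | succ k ih =>
    have hne : ∀ w ∈ e.support, w ≠ [] := by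
      rintro w hw rfl
      simpa using (he hw).2.1
    set F : Finset (List L) := (e.support.image List.tail).filter
      fun w ↦ w ≠ [] ∧ wordWt wt w + q = N with hF
    have hFmem : ∀ w, w ∈ F ↔ w ≠ [] ∧ wordWt wt w + q = N ∧ ∃ x, x :: w ∈ e.support := by
      intro w
      rw [hF, Finset.mem_filter, Finset.mem_image]
      constructor
      · rintro ⟨⟨v, hv, rfl⟩, h1, h2⟩
        rcases v with _ | ⟨x, v⟩
        · exact absurd rfl (hne _ hv)
        · exact ⟨h1, h2, x, hv⟩
      · rintro ⟨h1, h2, x, hx⟩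
        exact ⟨⟨_, hx, rfl⟩, h1, h2⟩
    have hy : ∀ w ∈ F, ∃ y ∈ OpenLetters Q cl wt (q + 1),
        ext (fun x ↦ m [x]) y = slice w e := by
      intro w hw
      obtain ⟨hw1, hw2, -⟩ := (hFmem w).1 hw
      have hopen : slice w e ∈ OpenLetters Q cl wt q := by
        intro x hx
        have h1 : x :: w ∈ e.support := by simpa using hx
        refine ⟨?_, (bar_tail he h1 hw1).1⟩
        have := (he h1).2.2
        simp at this
        omega
      -- The slice is an m₁-cycle because its image is the part of D(e) with first letter lighter
      -- than `q`. It is killed by δ because contracting the first letter of `e` gives D²(e) = 0.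
      refine H.exact_open q hq2 _ hopen ?_ ?_
      · ext z
        by_contra hz
        obtain ⟨x, hx, hzx, -⟩ := ext_singleton_support H.adm (Finsupp.mem_support_iff.2 hz)
        have := (hopen hx).1
        rw [← ext_coder_apply_cons H.one_le H.lowersWt hne hq (by omega), hcyc] at hz
        exact hz rfl
      · rw [← ext_headContr_apply, ← ext_coder_ext_coder H.delta H.adm H.rel he, hcyc]; simp
    choose! y hyo hye using hy
    set w₁ : List L →₀ Q := ∑ w ∈ F, ins Q [] w (y w) with hw₁
    have hslice : ∀ w, slice w w₁ = if w ∈ F then y w else 0 := by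
      intro w
      rw [hw₁, map_sum]
      split_ifs with h
      · rw [Finset.sum_eq_single_of_mem w h fun w' _ h' ↦ slice_ins_of_ne h' _, slice_ins_self]
      · exact Finset.sum_eq_zero fun w' hw' ↦ slice_ins_of_ne (by rintro rfl; exact h hw') _
    have hw₁bar : w₁ ∈ Bar Q cl wt (N + 1) := by
      refine Submodule.sum_mem _ fun w hw ↦ ?_
      obtain ⟨h1, h2, x, hx⟩ := (hFmem w).1 hw
      have := bar_tail he hx h1
      exact ins_mem_Bar (hyo w hw) this.2.1 this.2.2 (by omega)
    have hw₁ne : ∀ w ∈ w₁.support, w ≠ [] := by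
      rintro w hw rfl
      simpa using (hw₁bar hw).2.1
    have hw₁q : ∀ x w, x :: w ∈ w₁.support → w ≠ [] → q + 1 ≤ wt x := by
      intro x w hx _
      rw [Finsupp.mem_support_iff, ← slice_apply, hslice] at hx
      split_ifs at hx with h
      · rw [(hyo w h (by simpa using hx)).1]
      · simp at hx
    -- The first letters of `w₁` have weight q + 1 ≥ 3, where δ vanishes, so D² vanishes on `w₁` and
    -- the corrected chain is again a cycle.
    have hDD : ext (coder wt m) (ext (coder wt m) w₁) = 0 := by
      rw [ext_coder_ext_coder H.delta H.adm H.rel hw₁bar]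
      ext w
      rw [ext_headContr_apply, hslice]
      split_ifs with h
      · refine ext_eq_zero fun x hx ↦ ?_
        by_contra h0
        have := (H.delta x h0).1
        have := (hyo w h hx).1
        omega
      · simp
    obtain ⟨u, hu, hue⟩ := ih (q + 1) (by omega) (by omega) (e - ext (coder wt m) w₁)
      (Submodule.sub_mem _ he (ext_coder_mem_Bar H.adm hw₁bar)) (by rw [map_sub, hcyc, hDD, sub_zero])
      (by
        intro x w hx hw
        by_contra hlt
        rw [Finsupp.mem_support_iff, Finsupp.sub_apply,
          ext_coder_apply_cons H.one_le H.lowersWt hw₁ne hw₁q (by omega), hslice] at hx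
        by_cases h : w ∈ F
        · rw [if_pos h, hye w h, slice_apply, sub_self] at hx
          exact hx rfl
        · rw [if_neg h, map_zero, Finsupp.zero_apply, sub_zero] at hx
          have hx' : x :: w ∈ e.support := by simpa using hx
          have h1 := hq x w hx' hw
          have h2 := (he hx').2.2
          simp at h2
          exact h ((hFmem w).2 ⟨hw, by omega, x, hx'⟩))
    exact ⟨u + w₁, Submodule.add_mem _ hu hw₁bar, by rw [map_add, hue, sub_add_cancel]⟩

/-- The bar construction is exact modulo the ideal generated by the values of `δ`. -/
theorem exists_of_cycle {I : Ideal Q}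
    (hI : ∀ r ∈ I, ∃ y ∈ OpenLetters Q cl wt 2, ext δ y = r) {N : ℕ} (hN : 2 ≤ N)
    {e : List L →₀ Q} (he : e ∈ Bar Q cl wt N) (hcyc : ∀ w, ext (coder wt m) e w ∈ I) :
    ∃ u ∈ Bar Q cl wt (N + 1), ext (coder wt m) u = e := by
  classical
  obtain ⟨N, rfl⟩ := Nat.exists_eq_add_of_le' (show 1 ≤ N by omega)
  -- Each coefficient of D(e) has the form δ(y). Prefixing the words of D(e) by these `y` gives a
  -- chain whose head contraction, equal to its image under D², is D(e). Subtracting D of this chain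
  -- turns `e` into a cycle over Q.
  choose y hyo hye using fun w ↦ hI _ (hcyc w)
  have hbar := ext_coder_mem_Bar H.adm he
  set w₁ : List L →₀ Q := ∑ w ∈ (ext (coder wt m) e).support, ins Q [] w (y w) with hw₁
  have hw₁bar : w₁ ∈ Bar Q cl wt (N + 1 + 1) := by
    refine Submodule.sum_mem _ fun w hw ↦ ?_
    exact ins_mem_Bar (hyo w) (hbar hw).1 (hbar hw).2.1 (by rw [(hbar hw).2.2]; omega)
  have h1 : ext (headContr δ) w₁ = ext (coder wt m) e := by
    rw [hw₁, map_sum]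
    conv_rhs => rw [← Finsupp.sum_single (ext (coder wt m) e)]
    refine Finset.sum_congr rfl fun w _ ↦ ?_
    rw [ext_ins, ← hye w, ← Finsupp.lsingle_apply (R := Q), map_ext]
    rfl
  obtain ⟨u, hu, hue⟩ := H.exists_of_cycle_aux (N + 1) hN (N + 1) 2 (by omega) le_rfl
    (e - ext (coder wt m) w₁) (Submodule.sub_mem _ he (ext_coder_mem_Bar H.adm hw₁bar))
    (by rw [map_sub, ext_coder_ext_coder H.delta H.adm H.rel hw₁bar, h1, sub_self])
    (fun x w hx hw ↦ H.two_le x (bar_tail (Submodule.sub_mem _ he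
      (ext_coder_mem_Bar H.adm hw₁bar)) hx hw).1)
  exact ⟨u + w₁, Submodule.add_mem _ hu hw₁bar, by rw [map_add, hue, sub_add_cancel]⟩

end ExactSystem

end Bar

/-! ### Transfer of minimality between open and closed words. -/

section Minimality

variable {L : Type*} {Q : Type*} [CommRing Q] {cl : L → Prop} {wt : L → ℕ} {δ : L → Q}

/-- The finitely supported functions with values in an ideal. -/
def CoeffIn (X : Type*) (J : Ideal Q) : Submodule Q (X →₀ Q) where
  carrier := {v | ∀ x, v x ∈ J}
  add_mem' h₁ h₂ x := J.add_mem (h₁ x) (h₂ x)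
  zero_mem' _ := J.zero_mem
  smul_mem' r _ h x := J.mul_mem_left r (h x)

theorem mem_CoeffIn {X : Type*} {J : Ideal Q} {v : X →₀ Q} :
    v ∈ CoeffIn X J ↔ ∀ x, v x ∈ J := Iff.rfl

theorem smul_mem_CoeffIn {X : Type*} {J J' : Ideal Q} {v : X →₀ Q} {r : Q} (hr : r ∈ J)
    (hv : v ∈ CoeffIn X J') : r • v ∈ CoeffIn X (J * J') :=
  fun x ↦ Ideal.mul_mem_mul hr (hv x)

theorem ext_mem_CoeffIn_mul {X Y : Type*} {J J' : Ideal Q} {f : X → (Y →₀ Q)} {t : X →₀ Q}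
    (ht : t ∈ CoeffIn X J) (hf : ∀ x ∈ t.support, f x ∈ CoeffIn Y J') :
    ext f t ∈ CoeffIn Y (J * J') := by
  rw [ext, Finsupp.linearCombination_apply]
  exact Submodule.sum_mem _ fun x hx ↦ smul_mem_CoeffIn (ht x) (hf x hx)

theorem ins_mem_CoeffIn {J : Ideal Q} {a c : List L} {v : L →₀ Q} (hv : v ∈ CoeffIn L J) :
    ins Q a c v ∈ CoeffIn (List L) J := by
  intro w
  by_cases h : ins Q a c v w = 0
  · rw [h]; exact J.zero_mem
  · obtain ⟨x, -, rfl⟩ := exists_of_mem_support_ins h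
    have : ins Q a c v (a ++ x :: c) = v x :=
      Finsupp.mapDomain_apply (fun x y h ↦ by simpa using h) v x
    rw [this]; exact hv x

theorem splitSum_mem {Y : Type*} [AddCommGroup Y] [Module Q Y] {P : Submodule Q Y}
    {F : List L → List L → Y} {w : List L} (h : ∀ b c, b ++ c = w → F b c ∈ P) :
    splitSum F w ∈ P := by
  rw [← Submodule.Quotient.mk_eq_zero, ← Submodule.mkQ_apply, map_splitSum]
  refine (splitSum_congr fun b c hbc ↦ ?_).trans (splitSum_zero w)
  simpa using h b c hbc

theorem splitSum_sub_first_mem {Y : Type*} [AddCommGroup Y] [Module Q Y] {P : Submodule Q Y}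
    {F : List L → List L → Y} {w : List L} (h : ∀ b c, b ++ c = w → b ≠ [] → F b c ∈ P) :
    splitSum F w - F [] w ∈ P := by
  rw [← Submodule.Quotient.mk_eq_zero, ← Submodule.mkQ_apply, map_sub, map_splitSum,
    splitSum_eq_first, sub_self]
  intro b c hbc hb
  simpa using h b c hbc hb

theorem splitSum_splitSum_sub_mem {Y : Type*} [AddCommGroup Y] [Module Q Y] {P : Submodule Q Y}
    {F : List L → List L → List L → Y} {w : List L}
    (h : ∀ a b c, a ++ b ++ c = w → b ≠ w → F a b c ∈ P) :
    splitSum (fun a q ↦ splitSum (fun b c ↦ F a b c) q) w - F [] w [] ∈ P := by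
  rw [← Submodule.Quotient.mk_eq_zero, ← Submodule.mkQ_apply, map_sub, map_splitSum]
  simp only [map_splitSum]
  rw [splitSum_splitSum_eq (F := fun a b c ↦ P.mkQ (F a b c)), sub_self]
  intro a b c habc hb
  simpa using h a b c habc hb

variable {m : List L → (L →₀ Q)} {J : Ideal Q}

theorem coder_mem_CoeffIn {w : List L} (h : ∀ a b c, a ++ b ++ c = w → m b ∈ CoeffIn L J) :
    coder wt m w ∈ CoeffIn (List L) J :=
  splitSum_mem fun a q haq ↦ splitSum_mem fun b c hbc ↦ Submodule.smul_mem _ _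
    (ins_mem_CoeffIn (h a b c (by rw [List.append_assoc, hbc, haq])))

theorem curv_mem_CoeffIn (hδ : ∀ x, δ x ∈ J) (w : List L) : curv δ w ∈ CoeffIn L J := by
  by_cases h : curv δ w = 0
  · rw [h]; exact Submodule.zero_mem _
  · obtain ⟨x, y, rfl⟩ := exists_pair_of_curv_ne δ h
    rw [curv_pair]
    classical
    refine Submodule.sub_mem _ (fun z ↦ ?_) fun z ↦ ?_
    · rw [Finsupp.single_apply]; split_ifs
      exacts [hδ x, J.zero_mem]
    · rw [Finsupp.single_apply]; split_ifs
      exacts [hδ y, J.zero_mem]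

theorem Good.length_two_le {w : List L} (hg : Good cl w) (hc : HasClosed cl w)
    (hl : w.length ≠ 1) : ∃ x v c, w = x :: (v ++ [c]) ∧ ¬ cl x ∧ ¬ HasClosed cl v ∧ cl c := by
  rcases w with _ | ⟨x, w⟩
  · simp at hc
  rcases List.eq_nil_or_concat' w with rfl | ⟨v, c, rfl⟩
  · simp at hl
  have h1 : ¬ HasClosed cl (x :: v) := Good.not_hasClosed (c := []) (by simpa using hg)
  simp at h1 hc
  exact ⟨x, v, c, rfl, h1.1, h1.2, by tauto⟩

/-- If closed letters satisfy a strong minimality condition, then minimality on open words implies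
minimality on closed words. -/
theorem ExactSystem.mem_CoeffIn_of_closed (H : ExactSystem cl wt δ m)
    (hδ : ∀ x, δ x ∈ J ^ 2) (h₁ : ∀ x, m [x] ∈ CoeffIn L J)
    (hL : ∀ p, 2 ≤ p → ∀ v ∈ ClosedLetters Q cl wt p,
      ext (fun x ↦ m [x]) v ∈ CoeffIn L (J ^ 2) → v ∈ CoeffIn L J)
    (P : List L → Prop) (hP : ∀ w, P w → Good cl w ∧ HasClosed cl w)
    (hP_ins : ∀ a b c x, P (a ++ b ++ c) → x ∈ (m b).support → P (a ++ x :: c))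
    (hP_sub : ∀ a b c, P (a ++ b ++ c) → HasClosed cl b → P b)
    (hP_open : ∀ a b c, P (a ++ b ++ c) → ¬ HasClosed cl b → m b ∈ CoeffIn L J)
    (w : List L) (hw : P w) : m w ∈ CoeffIn L J := by
  classical
  induction hn : wordWt wt w using Nat.strong_induction_on generalizing w with
  | _ n ih =>
  subst hn
  obtain ⟨hg, hc⟩ := hP w hw
  by_cases hl : w.length = 1
  · obtain ⟨x, rfl⟩ := List.length_eq_one_iff.1 hl
    exact h₁ x
  -- An open letter weighs at least 2 and a closed one at least 1. So `m w` lives in weight at least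
  -- 2, the range in which `hL` applies.
  have hwt : 3 ≤ wordWt wt w := by
    obtain ⟨x, v, c, rfl, hx, -, -⟩ := hg.length_two_le hc hl
    have := H.two_le x hx
    have := H.one_le c
    simp; omega
  have hmem : m w ∈ ClosedLetters Q cl wt (wordWt wt w - 1) := by
    intro x hx
    have := H.adm w x hx
    exact ⟨by omega, this.2.2 hc⟩
  refine hL _ (by omega) _ hmem ?_
  -- Erasing the value at `w` isolates the contribution of the proper blocks to D(w), to which the
  -- induction hypothesis applies.
  set m' : List L → (L →₀ Q) := fun v ↦ if v = w then 0 else m v with hm'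
  have h2 := coder_eq_add (wt := wt) (m := m) (m' := m') (w := w)
    fun a b c _ hb ↦ by rw [hm']; simp [hb]
  have hm'w : m' w = 0 := if_pos rfl
  have h3 : coder wt m' w ∈ CoeffIn (List L) J := by
    refine coder_mem_CoeffIn fun a b c habc ↦ ?_
    by_cases hb : b = w
    · rw [hb, hm'w]; exact Submodule.zero_mem _
    · rw [hm']; simp only [if_neg hb]
      by_cases hbc : HasClosed cl b
      · exact ih _ (wordWt_lt H.one_le habc hb) b (hP_sub a b c (habc ▸ hw) hbc) rfl
      · exact hP_open a b c (habc ▸ hw) hbc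
  -- One factor of `J` comes from the inner operation and one from the outer; the words between them
  -- have smaller weight than `w`.
  have h4 : ext m (coder wt m' w) ∈ CoeffIn L (J ^ 2) := by
    rw [pow_two]
    refine ext_mem_CoeffIn_mul h3 fun v hv ↦ ?_
    have hlow : LowersWt wt m' := by
      intro v x hx
      by_cases h : v = w
      · simp [hm', h] at hx
      · simp only [hm', if_neg h] at hx
        exact (H.adm v x hx).1
    have hlt := wordWt_of_mem_coder hlow hv
    obtain ⟨a, b, c, x, habc, hx, rfl⟩ := exists_of_mem_coder hv
    refine ih _ (by omega) _ (hP_ins a b c x (habc ▸ hw) ?_) rfl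
    by_cases h : b = w
    · simp [hm', h] at hx
    · simpa only [hm', if_neg h] using hx
  -- The relation at `w`, solved for m₁(m w). Both terms on the right have coefficients in `J ^ 2`,
  -- the curvature because δ does, and `hL` then divides by the differential.
  have h5 : ext (fun x ↦ m [x]) (m w) = curv δ w - ext m (coder wt m' w) := by
    rw [← (H.rel w hg : _ = _), h2, hm'w, sub_zero, map_add, ext_ins]
    simp
  rw [h5]
  exact Submodule.sub_mem _ (curv_mem_CoeffIn hδ w) h4

/-- Minimality in bounded weight. -/
theorem ExactSystem.mem_CoeffIn_of_wordWt_le (H : ExactSystem cl wt δ m)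
    (hδ : ∀ x, δ x ∈ J ^ 2) (h₁ : ∀ x, m [x] ∈ CoeffIn L J)
    (hL : ∀ p, 2 ≤ p → ∀ v ∈ ClosedLetters Q cl wt p,
      ext (fun x ↦ m [x]) v ∈ CoeffIn L (J ^ 2) → v ∈ CoeffIn L J) (N : ℕ)
    (hN : ∀ w, ¬ HasClosed cl w → wordWt wt w < N → m w ∈ CoeffIn L J)
    (w : List L) (hg : Good cl w) (hc : HasClosed cl w) (hw : wordWt wt w ≤ N) :
    m w ∈ CoeffIn L J := by
  refine H.mem_CoeffIn_of_closed hδ h₁ hL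
    (fun w ↦ (Good cl w ∧ HasClosed cl w) ∧ wordWt wt w ≤ N) (fun w h ↦ h.1) ?_ ?_ ?_ w
    ⟨⟨hg, hc⟩, hw⟩
  · rintro a b c x ⟨⟨hg, hc⟩, hw⟩ hx
    have := H.adm b x hx
    refine ⟨⟨(H.adm b).good_insert hg hx, ?_⟩, ?_⟩
    · simp [this.2] at hc ⊢; tauto
    · simp at hw ⊢; omega
  · rintro a b c ⟨⟨hg, hc⟩, hw⟩ hb
    exact ⟨⟨hg.sub, hb⟩, (wordWt_le rfl).trans hw⟩
  · rintro a b c ⟨⟨hg, hc⟩, hw⟩ hb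
    -- An open block of a word with a closed letter is a proper block, hence of strictly smaller
    -- weight. That is why weights below `N` suffice on the open side.
    refine hN b hb ((wordWt_lt H.one_le rfl ?_).trans_le hw)
    intro h
    rw [← h] at hc
    exact hb hc

/-- Minimality on words with one open and one closed letter. -/
theorem ExactSystem.mem_CoeffIn_pair (H : ExactSystem cl wt δ m)
    (hδ : ∀ x, δ x ∈ J ^ 2) (h₁ : ∀ x, m [x] ∈ CoeffIn L J)
    (hL : ∀ p, 2 ≤ p → ∀ v ∈ ClosedLetters Q cl wt p,
      ext (fun x ↦ m [x]) v ∈ CoeffIn L (J ^ 2) → v ∈ CoeffIn L J) (x c : L)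
    (hx : ¬ cl x) (hc : cl c) : m [x, c] ∈ CoeffIn L J := by
  have h0 : m [] = 0 := H.lowersWt.nil
  refine H.mem_CoeffIn_of_closed hδ h₁ hL
    (fun w ↦ (Good cl w ∧ HasClosed cl w) ∧ w.length ≤ 2) (fun w h ↦ h.1) ?_ ?_ ?_ [x, c]
    ⟨⟨good_cons hx (good_of_length_le (by simp)), by simp [hc]⟩, by simp⟩
  · rintro a b c x ⟨⟨hg, hc⟩, hw⟩ hx
    have := H.adm b x hx
    refine ⟨⟨(H.adm b).good_insert hg hx, ?_⟩, ?_⟩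
    · simp [this.2] at hc ⊢; tauto
    · have hb : b ≠ [] := by rintro rfl; simp [h0] at hx
      have := List.length_pos_of_ne_nil hb
      simp at hw ⊢; omega
  · rintro a b c ⟨⟨hg, hc⟩, hw⟩ hb
    exact ⟨⟨hg.sub, hb⟩, by simp at hw; omega⟩
  · rintro a b c ⟨⟨hg, hc⟩, hw⟩ hb
    rcases b with _ | ⟨x, _ | ⟨y, b⟩⟩
    · rw [h0]; exact Submodule.zero_mem _
    · exact h₁ x
    · simp at hw
      obtain rfl : a = [] := List.eq_nil_of_length_eq_zero (by omega)
      obtain rfl : c = [] := List.eq_nil_of_length_eq_zero (by omega)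
      simp at hc hb
      tauto

/-- The only way to reach `[x, c₀]` is to apply `m` to all of `v`. The alternative keeps the first
letter and produces `c₀`, of weight 1, from a block of total weight 2 that ends in `c₀`; but the
remaining open letters of such a block weigh 0 or at least 2. -/
theorem ExactSystem.coder_concat_apply (H : ExactSystem cl wt δ m) {v : List L}
    (hv : ¬ HasClosed cl v) {c₀ : L} (_hc : wt c₀ = 1) (x : L) :
    coder wt m (v ++ [c₀]) [x, c₀] = m v x := by
  have h0 : m [] = 0 := H.lowersWt.nil
  rw [coder, ← Finsupp.lapply_apply (R := Q), map_splitSum, splitSum_eq_first]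
  · rw [map_splitSum, splitSum_concat, splitSum_eq_last]
    · have h1 : ins Q [] [] (m (v ++ [c₀])) [x, c₀] = 0 := by
        by_contra h
        obtain ⟨y, -, hy⟩ := exists_of_mem_support_ins h
        simp at hy
      have h2 : ins Q [] [c₀] (m v) [x, c₀] = m v x := by
        rw [← slice_apply, slice_ins_self]
      simp [h1, h2]
    · intro b c _ hc'
      rw [sgn_nil, one_smul, Finsupp.lapply_apply]
      by_contra h
      obtain ⟨y, -, hy⟩ := exists_of_mem_support_ins h
      simp at hy
      exact hc' hy.2
  · intro a q haq ha
    rw [map_splitSum]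
    refine (splitSum_congr fun b c hbc ↦ ?_).trans (splitSum_zero q)
    rw [map_smul, Finsupp.lapply_apply]
    convert smul_zero _
    by_contra h
    obtain ⟨y, hy, hy'⟩ := exists_of_mem_support_ins h
    rcases a with _ | ⟨a₁, _ | ⟨a₂, a⟩⟩
    · exact ha rfl
    · simp at hy'
      obtain ⟨rfl, rfl, rfl⟩ := hy'
      have hwb := (H.adm b _ hy).1
      rw [List.append_nil] at hbc
      subst hbc
      rcases v with _ | ⟨z, v⟩
      · simp at haq
        rw [haq.2, h0] at hy
        simp at hy
      · simp at haq
        obtain ⟨rfl, rfl⟩ := haq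
        simp at hwb hv
        rcases v with _ | ⟨z', v⟩
        · simp at hwb
        · simp at hv
          have := H.two_le z' hv.2.1
          simp at hwb
          omega
    · have := congrArg List.length hy'
      simp at this

/-- All other terms of D(v c₀) come from proper open blocks of `v`, or from blocks that end in `c₀`
and omit a nonempty part of `v`. The latter have weight at most that of `v`, since `c₀` has weight
1, so both kinds are minimal by hypothesis. -/
theorem ExactSystem.coder_concat_sub_mem (H : ExactSystem cl wt δ m) {v : List L}
    (hv : ¬ HasClosed cl v) {c₀ : L} (hcl : cl c₀) (hc : wt c₀ = 1)
    (hopen : ∀ w, ¬ HasClosed cl w → wordWt wt w < wordWt wt v → m w ∈ CoeffIn L J)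
    (hclosed : ∀ w, Good cl w → HasClosed cl w → wordWt wt w ≤ wordWt wt v → m w ∈ CoeffIn L J) :
    coder wt m (v ++ [c₀]) - (ins Q [] [c₀] (m v) + ins Q [] [] (m (v ++ [c₀]))) ∈
      CoeffIn (List L) J := by
  have h0 : m [] = 0 := H.lowersWt.nil
  have h1 : coder wt m (v ++ [c₀]) =
      splitSum (fun a q ↦ splitSum (fun b c ↦ sgn Q wt a • ins Q a (c ++ [c₀]) (m b)) q) v +
      splitSum (fun a q ↦ sgn Q wt a • ins Q a [] (m (q ++ [c₀]))) v := by
    rw [coder, splitSum_concat, splitSum_nil, h0, map_zero, smul_zero, add_zero, ← splitSum_add]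
    simp only [splitSum_concat]
  rw [h1, add_sub_add_comm]
  refine Submodule.add_mem _ ?_ ?_
  · have := splitSum_splitSum_sub_mem (P := CoeffIn (List L) J) (w := v)
      (F := fun a b c ↦ sgn Q wt a • ins Q a (c ++ [c₀]) (m b)) ?_
    · simpa using this
    · intro a b c habc hb
      refine Submodule.smul_mem _ _ (ins_mem_CoeffIn (hopen b ?_ (wordWt_lt H.one_le habc hb)))
      rw [← habc] at hv
      simp at hv
      tauto
  · have := splitSum_sub_first_mem (P := CoeffIn (List L) J) (w := v)
      (F := fun a q ↦ sgn Q wt a • ins Q a [] (m (q ++ [c₀]))) ?_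
    · simpa using this
    · intro a q haq ha
      refine Submodule.smul_mem _ _ (ins_mem_CoeffIn (hclosed _ ?_ ?_ ?_))
      · refine good_append_singleton ?_ _
        rw [← haq] at hv
        simp at hv
        tauto
      · simp [hcl]
      · have := wordWt_pos H.one_le ha
        rw [← haq]; simp [hc]; omega

end Minimality

/-! ### Regular local rings are domains; regular systems of parameters. -/

section RegularLocal

open IsLocalRing

theorem maximalIdeal_quotient {Q : Type*} [CommRing Q] [IsLocalRing Q] {I : Ideal Q}
    (hI : I ≤ maximalIdeal Q) [IsLocalRing (Q ⧸ I)] :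
    maximalIdeal (Q ⧸ I) = (maximalIdeal Q).map (Ideal.Quotient.mk I) := by
  symm
  rcases Ideal.map_eq_top_or_isMaximal_of_surjective (Ideal.Quotient.mk I)
    Ideal.Quotient.mk_surjective (maximalIdeal.isMaximal Q) with h | h
  · exfalso
    have := congrArg (Ideal.comap (Ideal.Quotient.mk I)) h
    rw [Ideal.comap_map_of_surjective _ Ideal.Quotient.mk_surjective, Ideal.comap_top,
      ← RingHom.ker_eq_comap_bot, Ideal.mk_ker, sup_eq_left.2 hI] at this
    exact (maximalIdeal.isMaximal Q).ne_top this
  · exact eq_maximalIdeal h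

theorem isLocalRing_quotient {Q : Type*} [CommRing Q] [IsLocalRing Q] {I : Ideal Q}
    (hI : I ≤ maximalIdeal Q) : IsLocalRing (Q ⧸ I) := by
  have : Nontrivial (Q ⧸ I) :=
    Ideal.Quotient.nontrivial_iff.2 fun h ↦ (maximalIdeal.isMaximal Q).ne_top (top_le_iff.1 (h ▸ hI))
  exact IsLocalRing.of_surjective' _ Ideal.Quotient.mk_surjective

theorem not_height_maximalIdeal_le {Q : Type*} [CommRing Q] [IsLocalRing Q] {d : ℕ}
    (hd : (d + 1 : ℕ) ≤ ringKrullDim Q) : maximalIdeal Q ∉ minimalPrimes Q := by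
  intro h
  have h1 := maximalIdeal_height_eq_ringKrullDim (R := Q)
  rw [Ideal.height_eq_zero_iff.2 h] at h1
  rw [← h1] at hd
  norm_cast at hd

/-- A Noetherian local ring whose maximal ideal is generated by `dim` elements is a domain. -/
theorem isDomain_of_span (d : ℕ) : ∀ (Q : Type u) [CommRing Q] [IsLocalRing Q] [IsNoetherianRing Q]
    (s : Finset Q), Ideal.span (s : Set Q) = maximalIdeal Q → s.card ≤ d →
    (d : WithBot ℕ∞) ≤ ringKrullDim Q → IsDomain Q := by
  classical
  induction d with
  | zero =>
    intro Q _ _ _ s hs hd _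
    have : s = ∅ := by simpa using hd
    rw [this, Finset.coe_empty, Ideal.span_empty] at hs
    exact (isField_iff_maximalIdeal_eq.2 hs.symm).isDomain
  | succ d ih =>
    intro Q _ _ _ s hs hcard hd
    have hmin := not_height_maximalIdeal_le hd
    -- Prime avoidance for 𝔫² and the finitely many minimal primes; one ideal in the list may fail
    -- to be prime. If 𝔫 ⊆ 𝔫², then 𝔫 = 0 by Nakayama, so 𝔫 would be a minimal prime, against
    -- positive dimension.
    obtain ⟨x, hx, hx2, hxP⟩ : ∃ x ∈ maximalIdeal Q, x ∉ maximalIdeal Q ^ 2 ∧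
        ∀ P ∈ minimalPrimes Q, x ∉ P := by
      by_contra! hcon
      have hfin := minimalPrimes.finite_of_isNoetherianRing Q
      have hsub : ((maximalIdeal Q : Ideal Q) : Set Q) ⊆
          ⋃ i ∈ ((insert (maximalIdeal Q ^ 2) hfin.toFinset : Finset (Ideal Q)) : Set (Ideal Q)),
            (id i : Ideal Q) := by
        intro y hy
        by_cases h2 : y ∈ maximalIdeal Q ^ 2
        · exact Set.mem_biUnion (by simp) h2
        · obtain ⟨P, hP, hyP⟩ := hcon y hy h2
          exact Set.mem_biUnion (by simp [hP]) hyP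
      rw [Ideal.subset_union_prime (maximalIdeal Q ^ 2) (maximalIdeal Q ^ 2)] at hsub
      · obtain ⟨i, hi, hle⟩ := hsub
        rw [Finset.mem_insert] at hi
        rcases hi with rfl | hi
        · have h0 : maximalIdeal Q = ⊥ := by
            refine Submodule.eq_bot_of_le_smul_of_le_jacobson_bot (maximalIdeal Q) _
              (IsNoetherian.noetherian _) ?_ (maximalIdeal_le_jacobson _)
            rw [smul_eq_mul, ← pow_two]; exact hle
          apply hmin
          have hp : (⊥ : Ideal Q).IsPrime := h0 ▸ (maximalIdeal.isMaximal Q).isPrime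
          rw [h0]
          exact ⟨⟨hp, le_rfl⟩, fun _ _ _ ↦ bot_le⟩
        · rw [Set.Finite.mem_toFinset] at hi
          have hp : i.IsPrime := hi.1.1
          have : i = maximalIdeal Q := le_antisymm (le_maximalIdeal hp.ne_top) hle
          exact hmin (this ▸ hi)
      · intro i hi h _
        rw [Finset.mem_insert] at hi
        rcases hi with rfl | hi
        · exact absurd rfl h
        · rw [Set.Finite.mem_toFinset] at hi
          exact hi.1.1
    obtain ⟨a, ha⟩ : ∃ a : Q → Q, ∑ f ∈ s, a f * f = x := by
      rw [← hs] at hx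
      obtain ⟨a, -, ha⟩ := Submodule.mem_span_finset.1 hx
      exact ⟨a, by simpa using ha⟩
    -- Since x ∉ 𝔫², some generator `f` occurs in `x` with a unit coefficient. It becomes redundant
    -- modulo `x`, so the quotient needs one generator less, while the dimension drops by at most
    -- one.
    obtain ⟨f, hf, haf⟩ : ∃ f ∈ s, IsUnit (a f) := by
      by_contra! h
      apply hx2
      rw [← ha, pow_two]
      exact Ideal.sum_mem _ fun f hf ↦ Ideal.mul_mem_mul ((mem_maximalIdeal _).2 (h f hf))
        (hs ▸ Ideal.subset_span hf)
    have hspan1 : Ideal.span {x} ≤ maximalIdeal Q := (Ideal.span_singleton_le_iff_mem _).2 hx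
    have := isLocalRing_quotient hspan1
    have hdomain : IsDomain (Q ⧸ Ideal.span {x}) := by
      refine ih (Q ⧸ Ideal.span {x}) ((s.erase f).image (Ideal.Quotient.mk _)) ?_ ?_ ?_
      · rw [maximalIdeal_quotient hspan1, Finset.coe_image, ← Ideal.map_span]
        refine le_antisymm (Ideal.map_mono ?_) ?_
        · rw [← hs]; exact Ideal.span_mono (by simp)
        · rw [← hs, Ideal.map_span, Ideal.span_le]
          rintro _ ⟨g, hg, rfl⟩
          by_cases hgf : g = f
          · subst hgf
            have h1 : Ideal.Quotient.mk (Ideal.span {x}) (a g * g) =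
                - ∑ h ∈ s.erase g, Ideal.Quotient.mk (Ideal.span {x}) (a h * h) := by
              rw [eq_neg_iff_add_eq_zero, ← map_sum, ← map_add, Finset.add_sum_erase s (fun h ↦ a h * h) hf, ha,
                Ideal.Quotient.eq_zero_iff_mem]
              exact Ideal.mem_span_singleton_self x
            rw [map_mul] at h1
            obtain ⟨b, hb⟩ := haf.exists_left_inv
            have h2 : Ideal.Quotient.mk (Ideal.span {x}) g = Ideal.Quotient.mk (Ideal.span {x}) b *
                (Ideal.Quotient.mk (Ideal.span {x}) (a g) * Ideal.Quotient.mk _ g) := by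
              rw [← mul_assoc, ← map_mul, hb, map_one, one_mul]
            rw [h2, h1]
            refine Ideal.mul_mem_left _ _ (Ideal.neg_mem_iff _ |>.2 (Ideal.sum_mem _ fun h hh ↦ ?_))
            exact Ideal.mem_map_of_mem _ (Ideal.mul_mem_left _ _ (Ideal.subset_span hh))
          · exact Ideal.mem_map_of_mem _ (Ideal.subset_span (by simpa [hgf] using hg))
      · refine Finset.card_image_le.trans ?_
        rw [Finset.card_erase_of_mem hf]; omega
      · have h1 := ringKrullDim_le_ringKrullDim_quotient_add_card {x} (by
          simp only [Finset.coe_singleton, Set.singleton_subset_iff, SetLike.mem_coe]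
          rw [Ring.jacobson_eq_sInf_isMaximal, Submodule.mem_sInf]
          intro M hM
          rw [eq_maximalIdeal hM]; exact hx)
        rw [Finset.coe_singleton, Finset.card_singleton] at h1
        have h2 := hd.trans h1
        push_cast at h2
        exact ENat.WithBot.add_le_add_one_right_iff.1 h2
    have hprime : (Ideal.span {x}).IsPrime := (Ideal.Quotient.isDomain_iff_prime _).1 hdomain
    obtain ⟨P, hP, hPx⟩ := Ideal.exists_minimalPrimes_le (bot_le (a := Ideal.span {x}))
    have hPp : P.IsPrime := hP.1.1
    -- Every element of P is a multiple of `x`, and `x` is not in P, so the cofactor lies in P. Thus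
    -- P = xP, and Nakayama gives P = 0.
    have hPbot : P = ⊥ := by
      refine Submodule.eq_bot_of_le_smul_of_le_jacobson_bot (maximalIdeal Q) _
        (IsNoetherian.noetherian _) ?_ (maximalIdeal_le_jacobson _)
      intro y hy
      obtain ⟨z, rfl⟩ := Ideal.mem_span_singleton'.1 (hPx hy)
      have hz : z ∈ P := (hPp.mem_or_mem hy).resolve_right (hxP P hP)
      rw [mul_comm, smul_eq_mul]
      exact Ideal.mul_mem_mul hx hz
    have : (⊥ : Ideal Q).IsPrime := hPbot ▸ hPp
    exact (IsDomain.of_bot_isPrime Q)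

/-- A regular system of parameters: it generates the maximal ideal, it is a regular sequence, and
it is independent modulo the square of the maximal ideal. -/
theorem exists_regular_system (Q : Type u) [CommRing Q] [IsRegularLocalRing Q] :
    ∃ (d : ℕ) (x : ℕ → Q), (d : WithBot ℕ∞) = ringKrullDim Q ∧
      Ideal.span (x '' Set.Iio d) = maximalIdeal Q ∧
      (∀ l < d, ∀ q, x l * q ∈ Ideal.span (x '' Set.Iio l) → q ∈ Ideal.span (x '' Set.Iio l)) ∧
      (∀ l < d, ∀ b, x l * b ∈ maximalIdeal Q ^ 2 ⊔ Ideal.span (x '' (Set.Iio d \ {l})) →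
        b ∈ maximalIdeal Q) := by
  classical
  set d := (maximalIdeal Q).spanFinrank with hd
  have hdim : (d : WithBot ℕ∞) = ringKrullDim Q := IsRegularLocalRing.spanFinrank_maximalIdeal
  obtain ⟨s, hs, hspan⟩ :=
    (IsNoetherian.noetherian (maximalIdeal Q)).exists_span_finset_card_eq_spanFinrank
  have hcard : s.card = d := hs
  obtain ⟨x, hx⟩ : ∃ x : ℕ → Q, x '' Set.Iio d = s := by
    refine ⟨fun i ↦ if h : i < d then s.equivFin.symm ⟨i, hcard ▸ h⟩ else 0, ?_⟩
    ext y
    simp only [Set.mem_image, Set.mem_Iio, Finset.mem_coe]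
    constructor
    · rintro ⟨i, hi, rfl⟩
      simp [hi]
    · intro hy
      refine ⟨s.equivFin ⟨y, hy⟩, by rw [← hcard]; exact (s.equivFin ⟨y, hy⟩).2, ?_⟩
      rw [dif_pos (by rw [← hcard]; exact (s.equivFin ⟨y, hy⟩).2)]
      simp
  have hspan' : Ideal.span (x '' Set.Iio d) = maximalIdeal Q := by rw [hx]; exact hspan
  have hmem : ∀ i < d, x i ∈ maximalIdeal Q := fun i hi ↦
    hspan' ▸ Ideal.subset_span ⟨i, hi, rfl⟩
  -- The number `d` of generators is minimal, so none of them can be dropped.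
  have hnot : ∀ l < d, ¬ maximalIdeal Q ≤ Ideal.span (x '' (Set.Iio d \ {l})) := by
    intro l hl h
    have h1 : maximalIdeal Q = Ideal.span (((Finset.range d).erase l).image x : Set Q) := by
      have : (((Finset.range d).erase l).image x : Set Q) = x '' (Set.Iio d \ {l}) := by
        ext y; simp [and_comm]
      rw [this]
      refine le_antisymm h ?_
      rw [← hspan']
      exact Ideal.span_mono (Set.image_mono Set.sdiff_subset)
    have h2 : (maximalIdeal Q).spanFinrank ≤ d - 1 := by
      rw [h1]
      refine (Submodule.spanFinrank_span_le_ncard_of_finite (Finset.finite_toSet _)).trans ?_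
      rw [Set.ncard_coe_finset]
      refine Finset.card_image_le.trans ?_
      rw [Finset.card_erase_of_mem (by simpa using hl), Finset.card_range]
    omega
  refine ⟨d, x, hdim, hspan', ?_, ?_⟩
  · intro l hl q hq
    have hle : Ideal.span (x '' Set.Iio l) ≤ maximalIdeal Q := by
      rw [← hspan']
      exact Ideal.span_mono (Set.image_mono (Set.Iio_subset_Iio hl.le))
    have := isLocalRing_quotient hle
    -- The maximal ideal of the quotient by the first `l` parameters is generated by the other d -
    -- l, and its dimension is at least d - l. In this domain the image of x_l is nonzero by `hnot`,
    -- hence regular.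
    have hdom : IsDomain (Q ⧸ Ideal.span (x '' Set.Iio l)) := by
      refine isDomain_of_span (d - l) _
        (((Finset.Ico l d).image x).image (Ideal.Quotient.mk _)) ?_ ?_ ?_
      · rw [maximalIdeal_quotient hle, Finset.coe_image, ← Ideal.map_span, ← hspan']
        refine le_antisymm (Ideal.map_mono (Ideal.span_mono ?_)) ?_
        · rintro _ hy
          simp only [Finset.coe_image, Finset.coe_Ico, Set.mem_image, Set.mem_Ico] at hy
          obtain ⟨i, hi, rfl⟩ := hy
          exact ⟨i, hi.2, rfl⟩
        · rw [Ideal.map_span, Ideal.span_le]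
          rintro _ ⟨_, ⟨i, hi, rfl⟩, rfl⟩
          by_cases hil : i < l
          · have h0 : Ideal.Quotient.mk (Ideal.span (x '' Set.Iio l)) (x i) = 0 :=
              Ideal.Quotient.eq_zero_iff_mem.2 (Ideal.subset_span ⟨i, hil, rfl⟩)
            rw [h0]
            exact Ideal.zero_mem _
          · refine Ideal.mem_map_of_mem _ (Ideal.subset_span ?_)
            simp only [Finset.coe_image, Finset.coe_Ico, Set.mem_image, Set.mem_Ico]
            exact ⟨i, ⟨by omega, hi⟩, rfl⟩
      · refine Finset.card_image_le.trans (Finset.card_image_le.trans ?_)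
        simp
      · have h1 := ringKrullDim_le_ringKrullDim_quotient_add_card ((Finset.range l).image x) (by
          intro y hy
          simp only [Finset.coe_image, Finset.coe_range, Set.mem_image, Set.mem_Iio] at hy
          obtain ⟨i, hi, rfl⟩ := hy
          simp only [SetLike.mem_coe]
          rw [Ring.jacobson_eq_sInf_isMaximal, Submodule.mem_sInf]
          intro M hM
          rw [eq_maximalIdeal hM]; exact hmem i (by omega))
        rw [← hdim, Finset.coe_image, Finset.coe_range] at h1
        have h2 : (((Finset.range l).image x).card : WithBot ℕ∞) ≤ (l : WithBot ℕ∞) := by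
          exact_mod_cast Finset.card_image_le.trans (by simp)
        have h3 := h1.trans (add_le_add_right h2 _)
        have h4 : (d : WithBot ℕ∞) = ((d - l : ℕ) : WithBot ℕ∞) + (l : WithBot ℕ∞) := by
          exact_mod_cast (Nat.sub_add_cancel hl.le).symm
        rw [h4] at h3
        exact ENat.WithBot.add_le_add_natCast_right_iff.1 h3
    have hp := (Ideal.Quotient.isDomain_iff_prime _).1 hdom
    refine (hp.mem_or_mem hq).resolve_left fun hxl ↦ hnot l hl ?_
    rw [← hspan', Ideal.span_le]
    rintro _ ⟨i, hi, rfl⟩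
    by_cases hil : i = l
    · subst hil
      refine Ideal.span_mono (Set.image_mono ?_) hxl
      intro j hj
      simp only [Set.mem_Iio, Set.mem_sdiff, Set.mem_singleton_iff] at hj ⊢
      omega
    · exact Ideal.subset_span ⟨i, ⟨hi, hil⟩, rfl⟩
  · intro l hl b hb
    by_contra hbn
    have hu : IsUnit b := by simpa using hbn
    have hxl : x l ∈ maximalIdeal Q ^ 2 ⊔ Ideal.span (x '' (Set.Iio d \ {l})) := by
      obtain ⟨c, hc⟩ := hu.exists_right_inv
      have := Ideal.mul_mem_right c _ hb
      rwa [mul_assoc, hc, mul_one] at this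
    apply hnot l hl
    -- If x_l is in 𝔫² plus the ideal of the other parameters, these generate 𝔫 modulo 𝔫², hence
    -- generate 𝔫 by Nakayama, contrary to `hnot`.
    refine Submodule.le_of_le_smul_of_le_jacobson_bot (I := maximalIdeal Q)
      (IsNoetherian.noetherian _) (maximalIdeal_le_jacobson _) ?_
    rw [smul_eq_mul, ← pow_two, sup_comm]
    conv_lhs => rw [← hspan']
    rw [Ideal.span_le]
    rintro _ ⟨i, hi, rfl⟩
    by_cases hil : i = l
    · rw [hil]; exact hxl
    · exact Ideal.mem_sup_right (Ideal.subset_span ⟨i, ⟨hi, hil⟩, rfl⟩)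

end RegularLocal

/-! ### The Koszul complex as an iterated mapping cone. -/

section Koszul

open IsLocalRing

variable {Q : Type u} [CommRing Q]

/-- Combinations of basis elements of weight `p`. -/
def Homog (Q : Type*) [CommRing Q] {C : Type*} (wt : C → ℕ) (p : ℕ) : Submodule Q (C →₀ Q) :=
  Finsupp.supported Q Q {c | wt c = p}

theorem mem_Homog {C : Type*} {wt : C → ℕ} {p : ℕ} {v : C →₀ Q} :
    v ∈ Homog Q wt p ↔ ∀ c ∈ v.support, wt c = p := Iff.rfl

/-- A based complex of free modules, concentrated in weights `≥ 1`, with one basis element of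
weight one, that resolves `Q / J₀` and satisfies strong minimality modulo `J`. -/
structure IsKoszulLike (n J₀ J : Ideal Q) (C : Type u) (wt : C → ℕ) (d : C → (C →₀ Q)) (c₀ : C) :
    Prop where
  finite : Finite C
  one_le : ∀ c, 1 ≤ wt c
  wt_eq_one : ∀ c, wt c = 1 ↔ c = c₀
  lowers : ∀ c, ∀ x ∈ (d c).support, wt x + 1 = wt c
  sq : ∀ c, ext d (d c) = 0
  exact : ∀ p, 2 ≤ p → ∀ v ∈ Homog Q wt p, ext d v = 0 → ∃ y ∈ Homog Q wt (p + 1), ext d y = v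
  mem_iff : ∀ q, (∃ y ∈ Homog Q wt 2, ext d y = Finsupp.single c₀ q) ↔ q ∈ J₀
  minimal : ∀ c, d c ∈ CoeffIn C n
  strong : ∀ p, 2 ≤ p → ∀ v ∈ Homog Q wt p, ext d v ∈ CoeffIn C J → v ∈ CoeffIn C n

theorem ext_lowers {C : Type*} {wt : C → ℕ} {d : C → (C →₀ Q)}
    (h : ∀ c, ∀ x ∈ (d c).support, wt x + 1 = wt c) {p : ℕ} {v : C →₀ Q}
    (hv : v ∈ Homog Q wt (p + 1)) : ext d v ∈ Homog Q wt p :=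
  ext_mem fun c hc x hx ↦ by
    have h1 := h c x hx
    have h2 : wt c = p + 1 := hv hc
    change wt x = p
    omega

theorem isKoszulLike_zero (n J : Ideal Q) :
    IsKoszulLike n ⊥ J PUnit.{u + 1} (fun _ ↦ 1) (fun _ ↦ 0) PUnit.unit where
  finite := inferInstance
  one_le _ := le_rfl
  wt_eq_one _ := by simp
  lowers := by simp
  sq := by simp
  exact p hp v hv _ := by
    have hv0 : v = 0 := by
      by_contra h
      obtain ⟨c, hc⟩ := Finsupp.ne_iff.1 h
      have : 1 = p := hv (Finsupp.mem_support_iff.2 hc)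
      omega
    exact ⟨0, Submodule.zero_mem _, by rw [hv0, map_zero]⟩
  mem_iff q := by
    constructor
    · rintro ⟨y, -, hy⟩
      have : ext (fun _ : PUnit ↦ (0 : PUnit →₀ Q)) y = 0 := ext_eq_zero fun _ _ ↦ rfl
      rw [this] at hy
      simpa using (Finsupp.single_eq_zero.1 hy.symm)
    · rintro h
      rw [Ideal.mem_bot] at h
      exact ⟨0, Submodule.zero_mem _, by simp [h]⟩
  minimal _ := Submodule.zero_mem _
  strong p hp v hv _ := by
    intro c
    by_contra h
    have : 1 = p := hv (Finsupp.mem_support_iff.2 fun h0 ↦ h (by rw [h0]; exact n.zero_mem))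
    omega

variable {C : Type u}

/-- Recombine the two components of a vector on a disjoint union. -/
noncomputable def pairVec (C : Type u) : ((C →₀ Q) × (C →₀ Q)) ≃ₗ[Q] (C ⊕ C →₀ Q) :=
  (Finsupp.sumFinsuppLEquivProdFinsupp Q).symm

@[simp] theorem pairVec_inl (a b : C →₀ Q) (c : C) : pairVec C (a, b) (Sum.inl c) = a c :=
  Finsupp.sumFinsuppLEquivProdFinsupp_symm_inl Q (a, b) c

@[simp] theorem pairVec_inr (a b : C →₀ Q) (c : C) : pairVec C (a, b) (Sum.inr c) = b c :=
  Finsupp.sumFinsuppLEquivProdFinsupp_symm_inr Q (a, b) c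

theorem exists_pairVec (v : C ⊕ C →₀ Q) : ∃ a b, v = pairVec C (a, b) :=
  ⟨_, _, ((pairVec C).apply_symm_apply v).symm⟩

/-- The differential of the mapping cone of multiplication by `x`. -/
noncomputable def coneDiff (d : C → (C →₀ Q)) (x : Q) : C ⊕ C → (C ⊕ C →₀ Q) :=
  Sum.elim (fun c ↦ pairVec C (d c, 0)) (fun c ↦ pairVec C (Finsupp.single c x, -d c))

/-- The weights of the mapping cone. -/
def coneWt (wt : C → ℕ) : C ⊕ C → ℕ := Sum.elim wt (fun c ↦ wt c + 1)

theorem single_inl (c : C) (r : Q) :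
    Finsupp.single (Sum.inl c) r = pairVec C (Finsupp.single c r, 0) := by
  classical
  ext (i | i) <;> simp [Finsupp.single_apply]

theorem single_inr (c : C) (r : Q) :
    Finsupp.single (Sum.inr c) r = pairVec C (0, Finsupp.single c r) := by
  classical
  ext (i | i) <;> simp [Finsupp.single_apply]

theorem ext_coneDiff (d : C → (C →₀ Q)) (x : Q) (a b : C →₀ Q) :
    ext (coneDiff d x) (pairVec C (a, b)) = pairVec C (ext d a + x • b, -ext d b) := by
  have h : (a, b) = (a, 0) + (0, b) := by simp
  have h' : (ext d a + x • b, -ext d b) = (ext d a, (0 : C →₀ Q)) + (x • b, -ext d b) := by simp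
  rw [h, h', map_add, map_add, map_add]
  congr 1
  · induction a using Finsupp.induction_linear with
    | zero => simp only [map_zero, ← Prod.zero_eq_mk]
    | add a₁ a₂ h₁ h₂ =>
      have e1 : (a₁ + a₂, (0 : C →₀ Q)) = (a₁, 0) + (a₂, 0) := by simp
      have e2 : (ext d (a₁ + a₂), (0 : C →₀ Q)) = (ext d a₁, 0) + (ext d a₂, 0) := by simp
      rw [e1, e2, map_add, map_add, map_add, h₁ (by simp) (by simp), h₂ (by simp) (by simp)]
    | single c r =>
      rw [← single_inl]
      simp only [ext, Finsupp.linearCombination_single, coneDiff, Sum.elim_inl]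
      rw [← map_smul]; simp
  · induction b using Finsupp.induction_linear with
    | zero => simp only [map_zero, smul_zero, neg_zero, ← Prod.zero_eq_mk]
    | add a₁ a₂ h₁ h₂ =>
      have e1 : ((0 : C →₀ Q), a₁ + a₂) = (0, a₁) + (0, a₂) := by simp
      have e2 : (x • (a₁ + a₂), -ext d (a₁ + a₂)) =
          (x • a₁, -ext d a₁) + (x • a₂, -ext d a₂) := by simp [add_comm]
      rw [e1, e2, map_add, map_add, map_add, h₁ (by simp) (by simp), h₂ (by simp) (by simp)]
    | single c r =>
      rw [← single_inr]
      simp only [ext, Finsupp.linearCombination_single, coneDiff, Sum.elim_inr]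
      rw [← map_smul]; simp [mul_comm]

theorem pairVec_mem_Homog {wt : C → ℕ} {p : ℕ} {a b : C →₀ Q} :
    pairVec C (a, b) ∈ Homog Q (coneWt wt) (p + 1) ↔ a ∈ Homog Q wt (p + 1) ∧ b ∈ Homog Q wt p := by
  simp only [mem_Homog, Finsupp.mem_support_iff, Sum.forall, pairVec_inl, pairVec_inr, coneWt,
    Sum.elim_inl, Sum.elim_inr, add_left_inj]

theorem pairVec_mem_CoeffIn {J : Ideal Q} {a b : C →₀ Q} :
    pairVec C (a, b) ∈ CoeffIn (C ⊕ C) J ↔ a ∈ CoeffIn C J ∧ b ∈ CoeffIn C J := by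
  simp only [mem_CoeffIn, Sum.forall, pairVec_inl, pairVec_inr]

theorem IsKoszulLike.eq_single {n J₀ J : Ideal Q} {wt : C → ℕ} {d : C → (C →₀ Q)} {c₀ : C}
    (H : IsKoszulLike n J₀ J C wt d c₀) {v : C →₀ Q} (hv : v ∈ Homog Q wt 1) :
    v = Finsupp.single c₀ (v c₀) := by
  classical
  ext c
  rw [Finsupp.single_apply]
  split_ifs with h
  · rw [h]
  · by_contra h0
    exact h ((H.wt_eq_one c).1 (hv (Finsupp.mem_support_iff.2 h0))).symm

theorem IsKoszulLike.ext_of_one {n J₀ J : Ideal Q} {wt : C → ℕ} {d : C → (C →₀ Q)} {c₀ : C}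
    (H : IsKoszulLike n J₀ J C wt d c₀) {v : C →₀ Q} (hv : v ∈ Homog Q wt 1) : ext d v = 0 := by
  have h := ext_lowers (p := 0) H.lowers hv
  ext c
  by_contra h0
  have h1 : wt c = 0 := h (Finsupp.mem_support_iff.2 h0)
  have := H.one_le c
  omega

/-- The mapping cone of multiplication by `x`. -/
theorem IsKoszulLike.cone {n J₀ J J₀' J' : Ideal Q} {wt : C → ℕ} {d : C → (C →₀ Q)} {c₀ : C}
    (H : IsKoszulLike n J₀ J C wt d c₀) {x : Q} (hx : x ∈ n)
    (hreg : ∀ q, x * q ∈ J₀ → q ∈ J₀) (hJ₀' : J₀' = J₀ ⊔ Ideal.span {x})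
    (hJ : J' ≤ J) (hxJ : x ∈ J) (hmin : ∀ b, x * b ∈ J' ⊔ J₀ → b ∈ n) :
    IsKoszulLike n J₀' J' (C ⊕ C) (coneWt wt) (coneDiff d x) (Sum.inl c₀) where
  finite := have := H.finite; inferInstance
  one_le := by
    rintro (c | c)
    · exact H.one_le c
    · exact Nat.le_add_left _ _
  wt_eq_one := by
    rintro (c | c)
    · simpa [coneWt] using H.wt_eq_one c
    · have := H.one_le c
      simp [coneWt]; omega
  lowers := by
    classical
    rintro (c | c) (y | y) hy
    · exact H.lowers c y (by simpa [coneDiff] using hy)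
    · simp [coneDiff] at hy
    · simp [coneDiff, Finsupp.single_apply] at hy
      simp [coneWt, hy.1]
    · have := H.lowers c y (by simpa [coneDiff] using hy)
      simp [coneWt, this]
  sq := by
    rintro (c | c)
    · have : coneDiff d x (Sum.inl c) = pairVec C (d c, 0) := rfl
      rw [this, ext_coneDiff, H.sq]
      simp only [smul_zero, add_zero, map_zero, neg_zero, ← Prod.zero_eq_mk]
    · have : coneDiff d x (Sum.inr c) = pairVec C (Finsupp.single c x, -d c) := rfl
      rw [this, ext_coneDiff, map_neg, H.sq]
      simp only [ext, Finsupp.linearCombination_single, smul_neg, add_neg_cancel, neg_zero,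
        ← Prod.zero_eq_mk, map_zero]
  exact := by
    intro p hp v hv h0
    obtain ⟨p, rfl⟩ := Nat.exists_eq_add_of_le' (show 1 ≤ p by omega)
    obtain ⟨a, b, rfl⟩ := exists_pairVec v
    obtain ⟨ha, hb⟩ := pairVec_mem_Homog.1 hv
    rw [ext_coneDiff, ← map_zero (pairVec C), (pairVec C).injective.eq_iff, Prod.ext_iff] at h0
    obtain ⟨h1, h2⟩ := h0
    simp only [Prod.fst_zero, Prod.snd_zero, neg_eq_zero] at h1 h2
    -- The second component of a cycle bounds. In weight 1 the cycle condition makes x b(c₀) a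
    -- boundary, so it lies in J₀, and regularity of `x` modulo J₀ applies. In higher weight the
    -- smaller complex is exact.
    obtain ⟨b', hb', hbe⟩ : ∃ b' ∈ Homog Q wt (p + 1), ext d b' = b := by
      by_cases hp1 : p = 1
      · subst hp1
        have hbs := H.eq_single hb
        have hq : b c₀ ∈ J₀ := by
          refine hreg _ ((H.mem_iff _).1 ⟨-a, Submodule.neg_mem _ ha, ?_⟩)
          rw [map_neg, eq_neg_of_add_eq_zero_left h1, neg_neg]
          conv_lhs => rw [hbs]
          simp
        obtain ⟨y, hy, hye⟩ := (H.mem_iff _).2 hq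
        exact ⟨y, hy, by rw [hye, ← hbs]⟩
      · exact H.exact p (by omega) b hb h2
    have hc : a + x • b' ∈ Homog Q wt (p + 1) :=
      Submodule.add_mem _ ha (Submodule.smul_mem _ _ hb')
    obtain ⟨a', ha', hae⟩ := H.exact (p + 1) (by omega) _ hc (by rw [map_add, map_smul, hbe, h1])
    refine ⟨pairVec C (a', -b'), pairVec_mem_Homog.2 ⟨ha', Submodule.neg_mem _ hb'⟩, ?_⟩
    rw [ext_coneDiff, hae, map_neg, hbe]
    simp
  mem_iff := by
    intro q
    constructor
    · rintro ⟨y, hy, hye⟩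
      obtain ⟨a, b, rfl⟩ := exists_pairVec y
      obtain ⟨ha, hb⟩ := pairVec_mem_Homog.1 hy
      rw [ext_coneDiff, single_inl, (pairVec C).injective.eq_iff, Prod.ext_iff] at hye
      have h1 : ext d a = Finsupp.single c₀ (q - x * b c₀) := by
        have := eq_sub_of_add_eq hye.1
        rw [this, H.eq_single hb]
        simp
      rw [hJ₀', ← sub_add_cancel q (x * b c₀)]
      exact Submodule.add_mem_sup ((H.mem_iff _).1 ⟨a, ha, h1⟩)
        (Ideal.mul_mem_right _ _ (Ideal.mem_span_singleton_self x))
    · intro hq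
      rw [hJ₀'] at hq
      obtain ⟨r, hr, s, hs, rfl⟩ := Submodule.mem_sup.1 hq
      obtain ⟨t, rfl⟩ := Ideal.mem_span_singleton'.1 hs
      obtain ⟨y, hy, hye⟩ := (H.mem_iff _).2 hr
      have h1 : Finsupp.single c₀ t ∈ Homog Q wt 1 := by
        intro c hc
        have := Finsupp.support_single_subset hc
        exact (H.wt_eq_one c).2 (by simpa using this)
      refine ⟨pairVec C (y, Finsupp.single c₀ t), pairVec_mem_Homog.2 ⟨hy, h1⟩, ?_⟩
      rw [ext_coneDiff, hye, H.ext_of_one h1, single_inl]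
      simp [mul_comm]
  minimal := by
    classical
    rintro (c | c)
    · exact pairVec_mem_CoeffIn.2 ⟨H.minimal c, Submodule.zero_mem _⟩
    · refine pairVec_mem_CoeffIn.2 ⟨fun y ↦ ?_, Submodule.neg_mem _ (H.minimal c)⟩
      rw [Finsupp.single_apply]
      split_ifs
      exacts [hx, n.zero_mem]
  strong := by
    intro p hp v hv h
    obtain ⟨p, rfl⟩ := Nat.exists_eq_add_of_le' (show 1 ≤ p by omega)
    obtain ⟨a, b, rfl⟩ := exists_pairVec v
    obtain ⟨ha, hb⟩ := pairVec_mem_Homog.1 hv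
    rw [ext_coneDiff, pairVec_mem_CoeffIn] at h
    -- Enlarging J' to `J`, which contains `x`, hides the term x b, so the hypothesis on the smaller
    -- complex applies to `a`.
    refine pairVec_mem_CoeffIn.2 ⟨H.strong _ hp a ha fun c ↦ ?_, ?_⟩
    · have := J.sub_mem (hJ (h.1 c)) (J.mul_mem_right (b c) hxJ)
      simpa using this
    · by_cases hp1 : p = 1
      · subst hp1
        intro c
        by_cases hc : c = c₀
        · subst hc
          refine hmin _ ?_
          -- In weight 1 there is no induction for `b`. But d(a) has values in J₀, so x b lies in J'
          -- + J₀, and `hmin` applies.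
          have h1 : ext d a c ∈ J₀ := by
            refine (H.mem_iff _).1 ⟨a, ha, ?_⟩
            exact H.eq_single (ext_lowers (p := 1) H.lowers ha)
          have h2 := Submodule.add_mem_sup (h.1 c) (J₀.neg_mem h1)
          simpa using h2
        · have : b c = 0 := by
            rw [H.eq_single hb, Finsupp.single_eq_of_ne hc]
          rw [this]; exact n.zero_mem
      · refine H.strong p (by omega) b hb fun c ↦ hJ ?_
        have := J'.neg_mem (h.2 c)
        simpa using this

/-- The Koszul complex of a regular local ring. -/
theorem exists_koszul (Q : Type u) [CommRing Q] [IsRegularLocalRing Q] :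
    ∃ (C : Type u) (wt : C → ℕ) (d : C → (C →₀ Q)) (c₀ : C),
      IsKoszulLike (maximalIdeal Q) (maximalIdeal Q) (maximalIdeal Q ^ 2) C wt d c₀ := by
  obtain ⟨d, x, -, hspan, hreg, hmin⟩ := exists_regular_system Q
  -- After `l` cones the complex resolves the quotient by the first `l` parameters, and strong
  -- minimality holds modulo 𝔫² plus the parameters not yet used. At l = d this is strong minimality
  -- modulo 𝔫².
  have key : ∀ l ≤ d, ∃ (C : Type u) (wt : C → ℕ) (δ : C → (C →₀ Q)) (c₀ : C),
      IsKoszulLike (maximalIdeal Q) (Ideal.span (x '' Set.Iio l))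
        (maximalIdeal Q ^ 2 ⊔ Ideal.span (x '' Set.Ico l d)) C wt δ c₀ := by
    intro l
    induction l with
    | zero =>
      intro _
      have : Ideal.span (x '' Set.Iio 0) = ⊥ := by simp
      rw [this]
      exact ⟨_, _, _, _, isKoszulLike_zero _ _⟩
    | succ l ih =>
      intro hl
      obtain ⟨C, wt, δ, c₀, H⟩ := ih (by omega)
      refine ⟨_, _, _, _, H.cone (x := x l) ?_ (hreg l hl) ?_ ?_ ?_ ?_⟩
      · rw [← hspan]; exact Ideal.subset_span ⟨l, hl, rfl⟩
      · have : Set.Iio (l + 1) = Set.Iio l ∪ {l} := by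
          ext i; simp
        rw [this, Set.image_union, Ideal.span_union, Set.image_singleton]
      · refine sup_le_sup_left (Ideal.span_mono (Set.image_mono ?_)) _
        exact Set.Ico_subset_Ico_left (by omega)
      · exact Ideal.mem_sup_right (Ideal.subset_span ⟨l, ⟨le_rfl, hl⟩, rfl⟩)
      · intro b hb
        refine hmin l hl b ?_
        rw [sup_assoc, ← Ideal.span_union, ← Set.image_union] at hb
        have hle : x '' (Set.Ico (l + 1) d ∪ Set.Iio l) ⊆ x '' (Set.Iio d \ {l}) := by
          refine Set.image_mono fun i hi ↦ ?_
          simp at hi ⊢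
          omega
        exact (sup_le_sup_left (Ideal.span_mono hle) _ : _ ≤ _) hb
  obtain ⟨C, wt, δ, c₀, H⟩ := key d le_rfl
  refine ⟨C, wt, δ, c₀, ?_⟩
  rw [hspan] at H
  simpa using H

end Koszul

/-! ### Extension of scalars of free modules in coordinates. -/

section FreeTensor

variable {S k : Type u} [CommRing S] [CommRing k] (g : S →+* k)

/-- The `g`-semilinear map `x ↦ 1 ⊗ x`. -/
noncomputable def oneTensor (X : ModuleCat.{u} S) : X →ₛₗ[g] (ModuleCat.extendScalars.{u, u, u} g).obj X where
  toFun x := ((ModuleCat.extendRestrictScalarsAdj.{u, u, u} g).unit.app X).hom x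
  map_add' x y := map_add ((ModuleCat.extendRestrictScalarsAdj.{u, u, u} g).unit.app X).hom x y
  map_smul' s x := map_smul ((ModuleCat.extendRestrictScalarsAdj.{u, u, u} g).unit.app X).hom s x

lemma map_oneTensor {X Y : ModuleCat.{u} S} (f : X ⟶ Y) (x : X) :
    ((ModuleCat.extendScalars.{u, u, u} g).map f).hom (oneTensor g X x) =
      oneTensor g Y (f.hom x) := rfl

lemma hom_ext_oneTensor {X : ModuleCat.{u} S} {V : ModuleCat.{u} k}
    {α β : (ModuleCat.extendScalars.{u, u, u} g).obj X ⟶ V}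
    (h : ∀ x, α.hom (oneTensor g X x) = β.hom (oneTensor g X x)) : α = β :=
  ModuleCat.ExtendScalars.hom_ext h

/-- Descend a semilinear map to the extension of scalars. -/
noncomputable def descTensor {X : ModuleCat.{u} S} {V : ModuleCat.{u} k} (f : X →ₛₗ[g] V) :
    (ModuleCat.extendScalars.{u, u, u} g).obj X ⟶ V :=
  ((ModuleCat.extendRestrictScalarsAdj.{u, u, u} g).homEquiv X V).symm
    (ModuleCat.ofHom (Y := (ModuleCat.restrictScalars.{u} g).obj V)
      { toFun := f, map_add' := f.map_add, map_smul' := f.map_smulₛₗ })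

lemma descTensor_oneTensor {X : ModuleCat.{u} S} {V : ModuleCat.{u} k} (f : X →ₛₗ[g] V) (x : X) :
    (descTensor g f).hom (oneTensor g X x) = f x := by
  have h := ((ModuleCat.extendRestrictScalarsAdj.{u, u, u} g).homEquiv X V).apply_symm_apply
    (ModuleCat.ofHom (Y := (ModuleCat.restrictScalars.{u} g).obj V)
      { toFun := f, map_add' := f.map_add, map_smul' := f.map_smulₛₗ })
  exact congrArg (fun q ↦ q.hom x) h

/-- Apply a ring homomorphism to all coefficients. -/
noncomputable def redCoeff (ι : Type u) : (ι →₀ S) →ₛₗ[g] (ι →₀ k) where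
  toFun v := v.mapRange g (map_zero g)
  map_add' v w := Finsupp.mapRange_add (map_add g) v w
  map_smul' s v := Finsupp.ext fun i ↦ by simp

@[simp]
lemma redCoeff_apply (ι : Type u) (v : ι →₀ S) (i : ι) : redCoeff g ι v i = g (v i) := rfl

@[simp]
lemma redCoeff_single {ι : Type u} (i : ι) (s : S) :
    redCoeff g ι (Finsupp.single i s) = Finsupp.single i (g s) :=
  Finsupp.mapRange_single (hf := map_zero g)

lemma redCoeff_ext {ι κ : Type u} (f : ι → (κ →₀ S)) (v : ι →₀ S) :
    redCoeff g κ (ext f v) = ext (fun i ↦ redCoeff g κ (f i)) (redCoeff g ι v) := by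
  induction v using Finsupp.induction_linear with
  | zero => simp
  | add v w hv hw => simp only [map_add, hv, hw]
  | single i s => simp

lemma redCoeff_eq_zero {ι : Type u} {v : ι →₀ S} :
    redCoeff g ι v = 0 ↔ v ∈ CoeffIn ι (RingHom.ker g) := by
  rw [Finsupp.ext_iff]; rfl

/-- The vectors `1 ⊗ e_i`. -/
noncomputable def oneTensorBasis (ι : Type u) (i : ι) :
    (ModuleCat.extendScalars.{u, u, u} g).obj (ModuleCat.of S (ι →₀ S)) :=
  oneTensor g (ModuleCat.of S (ι →₀ S)) (Finsupp.single i 1 : ι →₀ S)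

lemma oneTensor_eq_linearCombination (ι : Type u) (x : ι →₀ S) :
    Finsupp.linearCombination k (oneTensorBasis g ι) (redCoeff g ι x) =
      oneTensor g (ModuleCat.of S (ι →₀ S)) x := by
  induction x using Finsupp.induction_linear with
  | zero => rw [map_zero, map_zero]; exact (map_zero (oneTensor g _)).symm
  | add v w hv hw =>
    rw [map_add, map_add, hv, hw]
    exact (map_add (oneTensor g (ModuleCat.of S (ι →₀ S))) v w).symm
  | single i s =>
    rw [redCoeff_single, Finsupp.linearCombination_single, oneTensorBasis]
    refine ((oneTensor g (ModuleCat.of S (ι →₀ S))).map_smulₛₗ s _).symm.trans (congrArg _ ?_)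
    change s • (Finsupp.single i 1 : ι →₀ S) = _
    simp

/-- Extension of scalars of a free module is free. -/
noncomputable def freeTensorIso (ι : Type u) :
    (ModuleCat.extendScalars.{u, u, u} g).obj (ModuleCat.of S (ι →₀ S)) ≅
      ModuleCat.of k (ι →₀ k) where
  hom := descTensor g (X := ModuleCat.of S (ι →₀ S)) (V := ModuleCat.of k (ι →₀ k)) (redCoeff g ι)
  inv := ModuleCat.ofHom
    (Y := (ModuleCat.extendScalars.{u, u, u} g).obj (ModuleCat.of S (ι →₀ S)))
    (Finsupp.linearCombination k (oneTensorBasis g ι))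
  hom_inv_id := hom_ext_oneTensor g fun x ↦
    (congrArg (Finsupp.linearCombination k (oneTensorBasis g ι))
      (descTensor_oneTensor g (X := ModuleCat.of S (ι →₀ S)) (V := ModuleCat.of k (ι →₀ k))
        (redCoeff g ι) x)).trans (oneTensor_eq_linearCombination g ι x)
  inv_hom_id := ModuleCat.hom_ext <| Finsupp.lhom_ext' fun i ↦ LinearMap.ext_ring <| by
    have h := descTensor_oneTensor g (X := ModuleCat.of S (ι →₀ S)) (V := ModuleCat.of k (ι →₀ k))
        (redCoeff g ι) (Finsupp.single i 1 : ι →₀ S)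
    refine Eq.trans ?_ (h.trans ?_)
    · refine congrArg (descTensor g (X := ModuleCat.of S (ι →₀ S)) (V := ModuleCat.of k (ι →₀ k))
        (redCoeff g ι)).hom ?_
      refine (Finsupp.linearCombination_single ..).trans (one_smul k _)
    · exact (redCoeff_single g i 1).trans (by rw [map_one]; rfl)

lemma freeTensorIso_hom_oneTensor (ι : Type u) (v : ι →₀ S) :
    (freeTensorIso g ι).hom.hom (oneTensor g (ModuleCat.of S (ι →₀ S)) v) = redCoeff g ι v :=
  descTensor_oneTensor g (V := ModuleCat.of k (ι →₀ k)) _ _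

lemma map_comp_freeTensorIso {ι κ : Type u} (f : ι → (κ →₀ S)) :
    (ModuleCat.extendScalars.{u, u, u} g).map
        (ModuleCat.ofHom (X := (ι →₀ S)) (Y := (κ →₀ S)) (ext f)) ≫
        (freeTensorIso g κ).hom =
      (freeTensorIso g ι).hom ≫ ModuleCat.ofHom (ext fun i ↦ redCoeff g κ (f i)) := by
  refine hom_ext_oneTensor g fun x ↦ ?_
  rw [ModuleCat.hom_comp, ModuleCat.hom_comp, LinearMap.comp_apply, LinearMap.comp_apply,
    map_oneTensor]
  erw [freeTensorIso_hom_oneTensor, freeTensorIso_hom_oneTensor]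
  exact redCoeff_ext g f x

end FreeTensor

/-! ### Homology of complexes of vector spaces in terms of elements. -/

section Homology

variable {k : Type u}

/-- By rank-nullity the dimension of the homology is that of the middle term minus the ranks of both
maps, so equality means that both ranks vanish. -/
lemma finrank_homology_eq_iff [Field k] (S : ShortComplex (ModuleCat.{u} k))
    [Module.Finite k S.X₂] :
    Module.finrank k S.homology = Module.finrank k S.X₂ ↔ S.f = 0 ∧ S.g = 0 := by
  have e : Module.finrank k S.homology =
      Module.finrank k (LinearMap.ker S.g.hom ⧸ LinearMap.range S.moduleCatToCycles) :=
    (S.moduleCatHomologyIso.toLinearEquiv).finrank_eq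
  have h1 := Submodule.finrank_quotient_add_finrank (LinearMap.range S.moduleCatToCycles)
  have h2 := S.g.hom.finrank_range_add_finrank_ker
  rw [e]
  constructor
  · intro h
    have h3 : Module.finrank k (LinearMap.range S.g.hom) = 0 := by omega
    have h4 : Module.finrank k (LinearMap.range S.moduleCatToCycles) = 0 := by omega
    rw [Submodule.finrank_eq_zero, LinearMap.range_eq_bot] at h3 h4
    refine ⟨ModuleCat.hom_ext (LinearMap.ext fun x ↦ ?_), ModuleCat.hom_ext h3⟩
    exact congrArg Subtype.val (LinearMap.congr_fun h4 x)
  · rintro ⟨hf, hg⟩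
    have h3 : LinearMap.range S.g.hom = ⊥ := by rw [hg]; exact LinearMap.range_zero
    have h4 : LinearMap.range S.moduleCatToCycles = ⊥ := by
      rw [LinearMap.range_eq_bot]
      refine LinearMap.ext fun x ↦ Subtype.ext ?_
      change S.f.hom x = 0
      rw [hf]; rfl
    rw [h3, finrank_bot] at h2
    rw [h4, finrank_bot] at h1
    rw [h4]
    omega

lemma homologyπ_eq_zero_iff [CommRing k] (S : ShortComplex (ModuleCat.{u} k)) (c : S.cycles) :
    S.homologyπ.hom c = 0 ↔ ∃ z, S.f.hom z = S.iCycles.hom c := by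
  have h := S.moduleCat_pOpcycles_eq_zero_iff (S.iCycles.hom c)
  have hm : Function.Injective S.homologyι.hom := (ModuleCat.mono_iff_injective _).1 inferInstance
  have h' : S.homologyι.hom (S.homologyπ.hom c) = S.pOpcycles.hom (S.iCycles.hom c) :=
    congrArg (fun q ↦ q.hom c) S.homology_π_ι
  rw [← hm.eq_iff, h', map_zero]
  exact h

/-- A homology class is zero exactly when a representing cycle is a boundary. The elementwise form
is the one used for the change of rings map. -/
lemma injective_homologyMap_iff [CommRing k] {S₁ S₂ : ShortComplex (ModuleCat.{u} k)} (φ : S₁ ⟶ S₂) :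
    Function.Injective (ShortComplex.homologyMap φ).hom ↔
      ∀ x, S₁.g.hom x = 0 → (∃ y, S₂.f.hom y = φ.τ₂.hom x) → ∃ z, S₁.f.hom z = x := by
  have hπ : Function.Surjective S₁.homologyπ.hom := (ModuleCat.epi_iff_surjective _).1 inferInstance
  have hm (c : S₁.cycles) : (ShortComplex.homologyMap φ).hom (S₁.homologyπ.hom c) =
      S₂.homologyπ.hom ((ShortComplex.cyclesMap φ).hom c) :=
    congrArg (fun q ↦ q.hom c) (ShortComplex.homologyπ_naturality φ)
  have hi (c : S₁.cycles) : S₂.iCycles.hom ((ShortComplex.cyclesMap φ).hom c) =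
      φ.τ₂.hom (S₁.iCycles.hom c) :=
    congrArg (fun q ↦ q.hom c) (ShortComplex.cyclesMap_i φ)
  rw [injective_iff_map_eq_zero]
  constructor
  · intro h x hx hy
    let c : S₁.cycles := S₁.moduleCatCyclesIso.inv.hom ⟨x, hx⟩
    have hc : S₁.iCycles.hom c = x := ShortComplex.moduleCatCyclesIso_inv_iCycles_apply S₁ ⟨x, hx⟩
    have := h (S₁.homologyπ.hom c) (by rw [hm, homologyπ_eq_zero_iff, hi, hc]; exact hy)
    rw [homologyπ_eq_zero_iff, hc] at this
    exact this
  · intro h a ha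
    obtain ⟨c, rfl⟩ := hπ a
    rw [hm, homologyπ_eq_zero_iff, hi] at ha
    rw [homologyπ_eq_zero_iff]
    refine h _ ?_ ha
    exact congrArg (fun q ↦ q.hom c) S₁.iCycles_g

lemma finrank_homology_chainComplex [Field k] (K : ChainComplex (ModuleCat.{u} k) ℕ) (n : ℕ)
    [Module.Finite k (K.X n)] :
    Module.finrank k (K.homology n) = Module.finrank k (K.X n) ↔
      K.d (n + 1) n = 0 ∧ ∀ m, m + 1 = n → K.d n m = 0 := by
  have : Module.Finite k (K.sc n).X₂ := ‹_›
  refine (finrank_homology_eq_iff (K.sc n)).trans (and_congr ?_ ?_)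
  · change K.d ((ComplexShape.down ℕ).prev n) n = 0 ↔ _
    rw [ChainComplex.prev]
  · change K.d n ((ComplexShape.down ℕ).next n) = 0 ↔ _
    cases n with
    | zero =>
      rw [ChainComplex.next_nat_zero]
      exact iff_of_true (K.shape _ _ (by simp)) (by simp)
    | succ n =>
      rw [ChainComplex.next_nat_succ]
      exact ⟨fun h m hm ↦ by obtain rfl : m = n := by omega
                             exact h, fun h ↦ h n rfl⟩

lemma injective_homologyMap_chainComplex [CommRing k] {K L : ChainComplex (ModuleCat.{u} k) ℕ}
    (φ : K ⟶ L) (n : ℕ) :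
    Function.Injective (HomologicalComplex.homologyMap φ n).hom ↔
      ∀ x, (∀ m, m + 1 = n → (K.d n m).hom x = 0) → (∃ y, (L.d (n + 1) n).hom y = (φ.f n).hom x) →
        ∃ z, (K.d (n + 1) n).hom z = x := by
  refine (injective_homologyMap_iff
    ((HomologicalComplex.shortComplexFunctor _ (ComplexShape.down ℕ) n).map φ)).trans ?_
  refine forall_congr' fun x ↦ ?_
  have h1 : (K.sc n).g.hom x = 0 ↔ ∀ m, m + 1 = n → (K.d n m).hom x = 0 := by
    change (K.d n ((ComplexShape.down ℕ).next n)).hom x = 0 ↔ _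
    cases n with
    | zero =>
      rw [ChainComplex.next_nat_zero]
      refine iff_of_true ?_ (by simp)
      rw [K.shape _ _ (by simp)]; rfl
    | succ n =>
      rw [ChainComplex.next_nat_succ]
      exact ⟨fun h m hm ↦ by obtain rfl : m = n := by omega
                             exact h, fun h ↦ h n rfl⟩
  have h2 (C : ChainComplex (ModuleCat.{u} k) ℕ) (x : C.X n) :
      (∃ z, (C.sc n).f.hom z = x) ↔ ∃ z, (C.d (n + 1) n).hom z = x := by
    change (∃ z, (C.d ((ComplexShape.down ℕ).prev n) n).hom z = x) ↔ _
    rw [ChainComplex.prev]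
  exact imp_congr h1 (imp_congr (h2 L _) (h2 K x))

end Homology

/-! ### Resolutions described by bases. -/

section Based

variable {S : Type u} [CommRing S]

/-- The complex of free modules with bases `ι n` and differential `∂`. -/
noncomputable abbrev basedComplex (ι : ℕ → Type u) (bd : ∀ n, ι (n + 1) → (ι n →₀ S))
    (sq : ∀ n x, ext (bd n) (bd (n + 1) x) = 0) : ChainComplex (ModuleCat.{u} S) ℕ :=
  ChainComplex.of (fun n ↦ ModuleCat.of S (ι n →₀ S)) (fun n ↦ ModuleCat.ofHom (ext (bd n)))
    fun n ↦ ModuleCat.hom_ext <| Finsupp.lhom_ext' fun x ↦ LinearMap.ext_ring <| by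
      change ext (bd n) (ext (bd (n + 1)) (Finsupp.single x 1)) = 0
      rw [Finsupp.linearCombination_single, one_smul, sq]

lemma basedComplex_d (ι : ℕ → Type u) (bd : ∀ n, ι (n + 1) → (ι n →₀ S))
    (sq : ∀ n x, ext (bd n) (bd (n + 1) x) = 0) (n : ℕ) :
    (basedComplex ι bd sq).d (n + 1) n = ModuleCat.ofHom (ext (bd n)) :=
  ChainComplex.of_d (fun n ↦ ModuleCat.of S (ι n →₀ S)) (fun n ↦ ModuleCat.ofHom (ext (bd n))) n

/-- Free resolutions given by bases. -/
structure IsBasedRes {M : Type u} [AddCommGroup M] [Module S M] (ι : ℕ → Type u)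
    (bd : ∀ n, ι (n + 1) → (ι n →₀ S)) (aug : ι 0 → M) : Prop where
  sq : ∀ n x, ext (bd n) (bd (n + 1) x) = 0
  aug_bd : ∀ x, ext (Q := S) aug (bd 0 x) = 0
  surj : ∀ y, ∃ v, ext (Q := S) aug v = y
  exact_zero : ∀ v, ext (Q := S) aug v = 0 → ∃ u, ext (Q := S) (bd 0) u = v
  exact_succ : ∀ n v, ext (Q := S) (bd n) v = 0 → ∃ u, ext (Q := S) (bd (n + 1)) u = v

variable {M : ModuleCat.{u} S} {ι : ℕ → Type u} {bd : ∀ n, ι (n + 1) → (ι n →₀ S)} {aug : ι 0 → M}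

lemma IsBasedRes.d_comp_aug (h : IsBasedRes ι bd aug) :
    (basedComplex ι bd h.sq).d 1 0 ≫ ModuleCat.ofHom (Y := M) (ext (Q := S) aug) = 0 := by
  rw [basedComplex_d]
  refine ModuleCat.hom_ext <| Finsupp.lhom_ext' fun x ↦ LinearMap.ext_ring <| ?_
  change ext (Q := S) aug (ext (bd 0) (Finsupp.single x 1)) = 0
  rw [Finsupp.linearCombination_single, one_smul, h.aug_bd]

lemma IsBasedRes.exactAt_succ (h : IsBasedRes ι bd aug) (n : ℕ) :
    (basedComplex ι bd h.sq).ExactAt (n + 1) := by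
  rw [HomologicalComplex.exactAt_iff' _ (n + 1 + 1) (n + 1) n (by simp) (by simp),
    ShortComplex.moduleCat_exact_iff]
  intro x hx
  change ((basedComplex ι bd h.sq).d (n + 1) n).hom x = 0 at hx
  change ∃ y, ((basedComplex ι bd h.sq).d (n + 2) (n + 1)).hom y = x
  rw [basedComplex_d] at hx ⊢
  exact h.exact_succ n x hx

/-- The augmentation of the complex of a based resolution. -/
noncomputable def IsBasedRes.π (h : IsBasedRes ι bd aug) :
    basedComplex ι bd h.sq ⟶ (ChainComplex.single₀ (ModuleCat.{u} S)).obj M :=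
  (ChainComplex.toSingle₀Equiv _ _).symm ⟨ModuleCat.ofHom (Y := M) (ext (Q := S) aug), h.d_comp_aug⟩

lemma IsBasedRes.π_f_zero (h : IsBasedRes ι bd aug) :
    h.π.f 0 = ModuleCat.ofHom (Y := M) (ext (Q := S) aug) :=
  ChainComplex.toSingle₀Equiv_symm_apply_f_zero ..

lemma IsBasedRes.π_apply (h : IsBasedRes ι bd aug) (v : ι 0 →₀ S) :
    (h.π.f 0).hom v = ext (Q := S) aug v := by
  rw [h.π_f_zero]; rfl

lemma IsBasedRes.quasiIso (h : IsBasedRes ι bd aug) : QuasiIso h.π := by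
  refine ⟨fun n ↦ ?_⟩
  cases n with
  | zero =>
    rw [ChainComplex.quasiIsoAt₀_iff, ShortComplex.quasiIso_iff_of_zeros']
    rotate_left
    · rfl
    · rfl
    · rfl
    constructor
    · rw [ShortComplex.moduleCat_exact_iff]
      intro x hx
      change (h.π.f 0).hom x = 0 at hx
      change ∃ y, ((basedComplex ι bd h.sq).d 1 0).hom y = x
      rw [h.π_f_zero] at hx
      rw [basedComplex_d]
      exact h.exact_zero x hx
    · change Epi (h.π.f 0)
      rw [h.π_f_zero]
      exact (ModuleCat.epi_iff_surjective (ModuleCat.ofHom (Y := M) (ext (Q := S) aug))).2 h.surj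
  | succ n =>
    rw [quasiIsoAt_iff_exactAt']
    · exact h.exactAt_succ n
    · apply ChainComplex.exactAt_succ_single_obj

/-- The projective resolution of a based resolution. -/
noncomputable def IsBasedRes.resolution (h : IsBasedRes ι bd aug) : ProjectiveResolution M where
  complex := basedComplex ι bd h.sq
  projective n := by
    change Projective (ModuleCat.of S (ι n →₀ S))
    infer_instance
  π := h.π
  quasiIso := h.quasiIso

end Based

/-! ### Dimensions of Tor from based resolutions. -/

section Tor

variable {S k : Type u} [CommRing S] [Field k] (g : S →+* k)

/-- Reduction of the coefficients of the differential. -/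
noncomputable def redBd {ι κ : Type u} (f : ι → (κ →₀ S)) : ι → (κ →₀ k) :=
  fun x ↦ redCoeff g κ (f x)

lemma redBd_sq {ι : ℕ → Type u} {bd : ∀ n, ι (n + 1) → (ι n →₀ S)}
    (sq : ∀ n x, ext (bd n) (bd (n + 1) x) = 0) (n : ℕ) (x : ι (n + 2)) :
    ext (redBd g (bd n)) (redBd g (bd (n + 1)) x) = 0 :=
  (redCoeff_ext g (bd n) _).symm.trans (by rw [sq, map_zero])

/-- `k ⊗ F` for a complex `F` of based free modules. -/
noncomputable def basedTensorIso {ι : ℕ → Type u} {bd : ∀ n, ι (n + 1) → (ι n →₀ S)}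
    (sq : ∀ n x, ext (bd n) (bd (n + 1) x) = 0) :
    ((ModuleCat.extendScalars.{u, u, u} g).mapHomologicalComplex _).obj (basedComplex ι bd sq) ≅
      basedComplex ι (fun n ↦ redBd g (bd n)) (redBd_sq g sq) :=
  HomologicalComplex.Hom.isoOfComponents (fun n ↦ freeTensorIso g (ι n)) <| by
    rintro i j rfl
    change (freeTensorIso g (ι (j + 1))).hom ≫ _ =
      (ModuleCat.extendScalars.{u, u, u} g).map ((basedComplex ι bd sq).d (j + 1) j) ≫
        (freeTensorIso g (ι j)).hom
    rw [basedComplex_d, basedComplex_d]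
    exact (map_comp_freeTensorIso g (bd j)).symm

lemma ext_eq_zero_iff {R : Type*} [CommRing R] {ι : Type*} {Y : Type*} [AddCommGroup Y] [Module R Y]
    (f : ι → Y) : ext (Q := R) f = 0 ↔ ∀ x, f x = 0 :=
  ⟨fun h x ↦ by simpa using LinearMap.congr_fun h (Finsupp.single x 1),
    fun h ↦ Finsupp.lhom_ext' fun x ↦ LinearMap.ext_ring (by simp [h])⟩

lemma ofHom_ext_redBd_eq_zero_iff {ι κ : Type u} (f : ι → (κ →₀ S)) :
    ModuleCat.ofHom (ext (Q := k) (redBd g f)) = 0 ↔ ∀ x, f x ∈ CoeffIn κ (RingHom.ker g) := by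
  refine Iff.trans ⟨fun h ↦ congrArg ModuleCat.Hom.hom h, fun h ↦ ModuleCat.hom_ext h⟩ ?_
  refine (ext_eq_zero_iff _).trans (forall_congr' fun x ↦ redCoeff_eq_zero g)

variable {M : ModuleCat.{u} S} {ι : ℕ → Type u} {bd : ∀ n, ι (n + 1) → (ι n →₀ S)} {aug : ι 0 → M}

/-- `Tor_n(M, k)` has dimension `|ι n|` if and only if the differentials next to degree `n` are
minimal. -/
lemma IsBasedRes.finrank_tor_eq_iff (h : IsBasedRes ι bd aug) (n : ℕ) [Finite (ι n)] :
    Module.finrank k ((torField g n).obj M) = Nat.card (ι n) ↔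
      (∀ x, bd n x ∈ CoeffIn (ι n) (RingHom.ker g)) ∧
        ∀ m, m + 1 = n → ∀ x, bd m x ∈ CoeffIn (ι m) (RingHom.ker g) := by
  let K := basedComplex ι (fun n ↦ redBd g (bd n)) (redBd_sq g h.sq)
  have e : (torField g n).obj M ≅ K.homology n :=
    h.resolution.isoLeftDerivedObj (ModuleCat.extendScalars.{u, u, u} g) n ≪≫
      (HomologicalComplex.homologyFunctor _ _ n).mapIso (basedTensorIso g h.sq)
  have : Module.Finite k (K.X n) := inferInstanceAs (Module.Finite k (ι n →₀ k))
  have hc : Module.finrank k (K.X n) = Nat.card (ι n) := by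
    have := Fintype.ofFinite (ι n)
    rw [Nat.card_eq_fintype_card]
    exact Module.finrank_finsupp_self k
  rw [e.toLinearEquiv.finrank_eq, ← hc, finrank_homology_chainComplex, basedComplex_d]
  refine and_congr (ofHom_ext_redBd_eq_zero_iff g _) (forall_congr' fun m ↦ forall_congr' ?_)
  rintro rfl
  rw [basedComplex_d]
  exact ofHom_ext_redBd_eq_zero_iff g _

end Tor

/-! ### Independence of the change of rings map from the chosen resolutions. -/

section Homotopy

/-- Only the source has to be projective, while the target has to be exact. This asymmetry is
needed: an R-projective resolution restricted to Q is exact but in general not projective. -/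
lemma exists_homotopy_zero {C : Type*} [Category* C] [Abelian C] {P D : ChainComplex C ℕ}
    [∀ n, Projective (P.X n)] {N : C} (p : D.X 0 ⟶ N) (zero_p : D.d 1 0 ≫ p = 0)
    (ex0 : (ShortComplex.mk (D.d 1 0) p zero_p).Exact)
    (exs : ∀ n, (ShortComplex.mk _ _ (D.d_comp_d (n + 2) (n + 1) n)).Exact)
    (f : P ⟶ D) (hf : f.f 0 ≫ p = 0) : Nonempty (Homotopy f 0) := by
  let z0 : P.X 0 ⟶ D.X 1 := ex0.liftFromProjective (f.f 0) hf
  have hz0 : z0 ≫ D.d 1 0 = f.f 0 := ex0.liftFromProjective_comp _ _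
  have hw : (f.f 1 - P.d 1 0 ≫ z0) ≫ D.d 1 0 = 0 := by
    rw [Preadditive.sub_comp, Category.assoc, hz0, f.comm, sub_self]
  let z1 : P.X 1 ⟶ D.X 2 := (exs 0).liftFromProjective (f.f 1 - P.d 1 0 ≫ z0) hw
  have hz1 : z1 ≫ D.d 2 1 = f.f 1 - P.d 1 0 ≫ z0 := (exs 0).liftFromProjective_comp _ _
  have hw' (n : ℕ) (q₀ : P.X n ⟶ D.X (n + 1)) (q₁ : P.X (n + 1) ⟶ D.X (n + 2))
      (h : f.f (n + 1) = P.d (n + 1) n ≫ q₀ + q₁ ≫ D.d (n + 2) (n + 1)) :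
      (f.f (n + 2) - P.d (n + 2) (n + 1) ≫ q₁) ≫ D.d (n + 2) (n + 1) = 0 := by
    rw [Preadditive.sub_comp, f.comm, h, Preadditive.comp_add, Category.assoc,
      ← Category.assoc (P.d _ _), P.d_comp_d, Limits.zero_comp, zero_add, sub_self]
  refine ⟨Homotopy.mkInductive f z0 hz0.symm z1 (by rw [hz1]; abel) fun n q ↦
    ⟨(exs (n + 1)).liftFromProjective _ (hw' n q.1 q.2.1 q.2.2), ?_⟩⟩
  have h := (exs (n + 1)).liftFromProjective_comp _ (hw' n q.1 q.2.1 q.2.2)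
  change _ ≫ D.d (n + 3) (n + 2) = _ at h
  rw [h]; abel

variable {Q R k : Type u} [CommRing Q] [CommRing R] [Field k] (φ : Q →+* R)

lemma nonempty_homotopy_restrictComplex {M : ModuleCat.{u} R}
    (G : ProjectiveResolution ((ModuleCat.restrictScalars.{u} φ).obj M))
    (F : ProjectiveResolution M) (f f' : G.complex ⟶ restrictComplex φ F)
    (h : f.f 0 ≫ (ModuleCat.restrictScalars.{u} φ).map (F.π.f 0) =
      f'.f 0 ≫ (ModuleCat.restrictScalars.{u} φ).map (F.π.f 0)) : Nonempty (Homotopy f f') := by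
  let D := restrictComplex φ F
  let p : D.X 0 ⟶ (ModuleCat.restrictScalars.{u} φ).obj M :=
    (ModuleCat.restrictScalars.{u} φ).map (F.π.f 0)
  have zero_p : D.d 1 0 ≫ p = 0 :=
    (ShortComplex.mk _ _ F.complex_d_comp_π_f_zero).map (ModuleCat.restrictScalars.{u} φ) |>.zero
  have ex0 : (ShortComplex.mk (D.d 1 0) p zero_p).Exact :=
    ModuleCat.restrictScalars_map_exact φ _ F.exact₀
  have exs (n : ℕ) : (ShortComplex.mk _ _ (D.d_comp_d (n + 2) (n + 1) n)).Exact :=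
    ModuleCat.restrictScalars_map_exact φ _ (F.exact_succ n)
  obtain ⟨H⟩ := exists_homotopy_zero p zero_p ex0 exs (f - f') (by
    change (f.f 0 - f'.f 0) ≫ p = 0
    rw [Preadditive.sub_comp]
    exact sub_eq_zero.2 h)
  exact ⟨Homotopy.equivSubZero.invFun H⟩

variable (g : R →+* k)

/-- The morphism `k ⊗_Q F → k ⊗_R F` for a complex `F` of `R`-modules. -/
noncomputable def tensorChangeComplex (F : ChainComplex (ModuleCat.{u} R) ℕ) :
    ((ModuleCat.extendScalars.{u, u, u} (g.comp φ)).mapHomologicalComplex _).obj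
        (((ModuleCat.restrictScalars.{u} φ).mapHomologicalComplex _).obj F) ⟶
      ((ModuleCat.extendScalars.{u, u, u} g).mapHomologicalComplex _).obj F :=
  (NatTrans.mapHomologicalComplex (tensorChange φ g) (ComplexShape.down ℕ)).app F

lemma tensorChangeComplex_naturality {F F' : ChainComplex (ModuleCat.{u} R) ℕ} (b : F ⟶ F') :
    ((ModuleCat.extendScalars.{u, u, u} (g.comp φ)).mapHomologicalComplex _).map
        (((ModuleCat.restrictScalars.{u} φ).mapHomologicalComplex _).map b) ≫
        tensorChangeComplex φ g F' =
      tensorChangeComplex φ g F ≫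
        ((ModuleCat.extendScalars.{u, u, u} g).mapHomologicalComplex _).map b :=
  (NatTrans.mapHomologicalComplex (tensorChange φ g) (ComplexShape.down ℕ)).naturality b

/-- The morphism `k ⊗_Q G → k ⊗_R F` induced by `G → F`. -/
noncomputable def tensorHom {G : ChainComplex (ModuleCat.{u} Q) ℕ}
    {F : ChainComplex (ModuleCat.{u} R) ℕ}
    (f : G ⟶ ((ModuleCat.restrictScalars.{u} φ).mapHomologicalComplex _).obj F) :
    ((ModuleCat.extendScalars.{u, u, u} (g.comp φ)).mapHomologicalComplex _).obj G ⟶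
      ((ModuleCat.extendScalars.{u, u, u} g).mapHomologicalComplex _).obj F :=
  ((ModuleCat.extendScalars.{u, u, u} (g.comp φ)).mapHomologicalComplex _).map f ≫
    tensorChangeComplex φ g F

lemma homologyMap_tensorHom_congr {G : ChainComplex (ModuleCat.{u} Q) ℕ}
    {F : ChainComplex (ModuleCat.{u} R) ℕ}
    {f f' : G ⟶ ((ModuleCat.restrictScalars.{u} φ).mapHomologicalComplex _).obj F}
    (h : Homotopy f f') (n : ℕ) :
    HomologicalComplex.homologyMap (tensorHom φ g f) n =
      HomologicalComplex.homologyMap (tensorHom φ g f') n := by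
  rw [tensorHom, tensorHom, HomologicalComplex.homologyMap_comp,
    HomologicalComplex.homologyMap_comp,
    ((ModuleCat.extendScalars.{u, u, u} (g.comp φ)).mapHomotopy h).homologyMap_eq]

lemma tensorHom_comp {G G' : ChainComplex (ModuleCat.{u} Q) ℕ}
    {F F' : ChainComplex (ModuleCat.{u} R) ℕ} (a : G' ⟶ G) (b : F ⟶ F')
    (f : G ⟶ ((ModuleCat.restrictScalars.{u} φ).mapHomologicalComplex _).obj F) :
    tensorHom φ g (a ≫ f ≫ ((ModuleCat.restrictScalars.{u} φ).mapHomologicalComplex _).map b) =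
      ((ModuleCat.extendScalars.{u, u, u} (g.comp φ)).mapHomologicalComplex _).map a ≫
        tensorHom φ g f ≫
          ((ModuleCat.extendScalars.{u, u, u} g).mapHomologicalComplex _).map b := by
  rw [tensorHom, tensorHom, Functor.map_comp, Functor.map_comp, Category.assoc, Category.assoc,
    Category.assoc, tensorChangeComplex_naturality]

lemma isIso_homologyMap_extendScalars {S : Type u} [CommRing S] (g : S →+* k)
    {C D : ChainComplex (ModuleCat.{u} S) ℕ} (e : HomotopyEquiv C D) (n : ℕ) :
    IsIso (HomologicalComplex.homologyMap
      (((ModuleCat.extendScalars.{u, u, u} g).mapHomologicalComplex _).map e.hom) n) :=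
  (((ModuleCat.extendScalars.{u, u, u} g).mapHomotopyEquiv e).toHomologyIso n).isIso_hom

lemma injective_comp_iff_of_isIso {X' X Y Y' : ModuleCat.{u} k} (a : X' ⟶ X) (f : X ⟶ Y)
    (b : Y ⟶ Y') [IsIso a] [IsIso b] :
    Function.Injective (a ≫ f ≫ b).hom ↔ Function.Injective f.hom := by
  rw [← ModuleCat.mono_iff_injective, ← ModuleCat.mono_iff_injective]
  constructor
  · intro h
    have h' : Mono (f ≫ b) := by
      have : f ≫ b = inv a ≫ a ≫ f ≫ b := by rw [IsIso.inv_hom_id_assoc]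
      rw [this]
      exact mono_comp _ _
    exact mono_of_mono f b
  · intro h
    exact mono_comp _ _

/-- Other resolutions are homotopy equivalent to the chosen ones, and lifts of the identity are
homotopic, so the two maps differ by isomorphisms at both ends. Injectivity can thus be tested on
explicit resolutions. -/
lemma changeOfRings_injective_iff {M : ModuleCat.{u} R}
    (G : ProjectiveResolution ((ModuleCat.restrictScalars.{u} φ).obj M))
    (F : ProjectiveResolution M) (f : G.complex ⟶ restrictComplex φ F)
    (hf : f.f 0 ≫ (ModuleCat.restrictScalars.{u} φ).map (F.π.f 0) = G.π.f 0) (n : ℕ) :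
    Function.Injective (changeOfRings φ g M n).hom ↔
      Function.Injective (HomologicalComplex.homologyMap (tensorHom φ g f) n).hom := by
  let G₀ := projectiveResolution ((ModuleCat.restrictScalars.{u} φ).obj M)
  let F₀ := projectiveResolution M
  let a := ProjectiveResolution.homotopyEquiv G G₀
  let b := ProjectiveResolution.homotopyEquiv F₀ F
  have hc := (exists_comparison φ G₀ F₀).choose_spec
  have ha : a.hom.f 0 ≫ G₀.π.f 0 = G.π.f 0 :=
    congrArg (fun q ↦ HomologicalComplex.Hom.f q 0) (ProjectiveResolution.homotopyEquiv_hom_π G G₀)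
  have hb : b.hom.f 0 ≫ F.π.f 0 = F₀.π.f 0 :=
    congrArg (fun q ↦ HomologicalComplex.Hom.f q 0) (ProjectiveResolution.homotopyEquiv_hom_π F₀ F)
  obtain ⟨H⟩ := nonempty_homotopy_restrictComplex φ G F f
    (a.hom ≫ comparison φ G₀ F₀ ≫
      ((ModuleCat.restrictScalars.{u} φ).mapHomologicalComplex _).map b.hom) (by
      rw [hf]
      refine ModuleCat.hom_ext (LinearMap.ext fun x ↦ ?_)
      have hc' := congrArg (fun q ↦ q.hom ((a.hom.f 0).hom x)) hc
      have ha' := congrArg (fun q ↦ q.hom x) ha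
      have hb' := congrArg (fun q ↦ q.hom (((comparison φ G₀ F₀).f 0).hom ((a.hom.f 0).hom x))) hb
      exact (hb'.trans (hc'.trans ha')).symm)
  have := isIso_homologyMap_extendScalars (g.comp φ) a n
  have := isIso_homologyMap_extendScalars g b n
  rw [homologyMap_tensorHom_congr φ g H n, tensorHom_comp, HomologicalComplex.homologyMap_comp,
    HomologicalComplex.homologyMap_comp, injective_comp_iff_of_isIso]
  have e₁ := (G₀.isoLeftDerivedObj (ModuleCat.extendScalars.{u, u, u} (g.comp φ)) n).isIso_hom
  have e₂ := (F₀.isoLeftDerivedObj (ModuleCat.extendScalars.{u, u, u} g) n).isIso_inv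
  exact @injective_comp_iff_of_isIso _ _ _ _ _ _
    (G₀.isoLeftDerivedObj (ModuleCat.extendScalars.{u, u, u} (g.comp φ)) n).hom
    (HomologicalComplex.homologyMap (tensorHom φ g (comparison φ G₀ F₀)) n)
    (F₀.isoLeftDerivedObj (ModuleCat.extendScalars.{u, u, u} g) n).inv e₁ e₂

lemma tensorChange_oneTensor (X : ModuleCat.{u} R) (x : X) :
    ((tensorChange φ g).app X).hom
        (oneTensor (g.comp φ) ((ModuleCat.restrictScalars.{u} φ).obj X) x) = oneTensor g X x := by
  have h1 := ModuleCat.extendScalarsComp_hom_app_one_tmul φ g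
    ((ModuleCat.restrictScalars.{u} φ).obj X) x
  have h2 := ModuleCat.extendRestrictScalarsAdj_counit_app_apply_one_tmul φ X x
  have h3 := map_oneTensor g ((ModuleCat.extendRestrictScalarsAdj.{u, u, u} φ).counit.app X)
    (oneTensor φ ((ModuleCat.restrictScalars.{u} φ).obj X) x)
  refine (congrArg ((ModuleCat.extendScalars.{u, u, u} g).map
    ((ModuleCat.extendRestrictScalarsAdj.{u, u, u} φ).counit.app X)).hom h1).trans ?_
  exact h3.trans (congrArg (oneTensor g X) h2)

end Homotopy

/-! ### The change of rings map in coordinates. -/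

section BasedComparison

variable {Q R k : Type u} [CommRing Q] [CommRing R] [Field k] (φ : Q →+* R) (g : R →+* k)

/-- The `Q`-linear map from a free `Q`-module to a free `R`-module given on bases. -/
noncomputable def semiExt {ι κ : Type u} (t : ι → (κ →₀ R)) :
    ModuleCat.of Q (ι →₀ Q) ⟶ (ModuleCat.restrictScalars.{u} φ).obj (ModuleCat.of R (κ →₀ R)) :=
  ModuleCat.ofHom (Y := (ModuleCat.restrictScalars.{u} φ).obj (ModuleCat.of R (κ →₀ R)))
    { toFun := fun v ↦ ext t (redCoeff φ ι v)
      map_add' := fun v w ↦ by rw [map_add, map_add]; rfl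
      map_smul' := fun q v ↦ by rw [map_smulₛₗ, map_smul]; rfl }

lemma semiExt_apply {ι κ : Type u} (t : ι → (κ →₀ R)) (v : ι →₀ Q) :
    (semiExt φ t).hom v = ext t (redCoeff φ ι v) := rfl

lemma redCoeff_comp {ι : Type u} (v : ι →₀ Q) :
    redCoeff g ι (redCoeff φ ι v) = redCoeff (g.comp φ) ι v := by
  ext i; rfl

lemma ext_ext_restrictScalars {M : ModuleCat.{u} R} {ι κ : Type u} {aug : ι → M} {aug' : κ → M}
    (t : ι → (κ →₀ R)) (ht : ∀ x, ext (Q := R) aug' (t x) = aug x) (v : ι →₀ Q) :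
    ext (Q := R) aug' (ext t (redCoeff φ ι v)) =
      ext (Q := Q) (Y := (ModuleCat.restrictScalars.{u} φ).obj M) aug v := by
  let A : (ι →₀ Q) →ₗ[Q] (ModuleCat.restrictScalars.{u} φ).obj M :=
    (semiExt φ t ≫ (ModuleCat.restrictScalars.{u} φ).map
      (ModuleCat.ofHom (Y := M) (ext (Q := R) aug'))).hom
  have h : A = ext (Q := Q) (Y := (ModuleCat.restrictScalars.{u} φ).obj M) aug := by
    refine Finsupp.lhom_ext' fun x ↦ LinearMap.ext_ring ?_
    have e₁ : ext (Q := R) aug' (ext t (redCoeff φ ι (Finsupp.single x 1))) = aug x := by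
      rw [redCoeff_single, map_one, Finsupp.linearCombination_single, one_smul, ht]
    have e₂ := Finsupp.linearCombination_single Q (M := (ModuleCat.restrictScalars.{u} φ).obj M)
      (v := aug) 1 x
    exact e₁.trans (e₂.trans (one_smul Q (_ : (ModuleCat.restrictScalars.{u} φ).obj M))).symm
  exact LinearMap.congr_fun h v

variable {ιG ιF : ℕ → Type u} {bdG : ∀ n, ιG (n + 1) → (ιG n →₀ Q)}
  {bdF : ∀ n, ιF (n + 1) → (ιF n →₀ R)} (sqG : ∀ n x, ext (bdG n) (bdG (n + 1) x) = 0)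
  (sqF : ∀ n x, ext (bdF n) (bdF (n + 1) x) = 0) (t : ∀ n, ιG n → (ιF n →₀ R))

lemma semiExt_comm (ht : ∀ n x, ext (t n) (redCoeff φ _ (bdG n x)) = ext (bdF n) (t (n + 1) x))
    (n : ℕ) (v : ιG (n + 1) →₀ Q) :
    ext (t n) (redCoeff φ _ (ext (bdG n) v)) = ext (bdF n) (ext (t (n + 1)) (redCoeff φ _ v)) := by
  induction v using Finsupp.induction_linear with
  | zero => simp
  | add v w hv hw => simp only [map_add, hv, hw]
  | single x q =>
    simp only [Finsupp.linearCombination_single, map_smulₛₗ, redCoeff_single, ht,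
      RingHom.id_apply]

/-- The chain map over `Q` given by the images of basis elements. -/
noncomputable def basedHom
    (ht : ∀ n x, ext (t n) (redCoeff φ _ (bdG n x)) = ext (bdF n) (t (n + 1) x)) :
    basedComplex ιG bdG sqG ⟶
    ((ModuleCat.restrictScalars.{u} φ).mapHomologicalComplex _).obj (basedComplex ιF bdF sqF) where
  f n := semiExt φ (t n)
  comm' := by
    rintro i j rfl
    change semiExt φ (t (j + 1)) ≫
      (ModuleCat.restrictScalars.{u} φ).map ((basedComplex ιF bdF sqF).d (j + 1) j) =
        (basedComplex ιG bdG sqG).d (j + 1) j ≫ semiExt φ (t j)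
    rw [basedComplex_d, basedComplex_d]
    exact ModuleCat.hom_ext (LinearMap.ext fun v ↦ (semiExt_comm φ t ht j v).symm)

lemma tensorHom_basedHom_f
    (ht : ∀ n x, ext (t n) (redCoeff φ _ (bdG n x)) = ext (bdF n) (t (n + 1) x))
    (n : ℕ) :
    (tensorHom φ g (basedHom φ sqG sqF t ht)).f n ≫ (freeTensorIso g (ιF n)).hom =
      (freeTensorIso (g.comp φ) (ιG n)).hom ≫ ModuleCat.ofHom (ext (redBd g (t n))) := by
  refine hom_ext_oneTensor (g.comp φ) fun x ↦ ?_
  have h1 := map_oneTensor (g.comp φ) (semiExt φ (t n)) x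
  have h2 := tensorChange_oneTensor φ g (ModuleCat.of R (ιF n →₀ R)) ((semiExt φ (t n)).hom x)
  have h3 := freeTensorIso_hom_oneTensor g (ιF n) ((semiExt φ (t n)).hom x)
  have h4 := freeTensorIso_hom_oneTensor (g.comp φ) (ιG n) x
  have h5 : redCoeff g (ιF n) ((semiExt φ (t n)).hom x) =
      ext (redBd g (t n)) (redCoeff (g.comp φ) (ιG n) x) := by
    rw [semiExt_apply, redCoeff_ext, redCoeff_comp]; rfl
  have h6 := congrArg (fun y ↦ (freeTensorIso g (ιF n)).hom.hom
    (((tensorChange φ g).app (ModuleCat.of R (ιF n →₀ R))).hom y)) h1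
  refine h6.trans ((congrArg (freeTensorIso g (ιF n)).hom.hom h2).trans (h3.trans (h5.trans ?_)))
  exact congrArg (ext (redBd g (t n))) h4.symm

variable {M : ModuleCat.{u} R} {augG : ιG 0 → M} {augF : ιF 0 → M}

lemma injective_changeOfRings_iff_basedComplex
    (hG : IsBasedRes (S := Q) (M := (ModuleCat.restrictScalars.{u} φ).obj M) ιG bdG augG)
    (hF : IsBasedRes (S := R) ιF bdF augF) (ht₀ : ∀ x, ext (Q := R) augF (t 0 x) = augG x)
    (ht : ∀ n x, ext (t n) (redCoeff φ _ (bdG n x)) = ext (bdF n) (t (n + 1) x)) (n : ℕ) :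
    Function.Injective (changeOfRings φ g M n).hom ↔
      ∀ x, (∀ m, m + 1 = n →
          ((basedComplex ιG (fun n ↦ redBd (g.comp φ) (bdG n))
            (redBd_sq (g.comp φ) hG.sq)).d n m).hom x = 0) →
        (∃ y, ext (Q := k) (redBd g (bdF n)) y = ext (Q := k) (redBd g (t n)) x) →
          ∃ z, ext (Q := k) (redBd (g.comp φ) (bdG n)) z = x := by
  have hlift : (basedHom φ hG.sq hF.sq t ht).f 0 ≫
      (ModuleCat.restrictScalars.{u} φ).map (hF.resolution.π.f 0) = hG.resolution.π.f 0 := by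
    refine ModuleCat.hom_ext (LinearMap.ext fun v ↦ ?_)
    have e₁ := hF.π_apply ((semiExt φ (t 0)).hom v)
    have e₂ := IsBasedRes.π_apply (M := (ModuleCat.restrictScalars.{u} φ).obj M) hG v
    refine e₁.trans (Eq.trans ?_ e₂.symm)
    exact ext_ext_restrictScalars φ (t 0) ht₀ v
  rw [changeOfRings_injective_iff φ g hG.resolution hF.resolution _ hlift n]
  let a := basedTensorIso (g.comp φ) hG.sq
  let b := basedTensorIso g hF.sq
  let ψ := a.inv ≫ tensorHom φ g (basedHom φ hG.sq hF.sq t ht) ≫ b.hom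
  have hψ : Function.Injective (HomologicalComplex.homologyMap ψ n).hom ↔ Function.Injective
      (HomologicalComplex.homologyMap (tensorHom φ g (basedHom φ hG.sq hF.sq t ht)) n).hom := by
    rw [HomologicalComplex.homologyMap_comp, HomologicalComplex.homologyMap_comp]
    exact injective_comp_iff_of_isIso _ _ _
  have hf : ψ.f n = ModuleCat.ofHom (ext (redBd g (t n))) := by
    have h := tensorHom_basedHom_f φ g hG.sq hF.sq t ht n
    change (freeTensorIso (g.comp φ) (ιG n)).inv ≫ _ ≫ (freeTensorIso g (ιF n)).hom = _
    exact (Iso.inv_comp_eq _).2 h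
  refine hψ.symm.trans ((injective_homologyMap_chainComplex ψ n).trans ?_)
  refine forall_congr' fun x ↦ imp_congr Iff.rfl ?_
  rw [basedComplex_d, basedComplex_d, hf]
  exact Iff.rfl

lemma injective_changeOfRings
    (hG : IsBasedRes (S := Q) (M := (ModuleCat.restrictScalars.{u} φ).obj M) ιG bdG augG)
    (hF : IsBasedRes (S := R) ιF bdF augF) (ht₀ : ∀ x, ext (Q := R) augF (t 0 x) = augG x)
    (ht : ∀ n x, ext (t n) (redCoeff φ _ (bdG n x)) = ext (bdF n) (t (n + 1) x)) (n : ℕ)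
    (h : ∀ x, (∃ y, ext (Q := k) (redBd g (bdF n)) y = ext (Q := k) (redBd g (t n)) x) → x = 0) :
    Function.Injective (changeOfRings φ g M n).hom :=
  (injective_changeOfRings_iff_basedComplex φ g t hG hF ht₀ ht n).2 fun x _ hx ↦
    ⟨0, by rw [map_zero, h x hx]⟩

/-- If `G` is minimal, k ⊗ G has zero differential: every vector is a cycle and only zero is a
boundary. A vector whose image bounds in k ⊗ F is then itself zero. -/
lemma eq_zero_of_injective_changeOfRings
    (hG : IsBasedRes (S := Q) (M := (ModuleCat.restrictScalars.{u} φ).obj M) ιG bdG augG)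
    (hF : IsBasedRes (S := R) ιF bdF augF) (ht₀ : ∀ x, ext (Q := R) augF (t 0 x) = augG x)
    (ht : ∀ n x, ext (t n) (redCoeff φ _ (bdG n x)) = ext (bdF n) (t (n + 1) x)) (n : ℕ)
    (hmin : ∀ m x, redBd (g.comp φ) (bdG m) x = 0)
    (hinj : Function.Injective (changeOfRings φ g M n).hom) (x : ιG n →₀ k)
    (hx : ∃ y, ext (Q := k) (redBd g (bdF n)) y = ext (Q := k) (redBd g (t n)) x) : x = 0 := by
  have h0 (m : ℕ) : ext (Q := k) (redBd (g.comp φ) (bdG m)) = 0 :=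
    (ext_eq_zero_iff _).2 (hmin m)
  obtain ⟨z, hz⟩ := (injective_changeOfRings_iff_basedComplex φ g t hG hF ht₀ ht n).1 hinj x (by
    rintro m rfl
    rw [basedComplex_d, h0]; rfl) hx
  rw [← hz, h0]; rfl

end BasedComparison

/-! ### Minimal free resolutions over local and regular local rings. -/

section MinimalRes

open IsLocalRing

variable {Q : Type u} [CommRing Q]

lemma sub_mem_CoeffIn_of_eq_sup {ι : Type*} {J : Ideal Q} {x : Q} {v : ι →₀ Q}
    (hv : v ∈ CoeffIn ι (Ideal.span {x} ⊔ J)) : ∃ w : ι →₀ Q, v - x • w ∈ CoeffIn ι J := by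
  induction v using Finsupp.induction with
  | zero => exact ⟨0, by simp⟩
  | single_add i q v hi hq ih =>
    have hvi : v i = 0 := by simpa using hi
    have h1 : q ∈ Ideal.span {x} ⊔ J := by simpa [hvi] using hv i
    have h2 : v ∈ CoeffIn ι (Ideal.span {x} ⊔ J) := by
      intro j
      by_cases hij : i = j
      · subst hij; rw [hvi]; exact Ideal.zero_mem _
      · simpa [Finsupp.single_apply, hij] using hv j
    obtain ⟨w, hw⟩ := ih h2
    obtain ⟨a, ha, b, hb, hab⟩ := Submodule.mem_sup.1 h1
    obtain ⟨c, rfl⟩ := Ideal.mem_span_singleton'.1 ha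
    refine ⟨Finsupp.single i c + w, ?_⟩
    have : Finsupp.single i q + v - x • (Finsupp.single i c + w) =
        Finsupp.single i b + (v - x • w) := by
      rw [← hab, Finsupp.single_add, smul_add, Finsupp.smul_single, smul_eq_mul, mul_comm c x]
      abel
    rw [this]
    refine Submodule.add_mem _ (fun j ↦ ?_) hw
    by_cases hij : i = j
    · subst hij; simpa using hb
    · simp [hij]

lemma ext_mem_CoeffIn {ι κ : Type*} {J : Ideal Q} (f : ι → (κ →₀ Q)) {v : ι →₀ Q}
    (hv : v ∈ CoeffIn ι J) : ext f v ∈ CoeffIn κ J := by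
  rw [Finsupp.linearCombination_apply]
  exact Submodule.sum_mem _ fun i _ j ↦ Ideal.mul_mem_right _ _ (hv i)

lemma ext_mem_CoeffIn_of_forall {ι κ : Type*} {J : Ideal Q} {f : ι → (κ →₀ Q)}
    (hf : ∀ i, f i ∈ CoeffIn κ J) (v : ι →₀ Q) : ext f v ∈ CoeffIn κ J := by
  rw [Finsupp.linearCombination_apply]
  exact Submodule.sum_mem _ fun i _ ↦ Submodule.smul_mem _ _ (hf i)

lemma not_single_one_mem_CoeffIn {ι : Type*} {J : Ideal Q} (hJ : J ≠ ⊤) (i : ι) :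
    Finsupp.single i (1 : Q) ∉ CoeffIn ι J := fun h ↦
  hJ ((Ideal.eq_top_iff_one J).2 (by simpa using h i))

variable {M : Type u} [AddCommGroup M] [Module Q M] {ι : ℕ → Type u}
  {bd : ∀ n, ι (n + 1) → (ι n →₀ Q)} {aug : ι 0 → M}

/-- Finitely many columns already span the image. The relation that expresses any further column has
a coefficient 1; but it is a boundary, so by minimality its coefficients lie in the maximal ideal.
-/
lemma IsBasedRes.finite_of_minimal [IsNoetherianRing Q] [IsLocalRing Q] (h : IsBasedRes ι bd aug)
    (hmin : ∀ n x, bd n x ∈ CoeffIn (ι n) (maximalIdeal Q)) (h0 : Finite (ι 0)) (n : ℕ) :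
    Finite (ι n) := by
  induction n with
  | zero => exact h0
  | succ n ih =>
    have hfg : (Submodule.span Q (Set.range (bd n))).FG := IsNoetherian.noetherian _
    obtain ⟨s, hs, hsp⟩ := Submodule.fg_span_iff_fg_span_finset_subset _ |>.1 hfg
    classical
    obtain ⟨t, ht⟩ : ∃ t : Finset (ι (n + 1)), (t : Set (ι (n + 1))).image (bd n) = s := by
      obtain ⟨t, ht, ht'⟩ := Finset.subset_set_image_iff.1
        (show (s : Set _) ⊆ bd n '' Set.univ by rwa [Set.image_univ])
      exact ⟨t, by rw [← ht', Finset.coe_image]⟩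
    suffices hu : ∀ i, i ∈ t from Finite.of_finite_univ (t.finite_toSet.subset fun i _ ↦ hu i)
    intro i
    by_contra hi
    have h1 : bd n i ∈ Submodule.span Q (bd n '' t) := by
      rw [ht, ← hsp]
      exact Submodule.subset_span ⟨i, rfl⟩
    obtain ⟨u, hu, hu'⟩ := (Finsupp.mem_span_image_iff_linearCombination Q).1 h1
    obtain ⟨y, hy⟩ := h.exact_succ n (Finsupp.single i 1 - u) (by
      rw [map_sub, hu', Finsupp.linearCombination_single, one_smul, sub_self])
    have h2 := ext_mem_CoeffIn_of_forall (hmin (n + 1)) y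
    rw [hy] at h2
    have h3 : u i = 0 := by
      by_contra h
      exact hi (hu (Finsupp.mem_support_iff.2 h))
    have h4 : (Finsupp.single i (1 : Q) - u) i ∈ maximalIdeal Q := h2 i
    rw [Finsupp.sub_apply, h3, Finsupp.single_eq_same, sub_zero] at h4
    exact (Ideal.ne_top_iff_one _).1 (maximalIdeal.isMaximal Q).ne_top h4

/-- Vanishing of Tor with the quotient by the first `l` parameters in degrees above `l`. If d(v) =
x_l w modulo the earlier parameters, regularity of x_l makes `w` a cycle modulo them, hence a
boundary d(y') modulo them. Then v - x_l y' is a cycle modulo the earlier parameters, in one degree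
higher. -/
lemma IsBasedRes.exact_mod_regular (h : IsBasedRes ι bd aug) (x : ℕ → Q) (d : ℕ)
    (hx : ∀ l < d, ∀ q, x l * q ∈ Ideal.span (x '' Set.Iio l) → q ∈ Ideal.span (x '' Set.Iio l))
    (l : ℕ) (hl : l ≤ d) (n : ℕ) (hn : l ≤ n) (v : ι (n + 1) →₀ Q)
    (hv : ext (bd n) v ∈ CoeffIn (ι n) (Ideal.span (x '' Set.Iio l))) :
    ∃ y, v - ext (Q := Q) (bd (n + 1)) y ∈ CoeffIn (ι (n + 1)) (Ideal.span (x '' Set.Iio l)) := by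
  induction l generalizing n v with
  | zero =>
    have h0 : Ideal.span (x '' Set.Iio 0) = ⊥ := by
      rw [show Set.Iio 0 = (∅ : Set ℕ) by ext; simp]; simp
    rw [h0] at hv ⊢
    obtain ⟨y, hy⟩ := h.exact_succ n v (Finsupp.ext hv)
    exact ⟨y, by rw [hy, sub_self]; exact Submodule.zero_mem _⟩
  | succ l ih =>
    obtain ⟨n, rfl⟩ : ∃ n', n = n' + 1 := ⟨n - 1, by omega⟩
    have hJ : Ideal.span (x '' Set.Iio (l + 1)) =
        Ideal.span {x l} ⊔ Ideal.span (x '' Set.Iio l) := by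
      rw [← Ideal.span_union, show Set.Iio (l + 1) = insert l (Set.Iio l) by
        ext; grind, Set.image_insert_eq, Set.insert_eq]
    rw [hJ] at hv ⊢
    obtain ⟨w, hw⟩ := sub_mem_CoeffIn_of_eq_sup hv
    have h1 : ext (bd n) w ∈ CoeffIn (ι n) (Ideal.span (x '' Set.Iio l)) := by
      have h2 := ext_mem_CoeffIn (bd n) hw
      have h3 : ext (bd n) (ext (bd (n + 1)) v) = 0 := by
        rw [map_ext]; exact ext_eq_zero fun z _ ↦ h.sq n z
      rw [map_sub, h3, map_smul, zero_sub] at h2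
      intro j
      have h4 := h2 j
      exact hx l (by omega) _ (by simpa using h4)
    obtain ⟨y', hy'⟩ := ih (by omega) n (by omega) w h1
    obtain ⟨y, hy⟩ := ih (by omega) (n + 1) (by omega) (v - x l • y') (by
      have : ext (bd (n + 1)) (v - x l • y') =
          (ext (bd (n + 1)) v - x l • w) + x l • (w - ext (bd (n + 1)) y') := by
        rw [map_sub, map_smul, smul_sub]; abel
      rw [this]
      exact Submodule.add_mem _ hw (Submodule.smul_mem _ _ hy'))
    refine ⟨y, ?_⟩
    have : v - ext (bd (n + 1 + 1)) y = (v - x l • y' - ext (bd (n + 1 + 1)) y) + x l • y' := by abel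
    rw [this]
    refine Submodule.add_mem _ (fun j ↦ Submodule.mem_sup_right (hy j)) fun j ↦ ?_
    exact Submodule.mem_sup_left (Ideal.mul_mem_right _ _ (Ideal.mem_span_singleton_self _))

/-- Above dim Q, a cycle modulo 𝔫 is a boundary modulo 𝔫. By minimality a basis vector is such a
cycle, and boundaries lie in 𝔫, so no basis vector exists. -/
lemma IsBasedRes.isEmpty_of_minimal [IsRegularLocalRing Q] (h : IsBasedRes ι bd aug)
    (hmin : ∀ n x, bd n x ∈ CoeffIn (ι n) (maximalIdeal Q)) {n : ℕ}
    (hn : ringKrullDim Q < (n : WithBot ℕ∞)) : IsEmpty (ι n) := by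
  obtain ⟨d, x, hd, hspan, hreg, -⟩ := exists_regular_system Q
  rw [← hd] at hn
  have hn' : d < n := by exact_mod_cast hn
  obtain ⟨n, rfl⟩ : ∃ n', n = n' + 1 := ⟨n - 1, by omega⟩
  refine ⟨fun i ↦ ?_⟩
  obtain ⟨y, hy⟩ := h.exact_mod_regular x d hreg d le_rfl n (by omega) (Finsupp.single i 1) (by
    rw [hspan, Finsupp.linearCombination_single, one_smul]
    exact hmin n i)
  rw [hspan] at hy
  have := Submodule.add_mem _ hy (ext_mem_CoeffIn_of_forall (hmin (n + 1)) y)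
  rw [sub_add_cancel] at this
  exact not_single_one_mem_CoeffIn (maximalIdeal.isMaximal Q).ne_top i this

/-- Finitely generated modules over local rings have minimal systems of generators. -/
lemma exists_minimal_generators [IsLocalRing Q] (N : Type u) [AddCommGroup N] [Module Q N]
    [Module.Finite Q N] : ∃ (r : ℕ) (t : ULift.{u} (Fin r) → N),
      (∀ y, ∃ v, ext (Q := Q) t v = y) ∧
        ∀ v, ext (Q := Q) t v = 0 → v ∈ CoeffIn _ (maximalIdeal Q) := by
  classical
  have hex : ∃ (r : ℕ) (t : ULift.{u} (Fin r) → N), ∀ y, ∃ v, ext (Q := Q) t v = y := by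
    obtain ⟨r, s, hs⟩ := Module.Finite.exists_fin (R := Q) (M := N)
    refine ⟨r, fun i ↦ s i.down, fun y ↦ ?_⟩
    have hy : y ∈ Submodule.span Q (Set.range fun i : ULift.{u} (Fin r) ↦ s i.down) := by
      rw [show (Set.range fun i : ULift.{u} (Fin r) ↦ s i.down) = Set.range s from
        ULift.down_surjective.range_comp s, hs]
      trivial
    exact (Finsupp.mem_span_range_iff_exists_finsupp.1 hy).imp fun v hv ↦ hv
  obtain ⟨t, ht⟩ := Nat.find_spec hex
  refine ⟨Nat.find hex, t, ht, fun v hv ⟨i⟩ ↦ ?_⟩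
  by_contra hi
  -- A relation with a unit coefficient expresses one generator through the others, which
  -- contradicts the choice of the least number of generators.
  have hunit : IsUnit (v ⟨i⟩) := by
    by_contra h
    exact hi ((mem_maximalIdeal _).2 h)
  obtain ⟨r, hr⟩ : ∃ r, Nat.find hex = r + 1 := ⟨Nat.find hex - 1, by have := i.2; omega⟩
  refine Nat.find_min hex (m := r) (by omega) ?_
  obtain ⟨c, hc⟩ := hunit.exists_left_inv
  let e : Fin (r + 1) ≃ Fin (Nat.find hex) := finCongr hr.symm
  let j : Fin (r + 1) := e.symm i
  let s : ULift.{u} (Fin r) → N := fun l ↦ t ⟨e (j.succAbove l.down)⟩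
  refine ⟨s, ?_⟩
  have hmem : ∀ l, t l ∈ LinearMap.range (ext (Q := Q) s) := by
    have h1 : ∀ l : Fin (Nat.find hex), l ≠ i → t ⟨l⟩ ∈ LinearMap.range (ext (Q := Q) s) := by
      intro l hl
      obtain ⟨z, hz⟩ := Fin.exists_succAbove_eq (x := e.symm l) (y := j)
        (fun h ↦ hl (e.symm.injective h))
      refine ⟨Finsupp.single ⟨z⟩ 1, ?_⟩
      rw [Finsupp.linearCombination_single, one_smul]
      change t ⟨e (j.succAbove z)⟩ = _
      rw [hz, Equiv.apply_symm_apply]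
    rintro ⟨l⟩
    by_cases hl : l = i
    · subst hl
      have h2 : v ⟨l⟩ • t ⟨l⟩ ∈ LinearMap.range (ext (Q := Q) s) := by
        have h3 : ext (Q := Q) t v = v ⟨l⟩ • t ⟨l⟩ + ext (Q := Q) t (v.erase ⟨l⟩) := by
          conv_lhs => rw [← Finsupp.single_add_erase ⟨l⟩ v]
          rw [map_add, Finsupp.linearCombination_single]
        rw [hv] at h3
        have h4 : v ⟨l⟩ • t ⟨l⟩ = - ext (Q := Q) t (v.erase ⟨l⟩) := by
          rw [eq_neg_iff_add_eq_zero, ← h3]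
        rw [h4]
        refine Submodule.neg_mem _ ?_
        rw [Finsupp.linearCombination_apply]
        refine Submodule.sum_mem _ fun z hz ↦ Submodule.smul_mem _ _ ?_
        refine h1 z.down fun h ↦ ?_
        rw [Finsupp.mem_support_iff] at hz
        exact hz (by rw [← h]; simp)
      have := Submodule.smul_mem _ c h2
      rwa [smul_smul, hc, one_smul] at this
    · exact h1 l hl
  intro y
  obtain ⟨w, rfl⟩ := ht y
  rw [Finsupp.linearCombination_apply]
  exact Submodule.sum_mem (LinearMap.range (ext (Q := Q) s)) fun z _ ↦ Submodule.smul_mem _ _ (hmem z)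

/-- The kernel of the map given by chosen generators. -/
noncomputable def syzygyStep (r : (Σ r : ℕ, Submodule Q (ULift.{u} (Fin r) →₀ Q)) → ℕ)
    (t : ∀ s, ULift.{u} (Fin (r s)) → s.2) (s : Σ r : ℕ, Submodule Q (ULift.{u} (Fin r) →₀ Q)) :
    Σ r : ℕ, Submodule Q (ULift.{u} (Fin r) →₀ Q) :=
  ⟨r s, LinearMap.ker (ext (Q := Q) (t s))⟩

/-- Iterated syzygies. -/
noncomputable def syzygy (r : (Σ r : ℕ, Submodule Q (ULift.{u} (Fin r) →₀ Q)) → ℕ)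
    (t : ∀ s, ULift.{u} (Fin (r s)) → s.2) (s : Σ r : ℕ, Submodule Q (ULift.{u} (Fin r) →₀ Q)) :
    ℕ → Σ r : ℕ, Submodule Q (ULift.{u} (Fin r) →₀ Q)
  | 0 => s
  | n + 1 => syzygyStep r t (syzygy r t s n)

lemma ext_coe {N : Type*} [AddCommGroup N] [Module Q N] {K : Submodule Q N} {ι : Type*}
    (f : ι → K) (v : ι →₀ Q) : ext (fun x ↦ (f x : N)) v = (ext (Q := Q) f v : K) :=
  (map_ext K.subtype f v).symm

/-- Finitely generated modules over noetherian local rings have minimal free resolutions. -/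
lemma exists_minimal_basedRes [IsNoetherianRing Q] [IsLocalRing Q] (M : Type u) [AddCommGroup M]
    [Module Q M] [Module.Finite Q M] :
    ∃ (ι : ℕ → Type u) (bd : ∀ n, ι (n + 1) → (ι n →₀ Q)) (aug : ι 0 → M),
      IsBasedRes ι bd aug ∧ (∀ n x, bd n x ∈ CoeffIn (ι n) (maximalIdeal Q)) ∧
        ∀ n, Finite (ι n) := by
  obtain ⟨r₀, t₀, ht₀, hm₀⟩ := exists_minimal_generators (Q := Q) M
  have step (s : Σ r : ℕ, Submodule Q (ULift.{u} (Fin r) →₀ Q)) :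
      ∃ (r : ℕ) (t : ULift.{u} (Fin r) → s.2), (∀ y, ∃ v, ext (Q := Q) t v = y) ∧
        ∀ v, ext (Q := Q) t v = 0 → v ∈ CoeffIn _ (maximalIdeal Q) :=
    exists_minimal_generators s.2
  choose r t ht hm using step
  let S := syzygy r t ⟨r₀, LinearMap.ker (ext (Q := Q) t₀)⟩
  have hSmin (n : ℕ) : (S n).2 ≤ CoeffIn _ (maximalIdeal Q) := by
    cases n with
    | zero => exact fun v hv ↦ hm₀ v hv
    | succ n => exact fun v hv ↦ hm (S n) v hv
  let bd (n : ℕ) (x : ULift.{u} (Fin (S (n + 1)).1)) : ULift.{u} (Fin (S n).1) →₀ Q :=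
    (t (S n) x : _)
  have hval (n : ℕ) (v : ULift.{u} (Fin (S (n + 1)).1) →₀ Q) :
      ext (bd n) v = (ext (Q := Q) (t (S n)) v : (S n).2) := ext_coe (t (S n)) v
  have hker (n : ℕ) (v : ULift.{u} (Fin (S (n + 1)).1) →₀ Q) :
      v ∈ (S (n + 1)).2 ↔ ext (bd n) v = 0 := by
    rw [hval]
    exact (Submodule.coe_eq_zero (x := ext (Q := Q) (t (S n)) v)).symm
  have hmem (n : ℕ) (x : ULift.{u} (Fin (S (n + 1)).1)) : bd n x ∈ (S n).2 := (t (S n) x).2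
  have hex (n : ℕ) (v : ULift.{u} (Fin (S n).1) →₀ Q) (hv : v ∈ (S n).2) :
      ∃ u, ext (Q := Q) (bd n) u = v := by
    obtain ⟨u, hu⟩ := ht (S n) ⟨v, hv⟩
    exact ⟨u, (hval n u).trans (congrArg Subtype.val hu)⟩
  exact ⟨fun n ↦ ULift.{u} (Fin (S n).1), bd, t₀,
    ⟨fun n x ↦ (hker n _).1 (hmem (n + 1) x), fun x ↦ hmem 0 x, ht₀, fun v hv ↦ hex 0 v hv,
      fun n v hv ↦ hex (n + 1) v ((hker n v).2 hv)⟩, fun n x ↦ hSmin n (hmem n x),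
    fun n ↦ inferInstanceAs (Finite (ULift (Fin (S n).1)))⟩

end MinimalRes

/-! ### Renaming of letters. -/

section Push

variable {Q : Type*} [CommRing Q] {X X' : Type*}

/-- The linear map given by a map of bases. -/
noncomputable abbrev push (f : X → X') : (X →₀ Q) →ₗ[Q] (X' →₀ Q) := Finsupp.lmapDomain Q Q f

lemma push_single (f : X → X') (x : X) (q : Q) :
    push f (Finsupp.single x q) = Finsupp.single (f x) q := Finsupp.mapDomain_single

lemma ext_push {Y : Type*} [AddCommGroup Y] [Module Q Y] (g : X' → Y) (f : X → X') (v : X →₀ Q) :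
    ext g (push f v) = ext (fun x ↦ g (f x)) v := Finsupp.linearCombination_mapDomain ..

lemma exists_of_mem_support_push {f : X → X'} {v : X →₀ Q} {x' : X'}
    (h : x' ∈ (push f v).support) : ∃ x ∈ v.support, f x = x' := by
  classical
  simpa using Finsupp.mapDomain_support h

lemma push_apply {f : X → X'} (hf : Function.Injective f) (v : X →₀ Q) (x : X) :
    push f v (f x) = v x := Finsupp.mapDomain_apply hf v x

lemma push_injective {f : X → X'} (hf : Function.Injective f) :
    Function.Injective (push (Q := Q) f) := Finsupp.mapDomain_injective hf

lemma exists_push_eq {f : X → X'} (hf : Function.Injective f) {v : X' →₀ Q}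
    (h : ∀ x' ∈ v.support, ∃ x, f x = x') :
    ∃ w : X →₀ Q, push f w = v ∧ ∀ x ∈ w.support, f x ∈ v.support := by
  refine ⟨v.comapDomain f hf.injOn, Finsupp.mapDomain_comapDomain f hf v fun x' hx ↦ h x' hx,
    fun x hx ↦ by simpa using hx⟩

variable {L L' : Type*} {f : L → L'}

lemma splitSum_map {Y : Type*} [AddCommMonoid Y] (F : List L' → List L' → Y) (w : List L) :
    splitSum F (w.map f) = splitSum (fun b c ↦ F (b.map f) (c.map f)) w := by
  induction w generalizing F with
  | nil => rfl
  | cons x w ih => rw [List.map_cons, splitSum_cons, splitSum_cons, ih]; rfl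

lemma push_ins (a c : List L) (v : L →₀ Q) :
    push (List.map f) (ins Q a c v) = ins Q (a.map f) (c.map f) (push f v) := by
  induction v using Finsupp.induction_linear with
  | zero => simp
  | add v w hv hw => simp only [map_add, hv, hw]
  | single x q => simp only [ins_single, push_single]; simp

variable {wt : L → ℕ} {wt' : L' → ℕ} {m : List L → (L →₀ Q)} {m' : List L' → (L' →₀ Q)}

lemma wordWt_map (hwt : ∀ x, wt' (f x) = wt x) (w : List L) :
    wordWt wt' (w.map f) = wordWt wt w := by
  induction w with
  | nil => rfl
  | cons x w ih => rw [List.map_cons, wordWt_cons, wordWt_cons, hwt, ih]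

lemma coder_map (hwt : ∀ x, wt' (f x) = wt x) (hm : ∀ w, m' (w.map f) = push f (m w))
    (w : List L) : coder wt' m' (w.map f) = push (List.map f) (coder wt m w) := by
  rw [coder, coder, splitSum_map, map_splitSum]
  refine splitSum_congr fun a q _ ↦ ?_
  rw [splitSum_map, map_splitSum]
  refine splitSum_congr fun b c _ ↦ ?_
  rw [map_smul, push_ins, hm, sgn, sgn, wordWt_map hwt]

lemma ext_coder_map (hwt : ∀ x, wt' (f x) = wt x) (hm : ∀ w, m' (w.map f) = push f (m w))
    (w : List L) : ext m' (coder wt' m' (w.map f)) = push f (ext m (coder wt m w)) := by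
  rw [coder_map hwt hm, ext_push, map_ext]
  exact ext_congr fun v _ ↦ hm v

lemma curv_map {δ : L → Q} {δ' : L' → Q} (hδ : ∀ x, δ' (f x) = δ x) (w : List L) :
    curv δ' (w.map f) = push f (curv δ w) := by
  by_cases h : w.length = 2
  · obtain ⟨x, y, rfl⟩ := List.length_eq_two.1 h
    rw [List.map_cons, List.map_cons, List.map_nil, curv_pair, curv_pair, map_sub, push_single,
      push_single, hδ, hδ]
  · rw [curv_of_length_ne _ h, curv_of_length_ne _ (by simpa using h), map_zero]

lemma Rel.map {δ : L → Q} {δ' : L' → Q} (hwt : ∀ x, wt' (f x) = wt x)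
    (hm : ∀ w, m' (w.map f) = push f (m w)) (hδ : ∀ x, δ' (f x) = δ x) {w : List L}
    (h : Rel δ wt m w) : Rel δ' wt' m' (w.map f) := by
  rw [Rel, ext_coder_map hwt hm, curv_map hδ, h]

end Push

/-! ### A-infinity algebra and module structures on letters. -/

section Letters

variable {Q : Type*} [CommRing Q]

/-- Based complexes `(B, d, δ)` for the positive part of an acyclic resolution of `Q / I`. -/
structure IsAlgLetters (I : Ideal Q) {B : Type*} (wt : B → ℕ) (d : B → (B →₀ Q)) (δ : B → Q) :
    Prop where
  two_le : ∀ b, 2 ≤ wt b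
  lowers : ∀ b, ∀ x ∈ (d b).support, wt x + 1 = wt b
  delta : ∀ b, δ b ≠ 0 → wt b = 2
  sq : ∀ b, ext d (d b) = 0
  delta_d : ∀ b, ext δ (d b) = 0
  exact : ∀ p, 2 ≤ p → ∀ v ∈ Homog Q wt p, ext d v = 0 → ext δ v = 0 →
    ∃ y ∈ Homog Q wt (p + 1), ext d y = v
  mem_iff : ∀ r, r ∈ I ↔ ∃ y ∈ Homog Q wt 2, ext δ y = r
  finite : ∀ p, {b | wt b = p}.Finite

/-- Based complexes `(C, d)` for a free resolution of a module `N`, with degrees shifted by one. -/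
structure IsModLetters {N : Type*} [AddCommGroup N] [Module Q N] {C : Type*} (wt : C → ℕ)
    (d : C → (C →₀ Q)) (aug : C → N) : Prop where
  one_le : ∀ c, 1 ≤ wt c
  lowers : ∀ c, ∀ x ∈ (d c).support, wt x + 1 = wt c
  sq : ∀ c, ext d (d c) = 0
  aug_eq_zero : ∀ c, wt c ≠ 1 → aug c = 0
  aug_d : ∀ c, ext aug (d c) = 0
  surj : ∀ y, ∃ v ∈ Homog Q wt 1, ext aug v = y
  exact_one : ∀ v ∈ Homog Q wt 1, ext aug v = 0 → ∃ y ∈ Homog Q wt 2, ext d y = v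
  exact : ∀ p, 2 ≤ p → ∀ v ∈ Homog Q wt p, ext d v = 0 → ∃ y ∈ Homog Q wt (p + 1), ext d y = v
  finite : ∀ p, {c | wt c = p}.Finite

/-- A-infinity structures on letters. -/
structure IsAInf {B : Type*} (wt : B → ℕ) (d : B → (B →₀ Q)) (δ : B → Q)
    (m : List B → (B →₀ Q)) : Prop where
  single : ∀ b, m [b] = d b
  adm : ∀ w, Adm (fun _ ↦ False) wt w (m w)
  ext_delta : ∀ w, ext δ (m w) = 0
  rel : ∀ w, Rel δ wt m w

variable {B : Type*} {I : Ideal Q} {wt : B → ℕ} {d : B → (B →₀ Q)} {δ : B → Q}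

lemma rel_nil {L : Type*} {wt : L → ℕ} {δ : L → Q} {m : List L → (L →₀ Q)} (h : m [] = 0) :
    Rel δ wt m [] := by
  rw [Rel, curv_of_length_ne _ (by simp), coder, splitSum_nil, splitSum_nil, h]
  simp

lemma rel_singleton {L : Type*} {wt : L → ℕ} {δ : L → Q} {m : List L → (L →₀ Q)} (h : m [] = 0)
    (x : L) (hx : ext (fun y ↦ m [y]) (m [x]) = 0) : Rel δ wt m [x] := by
  rw [Rel, curv_of_length_ne _ (by simp), coder_singleton h, ext_ins]
  exact hx

lemma eq_nil_or_singleton_of_length_le {L : Type*} {w : List L} (h : w.length ≤ 1) :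
    w = [] ∨ ∃ x, w = [x] := by
  rcases w with _ | ⟨x, _ | ⟨y, w⟩⟩
  · exact Or.inl rfl
  · exact Or.inr ⟨x, rfl⟩
  · simp at h

/-- The structure on words of length at most one. -/
noncomputable def singleOnly {L : Type*} (d : L → (L →₀ Q)) : List L → (L →₀ Q)
  | [x] => d x
  | _ => 0

/-- Obstruction theory without closed letters and with no auxiliary functional, started from the
differential on words of length one. -/
theorem IsAlgLetters.exists_isAInf (hB : IsAlgLetters I wt d δ) : ∃ m, IsAInf wt d δ m := by
  have hone (x : B) : 1 ≤ wt x := by have := hB.two_le x; omega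
  obtain ⟨m, h1, h2, h3, h4⟩ := exists_extension (cl := fun _ : B ↦ False) (wt := wt) (δ := δ) hone
    (fun x hx ↦ ⟨hB.delta x hx, not_false⟩) (0 : (B →₀ Q) →ₗ[Q] Q) (fun _ ↦ rfl)
    (fun w ↦ w.length ≤ 1) (singleOnly d) (fun w hw ↦ hw)
    (fun a b c h ↦ by simp only [List.length_append] at h; omega)
    (fun a b c x h hx ↦ by
      rcases b with _ | ⟨y, b⟩
      · simp [singleOnly] at hx
      · simp only [List.length_append, List.length_cons] at h ⊢; omega)
    (fun w hw ↦ by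
      rcases eq_nil_or_singleton_of_length_le hw with rfl | ⟨x, rfl⟩
      · exact ⟨fun x hx ↦ by simp [singleOnly] at hx, by simp [singleOnly], rfl⟩
      · exact ⟨fun y hy ↦ ⟨by simpa [singleOnly] using hB.lowers x y hy, by simp⟩, hB.delta_d x, rfl⟩)
    (fun w hw ↦ by
      rcases eq_nil_or_singleton_of_length_le hw with rfl | ⟨x, rfl⟩
      · exact rel_nil rfl
      · exact rel_singleton rfl x (hB.sq x))
    (fun w hw _ v hv hdv hδv _ ↦ by
      have hlen : 2 ≤ w.length := by omega
      obtain ⟨x, y, w, rfl⟩ : ∃ x y w', w = x :: y :: w' := by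
        rcases w with _ | ⟨x, _ | ⟨y, w⟩⟩
        · simp at hlen
        · simp at hlen
        · exact ⟨x, y, w, rfl⟩
      have hx := hB.two_le x
      have hy := hB.two_le y
      obtain ⟨p, hp⟩ : ∃ p, wordWt wt (x :: y :: w) = p + 2 :=
        ⟨wordWt wt (x :: y :: w) - 2, by simp only [wordWt_cons]; omega⟩
      have hp2 : 2 ≤ p := by simp only [wordWt_cons] at hp; omega
      -- Two letters of weight at least 2 force p ≥ 2, so the obstruction lies where the letters are
      -- exact. The condition on δ matters only for p = 2, and the solution has weight at least 3,
      -- where δ vanishes again.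
      obtain ⟨u, hu, hu'⟩ := hB.exact p hp2 v (fun z hz ↦ by
        have := (hv z hz).1
        change wt z = p
        omega) hdv hδv
      refine ⟨u, fun z hz ↦ ⟨by have : wt z = p + 1 := hu hz; omega, by simp [HasClosed]⟩, ?_, rfl, hu'⟩
      refine ext_eq_zero fun z hz ↦ ?_
      by_contra h
      have := hB.delta z h
      have : wt z = p + 1 := hu hz
      omega)
  exact ⟨m, fun b ↦ h1 [b] (by simp), h2, h3, fun w ↦ h4 w (good_of_not_hasClosed (by simp [HasClosed]))⟩

/-- The letters of the right summand are closed. -/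
def sumCl (B C : Type*) : B ⊕ C → Prop := fun x ↦ x.isRight = true

@[simp] lemma not_sumCl_inl {B C : Type*} (b : B) : ¬ sumCl B C (Sum.inl b) := by simp [sumCl]

@[simp] lemma sumCl_inr {B C : Type*} (c : C) : sumCl B C (Sum.inr c) := by simp [sumCl]

lemma exists_map_inl_of_not_hasClosed {C : Type*} {w : List (B ⊕ C)}
    (h : ¬ HasClosed (sumCl B C) w) : ∃ v : List B, w = v.map Sum.inl := by
  induction w with
  | nil => exact ⟨[], rfl⟩
  | cons x w ih =>
    rw [hasClosed_cons, not_or] at h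
    obtain ⟨v, rfl⟩ := ih h.2
    cases x with
    | inl b => exact ⟨b :: v, rfl⟩
    | inr c => simp at h

lemma not_hasClosed_map_inl {C : Type*} (v : List B) :
    ¬ HasClosed (sumCl B C) (v.map Sum.inl) := by
  simp [HasClosed]

/-- The structure on closed words of length one. -/
noncomputable def closedLetters {C : Type*} (dC : C → (C →₀ Q)) : B ⊕ C → ((B ⊕ C) →₀ Q) :=
  Sum.elim 0 fun c ↦ push Sum.inr (dC c)

open Classical in
/-- The structure on open words, and on closed letters. -/
noncomputable def openStructure {C : Type*} (m : List B → (B →₀ Q)) (dC : C → (C →₀ Q))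
    (w : List (B ⊕ C)) : (B ⊕ C) →₀ Q :=
  if HasClosed (sumCl B C) w then singleOnly (closedLetters dC) w
  else push Sum.inl (m (w.filterMap Sum.getLeft?))

lemma openStructure_map_inl {C : Type*} (m : List B → (B →₀ Q)) (dC : C → (C →₀ Q)) (v : List B) :
    openStructure m dC (v.map Sum.inl) = push Sum.inl (m v) := by
  rw [openStructure, if_neg (not_hasClosed_map_inl v), List.filterMap_map]
  congr 2
  exact List.filterMap_some

lemma openStructure_inr {C : Type*} (m : List B → (B →₀ Q)) (dC : C → (C →₀ Q)) (c : C) :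
    openStructure m dC [Sum.inr c] = push Sum.inr (dC c) := by
  rw [openStructure, if_pos (by simp)]
  rfl

lemma openStructure_inl {C : Type*} (m : List B → (B →₀ Q)) (dC : C → (C →₀ Q)) (b : B) :
    openStructure m dC [Sum.inl b] = push Sum.inl (m [b]) :=
  openStructure_map_inl m dC [b]

variable {C : Type*} {wtC : C → ℕ} {dC : C → (C →₀ Q)} {N : Type*} [AddCommGroup N] [Module Q N]
  {aug : C → N} {mB : List B → (B →₀ Q)}

lemma one_le_sumElim (hB : IsAlgLetters I wt d δ) (hC : IsModLetters wtC dC aug) (x : B ⊕ C) :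
    1 ≤ Sum.elim wt wtC x := by
  cases x with
  | inl b => exact le_trans one_le_two (hB.two_le b)
  | inr c => exact hC.one_le c

lemma sumElim_delta (hB : IsAlgLetters I wt d δ) (x : B ⊕ C) (hx : Sum.elim δ 0 x ≠ 0) :
    Sum.elim wt wtC x = 2 ∧ ¬ sumCl B C x := by
  cases x with
  | inl b => exact ⟨hB.delta b hx, by simp⟩
  | inr c => simp at hx

lemma IsAlgLetters.delta_mem (hB : IsAlgLetters I wt d δ) (b : B) : δ b ∈ I := by
  by_cases hx : δ b = 0
  · rw [hx]; exact I.zero_mem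
  · refine (hB.mem_iff _).2 ⟨Finsupp.single b 1, ?_, by simp⟩
    intro z hz
    obtain rfl : z = b := by simpa using Finsupp.support_single_subset hz
    exact hB.delta z hx

lemma sumElim_delta_smul (hB : IsAlgLetters I wt d δ) (hN : ∀ r ∈ I, ∀ y : N, r • y = 0)
    (x : B ⊕ C) (y : N) : (Sum.elim δ 0 x : Q) • y = 0 := by
  cases x with
  | inl b => exact hN _ (hB.delta_mem b) y
  | inr c => exact zero_smul Q y

/-- The values of δ lie in I, which annihilates the module, so the augmentation does not see the
curvature. -/
lemma ext_aug_curv (hB : IsAlgLetters I wt d δ) (hN : ∀ r ∈ I, ∀ y : N, r • y = 0)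
    (w : List (B ⊕ C)) : ext (Sum.elim 0 aug : B ⊕ C → N) (curv (Sum.elim δ 0) w) = 0 := by
  by_cases h : w.length = 2
  · obtain ⟨x, y, rfl⟩ := List.length_eq_two.1 h
    rw [curv_pair, map_sub, Finsupp.linearCombination_single, Finsupp.linearCombination_single,
      sumElim_delta_smul hB hN, sumElim_delta_smul hB hN, sub_zero]
  · rw [curv_of_length_ne _ h, map_zero]

lemma openStructure_nil (hm : IsAInf wt d δ mB) : openStructure mB dC [] = 0 := by
  have := openStructure_map_inl mB dC []
  rw [(hm.adm []).nil, map_zero] at this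
  exact this

lemma ext_openStructure_inr (v : C →₀ Q) :
    ext (fun x ↦ openStructure mB dC [x]) (push Sum.inr v) = push Sum.inr (ext dC v) := by
  rw [ext_push, map_ext]
  exact ext_congr fun c _ ↦ openStructure_inr ..

lemma ext_openStructure_inl (hm : IsAInf wt d δ mB) (v : B →₀ Q) :
    ext (fun x ↦ openStructure mB dC [x]) (push Sum.inl v) = push Sum.inl (ext d v) := by
  rw [ext_push, map_ext]
  refine ext_congr fun c _ ↦ ?_
  rw [← hm.single]
  exact openStructure_inl ..

lemma openStructure_sq (hB : IsAlgLetters I wt d δ) (hm : IsAInf wt d δ mB)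
    (hC : IsModLetters wtC dC aug) (x : B ⊕ C) :
    ext (fun y ↦ openStructure mB dC [y]) (openStructure mB dC [x]) = 0 := by
  cases x with
  | inl b => rw [openStructure_inl, ext_openStructure_inl hm, hm.single, hB.sq, map_zero]
  | inr c => rw [openStructure_inr, ext_openStructure_inr, hC.sq, map_zero]

lemma map_inl_or_inr_of {w : List (B ⊕ C)} (hw : ¬ HasClosed (sumCl B C) w ∨ w.length ≤ 1) :
    (∃ v : List B, w = v.map Sum.inl) ∨ ∃ c, w = [Sum.inr c] := by
  by_cases h : HasClosed (sumCl B C) w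
  · rcases eq_nil_or_singleton_of_length_le (hw.resolve_left (not_not.2 h)) with rfl | ⟨x, rfl⟩
    · exact Or.inl ⟨[], rfl⟩
    · cases x with
      | inl b => exact Or.inl ⟨[b], rfl⟩
      | inr c => exact Or.inr ⟨c, rfl⟩
  · exact Or.inl (exists_map_inl_of_not_hasClosed h)

lemma ext_sumElim_push_inr (v : C →₀ Q) :
    ext (Sum.elim δ 0 : B ⊕ C → Q) (push Sum.inr v) = 0 := by
  rw [ext_push]
  exact ext_eq_zero fun _ _ ↦ rfl

lemma openStructure_adm (hm : IsAInf wt d δ mB) (hC : IsModLetters wtC dC aug) (w : List (B ⊕ C))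
    (hw : ¬ HasClosed (sumCl B C) w ∨ w.length ≤ 1) :
    Adm (sumCl B C) (Sum.elim wt wtC) w (openStructure mB dC w) ∧
      ext (Sum.elim δ 0) (openStructure mB dC w) = 0 ∧
      ext (Sum.elim 0 aug : B ⊕ C → N) (openStructure mB dC w) = 0 := by
  rcases map_inl_or_inr_of hw with ⟨v, rfl⟩ | ⟨c, rfl⟩
  · rw [openStructure_map_inl]
    refine ⟨fun x hx ↦ ?_, ?_, ?_⟩
    · obtain ⟨b, hb, rfl⟩ := exists_of_mem_support_push hx
      refine ⟨?_, iff_of_false (by simp) (not_hasClosed_map_inl v)⟩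
      rw [wordWt_map (fun _ ↦ rfl)]
      exact (hm.adm v b hb).1
    · rw [ext_push]
      exact hm.ext_delta v
    · rw [ext_push]
      exact ext_eq_zero fun _ _ ↦ rfl
  · rw [openStructure_inr]
    refine ⟨fun x hx ↦ ?_, ext_sumElim_push_inr _, ?_⟩
    · obtain ⟨b, hb, rfl⟩ := exists_of_mem_support_push hx
      exact ⟨by simpa using hC.lowers c b hb, by simp⟩
    · rw [ext_push]
      exact hC.aug_d c

lemma exists_push_inr {p : ℕ} {v : (B ⊕ C) →₀ Q}
    (hv : ∀ z ∈ v.support, Sum.elim wt wtC z = p ∧ sumCl B C z) :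
    ∃ v' ∈ Homog Q wtC p, push Sum.inr v' = v := by
  obtain ⟨v', h1, h2⟩ := exists_push_eq Sum.inr_injective (v := v) fun x hx ↦ by
    rcases x with b | c
    · simpa using (hv _ hx).2
    · exact ⟨c, rfl⟩
  exact ⟨v', fun c hc ↦ (hv _ (h2 c hc)).1, h1⟩

lemma exists_push_inl {p : ℕ} {v : (B ⊕ C) →₀ Q}
    (hv : ∀ z ∈ v.support, Sum.elim wt wtC z = p ∧ ¬ sumCl B C z) :
    ∃ v' ∈ Homog Q wt p, push Sum.inl v' = v := by
  obtain ⟨v', h1, h2⟩ := exists_push_eq Sum.inl_injective (v := v) fun x hx ↦ by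
    rcases x with b | c
    · exact ⟨b, rfl⟩
    · simpa using (hv _ hx).2
  exact ⟨v', fun c hc ↦ (hv _ (h2 c hc)).1, h1⟩

/-- The obstruction at a word with a closed letter consists of closed letters. In weight 1, where
the module itself is the homology, being a cycle is not enough; this is why the augmentation is
carried along in the obstruction theory. -/
lemma exists_openStructure_step (hB : IsAlgLetters I wt d δ) (hC : IsModLetters wtC dC aug)
    (w : List (B ⊕ C)) (hw : ¬ (¬ HasClosed (sumCl B C) w ∨ w.length ≤ 1))
    (hg : Good (sumCl B C) w) (v : (B ⊕ C) →₀ Q)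
    (hv : ∀ z ∈ v.support, Sum.elim wt wtC z + 2 = wordWt (Sum.elim wt wtC) w ∧
      (sumCl B C z ↔ HasClosed (sumCl B C) w))
    (hdv : ext (fun x ↦ openStructure mB dC [x]) v = 0)
    (hθv : ext (Sum.elim 0 aug : B ⊕ C → N) v = 0) :
    ∃ y, Adm (sumCl B C) (Sum.elim wt wtC) w y ∧ ext (Q := Q) (Sum.elim δ 0) y = 0 ∧
      ext (Q := Q) (Sum.elim 0 aug : B ⊕ C → N) y = 0 ∧
        ext (Q := Q) (fun x ↦ openStructure mB dC [x]) y = v := by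
  rw [not_or, not_not, not_le] at hw
  obtain ⟨p, hp⟩ : ∃ p, wordWt (Sum.elim wt wtC) w = p + 3 := by
    refine ⟨wordWt (Sum.elim wt wtC) w - 3, ?_⟩
    obtain ⟨x, y, w, rfl⟩ : ∃ x y w', w = x :: y :: w' := by
      rcases w with _ | ⟨x, _ | ⟨y, w⟩⟩
      · simp at hw
      · simp at hw
      · exact ⟨x, y, w, rfl⟩
    have hx : ¬ sumCl B C x := fun hx ↦ by simpa using hg [] x (y :: w) rfl hx
    have hx2 : 2 ≤ Sum.elim wt wtC x := by
      cases x with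
      | inl b => exact hB.two_le b
      | inr c => simp at hx
    have := one_le_sumElim hB hC y
    simp only [wordWt_cons]
    omega
  obtain ⟨v', hv', rfl⟩ := exists_push_inr (wt := wt) (wtC := wtC) (p := p + 1) (v := v) fun z hz ↦
    ⟨by have := (hv z hz).1; omega, (hv z hz).2.2 hw.1⟩
  rw [ext_openStructure_inr] at hdv
  have hdv' : ext dC v' = 0 := push_injective Sum.inr_injective (by rw [hdv, map_zero])
  rw [ext_push] at hθv
  obtain ⟨y, hy, hy'⟩ : ∃ y ∈ Homog Q wtC (p + 2), ext dC y = v' := by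
    rcases Nat.eq_zero_or_pos p with rfl | hp
    · exact hC.exact_one v' hv' hθv
    · exact hC.exact (p + 1) (by omega) v' hv' hdv'
  refine ⟨push Sum.inr y, fun z hz ↦ ?_, ext_sumElim_push_inr y, ?_, by
    rw [ext_openStructure_inr, hy']⟩
  · obtain ⟨c, hc, rfl⟩ := exists_of_mem_support_push hz
    have : wtC c = p + 2 := hy hc
    exact ⟨by simp only [Sum.elim_inr]; omega, iff_of_true (by simp) hw.1⟩
  · rw [ext_push]
    refine ext_eq_zero fun c hc ↦ hC.aug_eq_zero c ?_
    have : wtC c = p + 2 := hy hc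
    omega

lemma openStructure_rel (hB : IsAlgLetters I wt d δ) (hm : IsAInf wt d δ mB)
    (hC : IsModLetters wtC dC aug) (w : List (B ⊕ C))
    (hw : ¬ HasClosed (sumCl B C) w ∨ w.length ≤ 1) :
    Rel (Sum.elim δ 0) (Sum.elim wt wtC) (openStructure mB dC) w := by
  rcases map_inl_or_inr_of hw with ⟨v, rfl⟩ | ⟨c, rfl⟩
  · exact Rel.map (wt := wt) (δ := δ) (m := mB) (f := Sum.inl) (fun _ ↦ rfl)
      (openStructure_map_inl mB dC) (fun _ ↦ rfl) (hm.rel v)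
  · exact rel_singleton (openStructure_nil hm) _ (openStructure_sq hB hm hC _)

/-- A given A-infinity algebra structure is kept on open words, and the resolution of a module
annihilated by I receives an A-infinity module structure over it. The obstruction theory starts from
all open words and all single letters. -/
theorem exists_exactSystem (hB : IsAlgLetters I wt d δ) (hm : IsAInf wt d δ mB)
    (hC : IsModLetters wtC dC aug) (hN : ∀ r ∈ I, ∀ y : N, r • y = 0) :
    ∃ m : List (B ⊕ C) → ((B ⊕ C) →₀ Q),
      ExactSystem (sumCl B C) (Sum.elim wt wtC) (Sum.elim δ 0) m ∧
      (∀ w, m (w.map Sum.inl) = push Sum.inl (mB w)) ∧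
      ∀ c, m [Sum.inr c] = push Sum.inr (dC c) := by
  obtain ⟨m, h1, h2, h3, h4⟩ := exists_extension (cl := sumCl B C) (wt := Sum.elim wt wtC)
    (δ := Sum.elim δ 0) (one_le_sumElim hB hC) (sumElim_delta hB)
    (ext (Sum.elim 0 aug : B ⊕ C → N)) (ext_aug_curv hB hN)
    (fun w ↦ ¬ HasClosed (sumCl B C) w ∨ w.length ≤ 1) (openStructure mB dC)
    (fun w hw ↦ Or.inr hw)
    (fun a b c h ↦ by
      rcases h with h | h
      · left; simp only [hasClosed_append, not_or] at h; exact h.1.2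
      · right; simp only [List.length_append] at h; omega)
    (fun a b c x h hx ↦ by
      rcases b with _ | ⟨y, b⟩
      · rw [openStructure_nil hm] at hx; simp at hx
      rcases h with h | h
      · left
        simp only [hasClosed_append, not_or] at h
        have := (openStructure_adm hm hC _ (Or.inl h.1.2)).1 x hx
        simp only [hasClosed_append, hasClosed_cons x, not_or]
        exact ⟨h.1.1, fun hx ↦ h.1.2 (this.2.1 hx), h.2⟩
      · right; simp only [List.length_append, List.length_cons] at h ⊢; omega)
    (openStructure_adm hm hC)
    (openStructure_rel hB hm hC)
    (fun w hw hg v hv hdv _ hθv ↦ exists_openStructure_step hB hC w hw hg v hv hdv hθv)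
  have hm1 (x : B ⊕ C) : m [x] = openStructure mB dC [x] := h1 _ (Or.inr (by simp))
  have hmB (w : List B) : m (w.map Sum.inl) = push Sum.inl (mB w) := by
    rw [h1 _ (Or.inl (not_hasClosed_map_inl w)), openStructure_map_inl]
  refine ⟨m, ⟨one_le_sumElim hB hC, ?_, sumElim_delta hB, h2, h3, h4, ?_, ?_⟩, hmB,
    fun c ↦ (hm1 _).trans (openStructure_inr ..)⟩
  · rintro (b | c) hx
    · exact hB.two_le b
    · simp at hx
  · intro p hp v hv hdv hδv
    obtain ⟨v', hv', rfl⟩ := exists_push_inl hv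
    simp only [hm1] at hdv ⊢
    rw [ext_openStructure_inl hm] at hdv
    have hdv' : ext d v' = 0 := push_injective Sum.inl_injective (by rw [hdv, map_zero])
    rw [ext_push] at hδv
    obtain ⟨y, hy, rfl⟩ := hB.exact p hp v' hv' hdv' hδv
    refine ⟨push Sum.inl y, fun z hz ↦ ?_, ext_openStructure_inl hm y⟩
    obtain ⟨b, hb, rfl⟩ := exists_of_mem_support_push hz
    exact ⟨hy hb, by simp⟩
  · intro p hp v hv hdv
    obtain ⟨v', hv', rfl⟩ := exists_push_inr hv
    simp only [hm1] at hdv ⊢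
    rw [ext_openStructure_inr] at hdv
    have hdv' : ext dC v' = 0 := push_injective Sum.inr_injective (by rw [hdv, map_zero])
    obtain ⟨y, hy, rfl⟩ := hC.exact p hp v' hv' hdv'
    refine ⟨push Sum.inr y, fun z hz ↦ ?_, ext_openStructure_inr y⟩
    obtain ⟨b, hb, rfl⟩ := exists_of_mem_support_push hz
    exact ⟨hy hb, by simp⟩

end Letters

/-! ### Cutting a differential on a graded basis into matrices. -/

section Graded

variable {S : Type u} [CommRing S] {X : Type u} {P : ℕ → Set X} {D : X → (X →₀ S)}
  {M : Type u} [AddCommGroup M] [Module S M] {a : X → M}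

/-- The matrix of `D` with rows in degree `n` and columns in degree `n + 1`. -/
noncomputable def gradedBd (P : ℕ → Set X) (D : X → (X →₀ S)) (n : ℕ) (x : P (n + 1)) : P n →₀ S :=
  (D x).comapDomain Subtype.val Subtype.val_injective.injOn

lemma push_gradedBd (hD : ∀ n, ∀ x ∈ P (n + 1), D x ∈ Finsupp.supported S S (P n)) (n : ℕ)
    (x : P (n + 1)) : push Subtype.val (gradedBd P D n x) = D x :=
  Finsupp.mapDomain_comapDomain _ Subtype.val_injective _ fun y hy ↦ ⟨⟨y, hD n x x.2 hy⟩, rfl⟩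

lemma ext_push_val (hD : ∀ n, ∀ x ∈ P (n + 1), D x ∈ Finsupp.supported S S (P n)) (n : ℕ)
    (v : P (n + 1) →₀ S) : ext D (push Subtype.val v) = push Subtype.val (ext (gradedBd P D n) v) := by
  rw [ext_push, map_ext]
  exact ext_congr fun x _ ↦ (push_gradedBd hD n x).symm

lemma push_val_mem (n : ℕ) (v : P n →₀ S) : push Subtype.val v ∈ Finsupp.supported S S (P n) :=
  fun y hy ↦ by
    obtain ⟨x, -, rfl⟩ := exists_of_mem_support_push hy
    exact x.2

lemma exists_push_val {n : ℕ} {v : X →₀ S} (hv : v ∈ Finsupp.supported S S (P n)) :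
    ∃ w : P n →₀ S, push Subtype.val w = v := by
  obtain ⟨w, hw, -⟩ := exists_push_eq (f := (Subtype.val : P n → X)) Subtype.val_injective
    fun y hy ↦ ⟨⟨y, hv hy⟩, rfl⟩
  exact ⟨w, hw⟩

lemma isBasedRes_of_graded (hD : ∀ n, ∀ x ∈ P (n + 1), D x ∈ Finsupp.supported S S (P n))
    (sq : ∀ n, ∀ x ∈ P (n + 2), ext D (D x) = 0) (haug : ∀ x ∈ P 1, ext a (D x) = 0)
    (surj : ∀ y, ∃ v ∈ Finsupp.supported S S (P 0), ext a v = y)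
    (ex0 : ∀ v ∈ Finsupp.supported S S (P 0), ext a v = 0 →
      ∃ u ∈ Finsupp.supported S S (P 1), ext D u = v)
    (exs : ∀ n, ∀ v ∈ Finsupp.supported S S (P (n + 1)), ext D v = 0 →
      ∃ u ∈ Finsupp.supported S S (P (n + 2)), ext D u = v) :
    IsBasedRes (fun n ↦ P n) (gradedBd P D) (fun x ↦ a x) where
  sq n x := push_injective Subtype.val_injective <| by
    rw [← ext_push_val hD, push_gradedBd hD, map_zero, sq n x x.2]
  aug_bd x := by
    have h := ext_push (Q := S) a (Subtype.val : P 0 → X) (gradedBd P D 0 x)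
    rw [push_gradedBd hD, haug x x.2] at h
    exact h.symm
  surj y := by
    obtain ⟨v, hv, rfl⟩ := surj y
    obtain ⟨w, rfl⟩ := exists_push_val hv
    exact ⟨w, (ext_push (Q := S) a (Subtype.val : P 0 → X) w).symm⟩
  exact_zero v hv := by
    obtain ⟨u, hu, hu'⟩ := ex0 (push Subtype.val v) (push_val_mem 0 v) (by rw [ext_push]; exact hv)
    obtain ⟨w, rfl⟩ := exists_push_val hu
    rw [ext_push_val hD] at hu'
    exact ⟨w, push_injective Subtype.val_injective hu'⟩
  exact_succ n v hv := by
    obtain ⟨u, hu, hu'⟩ := exs n (push Subtype.val v) (push_val_mem _ v) (by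
      rw [ext_push_val hD, hv, map_zero])
    obtain ⟨w, rfl⟩ := exists_push_val hu
    rw [ext_push_val hD] at hu'
    exact ⟨w, push_injective Subtype.val_injective hu'⟩

lemma gradedBd_mem_CoeffIn_iff (hD : ∀ n, ∀ x ∈ P (n + 1), D x ∈ Finsupp.supported S S (P n))
    (n : ℕ) (x : P (n + 1)) (J : Ideal S) :
    gradedBd P D n x ∈ CoeffIn (P n) J ↔ D x ∈ CoeffIn X J := by
  refine ⟨fun h y ↦ ?_, fun h y ↦ h y⟩
  by_cases hy : y ∈ P n
  · exact h ⟨y, hy⟩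
  · have : D x y = 0 := by
      by_contra h
      exact hy (hD n x x.2 (Finsupp.mem_support_iff.2 h))
    rw [this]
    exact J.zero_mem

end Graded

/-! ### From degreewise bases to a single weighted alphabet. -/

section Sigma

variable {Q : Type u} [CommRing Q] {ι : ℕ → Type u}

/-- The total differential of a based complex. -/
noncomputable def sigmaD (bd : ∀ n, ι (n + 1) → (ι n →₀ Q)) : (Σ n, ι n) → ((Σ n, ι n) →₀ Q)
  | ⟨0, _⟩ => 0
  | ⟨n + 1, x⟩ => push (Sigma.mk n) (bd n x)

variable {bd : ∀ n, ι (n + 1) → (ι n →₀ Q)}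

lemma mem_support_sigmaD {x y : Σ n, ι n} (h : y ∈ (sigmaD bd x).support) : y.1 + 1 = x.1 := by
  obtain ⟨_ | n, x⟩ := x
  · simp [sigmaD] at h
  · obtain ⟨z, -, rfl⟩ := exists_of_mem_support_push (show y ∈ (push _ _).support from h)
    rfl

lemma ext_sigmaD_push (n : ℕ) (v : ι (n + 1) →₀ Q) :
    ext (sigmaD bd) (push (Sigma.mk (n + 1)) v) = push (Sigma.mk n) (ext (bd n) v) := by
  rw [ext_push, map_ext]
  rfl

lemma ext_sigmaD_push_zero (v : ι 0 →₀ Q) : ext (sigmaD bd) (push (Sigma.mk 0) v) = 0 := by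
  rw [ext_push]
  exact ext_eq_zero fun _ _ ↦ rfl

lemma ext_sigmaD_sigmaD (sq : ∀ n x, ext (bd n) (bd (n + 1) x) = 0) (x : Σ n, ι n) :
    ext (sigmaD bd) (sigmaD bd x) = 0 := by
  obtain ⟨_ | _ | n, x⟩ := x
  · exact map_zero _
  · exact ext_sigmaD_push_zero _
  · exact (ext_sigmaD_push n _).trans (by rw [sq, map_zero])

lemma exists_push_sigma {n : ℕ} {v : (Σ n, ι n) →₀ Q} (hv : ∀ x ∈ v.support, x.1 = n) :
    ∃ w, push (Sigma.mk n) w = v := by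
  obtain ⟨w, hw, -⟩ := exists_push_eq (f := Sigma.mk (β := ι) n) sigma_mk_injective (v := v)
    fun x hx ↦ by
      obtain ⟨i, x⟩ := x
      obtain rfl : i = n := hv _ hx
      exact ⟨x, rfl⟩
  exact ⟨w, hw⟩

lemma fst_of_mem_support_push {n : ℕ} {w : ι n →₀ Q} {x : Σ n, ι n}
    (hx : x ∈ (push (Sigma.mk n) w).support) : x.1 = n := by
  obtain ⟨y, -, rfl⟩ := exists_of_mem_support_push hx
  rfl

lemma sigmaD_mem_CoeffIn {J : Ideal Q} (h : ∀ n x, bd n x ∈ CoeffIn (ι n) J) (x : Σ n, ι n) :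
    sigmaD bd x ∈ CoeffIn _ J := by
  obtain ⟨_ | n, x⟩ := x
  · exact Submodule.zero_mem _
  · rintro ⟨i, y⟩
    by_cases hi : i = n
    · subst hi
      change push (Sigma.mk i) (bd i x) (Sigma.mk i y) ∈ J
      rw [push_apply sigma_mk_injective]
      exact h i x y
    · have : sigmaD bd ⟨n + 1, x⟩ ⟨i, y⟩ = 0 := by
        by_contra hne
        exact hi (fst_of_mem_support_push (Finsupp.mem_support_iff.2 hne))
      rw [this]; exact J.zero_mem

lemma finite_sigma_fst (hfin : ∀ n, Finite (ι n)) (n : ℕ) : {x : Σ n, ι n | x.1 = n}.Finite := by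
  have := hfin n
  refine (Set.finite_range (Sigma.mk (β := ι) n)).subset ?_
  rintro ⟨i, x⟩ hx
  obtain rfl : i = n := hx
  exact ⟨x, rfl⟩

variable {M : Type u} [AddCommGroup M] [Module Q M] {aug : ι 0 → M}

/-- The augmentation, extended by zero. -/
def sigmaAug (aug : ι 0 → M) : (Σ n, ι n) → M
  | ⟨0, x⟩ => aug x
  | ⟨_ + 1, _⟩ => 0

lemma ext_sigmaAug_push (v : ι 0 →₀ Q) :
    ext (sigmaAug aug) (push (Sigma.mk 0) v) = ext aug v := by
  rw [ext_push]; rfl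

lemma IsBasedRes.isModLetters (h : IsBasedRes (S := Q) ι bd aug) (hfin : ∀ n, Finite (ι n)) :
    IsModLetters (fun x : Σ n, ι n ↦ x.1 + 1) (sigmaD bd) (sigmaAug aug) where
  one_le x := by simp
  lowers x y hy := by have := mem_support_sigmaD hy; omega
  sq := ext_sigmaD_sigmaD h.sq
  aug_eq_zero x hx := by
    obtain ⟨_ | n, x⟩ := x
    · simp at hx
    · rfl
  aug_d x := by
    obtain ⟨_ | _ | n, x⟩ := x
    · exact map_zero _
    · exact (ext_sigmaAug_push _).trans (h.aug_bd x)
    · change ext (sigmaAug aug) (push (Sigma.mk (n + 1)) _) = 0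
      rw [ext_push]
      exact ext_eq_zero fun _ _ ↦ rfl
  surj y := by
    obtain ⟨v, rfl⟩ := h.surj y
    exact ⟨push (Sigma.mk 0) v, fun x hx ↦ by
      have := fst_of_mem_support_push hx
      change x.1 + 1 = 1
      omega, ext_sigmaAug_push v⟩
  exact_one v hv hv' := by
    obtain ⟨w, rfl⟩ := exists_push_sigma (n := 0) (v := v) fun x hx ↦ by
      have : x.1 + 1 = 1 := hv hx
      omega
    rw [ext_sigmaAug_push] at hv'
    obtain ⟨u, rfl⟩ := h.exact_zero w hv'
    exact ⟨push (Sigma.mk 1) u, fun x hx ↦ by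
      have := fst_of_mem_support_push hx
      change x.1 + 1 = 2
      omega, ext_sigmaD_push 0 u⟩
  exact p hp v hv hv' := by
    obtain ⟨n, rfl⟩ : ∃ n, p = n + 2 := ⟨p - 2, by omega⟩
    obtain ⟨w, rfl⟩ := exists_push_sigma (n := n + 1) (v := v) fun x hx ↦ by
      have : x.1 + 1 = n + 2 := hv hx
      omega
    rw [ext_sigmaD_push] at hv'
    obtain ⟨u, rfl⟩ := h.exact_succ n w (push_injective sigma_mk_injective (by rw [hv', map_zero]))
    exact ⟨push (Sigma.mk (n + 2)) u, fun x hx ↦ by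
      have := fst_of_mem_support_push hx
      change x.1 + 1 = n + 3
      omega, ext_sigmaD_push _ u⟩
  finite p := by
    refine (finite_sigma_fst hfin (p - 1)).subset fun x hx ↦ ?_
    change x.1 + 1 = p at hx
    change x.1 = p - 1
    omega

/-- The differential of the shifted complex `A_+[1]`. -/
noncomputable def shiftD (bd : ∀ n, ι (n + 1) → (ι n →₀ Q)) :
    (Σ n, ι (n + 1)) → ((Σ n, ι (n + 1)) →₀ Q) :=
  fun x ↦ -sigmaD (ι := fun n ↦ ι (n + 1)) (fun n ↦ bd (n + 1)) x

/-- The component of the differential from degree `1` to degree `0`. -/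
noncomputable def shiftDelta (bd : ∀ n, ι (n + 1) → (ι n →₀ Q)) (pt : ι 0) : (Σ n, ι (n + 1)) → Q
  | ⟨0, x⟩ => bd 0 x pt
  | ⟨_ + 1, _⟩ => 0

lemma ext_neg {X Y : Type*} [AddCommGroup Y] [Module Q Y] (f : X → Y) (v : X →₀ Q) :
    ext (fun x ↦ -f x) v = -ext f v := by
  simp [Finsupp.linearCombination_apply, Finsupp.sum]

lemma ext_shiftD_push (n : ℕ) (v : ι (n + 2) →₀ Q) :
    ext (shiftD bd) (push (Sigma.mk (β := fun n ↦ ι (n + 1)) (n + 1)) v) =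
      -push (Sigma.mk (β := fun n ↦ ι (n + 1)) n) (ext (bd (n + 1)) v) := by
  rw [show ext (shiftD bd) _ = _ from ext_neg _ _]
  exact congrArg _ (ext_sigmaD_push (ι := fun n ↦ ι (n + 1)) (bd := fun n ↦ bd (n + 1)) n v)

lemma ext_shiftDelta_push (pt : ι 0) (v : ι 1 →₀ Q) :
    ext (shiftDelta bd pt) (push (Sigma.mk (β := fun n ↦ ι (n + 1)) 0) v) = ext (bd 0) v pt := by
  rw [ext_push]
  exact (map_ext (Finsupp.lapply pt) (bd 0) v).symm

lemma ext_shiftD_shiftD (sq : ∀ n x, ext (bd n) (bd (n + 1) x) = 0) (x : Σ n, ι (n + 1)) :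
    ext (shiftD bd) (shiftD bd x) = 0 := by
  rw [show ext (shiftD bd) _ = _ from ext_neg _ _, shiftD, map_neg,
    ext_sigmaD_sigmaD (fun n x ↦ sq (n + 1) x), neg_zero, neg_zero]

lemma ext_shiftDelta_shiftD (sq : ∀ n x, ext (bd n) (bd (n + 1) x) = 0) (pt : ι 0)
    (x : Σ n, ι (n + 1)) : ext (shiftDelta bd pt) (shiftD bd x) = 0 := by
  rw [shiftD, map_neg, neg_eq_zero]
  obtain ⟨_ | _ | n, x⟩ := x
  · exact map_zero _
  · refine (ext_shiftDelta_push pt _).trans ?_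
    rw [sq]; rfl
  · change ext (shiftDelta bd pt) (push (Sigma.mk (n + 1)) _) = 0
    rw [ext_push]
    exact ext_eq_zero fun _ _ ↦ rfl

/-- The shifted differential is zero on the lowest letters, whose true differential goes to A_0. As
A_0 has rank one, `shiftDelta` supplies the missing cycle condition. The minus sign in the witness
undoes the sign of the shift. -/
lemma IsBasedRes.shift_exact (h : IsBasedRes (S := Q) ι bd aug) (pt : ι 0) (hpt : ∀ x, x = pt)
    (n : ℕ) (w : ι (n + 1) →₀ Q)
    (hv' : ext (shiftD bd) (push (Sigma.mk (β := fun n ↦ ι (n + 1)) n) w) = 0)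
    (hδ : ext (shiftDelta bd pt) (push (Sigma.mk (β := fun n ↦ ι (n + 1)) n) w) = 0) :
    ∃ u : ι (n + 2) →₀ Q,
      ext (shiftD bd) (-push (Sigma.mk (β := fun n ↦ ι (n + 1)) (n + 1)) u) =
        push (Sigma.mk (β := fun n ↦ ι (n + 1)) n) w := by
  have hw : ext (bd n) w = 0 := by
    cases n with
    | zero =>
      rw [ext_shiftDelta_push] at hδ
      ext x
      rw [hpt x, hδ]; rfl
    | succ n =>
      rw [ext_shiftD_push, neg_eq_zero] at hv'
      exact push_injective (f := Sigma.mk (β := fun n ↦ ι (n + 1)) n) sigma_mk_injective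
        (hv'.trans (map_zero _).symm)
  obtain ⟨u, rfl⟩ := h.exact_succ n w hw
  exact ⟨u, by rw [map_neg, ext_shiftD_push, neg_neg]⟩

lemma ext_of_forall_eq (pt : ι 0) (hpt : ∀ x, x = pt) (v : ι 0 →₀ Q) :
    ext aug v = v pt • aug pt := by
  have : v = Finsupp.single pt (v pt) := by
    ext x; rw [hpt x]; simp
  conv_lhs => rw [this, Finsupp.linearCombination_single]

lemma IsBasedRes.shift_mem_iff (h : IsBasedRes (S := Q) ι bd aug) (pt : ι 0) (hpt : ∀ x, x = pt)
    (r : Q) : r • aug pt = 0 ↔ ∃ w : ι 1 →₀ Q,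
      ext (shiftDelta bd pt) (push (Sigma.mk (β := fun n ↦ ι (n + 1)) 0) w) = r := by
  constructor
  · intro hr
    obtain ⟨u, hu⟩ := h.exact_zero (Finsupp.single pt r) (by
      rw [Finsupp.linearCombination_single, hr])
    exact ⟨u, by rw [ext_shiftDelta_push, hu, Finsupp.single_eq_same]⟩
  · rintro ⟨w, rfl⟩
    rw [ext_shiftDelta_push, ← ext_of_forall_eq pt hpt, map_ext]
    exact ext_eq_zero fun x _ ↦ h.aug_bd x

lemma fst_of_mem_support_push_shift {n : ℕ} {w : ι (n + 1) →₀ Q} {x : Σ n, ι (n + 1)}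
    (hx : x ∈ (push (Sigma.mk (β := fun n ↦ ι (n + 1)) n) w).support) : x.1 = n :=
  fst_of_mem_support_push (ι := fun n ↦ ι (n + 1)) hx

lemma IsBasedRes.isAlgLetters (h : IsBasedRes (S := Q) ι bd aug) (hfin : ∀ n, Finite (ι n))
    (pt : ι 0) (hpt : ∀ x, x = pt) (I : Ideal Q) (hI : ∀ r, r ∈ I ↔ r • aug pt = 0) :
    IsAlgLetters I (fun x : Σ n, ι (n + 1) ↦ x.1 + 2) (shiftD bd) (shiftDelta bd pt) where
  two_le x := by simp
  lowers x y hy := by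
    rw [shiftD, Finsupp.support_neg] at hy
    have := mem_support_sigmaD hy
    omega
  delta x hx := by
    obtain ⟨_ | n, x⟩ := x
    · rfl
    · exact absurd rfl hx
  sq := ext_shiftD_shiftD h.sq
  delta_d := ext_shiftDelta_shiftD h.sq pt
  exact p hp v hv hv' hδ := by
    obtain ⟨n, rfl⟩ : ∃ n, p = n + 2 := ⟨p - 2, by omega⟩
    obtain ⟨w, rfl⟩ := exists_push_sigma (ι := fun n ↦ ι (n + 1)) (n := n) (v := v) fun x hx ↦ by
      have : x.1 + 2 = n + 2 := hv hx
      omega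
    obtain ⟨u, hu⟩ := h.shift_exact pt hpt n w hv' hδ
    refine ⟨_, fun x hx ↦ ?_, hu⟩
    rw [Finset.mem_coe, Finsupp.support_neg] at hx
    have := fst_of_mem_support_push_shift hx
    change x.1 + 2 = n + 3
    omega
  mem_iff r := by
    rw [hI, h.shift_mem_iff pt hpt]
    constructor
    · rintro ⟨w, hw⟩
      refine ⟨_, fun x hx ↦ ?_, hw⟩
      have := fst_of_mem_support_push_shift hx
      change x.1 + 2 = 2
      omega
    · rintro ⟨y, hy, rfl⟩
      obtain ⟨w, rfl⟩ := exists_push_sigma (ι := fun n ↦ ι (n + 1)) (n := 0) (v := y) fun x hx ↦ by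
        have : x.1 + 2 = 2 := hy hx
        omega
      exact ⟨w, rfl⟩
  finite p := by
    refine (finite_sigma_fst (ι := fun n ↦ ι (n + 1)) (fun n ↦ hfin (n + 1)) (p - 2)).subset
      fun x hx ↦ ?_
    change x.1 + 2 = p at hx
    change x.1 = p - 2
    omega

end Sigma

/-! ### The Koszul complex as module letters. -/

section Koszul

variable {Q : Type u} [CommRing Q] {n J₀ J : Ideal Q} {C : Type u} {wt : C → ℕ}
  {d : C → (C →₀ Q)} {c₀ : C}

lemma IsKoszulLike.isModLetters (h : IsKoszulLike n J₀ J C wt d c₀) {N : Type*} [AddCommGroup N]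
    [Module Q N] (e : N) (he : ∀ y : N, ∃ q : Q, q • e = y) (hJ : ∀ q : Q, q • e = 0 ↔ q ∈ J₀)
    [DecidableEq C] : IsModLetters wt d (fun c ↦ if c = c₀ then e else 0) where
  one_le := h.one_le
  lowers := h.lowers
  sq := h.sq
  aug_eq_zero c hc := if_neg fun h' ↦ hc ((h.wt_eq_one c).2 h')
  aug_d c := by
    by_cases hc : wt c = 2
    · have h1 : d c = Finsupp.single c₀ (d c c₀) := by
        ext x
        by_cases hx : x = c₀
        · subst hx; simp
        · rw [Finsupp.single_eq_of_ne hx]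
          by_contra h0
          have := h.lowers c x (Finsupp.mem_support_iff.2 h0)
          exact hx ((h.wt_eq_one x).1 (by omega))
      rw [h1, Finsupp.linearCombination_single, if_pos rfl, hJ, ← h.mem_iff]
      refine ⟨Finsupp.single c 1, fun x hx ↦ ?_, by simpa using h1⟩
      obtain rfl : x = c := by simpa using Finsupp.support_single_subset hx
      exact hc
    · refine ext_eq_zero fun x hx ↦ if_neg fun h' ↦ hc ?_
      have h1 := h.lowers c x hx
      have h2 := (h.wt_eq_one x).2 h'
      omega
  surj y := by
    obtain ⟨q, rfl⟩ := he y
    refine ⟨Finsupp.single c₀ q, fun x hx ↦ ?_, by simp⟩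
    obtain rfl : x = c₀ := by simpa using Finsupp.support_single_subset hx
    exact (h.wt_eq_one x).2 rfl
  exact_one v hv hv' := by
    have h1 : v = Finsupp.single c₀ (v c₀) := by
      ext x
      by_cases hx : x = c₀
      · subst hx; simp
      · rw [Finsupp.single_eq_of_ne hx]
        by_contra h0
        exact hx ((h.wt_eq_one x).1 (hv (Finsupp.mem_support_iff.2 h0)))
    rw [h1, Finsupp.linearCombination_single, if_pos rfl, hJ, ← h.mem_iff] at hv'
    rwa [h1]
  exact := h.exact
  finite p := by
    have := h.finite
    exact Set.toFinite _

end Koszul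

/-! ### Module letters as based resolutions. -/

section ModLetters

variable {Q : Type u} [CommRing Q] {C : Type u} {wt : C → ℕ} {d : C → (C →₀ Q)}
  {M : Type u} [AddCommGroup M] [Module Q M] {aug : C → M}

lemma IsModLetters.isBasedRes (h : IsModLetters wt d aug) :
    IsBasedRes (S := Q) (fun n ↦ {c | wt c = n + 1}) (gradedBd (fun n ↦ {c | wt c = n + 1}) d)
      (fun x ↦ aug x) :=
  isBasedRes_of_graded
    (fun n x hx y hy ↦ by
      have := h.lowers x y hy
      change wt x = n + 2 at hx
      change wt y = n + 1
      omega)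
    (fun n x _ ↦ h.sq x) (fun x _ ↦ h.aug_d x) h.surj h.exact_one
    (fun n v hv hv' ↦ h.exact (n + 2) (by omega) v hv hv')

end ModLetters

/-! ### Multilinear maps and bases. -/

section Multilinear

variable {Q : Type*} [CommRing Q] {V W : Type*} [AddCommGroup V] [Module Q V] [AddCommGroup W]
  [Module Q W] {B : Type*}

lemma splitSum_eq_sum_range {L Y : Type*} [AddCommMonoid Y] (F : List L → List L → Y)
    (w : List L) :
    splitSum F w = ∑ j ∈ Finset.range (w.length + 1), F (w.take j) (w.drop j) := by
  induction w generalizing F with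
  | nil => simp [splitSum_nil]
  | cons x w ih =>
    rw [splitSum_cons, ih, List.length_cons, Finset.sum_range_succ' _ (w.length + 1), add_comm]
    rfl

/-- The multilinear map with given values on basis vectors. -/
lemma exists_multilinear (E : Module.Basis B Q V) (n : ℕ) (f : (Fin n → B) → W) :
    ∃ m : MultilinearMap Q (fun _ : Fin n ↦ V) W, ∀ v, m (fun t ↦ E (v t)) = f v := by
  classical
  refine ⟨((MultilinearMap.fromDFinsuppEquiv (fun _ : Fin n ↦ B) Q) (fun p ↦
    MultilinearMap.mkPiRing Q (Fin n) (f p))).compLinearMap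
      (fun _ ↦ (finsuppLequivDFinsupp Q).toLinearMap ∘ₗ E.repr.toLinearMap), fun v ↦ ?_⟩
  have h (t : Fin n) : ((finsuppLequivDFinsupp Q).toLinearMap ∘ₗ E.repr.toLinearMap) (E (v t)) =
      DFinsupp.single (v t) 1 := by
    simp
  rw [MultilinearMap.compLinearMap_apply, funext h, MultilinearMap.fromDFinsuppEquiv_single]
  simp

lemma basis_mem_smul_top_iff (E : Module.Basis B Q V) (J : Ideal Q) (x : V) :
    x ∈ J • (⊤ : Submodule Q V) ↔ E.repr x ∈ CoeffIn B J := by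
  constructor
  · intro h
    refine Submodule.smul_induction_on h (fun r hr y _ b ↦ ?_) fun y z hy hz ↦ ?_
    · rw [map_smul]
      exact J.mul_mem_right _ hr
    · rw [map_add]
      exact Submodule.add_mem _ hy hz
  · intro h
    rw [← E.linearCombination_repr x, Finsupp.linearCombination_apply]
    exact Submodule.sum_mem _ fun b _ ↦ Submodule.smul_mem_smul (h b) trivial

/-- A property of sequences that is linear in each of the first `n` variables may be checked on
basis vectors. -/
lemma eq_zero_of_basis (E : Module.Basis B Q V) (n : ℕ) (f : (ℕ → V) → W)
    (hlin : ∀ p < n, ∀ x : ℕ → V, ∃ l : V →ₗ[Q] W, ∀ y, f (Function.update x p y) = l y)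
    (hbasis : ∀ x : ℕ → V, (∀ t < n, ∃ b, x t = E b) → f x = 0) (x : ℕ → V) : f x = 0 := by
  suffices ∀ k ≤ n, ∀ x : ℕ → V, (∀ t, k ≤ t → t < n → ∃ b, x t = E b) → f x = 0 from
    this n le_rfl x fun t h h' ↦ absurd h (by omega)
  intro k
  induction k with
  | zero => exact fun _ x hx ↦ hbasis x fun t ht ↦ hx t (Nat.zero_le _) ht
  | succ k ih =>
    intro hk x hx
    obtain ⟨l, hl⟩ := hlin k hk x
    have : l = 0 := E.ext fun b ↦ by
      rw [← hl]
      refine ih (by omega) _ fun t ht ht' ↦ ?_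
      by_cases htk : t = k
      · subst htk
        exact ⟨b, by simp⟩
      · rw [Function.update_of_ne htk]
        exact hx t (by omega) ht'
    rw [← Function.update_eq_self k x, hl, this]
    rfl

end Multilinear

/-! ### Dictionary between multilinear A-infinity structures and functions on words. -/

section Stasheff

variable {Q : Type u} [CommRing Q] {A : ChainComplex (ModuleCat.{u} Q) ℕ}

/-- The value of a sequence of multilinear maps on a word. -/
def evalWord (m : (n : ℕ) → MultilinearMap Q (fun _ : Fin n ↦ Aplus A) (Aplus A))
    (l : List (Aplus A)) : Aplus A :=
  m l.length fun t ↦ l[t]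

variable {m : (n : ℕ) → MultilinearMap Q (fun _ : Fin n ↦ Aplus A) (Aplus A)}

lemma evalWord_eq {l : List (Aplus A)} {k : ℕ} (h : l.length = k) {f : Fin k → Aplus A}
    (hf : ∀ (t : ℕ) (ht : t < l.length), l[t] = f ⟨t, h ▸ ht⟩) : evalWord m l = m k f := by
  subst h
  exact congrArg (m l.length) (funext fun t ↦ hf t t.2)

lemma evalWord_append_zero_cons (a c : List (Aplus A)) : evalWord m (a ++ 0 :: c) = 0 :=
  (m _).map_coord_zero ⟨a.length, by simp⟩ (by simp)

/-- A prefix of length j and a block of length i amount to a factorization into three words.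
Factorizations with an empty middle block contribute nothing because `m 0 = 0`. -/
lemma stasheffSum_eq_splitSum (hm : m 0 = 0) (l : List (Aplus A)) :
    stasheffSum m l.length (fun t ↦ l.getD t 0) =
      splitSum (fun a q ↦ splitSum (fun b c ↦
        evalWord m (a.map (signMap A) ++ evalWord m b :: c)) q) l := by
  set H : ℕ → ℕ → Aplus A := fun i j ↦ evalWord m ((l.take j).map (signMap A) ++
    evalWord m ((l.drop j).take i) :: ((l.drop j).drop i)) with hH
  have h0 (j : ℕ) : H 0 j = 0 := by
    have : evalWord m ([] : List (Aplus A)) = 0 := by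
      change m 0 _ = 0
      rw [hm]; rfl
    rw [hH]
    simp only [List.take_zero, this]
    exact evalWord_append_zero_cons _ _
  have hR : splitSum (fun a q ↦ splitSum (fun b c ↦
        evalWord m (a.map (signMap A) ++ evalWord m b :: c)) q) l =
      ∑ j ∈ Finset.range (l.length + 1), ∑ i ∈ Finset.range (l.length - j + 1), H i j := by
    rw [splitSum_eq_sum_range]
    refine Finset.sum_congr rfl fun j _ ↦ ?_
    rw [splitSum_eq_sum_range, List.length_drop]
  have hswap : ∑ j ∈ Finset.range (l.length + 1), ∑ i ∈ Finset.range (l.length - j + 1), H i j =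
      ∑ i ∈ Finset.range (l.length + 1), ∑ j ∈ Finset.range (l.length - i + 1), H i j :=
    Finset.sum_comm' fun i j ↦ by
      simp only [Finset.mem_range]
      omega
  have hsub : ∑ i ∈ Finset.range (l.length + 1), ∑ j ∈ Finset.range (l.length - i + 1), H i j =
      ∑ i ∈ Finset.Icc 1 l.length, ∑ j ∈ Finset.range (l.length - i + 1), H i j := by
    symm
    refine Finset.sum_subset (fun i hi ↦ ?_) fun i hi hi' ↦ ?_
    · simp only [Finset.mem_Icc, Finset.mem_range] at hi ⊢
      omega
    · have : i = 0 := by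
        simp only [Finset.mem_Icc, Finset.mem_range] at hi hi'
        omega
      subst this
      exact Finset.sum_eq_zero fun j _ ↦ h0 j
  rw [hR, hswap, hsub, stasheffSum]
  refine Finset.sum_congr rfl fun i hi ↦ Finset.sum_congr rfl fun j hj ↦ ?_
  simp only [Finset.mem_Icc, Finset.mem_range] at hi hj
  symm
  refine evalWord_eq ?_ fun t ht ↦ ?_
  · simp only [List.length_append, List.length_map, List.length_take, List.length_cons,
      List.length_drop]
    omega
  · simp only [List.length_append, List.length_map, List.length_take, List.length_cons,
      List.length_drop] at ht
    rcases lt_trichotomy t j with h | rfl | h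
    · rw [List.getElem_append_left (by simp; omega), if_pos h]
      simp [List.getD_eq_getElem?_getD, List.getElem?_eq_getElem (show t < l.length by omega)]
    · rw [List.getElem_append_right (by simp), if_neg (lt_irrefl _), if_pos rfl]
      have : t - ((l.take t).map (signMap A)).length = 0 := by simp; omega
      simp only [this, List.getElem_cons_zero]
      refine evalWord_eq (by simp; omega) fun s hs ↦ ?_
      simp only [List.length_take, List.length_drop] at hs
      simp [List.getD_eq_getElem?_getD, List.getElem?_eq_getElem (show t + s < l.length by omega)]
    · rw [List.getElem_append_right (by simp; omega), if_neg (by simp; omega), if_neg (by simp; omega)]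
      obtain ⟨s, hs⟩ : ∃ s, t - ((l.take j).map (signMap A)).length = s + 1 :=
        ⟨t - j - 1, by simp; omega⟩
      have hs' : t = j + s + 1 := by
        simp at hs; omega
      simp only [hs, List.getElem_cons_succ, List.getElem_drop]
      have h2 : t + i - 1 = j + (i + s) := by omega
      simp only [h2]
      simp [List.getD_eq_getElem?_getD,
        List.getElem?_eq_getElem (show j + (i + s) < l.length by omega)]

lemma exists_linear_of_update {k : ℕ} (f : MultilinearMap Q (fun _ : Fin k ↦ Aplus A) (Aplus A))
    (G : Aplus A → Fin k → Aplus A) (s : Fin k) (g : Aplus A →ₗ[Q] Aplus A)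
    (hs : ∀ y, G y s = g y) (h : ∀ y t, t ≠ s → G y t = G 0 t) :
    ∃ l : Aplus A →ₗ[Q] Aplus A, ∀ y, f (G y) = l y := by
  refine ⟨f.toLinearMap (G 0) s ∘ₗ g, fun y ↦ ?_⟩
  rw [LinearMap.comp_apply, MultilinearMap.toLinearMap_apply]
  congr 1
  funext t
  by_cases ht : t = s
  · subst ht
    rw [Function.update_self, hs]
  · rw [Function.update_of_ne ht, h y t ht]

lemma exists_linear_sum {ι : Type*} (s : Finset ι) (f : ι → Aplus A → Aplus A)
    (h : ∀ i ∈ s, ∃ l : Aplus A →ₗ[Q] Aplus A, ∀ y, f i y = l y) :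
    ∃ l : Aplus A →ₗ[Q] Aplus A, ∀ y, ∑ i ∈ s, f i y = l y := by
  classical
  choose! l hl using h
  exact ⟨∑ i ∈ s, l i, fun y ↦ by
    rw [LinearMap.sum_apply]; exact Finset.sum_congr rfl fun i hi ↦ hl i hi y⟩

/-- The Stasheff sum is linear in each variable. -/
lemma exists_linear_stasheffSum {n p : ℕ} (hp : p < n) (x : ℕ → Aplus A) :
    ∃ l : Aplus A →ₗ[Q] Aplus A, ∀ y, stasheffSum m n (Function.update x p y) = l y := by
  refine exists_linear_sum _ _ fun i hi ↦ exists_linear_sum _ _ fun j hj ↦ ?_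
  simp only [Finset.mem_Icc, Finset.mem_range] at hi hj
  rcases lt_or_ge p j with h | h
  · refine exists_linear_of_update (m (n - i + 1)) (fun y t ↦ _) ⟨p, by omega⟩ (signMap A)
      (fun y ↦ ?_) fun y t ht ↦ ?_
    · simp [h]
    · have ht' : (t : ℕ) ≠ p := fun h' ↦ ht (Fin.ext h')
      have h1 (s : Fin i) : j + s ≠ p := by omega
      simp only [Function.update_of_ne ht', Function.update_of_ne (h1 _)]
      split_ifs
      · rfl
      · rfl
      · rw [Function.update_of_ne (by omega), Function.update_of_ne (by omega)]
  · rcases lt_or_ge p (j + i) with h' | h'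
    · refine exists_linear_of_update (m (n - i + 1)) (fun y t ↦ _) ⟨j, by omega⟩
        ((m i).toLinearMap (fun s ↦ x (j + s)) ⟨p - j, by omega⟩) (fun y ↦ ?_) fun y t ht ↦ ?_
      · simp only [lt_irrefl, if_false, if_true, MultilinearMap.toLinearMap_apply]
        congr 1
        funext s
        by_cases hs : s = ⟨p - j, by omega⟩
        · subst hs
          have : j + (p - j) = p := by omega
          simp [this]
        · rw [Function.update_of_ne hs, Function.update_of_ne]
          intro hs'
          exact hs (Fin.ext (by simp; omega))
      · have ht' : (t : ℕ) ≠ j := fun h' ↦ ht (Fin.ext h')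
        simp only [if_neg ht']
        split_ifs
        · rw [Function.update_of_ne (by omega), Function.update_of_ne (by omega)]
        · rw [Function.update_of_ne (by omega), Function.update_of_ne (by omega)]
    · refine exists_linear_of_update (m (n - i + 1)) (fun y t ↦ _) ⟨p - i + 1, by omega⟩
        LinearMap.id (fun y ↦ ?_) fun y t ht ↦ ?_
      · have h1 : p - i + 1 + i - 1 = p := by omega
        simp only [h1, if_neg (show ¬ p - i + 1 < j by omega),
          if_neg (show ¬ p - i + 1 = j by omega), Function.update_self]
        rfl
      · have ht' : (t : ℕ) ≠ p - i + 1 := fun h' ↦ ht (Fin.ext h')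
        have h1 (s : Fin i) : j + s ≠ p := by omega
        simp only [Function.update_of_ne (h1 _)]
        split_ifs
        · rw [Function.update_of_ne (by omega), Function.update_of_ne (by omega)]
        · rfl
        · rw [Function.update_of_ne (by omega), Function.update_of_ne (by omega)]

variable (m) in
/-- The value on a word as a linear function of one letter. -/
def evalLin (u w : List (Aplus A)) : Aplus A →ₗ[Q] Aplus A :=
  (m (u.length + w.length + 1)).toLinearMap (fun t ↦ (u ++ 0 :: w).getD t 0) ⟨u.length, by omega⟩

lemma evalWord_append_cons (u w : List (Aplus A)) (y : Aplus A) :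
    evalWord m (u ++ y :: w) = evalLin m u w y := by
  rw [evalLin, MultilinearMap.toLinearMap_apply]
  refine evalWord_eq (by simp; omega) fun t ht ↦ ?_
  simp only [List.length_append, List.length_cons] at ht
  by_cases h : t = u.length
  · subst h
    rw [Function.update_self, List.getElem_append_right le_rfl]
    simp
  · rw [Function.update_of_ne (fun h' ↦ h (congrArg Fin.val h'))]
    simp only [List.getD_eq_getElem?_getD]
    rcases lt_or_gt_of_ne h with h | h
    · rw [List.getElem_append_left h, List.getElem?_append_left h]
      simp [h]
    · rw [List.getElem_append_right h.le, List.getElem?_append_right h.le]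
      obtain ⟨s, hs⟩ : ∃ s, t - u.length = s + 1 := ⟨t - u.length - 1, by omega⟩
      have : s < w.length := by omega
      simp [hs, this]

variable {ι : ℕ → Type u} (b : ∀ n, Module.Basis (ι n) Q (A.X n))

/-- The matrices of the differential. -/
noncomputable def coordBd (n : ℕ) (j : ι (n + 1)) : ι n →₀ Q := (b n).repr ((A.d (n + 1) n).hom (b (n + 1) j))

/-- The basis of `A_+[1]`. -/
noncomputable def plusBasis : Module.Basis (Σ n, ι (n + 1)) Q (Aplus A) := DFinsupp.basis fun n ↦ b (n + 1)

lemma plusBasis_repr_lof (i : ℕ) (a : A.X (i + 1)) :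
    (plusBasis b).repr (DirectSum.lof Q ℕ (fun i ↦ A.X (i + 1)) i a) =
      push (Sigma.mk (β := fun n ↦ ι (n + 1)) i) ((b (i + 1)).repr a) := by
  have h : (plusBasis b).repr.toLinearMap ∘ₗ DirectSum.lof Q ℕ (fun i ↦ A.X (i + 1)) i =
      push (Sigma.mk (β := fun n ↦ ι (n + 1)) i) ∘ₗ (b (i + 1)).repr.toLinearMap := by
    refine (b (i + 1)).ext fun j ↦ ?_
    rw [LinearMap.comp_apply, LinearMap.comp_apply, LinearEquiv.coe_coe, LinearEquiv.coe_coe,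
      Module.Basis.repr_self, push_single]
    refine ((sigmaFinsuppLequivDFinsupp Q).symm_apply_eq).2 ?_
    refine Eq.trans ?_ (sigmaFinsuppEquivDFinsupp_single _ _).symm
    refine (DFinsupp.mapRange_single (hf := fun i ↦ map_zero _)).trans ?_
    exact congrArg _ (Module.Basis.repr_self _ _)
  exact LinearMap.congr_fun h a

lemma plusBasis_apply (x : Σ n, ι (n + 1)) :
    plusBasis b x = DirectSum.lof Q ℕ (fun i ↦ A.X (i + 1)) x.1 (b (x.1 + 1) x.2) := by
  apply (plusBasis b).repr.injective
  rw [plusBasis_repr_lof, Module.Basis.repr_self, Module.Basis.repr_self, push_single]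

lemma repr_dPlus (x : Σ n, ι (n + 1)) :
    (plusBasis b).repr (dPlus A (plusBasis b x)) = shiftD (coordBd b) x := by
  rw [plusBasis_apply, dPlus, DirectSum.toModule_lof]
  obtain ⟨_ | n, x⟩ := x
  · simp [shiftD, sigmaD]
  · simp only [LinearMap.neg_apply, LinearMap.comp_apply, map_neg, plusBasis_repr_lof]
    rfl

lemma dOne_plusBasis {e : A.X 0 ≃ₗ[Q] Q} (pt : ι 0) (he : ∀ a, e a = (b 0).repr a pt)
    (x : Σ n, ι (n + 1)) : dOne A e (plusBasis b x) = shiftDelta (coordBd b) pt x := by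
  rw [plusBasis_apply, dOne, DirectSum.toModule_lof]
  obtain ⟨_ | n, x⟩ := x
  · exact he _
  · rfl

lemma signMap_plusBasis (x : Σ n, ι (n + 1)) :
    signMap A (plusBasis b x) = (-1 : Q) ^ (x.1 + 2) • plusBasis b x := by
  rw [plusBasis_apply, signMap, DirectSum.toModule_lof]
  rfl

variable (m) in
/-- The coordinates of a sequence of multilinear maps on words of basis vectors. -/
noncomputable def wordVal (w : List (Σ n, ι (n + 1))) : (Σ n, ι (n + 1)) →₀ Q :=
  (plusBasis b).repr (evalWord m (w.map (plusBasis b)))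

/-- By multilinearity the signs attached to the letters of the prefix can be pulled out one at a
time; together they form the Koszul sign of the prefix. -/
lemma evalLin_sign (u a w : List (Σ n, ι (n + 1))) :
    evalLin m (u.map (plusBasis b) ++ (a.map (plusBasis b)).map (signMap A))
      (w.map (plusBasis b)) =
      sgn Q (fun x : Σ n, ι (n + 1) ↦ x.1 + 2) a •
        evalLin m ((u ++ a).map (plusBasis b)) (w.map (plusBasis b)) := by
  induction a generalizing u with
  | nil => simp
  | cons x a ih =>
    refine LinearMap.ext fun y ↦ ?_
    have h1 := LinearMap.congr_fun (ih (u ++ [x])) y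
    rw [sgn_cons, mul_smul, LinearMap.smul_apply, LinearMap.smul_apply]
    rw [LinearMap.smul_apply, List.append_assoc] at h1
    change _ = _ • (_ • evalLin m ((u ++ ([x] ++ a)).map (plusBasis b)) _ y)
    rw [← h1, ← evalWord_append_cons, ← evalWord_append_cons]
    simp only [List.map_cons, List.map_append, List.map_nil, signMap_plusBasis, List.append_assoc,
      List.cons_append, List.nil_append]
    rw [evalWord_append_cons, map_smul, evalWord_append_cons]

/-- The bridge between the two languages: on basis vectors the Stasheff sum is the composite of `m`
with its coderivation. The Stasheff relations thereby become `Rel` on words. -/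
lemma repr_stasheffSum (hm : m 0 = 0) (w : List (Σ n, ι (n + 1))) :
    (plusBasis b).repr (stasheffSum m w.length fun t ↦ (w.map (plusBasis b)).getD t 0) =
      ext (wordVal m b) (coder (fun x : Σ n, ι (n + 1) ↦ x.1 + 2) (wordVal m b) w) := by
  have h := stasheffSum_eq_splitSum hm (w.map (plusBasis b))
  rw [List.length_map] at h
  rw [h, splitSum_map, coder, map_splitSum, map_splitSum]
  refine splitSum_congr fun a q _ ↦ ?_
  rw [splitSum_map, map_splitSum, map_splitSum]
  refine splitSum_congr fun u c _ ↦ ?_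
  have h2 := evalLin_sign (m := m) b [] a c
  rw [List.map_nil, List.nil_append, List.nil_append] at h2
  rw [map_smul, ext_ins, evalWord_append_cons, h2, LinearMap.smul_apply, map_smul]
  congr 1
  have h3 := (plusBasis b).linearCombination_repr (evalWord m (u.map (plusBasis b)))
  rw [← h3, map_ext, ← LinearEquiv.coe_coe, map_ext]
  refine ext_congr fun x _ ↦ ?_
  rw [LinearEquiv.coe_coe, ← evalWord_append_cons, wordVal, List.map_append, List.map_cons]

lemma plusBasis_repr_apply (y : Aplus A) (p : ℕ) (j : ι (p + 1)) :
    (plusBasis b).repr y ⟨p, j⟩ = (b (p + 1)).repr (y p) j := by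
  have h : Finsupp.lapply ⟨p, j⟩ ∘ₗ (plusBasis b).repr.toLinearMap =
      (b (p + 1)).coord j ∘ₗ DirectSum.component Q ℕ (fun i ↦ A.X (i + 1)) p := by
    refine DirectSum.linearMap_ext _ fun i ↦ LinearMap.ext fun a ↦ ?_
    change (plusBasis b).repr (DirectSum.lof Q ℕ (fun i ↦ A.X (i + 1)) i a) ⟨p, j⟩ =
      (b (p + 1)).repr (DirectSum.lof Q ℕ (fun i ↦ A.X (i + 1)) i a p) j
    rw [plusBasis_repr_lof]
    by_cases hi : i = p
    · subst hi
      rw [DirectSum.lof_apply]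
      exact push_apply sigma_mk_injective _ _
    · have h0 : DirectSum.lof Q ℕ (fun i ↦ A.X (i + 1)) i a p = 0 :=
        DirectSum.of_eq_of_ne _ _ _ (Ne.symm hi)
      rw [h0, map_zero, Finsupp.zero_apply]
      by_contra hne
      exact hi (fst_of_mem_support_push_shift (Finsupp.mem_support_iff.2 hne)).symm
  exact LinearMap.congr_fun h y

lemma repr_apply_eq_zero {y : Aplus A} {x : Σ n, ι (n + 1)} (h : y x.1 = 0) :
    (plusBasis b).repr y x = 0 := by
  obtain ⟨p, j⟩ := x
  rw [plusBasis_repr_apply, h, map_zero, Finsupp.zero_apply]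

lemma apply_eq_zero_of_repr {y : Aplus A} {p : ℕ}
    (h : ∀ x : Σ n, ι (n + 1), x.1 = p → (plusBasis b).repr y x = 0) : y p = 0 := by
  refine (LinearEquiv.map_eq_zero_iff (b (p + 1)).repr).1 (Finsupp.ext fun j ↦ ?_)
  rw [← plusBasis_repr_apply]
  exact h _ rfl

lemma sum_deg_eq_wordWt (w : List (Σ n, ι (n + 1))) :
    ∑ j : Fin w.length, (w[j].1 + 2) = wordWt (fun x : Σ n, ι (n + 1) ↦ x.1 + 2) w := by
  rw [wordWt, ← List.sum_ofFn]
  congr 1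
  exact List.ofFn_getElem_eq_map w fun x ↦ x.1 + 2

lemma length_mul_two_le_wordWt (w : List (Σ n, ι (n + 1))) :
    w.length * 2 ≤ wordWt (fun x : Σ n, ι (n + 1) ↦ x.1 + 2) w := by
  induction w with
  | nil => simp
  | cons x w ih => rw [List.length_cons, wordWt_cons]; omega

lemma stasheffSum_congr {n : ℕ} {x y : ℕ → Aplus A} (h : ∀ t < n, x t = y t) :
    stasheffSum m n x = stasheffSum m n y := by
  refine Finset.sum_congr rfl fun i hi ↦ Finset.sum_congr rfl fun j hj ↦ congrArg _ ?_
  simp only [Finset.mem_Icc, Finset.mem_range] at hi hj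
  have h1 : (fun s : Fin i ↦ x (j + s)) = fun s : Fin i ↦ y (j + s) :=
    funext fun s ↦ h _ (by omega)
  funext t
  rw [h1]
  split_ifs
  · rw [h t (by omega)]
  · rfl
  · rw [h _ (by omega)]

variable {e : A.X 0 ≃ₗ[Q] Q}

lemma wordVal_singleton (s : AInfinityStructure A e) (x : Σ n, ι (n + 1)) :
    wordVal s.m b [x] = shiftD (coordBd b) x := by
  rw [← repr_dPlus, wordVal]
  exact congrArg _ (s.rel_one _)

lemma wordVal_nil (hm : m 0 = 0) : wordVal m b [] = 0 := by
  have : evalWord m ([] : List (Aplus A)) = 0 := by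
    change m 0 _ = 0
    rw [hm]; rfl
  rw [wordVal, List.map_nil, this, map_zero]

lemma wordVal_adm (s : AInfinityStructure A e) (w : List (Σ n, ι (n + 1))) :
    Adm (fun _ ↦ False) (fun x : Σ n, ι (n + 1) ↦ x.1 + 2) w (wordVal s.m b w) := by
  intro x hx
  refine ⟨?_, iff_of_false id (by simp [HasClosed])⟩
  by_contra hne
  refine Finsupp.mem_support_iff.1 hx (repr_apply_eq_zero b ?_)
  have h := s.degree w.length (fun j ↦ w[j].1) (fun j ↦ b (w[j].1 + 1) w[j].2) x.1
    (by rwa [sum_deg_eq_wordWt])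
  rw [← h]
  congr 1
  refine evalWord_eq (by simp) fun t ht ↦ ?_
  rw [List.getElem_map, plusBasis_apply]
  rfl

lemma rel_iff_stasheffSum (hm : m 0 = 0) (pt : ι 0)
    (w : List (Σ n, ι (n + 1))) (hw : w.length ≠ 2) :
    Rel (shiftDelta (coordBd b) pt) (fun x : Σ n, ι (n + 1) ↦ x.1 + 2) (wordVal m b) w ↔
      stasheffSum m w.length (fun t ↦ (w.map (plusBasis b)).getD t 0) = 0 := by
  rw [Rel, curv_of_length_ne _ hw, ← repr_stasheffSum b hm, LinearEquiv.map_eq_zero_iff]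

lemma rel_pair_iff_stasheffSum (hm : m 0 = 0) (pt : ι 0) (he : ∀ a, e a = (b 0).repr a pt)
    (x y : Σ n, ι (n + 1)) :
    Rel (shiftDelta (coordBd b) pt) (fun x : Σ n, ι (n + 1) ↦ x.1 + 2) (wordVal m b) [x, y] ↔
      stasheffSum m 2 (fun t ↦ ([x, y].map (plusBasis b)).getD t 0) =
        dOne A e (plusBasis b x) • plusBasis b y - dOne A e (plusBasis b y) • plusBasis b x := by
  have h : curv (shiftDelta (coordBd b) pt) [x, y] = (plusBasis b).repr
      (dOne A e (plusBasis b x) • plusBasis b y - dOne A e (plusBasis b y) • plusBasis b x) := by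
    rw [curv_pair, map_sub, map_smul, map_smul, Module.Basis.repr_self, Module.Basis.repr_self,
      dOne_plusBasis b pt he, dOne_plusBasis b pt he]
    simp
  rw [Rel, h, ← repr_stasheffSum b hm]
  exact (plusBasis b).repr.injective.eq_iff

lemma AInfinityStructure.isAInf (s : AInfinityStructure A e) (pt : ι 0)
    (he : ∀ a, e a = (b 0).repr a pt) {I : Ideal Q}
    (hB : IsAlgLetters I (fun x : Σ n, ι (n + 1) ↦ x.1 + 2) (shiftD (coordBd b))
      (shiftDelta (coordBd b) pt)) :
    IsAInf (fun x : Σ n, ι (n + 1) ↦ x.1 + 2) (shiftD (coordBd b)) (shiftDelta (coordBd b) pt)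
      (wordVal s.m b) where
  single := wordVal_singleton b s
  adm := wordVal_adm b s
  ext_delta w := by
    rcases lt_or_ge w.length 2 with h | h
    · rcases eq_nil_or_singleton_of_length_le (Nat.le_of_lt_succ h) with rfl | ⟨x, rfl⟩
      · rw [wordVal_nil b s.m_zero, map_zero]
      · rw [wordVal_singleton, hB.delta_d]
    -- A word of length at least 2 has weight at least 4, so its value has weight at least 3,
    -- whereas δ lives in weight 2.
    · refine ext_eq_zero fun x hx ↦ ?_
      by_contra hne
      have h1 := (wordVal_adm b s w x hx).1
      have h2 := hB.delta x hne
      have h3 := length_mul_two_le_wordWt w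
      dsimp only at h1 h2
      omega
  rel w := by
    rcases Nat.lt_or_ge 2 w.length with h | h
    · exact (rel_iff_stasheffSum b s.m_zero pt w h.ne').2 (s.rel _ h _)
    · match w, h with
      | [], _ => exact rel_nil (wordVal_nil b s.m_zero)
      | [x], _ =>
        refine rel_singleton (wordVal_nil b s.m_zero) x ?_
        simp only [wordVal_singleton]
        exact hB.sq x
      | [x, y], _ => exact (rel_pair_iff_stasheffSum b s.m_zero pt he x y).2 (s.rel_two _)

lemma exists_word {n : ℕ} {x : ℕ → Aplus A} (hx : ∀ t < n, ∃ z, x t = plusBasis b z) :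
    ∃ w : List (Σ n, ι (n + 1)), w.length = n ∧
      ∀ t < n, x t = (w.map (plusBasis b)).getD t 0 := by
  choose z hz using hx
  refine ⟨List.ofFn fun t : Fin n ↦ z t t.2, by simp, fun t ht ↦ ?_⟩
  rw [hz t ht]
  simp [List.getD_eq_getElem?_getD, ht]

/-- The structure with given coordinates. -/
lemma IsAInf.exists_aInfinityStructure (pt : ι 0) (he : ∀ a, e a = (b 0).repr a pt)
    {mB : List (Σ n, ι (n + 1)) → ((Σ n, ι (n + 1)) →₀ Q)}
    (h : IsAInf (fun x : Σ n, ι (n + 1) ↦ x.1 + 2) (shiftD (coordBd b))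
      (shiftDelta (coordBd b) pt) mB) :
    ∃ s : AInfinityStructure A e, wordVal s.m b = mB := by
  choose m hm using fun n ↦ exists_multilinear (plusBasis b) n
    fun v ↦ (plusBasis b).repr.symm (mB (List.ofFn v))
  have hval : wordVal m b = mB := by
    funext w
    have : evalWord m (w.map (plusBasis b)) = m w.length fun t ↦ plusBasis b (w[t]) :=
      evalWord_eq (by simp) fun t ht ↦ by simp
    rw [wordVal, this, hm, LinearEquiv.apply_symm_apply]
    congr 1
    exact List.ofFn_getElem
  have m_zero : m 0 = 0 := by
    refine Module.Basis.ext_multilinear (fun _ ↦ plusBasis b) fun v ↦ ?_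
    rw [hm, List.ofFn_zero, (h.adm []).nil, map_zero]
    rfl
  refine ⟨⟨m, m_zero, ?_, ?_, ?_, ?_⟩, hval⟩
  · intro n d a p hp
    -- The degree condition concerns arbitrary elements of homogeneous summands; being multilinear
    -- in them, it is verified on basis elements, where it is the weight condition on words.
    have key : (DirectSum.component Q ℕ (fun i ↦ A.X (i + 1)) p).compMultilinearMap
        ((m n).compLinearMap fun j ↦ DirectSum.lof Q ℕ (fun i ↦ A.X (i + 1)) (d j)) = 0 := by
      refine Module.Basis.ext_multilinear (fun j ↦ b (d j + 1)) fun v ↦ ?_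
      have h1 := hm n fun j ↦ ⟨d j, v j⟩
      simp only [plusBasis_apply] at h1
      refine (congrArg (fun z : Aplus A ↦ z p) h1).trans ?_
      refine apply_eq_zero_of_repr b fun x hx ↦ ?_
      rw [LinearEquiv.apply_symm_apply]
      by_contra hne
      have h2 := (h.adm _ x (Finsupp.mem_support_iff.2 hne)).1
      apply hp
      rw [hx] at h2
      rw [h2, wordWt, List.map_ofFn, List.sum_ofFn]
      rfl
    exact congrArg (fun f ↦ f a) key
  · intro x
    have key : m 1 = (dPlus A).compMultilinearMap
        (MultilinearMap.ofSubsingleton Q (Aplus A) (Aplus A) (0 : Fin 1) LinearMap.id) := by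
      refine Module.Basis.ext_multilinear (fun _ ↦ plusBasis b) fun v ↦ ?_
      rw [hm]
      apply (plusBasis b).repr.injective
      rw [LinearEquiv.apply_symm_apply]
      refine (h.single (v 0)).trans ?_
      exact (repr_dPlus b _).symm
    rw [key]
    rfl
  · intro x
    rw [← sub_eq_zero]
    refine eq_zero_of_basis (plusBasis b) 2 (fun x ↦ stasheffSum m 2 x -
      (dOne A e (x 0) • x 1 - dOne A e (x 1) • x 0)) ?_ ?_ x
    · intro p hp x
      obtain ⟨l, hl⟩ := exists_linear_stasheffSum (m := m) hp x
      obtain ⟨l', hl'⟩ : ∃ l' : Aplus A →ₗ[Q] Aplus A, ∀ y,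
          dOne A e (Function.update x p y 0) • Function.update x p y 1 -
            dOne A e (Function.update x p y 1) • Function.update x p y 0 = l' y := by
        rcases (show p = 0 ∨ p = 1 by omega) with rfl | rfl
        · exact ⟨(dOne A e).smulRight (x 1) - dOne A e (x 1) • LinearMap.id, fun y ↦ by simp⟩
        · exact ⟨dOne A e (x 0) • LinearMap.id - (dOne A e).smulRight (x 0), fun y ↦ by simp⟩
      exact ⟨l - l', fun y ↦ by rw [LinearMap.sub_apply, ← hl, ← hl']⟩
    · intro x hx
      obtain ⟨u, hu⟩ := hx 0 two_pos
      obtain ⟨v, hv⟩ := hx 1 one_lt_two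
      have h1 := (rel_pair_iff_stasheffSum b m_zero pt he u v).1 (hval ▸ h.rel [u, v])
      rw [sub_eq_zero, hu, hv, ← h1]
      refine stasheffSum_congr fun t ht ↦ ?_
      interval_cases t
      · exact hu
      · exact hv
  · intro n hn x
    refine eq_zero_of_basis (plusBasis b) n (stasheffSum m n)
      (fun p hp x ↦ exists_linear_stasheffSum hp x) (fun x hx ↦ ?_) x
    obtain ⟨w, rfl, hw⟩ := exists_word b hx
    rw [stasheffSum_congr hw]
    exact (rel_iff_stasheffSum b m_zero pt w (by omega)).1 (hval ▸ h.rel w)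

lemma AInfinityStructure.isMinimal_iff [IsLocalRing Q] (s : AInfinityStructure A e) :
    s.IsMinimal ↔ ∀ w : List (Σ n, ι (n + 1)), 2 ≤ w.length →
      wordVal s.m b w ∈ CoeffIn _ (IsLocalRing.maximalIdeal Q) := by
  constructor
  · intro h w hw
    rw [wordVal, ← basis_mem_smul_top_iff]
    exact h _ (by simpa using hw) _
  · intro h n hn x
    rw [← Submodule.ker_mkQ (IsLocalRing.maximalIdeal Q • (⊤ : Submodule Q (Aplus A))),
      LinearMap.mem_ker]
    have key : (Submodule.mkQ (IsLocalRing.maximalIdeal Q •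
        (⊤ : Submodule Q (Aplus A)))).compMultilinearMap (s.m n) = 0 := by
      refine Module.Basis.ext_multilinear (fun _ ↦ plusBasis b) fun v ↦ ?_
      refine (Submodule.Quotient.mk_eq_zero _).2 ?_
      rw [basis_mem_smul_top_iff (plusBasis b)]
      have h1 := h (List.ofFn v) (by simpa using hn)
      have h2 : evalWord s.m ((List.ofFn v).map (plusBasis b)) =
          s.m n fun t ↦ plusBasis b (v t) :=
        evalWord_eq (by simp) fun t ht ↦ by simp
      rwa [wordVal, h2] at h1
    exact congrArg (fun f ↦ f x) key

end Stasheff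

/-! ### Counting the words of the bar construction. -/

section Words

variable {L : Type u} {cl : L → Prop} {wt : L → ℕ}

variable (cl wt) in
/-- The basis of the bar construction in degree `n`. -/
def Words (n : ℕ) : Set (List L) := {w | Good cl w ∧ HasClosed cl w ∧ wordWt wt w = n + 1}

lemma singleton_mem_Words {n : ℕ} {x : L} : [x] ∈ Words cl wt n ↔ cl x ∧ wt x = n + 1 := by
  simp [Words, good_of_length_le]

lemma Good.of_cons {x : L} {w : List L} (h : Good cl (x :: w)) (hw : w ≠ []) : ¬ cl x :=
  fun hx ↦ hw (h [] x w rfl hx)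

lemma cons_mem_Words {n : ℕ} {x : L} {w : List L} (hw : w ≠ []) : x :: w ∈ Words cl wt n ↔
    ¬ cl x ∧ Good cl w ∧ HasClosed cl w ∧ wt x + wordWt wt w = n + 1 := by
  constructor
  · rintro ⟨h1, h2, h3⟩
    have hx := h1.of_cons hw
    refine ⟨hx, Good.sub (a := [x]) (c := []) (by simpa using h1), ?_, by simpa using h3⟩
    simpa [hx] using h2
  · rintro ⟨h1, h2, h3, h4⟩
    exact ⟨good_cons h1 h2, by simp [h3], by simpa using h4⟩

lemma finite_wordWt_eq (hwt : ∀ x, 1 ≤ wt x) (hfin : ∀ p, {x | wt x = p}.Finite) (N : ℕ) :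
    {w | wordWt wt w = N}.Finite := by
  induction N using Nat.strong_induction_on with
  | _ N ih =>
    refine ((Set.finite_singleton []).union ((Set.finite_Iio N).biUnion fun p hp ↦
      (hfin (N - p)).image2 List.cons (ih p hp))).subset fun w hw ↦ ?_
    rcases w with _ | ⟨x, w⟩
    · exact Or.inl rfl
    · have h1 := hwt x
      have h2 : wt x + wordWt wt w = N := by simpa using hw
      refine Or.inr (Set.mem_biUnion (x := wordWt wt w) (by simp; omega)
        ⟨x, ?_, w, rfl, rfl⟩)
      change wt x = _
      omega

lemma finite_Words (hwt : ∀ x, 1 ≤ wt x) (hfin : ∀ p, {x | wt x = p}.Finite) (n : ℕ) :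
    (Words cl wt n).Finite :=
  (finite_wordWt_eq hwt hfin (n + 1)).subset fun _ hw ↦ hw.2.2

/-- A word of length at least 2 begins with an open letter, so its weight is at least 2 + 1, while
degree at most 1 means weight at most 2. -/
lemma eq_singleton_of_mem_Words (h1 : ∀ x, 1 ≤ wt x) (h2 : ∀ x, ¬ cl x → 2 ≤ wt x) {n : ℕ}
    (hn : n ≤ 1) {w : List L} (hw : w ∈ Words cl wt n) : ∃ x, w = [x] ∧ cl x ∧ wt x = n + 1 := by
  rcases w with _ | ⟨x, w⟩
  · exact absurd hw.2.1 (by simp)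
  · by_cases h : w = []
    · subst h
      exact ⟨x, rfl, singleton_mem_Words.1 hw⟩
    · obtain ⟨hx, -, -, h3⟩ := (cons_mem_Words h).1 hw
      have := h2 x hx
      have := wordWt_pos h1 h
      omega

/-- The generating function of the bar construction. -/
lemma mk_card_Words (hwt : ∀ x, 1 ≤ wt x) (hfin : ∀ p, {x | wt x = p}.Finite) :
    (PowerSeries.mk fun n ↦ (Nat.card (Words cl wt n) : ℚ)) =
      (PowerSeries.mk fun n ↦ (Nat.card {x | wt x = n + 1 ∧ cl x} : ℚ)) *
        (1 - PowerSeries.X * PowerSeries.mk fun n ↦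
          (Nat.card {x | wt x = n + 1 ∧ ¬ cl x} : ℚ))⁻¹ := by
  classical
  -- Clearing the denominator leaves the recursion W = C + X O W. A word is a closed letter, or an
  -- open letter followed by a word.
  rw [PowerSeries.eq_mul_inv_iff_mul_eq (by simp), mul_sub, mul_one, sub_eq_iff_eq_add]
  have hC (n : ℕ) : {x | wt x = n + 1 ∧ cl x}.Finite := (hfin (n + 1)).subset fun x h ↦ h.1
  have hO (n : ℕ) : {x | wt x = n + 1 ∧ ¬ cl x}.Finite := (hfin (n + 1)).subset fun x h ↦ h.1
  have hW := finite_Words (cl := cl) hwt hfin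
  have hcons : Function.Injective fun p : L × List L ↦ p.1 :: p.2 := fun p q h ↦ by
    simp only [List.cons.injEq] at h
    exact Prod.ext h.1 h.2
  have hne {n : ℕ} {w : List L} (hw : w ∈ Words cl wt n) : w ≠ [] := by
    rintro rfl
    exact absurd hw.2.1 (by simp)
  ext n
  rw [PowerSeries.coeff_mk, map_add, PowerSeries.coeff_mk, mul_left_comm]
  cases n with
  | zero =>
    rw [PowerSeries.coeff_zero_X_mul, add_zero, Nat.card_congr]
    refine (Equiv.ofBijective (fun x : {x | wt x = 0 + 1 ∧ cl x} ↦
      (⟨[x.1], singleton_mem_Words.2 x.2.symm⟩ : Words cl wt 0)) ⟨fun x y h ↦ ?_, fun w ↦ ?_⟩).symm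
    · exact Subtype.ext (by simpa using congrArg Subtype.val h)
    · obtain ⟨_ | ⟨x, w⟩, hw⟩ := w
      · exact absurd rfl (hne hw)
      · by_cases h : w = []
        · subst h
          exact ⟨⟨x, (singleton_mem_Words.1 hw).symm⟩, rfl⟩
        · obtain ⟨-, -, -, h3⟩ := (cons_mem_Words h).1 hw
          have := hwt x
          have := wordWt_pos hwt h
          omega
  | succ n =>
    rw [PowerSeries.coeff_succ_X_mul, PowerSeries.coeff_mul]
    simp only [PowerSeries.coeff_mk, Nat.card_coe_set_eq]
    have key : (hW (n + 1)).toFinset = (hC (n + 1)).toFinset.image (fun x ↦ [x]) ∪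
        (Finset.HasAntidiagonal.antidiagonal n).biUnion fun ij ↦
          ((hO ij.2).toFinset ×ˢ (hW ij.1).toFinset).image fun p ↦ p.1 :: p.2 := by
      ext w
      simp only [Set.Finite.mem_toFinset, Finset.mem_union, Finset.mem_image, Finset.mem_biUnion,
        Finset.HasAntidiagonal.mem_antidiagonal, Finset.mem_product, Prod.exists]
      constructor
      · intro hw
        rcases w with _ | ⟨x, w⟩
        · exact absurd rfl (hne hw)
        · by_cases h : w = []
          · subst h
            exact Or.inl ⟨x, (singleton_mem_Words.1 hw).symm, rfl⟩
          · obtain ⟨h1, h2, h3, h4⟩ := (cons_mem_Words h).1 hw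
            have h5 := hwt x
            have h6 := wordWt_pos hwt h
            exact Or.inr ⟨wordWt wt w - 1, wt x - 1, by omega, x, w,
              ⟨⟨by omega, h1⟩, h2, h3, by omega⟩, rfl⟩
      · rintro (⟨x, hx, rfl⟩ | ⟨i, j, hij, x, w, ⟨hx, hw⟩, rfl⟩)
        · exact singleton_mem_Words.2 hx.symm
        · refine (cons_mem_Words (hne hw)).2 ⟨hx.2, hw.1, hw.2.1, ?_⟩
          rw [hx.1, hw.2.2]
          omega
    rw [Set.ncard_eq_toFinset_card _ (hW (n + 1)), key, Finset.card_union_of_disjoint,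
      Finset.card_image_of_injective _ (fun x y h ↦ by simpa using h), Finset.card_biUnion]
    · push_cast
      rw [Set.ncard_eq_toFinset_card _ (hC (n + 1))]
      congr 1
      refine Finset.sum_congr rfl fun ij _ ↦ ?_
      rw [Finset.card_image_of_injective _ hcons, Finset.card_product,
        Set.ncard_eq_toFinset_card _ (hO ij.2), Set.ncard_eq_toFinset_card _ (hW ij.1)]
      push_cast
      ring
    · intro ij _ kl _ hne'
      rw [Function.onFun, Finset.disjoint_left]
      intro w hw hw'
      simp only [Set.Finite.mem_toFinset, Finset.mem_image, Finset.mem_product, Prod.exists] at hw hw'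
      obtain ⟨x, v, ⟨hx, hv⟩, rfl⟩ := hw
      obtain ⟨y, v', ⟨hy, hv'⟩, h⟩ := hw'
      obtain ⟨rfl, rfl⟩ := List.cons.inj h
      apply hne'
      have h1 := hx.1.symm.trans hy.1
      have h2 := hv.2.2.symm.trans hv'.2.2
      exact Prod.ext (by omega) (by omega)
    · rw [Finset.disjoint_left]
      intro w hw hw'
      simp only [Set.Finite.mem_toFinset, Finset.mem_image, Finset.mem_biUnion, Finset.mem_product,
        Prod.exists] at hw hw'
      obtain ⟨x, -, rfl⟩ := hw
      obtain ⟨i, j, -, y, v, ⟨-, hv⟩, h⟩ := hw'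
      exact hne hv (List.cons.inj h).2

end Words

/-! ### The bar resolution over R. -/

section Bar

variable {Q R : Type u} [CommRing Q] [CommRing R] {φ : Q →+* R} {L : Type u} {cl : L → Prop}
  {wt : L → ℕ} {δ : L → Q} {m : List L → (L →₀ Q)} {M : Type u} [AddCommGroup M] [Module R M]
  [Module Q M]

lemma exists_redCoeff_eq (hφ : Function.Surjective φ) {X : Type u} {s : Set X} {v : X →₀ R}
    (hv : v ∈ Finsupp.supported R R s) :
    ∃ w ∈ Finsupp.supported Q Q s, redCoeff φ X w = v := by
  classical
  choose q hq using hφ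
  have h0 : (if (0 : R) = 0 then 0 else q 0) = 0 := if_pos rfl
  refine ⟨v.mapRange (fun r ↦ if r = 0 then 0 else q r) h0, fun x hx ↦
    hv (Finsupp.support_mapRange hx), Finsupp.ext fun x ↦ ?_⟩
  rw [redCoeff_apply, Finsupp.mapRange_apply]
  split_ifs with h
  · rw [h, map_zero]
  · exact hq _

lemma redCoeff_mem_supported {X : Type u} {s : Set X} {v : X →₀ Q}
    (hv : v ∈ Finsupp.supported Q Q s) : redCoeff φ X v ∈ Finsupp.supported R R s := by
  intro x hx
  refine hv (Finsupp.mem_support_iff.2 fun h ↦ Finsupp.mem_support_iff.1 hx ?_)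
  rw [redCoeff_apply, h, map_zero]

lemma ext_redCoeff (hsm : ∀ (q : Q) (y : M), q • y = φ q • y) {X : Type u} (a : X → M)
    (v : X →₀ Q) : ext a (redCoeff φ X v) = ext a v := by
  induction v using Finsupp.induction_linear with
  | zero => simp
  | add v w hv hw => rw [map_add, map_add, map_add, hv, hw]
  | single x q =>
    rw [redCoeff_single, Finsupp.linearCombination_single, Finsupp.linearCombination_single, hsm]

/-- The augmentation of the bar construction. -/
def wordAug (a : L → M) : List L → M
  | [x] => a x
  | _ => 0

variable (φ wt m) in
/-- The differential of the bar construction over `R`. -/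
noncomputable def barBd (w : List L) : List L →₀ R := redCoeff φ (List L) (coder wt m w)

lemma ext_barBd (v : List L →₀ Q) :
    ext (barBd φ wt m) (redCoeff φ _ v) = redCoeff φ _ (ext (coder wt m) v) :=
  (redCoeff_ext φ (coder wt m) v).symm

variable (H : ExactSystem cl wt δ m) (hφ : Function.Surjective φ)
  (hI : ∀ r ∈ RingHom.ker φ, ∃ y ∈ OpenLetters Q cl wt 2, ext δ y = r)
  (hδ : ∀ x, φ (δ x) = 0)

include H in
lemma ExactSystem.barBd_mem (n : ℕ) (w : List L) (hw : w ∈ Words cl wt (n + 1)) :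
    barBd φ wt m w ∈ Finsupp.supported R R (Words cl wt n) :=
  redCoeff_mem_supported (coder_mem_Bar H.adm hw.1 hw.2.1 hw.2.2)

include H hδ in
-- Over Q the square is the contraction of the first letter, and its coefficient δ(x) maps to zero
-- in R.
lemma ExactSystem.barBd_sq (n : ℕ) (w : List L) (hw : w ∈ Words cl wt n) :
    ext (barBd φ wt m) (barBd φ wt m w) = 0 := by
  have h1 : Finsupp.single w (1 : Q) ∈ Bar Q cl wt (n + 1) :=
    Finsupp.single_mem_supported Q 1 hw
  have h2 := ext_coder_ext_coder H.delta H.adm H.rel h1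
  rw [Finsupp.linearCombination_single, Finsupp.linearCombination_single, one_smul, one_smul] at h2
  rw [barBd, ext_barBd, h2]
  cases w with
  | nil => rw [headContr_nil, map_zero]
  | cons x w => rw [headContr_cons, redCoeff_single, hδ, Finsupp.single_zero]

include H hφ hI in
-- A cycle over R lifts to a chain over Q whose boundary has coefficients in the kernel of φ. These
-- are values of δ, so exactness modulo that ideal applies.
lemma ExactSystem.barBd_exact (n : ℕ) (v : List L →₀ R)
    (hv : v ∈ Finsupp.supported R R (Words cl wt (n + 1))) (h : ext (barBd φ wt m) v = 0) :
    ∃ u ∈ Finsupp.supported R R (Words cl wt (n + 2)), ext (barBd φ wt m) u = v := by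
  obtain ⟨e, he, rfl⟩ := exists_redCoeff_eq hφ hv
  rw [ext_barBd, redCoeff_eq_zero] at h
  obtain ⟨u, hu, hue⟩ := H.exists_of_cycle hI (show 2 ≤ n + 1 + 1 by omega) he h
  exact ⟨redCoeff φ _ u, redCoeff_mem_supported hu, by rw [ext_barBd, hue]⟩

lemma exists_ins_eq (h1 : ∀ x, 1 ≤ wt x) (h2 : ∀ x, ¬ cl x → 2 ≤ wt x) {n : ℕ} (hn : n ≤ 1)
    {v : List L →₀ Q} (hv : v ∈ Finsupp.supported Q Q (Words cl wt n)) :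
    ∃ y ∈ ClosedLetters Q cl wt (n + 1), v = ins Q [] [] y := by
  refine ⟨toLetters v, fun x hx ↦ ?_, ?_⟩
  · exact (singleton_mem_Words.1 (hv (show [x] ∈ v.support by simpa using hx))).symm
  · ext w
    by_cases hw : ∃ x, w = [x]
    · obtain ⟨x, rfl⟩ := hw
      exact (Finsupp.mapDomain_apply (fun x y h ↦ by simpa using h) (toLetters v) x).symm
    · have h3 : v w = 0 := by
        by_contra h
        obtain ⟨x, hx, -⟩ := eq_singleton_of_mem_Words h1 h2 hn (hv (Finsupp.mem_support_iff.2 h))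
        exact hw ⟨x, hx⟩
      rw [h3]
      by_contra h
      obtain ⟨x, -, hx⟩ := exists_of_mem_support_ins (Ne.symm h)
      exact hw ⟨x, hx⟩

lemma ins_mem_Words {n : ℕ} {y : L →₀ Q} (hy : y ∈ ClosedLetters Q cl wt (n + 1)) :
    ins Q [] [] y ∈ Finsupp.supported Q Q (Words cl wt n) := by
  intro w hw
  obtain ⟨x, hx, rfl⟩ := exists_of_mem_support_ins (Finsupp.mem_support_iff.1 hw)
  exact singleton_mem_Words.2 (hy hx).symm

lemma ext_wordAug_ins (a : L → M) (y : L →₀ Q) : ext (wordAug a) (ins Q [] [] y) = ext a y := by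
  rw [ext_ins]; rfl

include H hφ hI hδ in
/-- The bar construction resolves `M` over `R`. -/
lemma ExactSystem.isBasedRes (hsm : ∀ (q : Q) (y : M), q • y = φ q • y) (a : L → M)
    (haug : ∀ x, cl x → wt x = 2 → ext a (m [x]) = 0)
    (hsurj : ∀ y, ∃ v ∈ ClosedLetters Q cl wt 1, ext a v = y)
    (hex : ∀ v ∈ ClosedLetters Q cl wt 1, ext a v = 0 →
      ∃ y ∈ ClosedLetters Q cl wt 2, ext (fun x ↦ m [x]) y = v) :
    IsBasedRes (S := R) (fun n ↦ Words cl wt n) (gradedBd (Words cl wt) (barBd φ wt m))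
      (fun w ↦ wordAug a w) := by
  have h0 : m [] = 0 := H.lowersWt.nil
  refine isBasedRes_of_graded H.barBd_mem (fun n w hw ↦ H.barBd_sq hδ _ w hw) ?_ ?_ ?_
    (H.barBd_exact hφ hI)
  · intro w hw
    obtain ⟨x, rfl, hx, hx'⟩ := eq_singleton_of_mem_Words H.one_le H.two_le le_rfl hw
    rw [barBd, ext_redCoeff hsm, coder_singleton h0, ext_wordAug_ins, haug x hx hx']
  · intro y
    obtain ⟨v, hv, rfl⟩ := hsurj y
    exact ⟨redCoeff φ _ (ins Q [] [] v), redCoeff_mem_supported (ins_mem_Words hv), by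
      rw [ext_redCoeff hsm, ext_wordAug_ins]⟩
  · intro v hv h
    obtain ⟨e, he, rfl⟩ := exists_redCoeff_eq hφ hv
    obtain ⟨y, hy, rfl⟩ := exists_ins_eq H.one_le H.two_le zero_le_one he
    rw [ext_redCoeff hsm, ext_wordAug_ins] at h
    obtain ⟨z, hz, rfl⟩ := hex y hy h
    refine ⟨redCoeff φ _ (ins Q [] [] z), redCoeff_mem_supported (ins_mem_Words hz), ?_⟩
    rw [ext_barBd, ext_ins, ins_ext]
    congr 1
    exact ext_congr fun x _ ↦ coder_singleton h0 x

lemma barBd_mem_CoeffIn_iff {k : Type u} [Field k] (g : R →+* k) (w : List L) :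
    barBd φ wt m w ∈ CoeffIn _ (RingHom.ker g) ↔
      coder wt m w ∈ CoeffIn _ (RingHom.ker (g.comp φ)) :=
  forall_congr' fun v ↦ by rw [barBd, redCoeff_apply]; rfl

end Bar

/-! ### Bases of the minimal resolution A. -/

section Resolution

variable {Q : Type u} [CommRing Q] {A : ChainComplex (ModuleCat.{u} Q) ℕ} {ι : ℕ → Type u}
  (b : ∀ n, Module.Basis (ι n) Q (A.X n))

lemma ext_coordBd (n : ℕ) (v : ι (n + 1) →₀ Q) :
    ext (coordBd b n) v = (b n).repr ((A.d (n + 1) n).hom ((b (n + 1)).repr.symm v)) := by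
  have h : ext (coordBd b n) =
      (b n).repr.toLinearMap ∘ₗ (A.d (n + 1) n).hom ∘ₗ (b (n + 1)).repr.symm.toLinearMap := by
    refine Finsupp.lhom_ext' fun x ↦ LinearMap.ext_ring ?_
    change ext (coordBd b n) (Finsupp.single x 1) =
      (b n).repr ((A.d (n + 1) n).hom ((b (n + 1)).repr.symm (Finsupp.single x 1)))
    rw [Finsupp.linearCombination_single, one_smul, Module.Basis.repr_symm_single_one]
    rfl
  exact LinearMap.congr_fun h v

lemma coordBd_sq (n : ℕ) (x : ι (n + 2)) : ext (coordBd b n) (coordBd b (n + 1) x) = 0 := by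
  rw [ext_coordBd, coordBd, LinearEquiv.symm_apply_apply]
  have h := congrArg (fun q ↦ q.hom (b (n + 2) x)) (A.d_comp_d (n + 2) (n + 1) n)
  exact (congrArg (b n).repr h).trans (map_zero _)

variable {R : Type u} [CommRing R] [IsLocalRing Q] {φ : Q →+* R} (A : MinimalFreeResolution φ)

namespace MinimalFreeResolution

/-- Index types of bases of the modules `A_n`. -/
def Index : ℕ → Type u
  | 0 => PUnit
  | n + 1 => letI := A.free (n + 1); Module.Free.ChooseBasisIndex Q (A.complex.X (n + 1))

/-- Bases of the modules `A_n`. -/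
noncomputable def basis : ∀ n, Module.Basis (A.Index n) Q (A.complex.X n)
  | 0 => (Module.Basis.singleton PUnit Q).map A.zeroEquiv.symm
  | n + 1 => letI := A.free (n + 1); Module.Free.chooseBasis Q (A.complex.X (n + 1))

/-- The basis element of `A_0`. -/
def pt : A.Index 0 := PUnit.unit

lemma eq_pt (x : A.Index 0) : x = A.pt := rfl

lemma zeroEquiv_eq (a : A.complex.X 0) : A.zeroEquiv a = (A.basis 0).repr a A.pt := by
  exact (Module.Basis.singleton_repr PUnit Q (A.zeroEquiv a) PUnit.unit).symm

lemma ext_one_eq (v : A.Index 0 →₀ Q) :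
    ext (Q := Q) (Y := (ModuleCat.restrictScalars φ).obj (ModuleCat.of R R)) (fun _ ↦ (1 : R)) v =
      (A.π.f 0).hom ((A.basis 0).repr.symm v) := by
  rw [A.augmentation, zeroEquiv_eq, LinearEquiv.apply_symm_apply]
  refine (ext_of_forall_eq (M := (ModuleCat.restrictScalars φ).obj (ModuleCat.of R R))
    (ι := A.Index) A.pt A.eq_pt v).trans ?_
  exact mul_one (φ (v A.pt))

lemma isBasedRes : IsBasedRes (S := Q)
    (M := (ModuleCat.restrictScalars φ).obj (ModuleCat.of R R)) A.Index (coordBd A.basis)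
    (fun _ ↦ (1 : R)) where
  sq := coordBd_sq A.basis
  aug_bd x := by
    rw [ext_one_eq, coordBd, LinearEquiv.symm_apply_apply]
    exact congrArg (fun q ↦ q.hom (A.basis 1 x)) A.complex_d_comp_π_f_zero
  surj y := by
    have h : Epi (A.π.f 0) := inferInstance
    rw [ModuleCat.epi_iff_surjective] at h
    obtain ⟨a, rfl⟩ := h y
    exact ⟨(A.basis 0).repr a, by rw [ext_one_eq, LinearEquiv.symm_apply_apply]⟩
  exact_zero v hv := by
    rw [ext_one_eq] at hv
    obtain ⟨a, ha⟩ := (ShortComplex.moduleCat_exact_iff _).1 A.exact₀ _ hv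
    refine ⟨(A.basis 1).repr a, ?_⟩
    rw [ext_coordBd, LinearEquiv.symm_apply_apply]
    exact (congrArg (A.basis 0).repr ha).trans (LinearEquiv.apply_symm_apply _ _)
  exact_succ n v hv := by
    rw [ext_coordBd, LinearEquiv.map_eq_zero_iff] at hv
    obtain ⟨a, ha⟩ := (ShortComplex.moduleCat_exact_iff _).1 (A.exact_succ n) _ hv
    refine ⟨(A.basis (n + 2)).repr a, ?_⟩
    rw [ext_coordBd, LinearEquiv.symm_apply_apply]
    exact (congrArg (A.basis (n + 1)).repr ha).trans (LinearEquiv.apply_symm_apply _ _)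

lemma coordBd_mem (n : ℕ) (x : A.Index (n + 1)) :
    coordBd A.basis n x ∈ CoeffIn _ (IsLocalRing.maximalIdeal Q) :=
  (basis_mem_smul_top_iff (A.basis n) _ _).1 (A.minimal n ⟨_, rfl⟩)

lemma finite_index [IsNoetherianRing Q] (n : ℕ) : Finite (A.Index n) :=
  A.isBasedRes.finite_of_minimal A.coordBd_mem (inferInstanceAs (Finite PUnit)) n

/-- The basis of `A_+[1]`. -/
abbrev Letter : Type u := Σ n, A.Index (n + 1)

/-- The degree in `A_+[1]`. -/
abbrev wt (x : A.Letter) : ℕ := x.1 + 2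

/-- The differential of `A_+[1]`. -/
noncomputable abbrev bd : A.Letter → (A.Letter →₀ Q) := shiftD (coordBd A.basis)

/-- The map `d_1`. -/
noncomputable abbrev delta : A.Letter → Q := shiftDelta (coordBd A.basis) A.pt

lemma isAlgLetters [IsNoetherianRing Q] : IsAlgLetters (RingHom.ker φ) A.wt A.bd A.delta :=
  A.isBasedRes.isAlgLetters A.finite_index A.pt A.eq_pt _ fun r ↦ by
    change φ r = 0 ↔ φ r * (1 : R) = 0
    rw [mul_one]

lemma bd_mem (x : A.Letter) : A.bd x ∈ CoeffIn _ (IsLocalRing.maximalIdeal Q) :=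
  Submodule.neg_mem _ (sigmaD_mem_CoeffIn (ι := fun n ↦ A.Index (n + 1))
    (fun n y ↦ A.coordBd_mem (n + 1) y) x)

end MinimalFreeResolution

end Resolution

/-! ### Closed letters in a disjoint union. -/

section SumLetters

variable {Q : Type u} [CommRing Q] {C : Type u} {B : Type u} {N : Type u} [AddCommGroup N] [Module Q N]
  {wtC : C → ℕ} {wt : B → ℕ} {dC : C → (C →₀ Q)} {aug : C → N}

lemma push_inr_mem {p : ℕ} {y : C →₀ Q} (hy : y ∈ Homog Q wtC p) :
    push Sum.inr y ∈ ClosedLetters Q (sumCl B C) (Sum.elim wt wtC) p := by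
  intro x hx
  obtain ⟨c, hc, rfl⟩ := exists_of_mem_support_push hx
  exact ⟨hy hc, by simp⟩

lemma ext_sumElim_inr (y : C →₀ Q) :
    ext (Sum.elim 0 aug : B ⊕ C → N) (push Sum.inr y) = ext aug y := by
  rw [ext_push]; rfl

lemma ext_push_inr {m : List (B ⊕ C) → ((B ⊕ C) →₀ Q)}
    (hm : ∀ c, m [Sum.inr c] = push Sum.inr (dC c)) (y : C →₀ Q) :
    ext (fun x ↦ m [x]) (push Sum.inr y) = push Sum.inr (ext dC y) := by
  rw [ext_push, map_ext]
  exact ext_congr fun c _ ↦ hm c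

end SumLetters

/-! ### The Golod bound as minimality of the bar resolution. -/

section Residue

open IsLocalRing

variable {Q R : Type u} [CommRing Q] [CommRing R] [IsLocalRing Q] [IsLocalRing R] {φ : Q →+* R}

lemma ker_residue_comp (hφ : Function.Surjective φ) :
    RingHom.ker ((residue R).comp φ) = maximalIdeal Q := by
  rw [← RingHom.comap_ker, ker_residue]
  have : IsLocalHom φ := hφ.isLocalHom
  exact ((IsLocalRing.local_hom_TFAE φ).out 0 4).1 this

/-- Poincaré series from minimal resolutions over `Q`. -/
lemma finrank_tor_of_minimal (hφ : Function.Surjective φ) {M : ModuleCat.{u} Q} {ι : ℕ → Type u}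
    {bd : ∀ n, ι (n + 1) → (ι n →₀ Q)} {aug : ι 0 → M} (h : IsBasedRes ι bd aug)
    (hmin : ∀ n x, bd n x ∈ CoeffIn (ι n) (maximalIdeal Q)) (n : ℕ) [Finite (ι n)] :
    Module.finrank (ResidueField R) ((torField ((residue R).comp φ) n).obj M) =
      Nat.card (ι n) := by
  refine (h.finrank_tor_eq_iff ((residue R).comp φ) n).2 ?_
  rw [ker_residue_comp hφ]
  exact ⟨hmin n, fun m _ ↦ hmin m⟩

variable [IsNoetherianRing Q]

omit [IsLocalRing R] [IsNoetherianRing Q] in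
-- A basis element of A_n has weight n + 1, and A_0 contributes no letters. The missing A_0 accounts
-- for the subtraction of 1 in the denominator of the Golod bound.
lemma card_open_eq (A : MinimalFreeResolution φ) {C : Type u} (wtC : C → ℕ) (n : ℕ) :
    (Nat.card {x | Sum.elim A.wt wtC x = n + 1 ∧ ¬ sumCl A.Letter C x} : ℚ) =
      if n = 0 then 0 else Nat.card (A.Index n) := by
  cases n with
  | zero =>
    rw [if_pos rfl, Nat.cast_inj, Nat.card_eq_zero]
    refine Or.inl ⟨?_⟩
    rintro ⟨x | x, h1, h2⟩
    · have : x.1 + 2 = 1 := h1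
      omega
    · simp at h2
  | succ n =>
    rw [if_neg (by omega), Nat.card_congr]
    refine (Equiv.ofBijective (fun x : A.Index (n + 1) ↦
      (⟨Sum.inl ⟨n, x⟩, by simp⟩ : {x | Sum.elim A.wt wtC x = n + 1 + 1 ∧ ¬ sumCl A.Letter C x}))
        ⟨fun x y h ↦ ?_, ?_⟩).symm
    · have := congrArg Subtype.val h
      simpa using this
    · rintro ⟨⟨i, x⟩ | x, h1, h2⟩
      · obtain rfl : i = n := by simpa using h1
        exact ⟨x, rfl⟩
      · simp at h2

omit [IsLocalRing R] [IsNoetherianRing Q] in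
lemma card_closed_eq (A : MinimalFreeResolution φ) {C : Type u} (wtC : C → ℕ) (n : ℕ) :
    Nat.card {x | Sum.elim A.wt wtC x = n + 1 ∧ sumCl A.Letter C x} =
      Nat.card {c | wtC c = n + 1} := by
  refine (Nat.card_congr (Equiv.ofBijective (fun x : {c | wtC c = n + 1} ↦
      (⟨Sum.inr x, x.2, by simp⟩ : {x | Sum.elim A.wt wtC x = n + 1 ∧ sumCl A.Letter C x}))
        ⟨fun x y h ↦ ?_, ?_⟩)).symm
  · exact Subtype.ext (by simpa using congrArg Subtype.val h)
  · rintro ⟨x | x, h1, h2⟩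
    · simp at h2
    · exact ⟨⟨x, h1⟩, rfl⟩

/-- The Golod bound counts the words of the bar construction. -/
lemma golodBound_eq (hφ : Function.Surjective φ) (A : MinimalFreeResolution φ)
    {M : ModuleCat.{u} R} {C : Type u} {wtC : C → ℕ} {dC : C → (C →₀ Q)}
    {aug : C → (ModuleCat.restrictScalars φ).obj M} (hC : IsModLetters wtC dC aug)
    (hmin : ∀ c, dC c ∈ CoeffIn C (maximalIdeal Q)) :
    golodBound φ M = PowerSeries.mk fun n ↦
      (Nat.card (Words (sumCl A.Letter C) (Sum.elim A.wt wtC) n) : ℚ) := by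
  have hB := A.isAlgLetters
  rw [mk_card_Words (one_le_sumElim hB hC)]
  swap
  · intro p
    refine (((hB.finite p).image Sum.inl).union ((hC.finite p).image Sum.inr)).subset ?_
    rintro (x | x) hx
    · exact Or.inl ⟨x, hx, rfl⟩
    · exact Or.inr ⟨x, hx, rfl⟩
  have h1 : poincareUnder φ M =
      PowerSeries.mk fun n ↦ (Nat.card {x | Sum.elim A.wt wtC x = n + 1 ∧ sumCl A.Letter C x} : ℚ) := by
    ext n
    rw [poincareUnder, poincareSeries, PowerSeries.coeff_mk, PowerSeries.coeff_mk, card_closed_eq]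
    have : Finite {c | wtC c = n + 1} := hC.finite (n + 1)
    exact congrArg _ (finrank_tor_of_minimal hφ hC.isBasedRes (fun n x ↦
      fun y ↦ hmin x y) n)
  have h2 : poincareUnder φ (ModuleCat.of R R) - 1 = PowerSeries.mk fun n ↦
      (Nat.card {x | Sum.elim A.wt wtC x = n + 1 ∧ ¬ sumCl A.Letter C x} : ℚ) := by
    ext n
    have := A.finite_index n
    rw [map_sub, poincareUnder, poincareSeries, PowerSeries.coeff_mk, PowerSeries.coeff_mk,
      card_open_eq, PowerSeries.coeff_one, finrank_tor_of_minimal hφ A.isBasedRes A.coordBd_mem n]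
    split_ifs with h
    · subst h
      rw [Nat.cast_zero, sub_eq_zero]
      have : Nat.card (A.Index 0) = 1 := Nat.card_unique (α := PUnit.{u + 1})
      rw [this, Nat.cast_one]
    · rw [sub_zero]
  rw [golodBound, h1, h2]

variable {C : Type u} {wtC : C → ℕ} {dC : C → (C →₀ Q)}

omit [IsLocalRing R] in
lemma exists_openLetters (A : MinimalFreeResolution φ) (r : Q) (hr : r ∈ RingHom.ker φ) :
    ∃ y ∈ OpenLetters Q (sumCl A.Letter C) (Sum.elim A.wt wtC) 2,
      ext (Sum.elim A.delta 0) y = r := by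
  obtain ⟨y, hy, rfl⟩ := (A.isAlgLetters.mem_iff r).1 hr
  refine ⟨push Sum.inl y, fun x hx ↦ ?_, ?_⟩
  · obtain ⟨b, hb, rfl⟩ := exists_of_mem_support_push hx
    exact ⟨hy hb, by simp⟩
  · rw [ext_push]; rfl

omit [IsLocalRing R] in
lemma isBasedRes_bar (hφ : Function.Surjective φ) (A : MinimalFreeResolution φ)
    {M : ModuleCat.{u} R} {aug : C → (ModuleCat.restrictScalars φ).obj M}
    (hC : IsModLetters wtC dC aug) {m : List (A.Letter ⊕ C) → ((A.Letter ⊕ C) →₀ Q)}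
    (H : ExactSystem (sumCl A.Letter C) (Sum.elim A.wt wtC) (Sum.elim A.delta 0) m)
    (hm : ∀ c, m [Sum.inr c] = push Sum.inr (dC c)) :
    IsBasedRes (S := R) (M := M) (fun n ↦ Words (sumCl A.Letter C) (Sum.elim A.wt wtC) n)
      (gradedBd (Words (sumCl A.Letter C) (Sum.elim A.wt wtC)) (barBd φ (Sum.elim A.wt wtC) m))
      (fun w ↦ wordAug (Sum.elim 0 aug : A.Letter ⊕ C → M) w.1) := by
  let : Module Q M := Module.compHom M φ
  refine H.isBasedRes hφ (exists_openLetters A) (fun x ↦ ?_) (fun _ _ ↦ rfl) _ ?_ ?_ ?_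
  · cases x with
    | inl b => exact A.isAlgLetters.delta_mem b
    | inr c => exact map_zero φ
  · rintro (x | x) hx hx'
    · simp at hx
    · rw [hm]
      exact (ext_sumElim_inr _).trans (hC.aug_d x)
  · intro y
    obtain ⟨v, hv, h⟩ := hC.surj y
    exact ⟨push Sum.inr v, push_inr_mem hv, (ext_sumElim_inr v).trans h⟩
  · intro v hv h
    obtain ⟨y, hy, rfl⟩ := exists_push_inr hv
    obtain ⟨z, hz, rfl⟩ := hC.exact_one y hy ((ext_sumElim_inr y).symm.trans h)
    exact ⟨push Sum.inr z, push_inr_mem hz, ext_push_inr hm z⟩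

/-- The Golod bound is attained in degree `n` if and only if the differentials of the bar
construction next to degree `n` are minimal. -/
lemma coeff_eq_iff (hφ : Function.Surjective φ) (A : MinimalFreeResolution φ)
    {M : ModuleCat.{u} R} {aug : C → (ModuleCat.restrictScalars φ).obj M}
    (hC : IsModLetters wtC dC aug) (hmin : ∀ c, dC c ∈ CoeffIn C (maximalIdeal Q))
    {m : List (A.Letter ⊕ C) → ((A.Letter ⊕ C) →₀ Q)}
    (H : ExactSystem (sumCl A.Letter C) (Sum.elim A.wt wtC) (Sum.elim A.delta 0) m)
    (hm : ∀ c, m [Sum.inr c] = push Sum.inr (dC c)) (n : ℕ) :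
    PowerSeries.coeff n (poincareOver M) = PowerSeries.coeff n (golodBound φ M) ↔
      (∀ w ∈ Words (sumCl A.Letter C) (Sum.elim A.wt wtC) (n + 1),
        coder (Sum.elim A.wt wtC) m w ∈ CoeffIn _ (maximalIdeal Q)) ∧
      ∀ i, i + 1 = n → ∀ w ∈ Words (sumCl A.Letter C) (Sum.elim A.wt wtC) (i + 1),
        coder (Sum.elim A.wt wtC) m w ∈ CoeffIn _ (maximalIdeal Q) := by
  have hF := isBasedRes_bar hφ A hC H hm
  have hB := A.isAlgLetters
  have hfin : Finite (Words (sumCl A.Letter C) (Sum.elim A.wt wtC) n) := by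
    refine finite_Words (one_le_sumElim hB hC) (fun p ↦ ?_) n
    refine (((hB.finite p).image Sum.inl).union ((hC.finite p).image Sum.inr)).subset ?_
    rintro (x | x) hx
    · exact Or.inl ⟨x, hx, rfl⟩
    · exact Or.inr ⟨x, hx, rfl⟩
  rw [golodBound_eq hφ A hC hmin, poincareOver, poincareSeries, PowerSeries.coeff_mk,
    PowerSeries.coeff_mk, Nat.cast_inj, hF.finrank_tor_eq_iff (residue R) n]
  have key (i : ℕ) (w : List (A.Letter ⊕ C))
      (hw : w ∈ Words (sumCl A.Letter C) (Sum.elim A.wt wtC) (i + 1)) :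
      gradedBd (Words (sumCl A.Letter C) (Sum.elim A.wt wtC)) (barBd φ (Sum.elim A.wt wtC) m) i
        ⟨w, hw⟩ ∈ CoeffIn _ (RingHom.ker (residue R)) ↔
      coder (Sum.elim A.wt wtC) m w ∈ CoeffIn _ (maximalIdeal Q) := by
    rw [gradedBd_mem_CoeffIn_iff H.barBd_mem, barBd_mem_CoeffIn_iff, ker_residue_comp hφ]
  refine and_congr ⟨fun h w hw ↦ (key n w hw).1 (h ⟨w, hw⟩), fun h w ↦ (key n w w.2).2 (h w w.2)⟩
    (forall_congr' fun i ↦ forall_congr' fun _ ↦ ⟨fun h w hw ↦ (key i w hw).1 (h ⟨w, hw⟩),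
      fun h w ↦ (key i w w.2).2 (h w w.2)⟩)

end Residue

/-! ### Reading off operations from the bar differential. -/

section PushCoeff

variable {Q : Type u} [CommRing Q] {B C : Type u} {J : Ideal Q} {wt : B → ℕ} {wtC : C → ℕ}
  {δ : B → Q} {m : List (B ⊕ C) → ((B ⊕ C) →₀ Q)} {mB : List B → (B →₀ Q)}

lemma push_mem_CoeffIn_iff {X Y : Type*} {f : X → Y} (hf : Function.Injective f) {v : X →₀ Q} :
    push f v ∈ CoeffIn Y J ↔ v ∈ CoeffIn X J := by
  constructor
  · intro h x
    rw [← push_apply hf v x]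
    exact h _
  · intro h y
    by_cases hy : push f v y = 0
    · rw [hy]; exact J.zero_mem
    · obtain ⟨x, -, rfl⟩ := exists_of_mem_support_push (Finsupp.mem_support_iff.2 hy)
      rw [push_apply hf]
      exact h x

/-- The coefficients of the operation at `v` all occur among those of D(v c₀), so minimality of the
bar differential at this one word suffices. -/
lemma mem_CoeffIn_of_coder_concat
    (H : ExactSystem (sumCl B C) (Sum.elim wt wtC) (Sum.elim δ 0) m)
    (h1 : ∀ w, m (w.map Sum.inl) = push Sum.inl (mB w)) {c₀ : C} (hc₀ : wtC c₀ = 1) (v : List B)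
    (h : coder (Sum.elim wt wtC) m (v.map Sum.inl ++ [Sum.inr c₀]) ∈ CoeffIn _ J) :
    mB v ∈ CoeffIn B J := by
  intro x
  have h2 := H.coder_concat_apply (not_hasClosed_map_inl v) (c₀ := Sum.inr c₀) hc₀ (Sum.inl x)
  rw [h1, push_apply Sum.inl_injective] at h2
  rw [← h2]
  exact h _

lemma concat_mem_Words {c₀ : C} (hc₀ : wtC c₀ = 1) (v : List B) :
    v.map Sum.inl ++ [Sum.inr c₀] ∈ Words (sumCl B C) (Sum.elim wt wtC) (wordWt wt v) := by
  refine ⟨good_append_singleton (not_hasClosed_map_inl v) _, by simp, ?_⟩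
  rw [wordWt_append, wordWt_map (f := Sum.inl) (wt := wt) (wt' := Sum.elim wt wtC) (fun _ ↦ rfl)]
  simp [hc₀]

end PushCoeff

/-! ### Golod modules, minimal structures, and equality in low degrees. -/

section Main

open IsLocalRing

lemma smul_restrictScalars_eq_zero {Q R : Type u} [CommRing Q] [CommRing R] {φ : Q →+* R}
    {M : ModuleCat.{u} R} (r : Q) (hr : r ∈ RingHom.ker φ)
    (y : (ModuleCat.restrictScalars φ).obj M) : r • y = 0 := by
  have : r • y = (φ r • (show M from y) : M) := rfl
  rw [this, hr, zero_smul]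
  rfl

variable {Q R : Type u} [CommRing Q] [IsRegularLocalRing Q] [CommRing R]
  {φ : Q →+* R} {A : MinimalFreeResolution φ} {mB : List A.Letter → (A.Letter →₀ Q)}
  {C : Type u} {wtC : C → ℕ} {dC : C → (C →₀ Q)} {c₀ : C}
  {m : List (A.Letter ⊕ C) → ((A.Letter ⊕ C) →₀ Q)}

/-- The place where I ⊆ 𝔫² enters: it puts the curvature into 𝔫², as the division step for closed
words requires. -/
lemma delta_mem_sq (hI : RingHom.ker φ ≤ maximalIdeal Q ^ 2) (x : A.Letter ⊕ C) :
    (Sum.elim A.delta 0 : A.Letter ⊕ C → Q) x ∈ maximalIdeal Q ^ 2 := by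
  cases x with
  | inl b => exact hI (A.isAlgLetters.delta_mem b)
  | inr c => exact Ideal.zero_mem _

lemma singleton_mem (hm : IsAInf A.wt A.bd A.delta mB)
    (hC : IsKoszulLike (maximalIdeal Q) (maximalIdeal Q) (maximalIdeal Q ^ 2) C wtC dC c₀)
    (h1 : ∀ w, m (w.map Sum.inl) = push Sum.inl (mB w))
    (h2 : ∀ c, m [Sum.inr c] = push Sum.inr (dC c)) (x : A.Letter ⊕ C) :
    m [x] ∈ CoeffIn _ (maximalIdeal Q) := by
  cases x with
  | inl b =>
    have := h1 [b]
    rw [List.map_singleton] at this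
    rw [this, push_mem_CoeffIn_iff Sum.inl_injective, hm.single]
    exact A.bd_mem b
  | inr c =>
    rw [h2, push_mem_CoeffIn_iff Sum.inr_injective]
    exact hC.minimal c

/-- Strong minimality of the Koszul complex, in terms of closed letters. A general minimal
resolution lacks this property, which is why the residue field plays a special role. -/
lemma mem_of_ext_closed_mem
    (hC : IsKoszulLike (maximalIdeal Q) (maximalIdeal Q) (maximalIdeal Q ^ 2) C wtC dC c₀)
    (h2 : ∀ c, m [Sum.inr c] = push Sum.inr (dC c)) (p : ℕ) (hp : 2 ≤ p)
    (v : (A.Letter ⊕ C) →₀ Q) (hv : v ∈ ClosedLetters Q (sumCl A.Letter C) (Sum.elim A.wt wtC) p)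
    (h : ext (fun x ↦ m [x]) v ∈ CoeffIn _ (maximalIdeal Q ^ 2)) :
    v ∈ CoeffIn _ (maximalIdeal Q) := by
  obtain ⟨y, hy, rfl⟩ := exists_push_inr hv
  rw [ext_push_inr h2, push_mem_CoeffIn_iff Sum.inr_injective] at h
  rw [push_mem_CoeffIn_iff Sum.inr_injective]
  exact hC.strong p hp y hy h

lemma mem_of_minimal (hm : ∀ w, mB w ∈ CoeffIn A.Letter (maximalIdeal Q))
    (h1 : ∀ w, m (w.map Sum.inl) = push Sum.inl (mB w)) (w : List (A.Letter ⊕ C))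
    (hw : ¬ HasClosed (sumCl A.Letter C) w) : m w ∈ CoeffIn _ (maximalIdeal Q) := by
  obtain ⟨v, rfl⟩ := exists_map_inl_of_not_hasClosed hw
  rw [h1, push_mem_CoeffIn_iff Sum.inl_injective]
  exact hm v

/-- A minimal A-infinity structure gives a minimal bar construction for the residue field. -/
lemma coder_mem_of_minimal (hI : RingHom.ker φ ≤ maximalIdeal Q ^ 2)
    (hm : IsAInf A.wt A.bd A.delta mB) (hmin : ∀ w, mB w ∈ CoeffIn A.Letter (maximalIdeal Q))
    (hC : IsKoszulLike (maximalIdeal Q) (maximalIdeal Q) (maximalIdeal Q ^ 2) C wtC dC c₀)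
    (H : ExactSystem (sumCl A.Letter C) (Sum.elim A.wt wtC) (Sum.elim A.delta 0) m)
    (h1 : ∀ w, m (w.map Sum.inl) = push Sum.inl (mB w))
    (h2 : ∀ c, m [Sum.inr c] = push Sum.inr (dC c)) (w : List (A.Letter ⊕ C))
    (hw : Good (sumCl A.Letter C) w) :
    coder (Sum.elim A.wt wtC) m w ∈ CoeffIn _ (maximalIdeal Q) := by
  refine coder_mem_CoeffIn fun a b c habc ↦ ?_
  by_cases hb : HasClosed (sumCl A.Letter C) b
  · exact H.mem_CoeffIn_of_wordWt_le (delta_mem_sq hI) (singleton_mem hm hC h1 h2)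
      (mem_of_ext_closed_mem hC h2) (wordWt (Sum.elim A.wt wtC) b)
      (fun v hv _ ↦ mem_of_minimal hmin h1 v hv) b (Good.sub (a := a) (c := c) (habc ▸ hw)) hb le_rfl
  · exact mem_of_minimal hmin h1 b hb

lemma IsAInf.minimal_of_length (hm : IsAInf A.wt A.bd A.delta mB)
    (h : ∀ w, 2 ≤ w.length → mB w ∈ CoeffIn A.Letter (maximalIdeal Q)) (w : List A.Letter) :
    mB w ∈ CoeffIn A.Letter (maximalIdeal Q) := by
  rcases lt_or_ge w.length 2 with hw | hw
  · rcases eq_nil_or_singleton_of_length_le (Nat.le_of_lt_succ hw) with rfl | ⟨x, rfl⟩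
    · rw [(hm.adm []).nil]
      exact Submodule.zero_mem _
    · rw [hm.single]
      exact A.bd_mem x
  · exact h w hw

/-- The coordinates of an A-infinity structure. -/
lemma isAInf_wordVal (s : AInfinityStructure A.complex A.zeroEquiv) :
    IsAInf A.wt A.bd A.delta (wordVal s.m A.basis) :=
  s.isAInf A.basis A.pt A.zeroEquiv_eq A.isAlgLetters

lemma exists_aInfinityStructure : Nonempty (AInfinityStructure A.complex A.zeroEquiv) := by
  obtain ⟨mB, hm⟩ := A.isAlgLetters.exists_isAInf
  obtain ⟨s, -⟩ := hm.exists_aInfinityStructure A.basis A.pt A.zeroEquiv_eq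
  exact ⟨s⟩

variable [IsLocalRing R] (hφ : Function.Surjective φ)

/-- The augmentation of the Koszul complex. -/
noncomputable def koszulAug (φ : Q →+* R) {C : Type u} (c₀ : C) :
    C → (ModuleCat.restrictScalars φ).obj (ModuleCat.of R (ResidueField R)) :=
  open Classical in fun c ↦ if c = c₀ then (1 : ResidueField R) else (0 : ResidueField R)

include hφ in
lemma IsKoszulLike.isModLetters_residue {J : Ideal Q} {C : Type u} {wt : C → ℕ}
    {d : C → (C →₀ Q)} {c₀ : C} (h : IsKoszulLike (maximalIdeal Q) (maximalIdeal Q) J C wt d c₀) :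
    IsModLetters wt d (koszulAug φ c₀) := by
  classical
  have hs (q : Q) : q • (show (ModuleCat.restrictScalars φ).obj (ModuleCat.of R (ResidueField R))
      from (1 : ResidueField R)) = residue R (φ q) := mul_one (residue R (φ q))
  have := h.isModLetters (N := (ModuleCat.restrictScalars φ).obj (ModuleCat.of R (ResidueField R)))
    (1 : ResidueField R) (fun y ↦ by
      obtain ⟨r, hr⟩ := residue_surjective (R := R) y
      obtain ⟨q, rfl⟩ := hφ r
      exact ⟨q, (hs q).trans hr⟩) fun q ↦ by
      rw [← ker_residue_comp hφ, RingHom.mem_ker]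
      exact ⟨fun h ↦ (hs q).symm.trans h, fun h ↦ (hs q).trans h⟩
  exact this

include hφ in
lemma exists_koszul_system (hm : IsAInf A.wt A.bd A.delta mB) :
    ∃ (C : Type u) (wtC : C → ℕ) (dC : C → (C →₀ Q)) (c₀ : C)
      (m : List (A.Letter ⊕ C) → ((A.Letter ⊕ C) →₀ Q)),
      IsKoszulLike (maximalIdeal Q) (maximalIdeal Q) (maximalIdeal Q ^ 2) C wtC dC c₀ ∧
      ExactSystem (sumCl A.Letter C) (Sum.elim A.wt wtC) (Sum.elim A.delta 0) m ∧
      (∀ w, m (w.map Sum.inl) = push Sum.inl (mB w)) ∧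
      ∀ c, m [Sum.inr c] = push Sum.inr (dC c) := by
  obtain ⟨C, wtC, dC, c₀, hC⟩ := exists_koszul Q
  obtain ⟨m, h⟩ := exists_exactSystem A.isAlgLetters hm (hC.isModLetters_residue hφ)
    smul_restrictScalars_eq_zero
  exact ⟨C, wtC, dC, c₀, m, hC, h⟩

include hφ in
-- With the Koszul complex as resolution of k, minimality of the algebra operations passes to all
-- operations and thus to the whole bar differential.
lemma isGolodRing_of_isMinimal (hI : RingHom.ker φ ≤ maximalIdeal Q ^ 2)
    (s : AInfinityStructure A.complex A.zeroEquiv) (hs : s.IsMinimal) : IsGolodRing φ := by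
  have hm := isAInf_wordVal s
  have hmin := hm.minimal_of_length ((s.isMinimal_iff A.basis).1 hs)
  obtain ⟨C, wtC, dC, c₀, m, hC, H, h1, h2⟩ := exists_koszul_system hφ hm
  have h3 := coder_mem_of_minimal hI hm hmin hC H h1 h2
  refine ⟨inferInstanceAs (Module.Finite R (ResidueField R)), PowerSeries.ext fun n ↦ ?_⟩
  exact (coeff_eq_iff hφ A (hC.isModLetters_residue hφ) hC.minimal H h2 n).2
    ⟨fun w hw ↦ h3 w hw.1, fun i _ w hw ↦ h3 w hw.1⟩

include hφ in
-- Any nonzero module serves here. Equality in all degrees makes the bar differential minimal, and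
-- prefixing a degree-0 generator by open words exposes every operation of the algebra.
lemma isMinimal_of_isGolodModule {M : ModuleCat.{u} R} [Nontrivial M] (hM : IsGolodModule φ M)
    (s : AInfinityStructure A.complex A.zeroEquiv) : s.IsMinimal := by
  have hm := isAInf_wordVal s
  have : Module.Finite R M := hM.1
  have : Module.Finite Q ((ModuleCat.restrictScalars φ).obj M) := by
    let : Algebra Q R := φ.toAlgebra
    let : Module Q M := Module.compHom M φ
    have : IsScalarTower Q R M := IsScalarTower.of_algebraMap_smul fun _ _ ↦ rfl
    have : Module.Finite Q R := Module.Finite.of_surjective (Algebra.linearMap Q R) hφ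
    have h : Module.Finite Q M := Module.Finite.trans R M
    exact h
  obtain ⟨ι, bd, aug, hι, hmin, hfin⟩ :=
    exists_minimal_basedRes (Q := Q) ((ModuleCat.restrictScalars φ).obj M)
  have hC := hι.isModLetters hfin
  obtain ⟨m, H, h1, h2⟩ := exists_exactSystem A.isAlgLetters hm hC smul_restrictScalars_eq_zero
  -- A nonzero module needs a generator; its basis element is the closed letter of weight 1.
  obtain ⟨c₀⟩ : Nonempty (ι 0) := by
    by_contra hempty
    rw [not_nonempty_iff] at hempty
    obtain ⟨y, hy⟩ := exists_ne (0 : M)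
    obtain ⟨v, rfl⟩ := hι.surj y
    rw [Subsingleton.elim v 0] at hy
    exact hy (map_zero _)
  rw [s.isMinimal_iff A.basis]
  intro v hv
  refine mem_CoeffIn_of_coder_concat H h1 (c₀ := ⟨0, c₀⟩) rfl v ?_
  have h3 := concat_mem_Words (wt := A.wt) (wtC := fun x : Σ n, ι n ↦ x.1 + 1) (c₀ := ⟨0, c₀⟩) rfl v
  obtain ⟨i, hi⟩ : ∃ i, wordWt A.wt v = i + 1 :=
    by
    have h4 : v.length * 2 ≤ wordWt A.wt v := length_mul_two_le_wordWt v
    exact ⟨wordWt A.wt v - 1, by omega⟩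
  rw [hi] at h3
  exact ((coeff_eq_iff hφ A hC (sigmaD_mem_CoeffIn hmin) H h2 i).1
    (congrArg (PowerSeries.coeff i) hM.2)).1 _ h3

include hφ in
-- A word `v` with a nonzero value has bounded weight, because the value involves a basis element of
-- some A_p with 1 ≤ p ≤ dim Q.
lemma isMinimal_of_coeff_eq (h : ∀ n : ℕ, (n : WithBot ℕ∞) ≤ ringKrullDim Q + 1 →
      PowerSeries.coeff n (poincareOver (ModuleCat.of R (ResidueField R))) =
        PowerSeries.coeff n (golodBound φ (ModuleCat.of R (ResidueField R))))
    (s : AInfinityStructure A.complex A.zeroEquiv) : s.IsMinimal := by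
  have hm := isAInf_wordVal s
  obtain ⟨C, wtC, dC, c₀, m, hC, H, h1, h2⟩ := exists_koszul_system hφ hm
  have hc₀ : wtC c₀ = 1 := (hC.wt_eq_one c₀).2 rfl
  rw [s.isMinimal_iff A.basis]
  intro v hv
  by_cases h0 : wordVal s.m A.basis v = 0
  · rw [h0]; exact Submodule.zero_mem _
  obtain ⟨x, hx⟩ := Finsupp.support_nonempty_iff.2 h0
  have hx' : x.1 + 2 + 1 = wordWt A.wt v := (hm.adm v x hx).1
  -- The letter `x` comes from A_p with p = x.1 + 1. The word v c₀ then has bar degree p + 2, and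
  -- its differential is the one into degree p + 1 ≤ dim Q + 1: this is where the bound in condition
  -- 6 comes from.
  have hdim : ((x.1 + 1 : ℕ) : WithBot ℕ∞) ≤ ringKrullDim Q := by
    by_contra hlt
    have := A.isBasedRes.isEmpty_of_minimal A.coordBd_mem (not_le.1 hlt)
    exact this.elim x.2
  refine mem_CoeffIn_of_coder_concat H h1 hc₀ v ?_
  have h3 := concat_mem_Words (wt := A.wt) hc₀ v
  rw [← hx'] at h3
  refine ((coeff_eq_iff hφ A (hC.isModLetters_residue hφ) hC.minimal H h2 (x.1 + 2)).1
    (h _ ?_)).1 _ h3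
  have h5 : ((x.1 + 2 : ℕ) : WithBot ℕ∞) = ((x.1 + 1 : ℕ) : WithBot ℕ∞) + 1 := rfl
  rw [h5]
  exact add_le_add_left hdim 1

end Main

/-! ### The resolution of the maximal ideal over Q as a twisted sum. -/

section Twist

variable {Q : Type u} [CommRing Q] {B C : Type u} {wt : B → ℕ} {wtC : C → ℕ}
  {d : B → (B →₀ Q)} {dC : C → (C →₀ Q)} {θ : B → (C →₀ Q)} {δ : B → Q} {c₀ : C}

/-- The differential of a twisted sum. -/
noncomputable def twistD (dC : C → (C →₀ Q)) (d : B → (B →₀ Q)) (θ : B → (C →₀ Q)) :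
    C ⊕ B → ((C ⊕ B) →₀ Q) :=
  Sum.elim (fun c ↦ push Sum.inl (dC c)) fun b ↦ push Sum.inr (d b) + push Sum.inl (θ b)

/-- The degrees in a twisted sum. -/
def twistWt (wtC : C → ℕ) (wt : B → ℕ) : C ⊕ B → ℕ := Sum.elim wtC fun b ↦ wt b + 1

lemma ext_twistD (y : C →₀ Q) (z : B →₀ Q) :
    ext (twistD dC d θ) (push Sum.inl y + push Sum.inr z) =
      push Sum.inl (ext dC y + ext θ z) + push Sum.inr (ext d z) := by
  rw [map_add, ext_push, ext_push, map_add, map_ext, map_ext, map_ext]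
  change _ + ext (fun b ↦ push Sum.inr (d b) + push Sum.inl (θ b)) z = _
  rw [ext_add, add_assoc, add_comm (ext (fun b ↦ push Sum.inl (θ b)) z)]
  rfl

lemma push_add_mem {p : ℕ} {y : C →₀ Q} {z : B →₀ Q} (hy : y ∈ Homog Q wtC (p + 1))
    (hz : z ∈ Homog Q wt p) :
    push Sum.inl y + push Sum.inr z ∈ Finsupp.supported Q Q {x | twistWt wtC wt x = p + 1} := by
  refine Submodule.add_mem _ (fun x hx ↦ ?_) fun x hx ↦ ?_
  · obtain ⟨c, hc, rfl⟩ := exists_of_mem_support_push hx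
    exact hy hc
  · obtain ⟨c, hc, rfl⟩ := exists_of_mem_support_push hx
    exact congrArg (· + 1) (hz hc)

lemma push_add_apply_inl (y : C →₀ Q) (z : B →₀ Q) (c : C) :
    (push Sum.inl y + push Sum.inr z : (C ⊕ B) →₀ Q) (Sum.inl c) = y c := by
  have : push (Q := Q) (Sum.inr : B → C ⊕ B) z (Sum.inl c) = 0 := by
    by_contra h
    obtain ⟨x, -, hx⟩ := exists_of_mem_support_push (Finsupp.mem_support_iff.2 h)
    simp at hx
  rw [Finsupp.add_apply, push_apply Sum.inl_injective, this, add_zero]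

lemma push_add_apply_inr (y : C →₀ Q) (z : B →₀ Q) (b : B) :
    (push Sum.inl y + push Sum.inr z : (C ⊕ B) →₀ Q) (Sum.inr b) = z b := by
  have : push (Q := Q) (Sum.inl : C → C ⊕ B) y (Sum.inr b) = 0 := by
    by_contra h
    obtain ⟨x, -, hx⟩ := exists_of_mem_support_push (Finsupp.mem_support_iff.2 h)
    simp at hx
  rw [Finsupp.add_apply, push_apply Sum.inr_injective, this, zero_add]

lemma exists_push_add {p : ℕ} {v : (C ⊕ B) →₀ Q}
    (hv : v ∈ Finsupp.supported Q Q {x | twistWt wtC wt x = p + 1}) :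
    ∃ y ∈ Homog Q wtC (p + 1), ∃ z ∈ Homog Q wt p, push Sum.inl y + push Sum.inr z = v := by
  refine ⟨v.comapDomain Sum.inl Sum.inl_injective.injOn, fun c hc ↦ ?_,
    v.comapDomain Sum.inr Sum.inr_injective.injOn, fun b hb ↦ ?_, ?_⟩
  · exact hv (show Sum.inl c ∈ v.support by simpa using hc)
  · have : twistWt wtC wt (Sum.inr b) = p + 1 := hv (show Sum.inr b ∈ v.support by simpa using hb)
    exact Nat.succ_injective this
  · refine Finsupp.ext fun x ↦ ?_
    cases x with
    | inl c => exact push_add_apply_inl _ _ c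
    | inr b => exact push_add_apply_inr _ _ b

lemma push_inl_add_push_inr_eq_zero {y : C →₀ Q} {z : B →₀ Q}
    (h : push Sum.inl y + push (Sum.inr : B → C ⊕ B) z = 0) : y = 0 ∧ z = 0 := by
  constructor
  · ext c
    rw [← push_add_apply_inl y z c, h]; rfl
  · ext b
    rw [← push_add_apply_inr y z b, h]; rfl

variable (hrel : ∀ b, ext θ (d b) + ext dC (θ b) = Finsupp.single c₀ (δ b))

include hrel in
lemma ext_twist_rel (z : B →₀ Q) :
    ext θ (ext d z) + ext dC (ext θ z) = Finsupp.single c₀ (ext δ z) := by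
  induction z using Finsupp.induction_linear with
  | zero => simp
  | add v w hv hw =>
    simp only [map_add, Finsupp.single_add, ← hv, ← hw]
    abel
  | single b q =>
    simp only [Finsupp.linearCombination_single, map_smul, ← smul_add, hrel]
    simp

variable {I J : Ideal Q} {n : Ideal Q} (hB : IsAlgLetters I wt d δ)
  (hC : IsKoszulLike n n J C wtC dC c₀) (hθ : ∀ b, θ b ∈ Homog Q wtC (wt b))

include hB hC hθ in
lemma twistD_mem (p : ℕ) (x : C ⊕ B) (hx : twistWt wtC wt x = p + 2) :
    twistD dC d θ x ∈ Finsupp.supported Q Q {x | twistWt wtC wt x = p + 1} := by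
  cases x with
  | inl c =>
    have h := push_add_mem (wt := wt) (wtC := wtC) (p := p) (y := dC c) (z := 0)
      (fun x hx' ↦ by
        have h1 := hC.lowers c x hx'
        change wtC c = p + 2 at hx
        change wtC x = p + 1
        omega) (Submodule.zero_mem _)
    rwa [map_zero, add_zero] at h
  | inr b =>
    have hx : wt b + 1 = p + 2 := hx
    have h := push_add_mem (wt := wt) (wtC := wtC) (p := p) (y := θ b) (z := d b)
      (by have := hθ b; rwa [show wt b = p + 1 by omega] at this) fun x hx' ↦ by
        have h1 := hB.lowers b x hx'
        change wt x = p
        omega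
    rwa [add_comm (push Sum.inl (θ b))] at h

include hB hC hrel in
-- By the twisting relation the square of the differential on `b` is δ(b) c₀. In this range `b` has
-- weight at least 3, so δ(b) = 0; the case of weight 2 is absorbed by the augmentation.
lemma ext_twistD_twistD (p : ℕ) (x : C ⊕ B) (hx : twistWt wtC wt x = p + 4) :
    ext (twistD dC d θ) (twistD dC d θ x) = 0 := by
  cases x with
  | inl c =>
    have h := ext_twistD (dC := dC) (d := d) (θ := θ) (dC c) 0
    rw [hC.sq, map_zero, add_zero, map_zero, map_zero, add_zero, map_zero, map_zero, add_zero] at h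
    exact h
  | inr b =>
    have h := ext_twistD (dC := dC) (d := d) (θ := θ) (θ b) (d b)
    have h0 : δ b = 0 := by
      by_contra hne
      have := hB.delta b hne
      have hx : wt b + 1 = p + 4 := hx
      omega
    rw [hB.sq, add_comm (ext dC _), hrel, h0, Finsupp.single_zero, map_zero, map_zero, add_zero,
      add_comm (push Sum.inl (θ b))] at h
    exact h

lemma eq_zero_of_mem_Homog (hB : IsAlgLetters I wt d δ) {p : ℕ} (hp : p < 2) {z : B →₀ Q}
    (hz : z ∈ Homog Q wt p) : z = 0 := by
  refine Finsupp.support_eq_empty.1 (Finset.eq_empty_of_forall_notMem fun x hx ↦ ?_)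
  have h1 : wt x = p := hz hx
  have h2 := hB.two_le x
  omega

lemma ext_Homog (hB : IsAlgLetters I wt d δ) {p : ℕ} {z : B →₀ Q} (hz : z ∈ Homog Q wt (p + 1)) :
    ext d z ∈ Homog Q wt p := ext_lowers hB.lowers hz

lemma ext_theta_mem (hθ : ∀ b, θ b ∈ Homog Q wtC (wt b)) {p : ℕ} {z : B →₀ Q}
    (hz : z ∈ Homog Q wt p) : ext θ z ∈ Homog Q wtC p :=
  ext_mem fun b hb ↦ by have := hθ b; rwa [show wt b = p from hz hb] at this

lemma ext_delta_eq_zero (hB : IsAlgLetters I wt d δ) {p : ℕ} (hp : p ≠ 2) {z : B →₀ Q}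
    (hz : z ∈ Homog Q wt p) : ext δ z = 0 :=
  ext_eq_zero fun b hb ↦ by
    by_contra h
    exact hp ((hz hb).symm.trans (hB.delta b h))

include hrel hB hC hθ in
lemma exists_of_twistD_eq_zero (p : ℕ) (v : (C ⊕ B) →₀ Q)
    (hv : v ∈ Finsupp.supported Q Q {x | twistWt wtC wt x = p + 3})
    (h : ext (twistD dC d θ) v = 0) :
    ∃ u ∈ Finsupp.supported Q Q {x | twistWt wtC wt x = p + 4}, ext (twistD dC d θ) u = v := by
  obtain ⟨y, hy, z, hz, rfl⟩ := exists_push_add hv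
  rw [ext_twistD] at h
  obtain ⟨h1, h2⟩ := push_inl_add_push_inr_eq_zero h
  have h3 : ext δ z = 0 := by
    have h4 := ext_twist_rel hrel z
    have h5 : ext dC (ext dC y) = 0 := by
      rw [map_ext]
      exact ext_eq_zero fun c _ ↦ hC.sq c
    rw [h2, map_zero, zero_add, ← neg_eq_of_add_eq_zero_right h1, map_neg, h5, neg_zero] at h4
    exact (Finsupp.single_eq_zero.1 h4.symm)
  obtain ⟨z', hz', rfl⟩ := hB.exact (p + 2) (by omega) z hz h2 h3
  have h6 := ext_twist_rel hrel z'
  rw [ext_delta_eq_zero hB (by omega) hz', Finsupp.single_zero] at h6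
  obtain ⟨y', hy', h7⟩ := hC.exact (p + 3) (by omega) (y - ext θ z')
    (Submodule.sub_mem _ hy (ext_theta_mem hθ hz')) (by
      rw [map_sub, sub_eq_zero]
      exact add_right_cancel (h1.trans (by rw [add_comm]; exact h6.symm)))
  exact ⟨_, push_add_mem hy' hz', by rw [ext_twistD, h7, sub_add_cancel]⟩

variable {R : Type u} [CommRing R] [IsLocalRing R] {φ : Q →+* R}

/-- The augmentation of a twisted sum. -/
def twistAug (φ : Q →+* R) (hmem : ∀ c, φ (dC c c₀) ∈ IsLocalRing.maximalIdeal R) : C ⊕ B →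
    (ModuleCat.restrictScalars φ).obj (ModuleCat.of R (IsLocalRing.maximalIdeal R)) :=
  Sum.elim (fun c ↦ (⟨φ (dC c c₀), hmem c⟩ : IsLocalRing.maximalIdeal R)) fun _ ↦
    (0 : IsLocalRing.maximalIdeal R)

variable (hmem : ∀ c, φ (dC c c₀) ∈ IsLocalRing.maximalIdeal R)

lemma coe_ext_twistAug (y : C →₀ Q) (z : B →₀ Q) :
    (show IsLocalRing.maximalIdeal R from ext (twistAug (B := B) φ hmem)
      (push Sum.inl y + push Sum.inr z)).1 = φ (ext dC y c₀) := by
  have h1 : ext (twistAug (B := B) φ hmem) (push Sum.inr z) = 0 := by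
    rw [ext_push]
    exact ext_eq_zero fun _ _ ↦ rfl
  rw [map_add, h1, add_zero, ext_push]
  induction y using Finsupp.induction_linear with
  | zero => simp only [map_zero, Finsupp.zero_apply]; rfl
  | add v w hv hw =>
    simp only [map_add, Finsupp.add_apply, ← hv, ← hw]
    rfl
  | single c q =>
    simp only [Finsupp.linearCombination_single, Finsupp.smul_apply, smul_eq_mul, map_mul]
    rfl

include hrel hB hC hθ in
-- The cone of a lift A → K of R → k, with the identity A_0 → K_0 cancelled: its degree p part is
-- K_{p+1} together with A_p for p ≥ 1. It resolves the kernel of R → k, and K_1 maps to 𝔪 through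
-- its differential.
lemma isBasedRes_twist (hI : RingHom.ker φ = I)
    (hsurj : ∀ r ∈ IsLocalRing.maximalIdeal R, ∃ q ∈ n, φ q = r) :
    IsBasedRes (S := Q)
      (M := (ModuleCat.restrictScalars φ).obj (ModuleCat.of R (IsLocalRing.maximalIdeal R)))
      (fun p ↦ {x | twistWt wtC wt x = p + 2})
      (gradedBd (fun p ↦ {x | twistWt wtC wt x = p + 2}) (twistD dC d θ))
      (fun x ↦ twistAug φ hmem x.1) := by
  refine isBasedRes_of_graded (fun p x hx ↦ twistD_mem hB hC hθ (p + 1) x hx)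
    (fun p x hx ↦ ext_twistD_twistD hrel hB hC p x hx) ?_ ?_ ?_
    (fun p v hv h ↦ exists_of_twistD_eq_zero hrel hB hC hθ p v hv h)
  · intro x hx
    refine Subtype.ext ?_
    cases x with
    | inl c =>
      have h := coe_ext_twistAug (B := B) hmem (dC c) 0
      rw [map_zero, add_zero, hC.sq] at h
      exact h.trans (map_zero φ)
    | inr b =>
      have hb : wt b = 2 := Nat.succ_injective hx
      have h := coe_ext_twistAug (B := B) hmem (θ b) (d b)
      have hd : d b = 0 := eq_zero_of_mem_Homog hB one_lt_two fun x hx ↦ by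
        have := hB.lowers b x hx
        change wt x = 1
        omega
      have h1 := hrel b
      rw [hd, map_zero, zero_add] at h1
      rw [h1, add_comm, Finsupp.single_eq_same] at h
      refine h.trans ?_
      have := hB.delta_mem b
      rwa [← hI] at this
  · intro y
    obtain ⟨q, hq, hq'⟩ := hsurj y.1 y.2
    obtain ⟨v, hv, hv'⟩ := (hC.mem_iff q).2 hq
    refine ⟨push Sum.inl v + push Sum.inr 0, push_add_mem hv (Submodule.zero_mem _),
      Subtype.ext ?_⟩
    refine (coe_ext_twistAug hmem v 0).trans ?_
    rw [hv', Finsupp.single_eq_same, hq']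
  · intro v hv h
    obtain ⟨y, hy, z, hz, rfl⟩ := exists_push_add hv
    obtain rfl := eq_zero_of_mem_Homog hB one_lt_two hz
    have h1 := (coe_ext_twistAug hmem y 0).symm.trans (congrArg Subtype.val h)
    -- A zero augmentation means that the differential of `y` is r c₀ with r ∈ I, hence r = δ(z). By
    -- the twisting relation y - θ z is a cycle of the Koszul complex, and therefore bounds.
    obtain ⟨z, hz, hz'⟩ := (hB.mem_iff (ext dC y c₀)).1 (hI ▸ h1)
    have h2 : ext d z = 0 := eq_zero_of_mem_Homog hB one_lt_two (ext_Homog hB hz)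
    have h3 := ext_twist_rel hrel z
    rw [h2, map_zero, zero_add, hz'] at h3
    have h4 : ext dC y = Finsupp.single c₀ (ext dC y c₀) := by
      ext c
      by_cases hc : c = c₀
      · rw [hc, Finsupp.single_eq_same]
      · rw [Finsupp.single_eq_of_ne hc]
        by_contra hne
        exact hc ((hC.wt_eq_one c).1 (ext_lowers hC.lowers hy (Finsupp.mem_support_iff.2 hne)))
    obtain ⟨y', hy', h5⟩ := hC.exact 2 le_rfl (y - ext θ z)
      (Submodule.sub_mem _ hy (ext_theta_mem hθ hz)) (by rw [map_sub, h3, ← h4, sub_self])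
    exact ⟨_, push_add_mem hy' hz, by rw [ext_twistD, h5, sub_add_cancel, h2]⟩

end Twist

/-! ### First syzygies, and compatibilities of pushforward. -/

section Truncate

variable {S : Type u} [CommRing S] {M N : Type u} [AddCommGroup M] [Module S M] [AddCommGroup N]
  [Module S N] {ι : ℕ → Type u} {bd : ∀ n, ι (n + 1) → (ι n →₀ S)} {aug : ι 0 → M}

/-- The resolution of a first syzygy. -/
lemma IsBasedRes.truncate (h : IsBasedRes ι bd aug) (j : N →ₗ[S] (ι 0 →₀ S))
    (hj : Function.Injective j) (hrange : ∀ v, ext (Q := S) aug v = 0 ↔ ∃ y, j y = v)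
    (aug' : ι 1 → N) (haug : ∀ x, j (aug' x) = bd 0 x) :
    IsBasedRes (fun n ↦ ι (n + 1)) (fun n ↦ bd (n + 1)) aug' := by
  have key (v : ι 1 →₀ S) : j (ext aug' v) = ext (bd 0) v := by
    rw [map_ext]
    exact ext_congr fun x _ ↦ haug x
  refine ⟨fun n ↦ h.sq (n + 1), fun x ↦ hj ?_, fun y ↦ ?_, fun v hv ↦ ?_,
    fun n ↦ h.exact_succ (n + 1)⟩
  · rw [key, h.sq, map_zero]
  · obtain ⟨u, hu⟩ := h.exact_zero (j y) ((hrange _).2 ⟨y, rfl⟩)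
    exact ⟨u, hj (by rw [key, hu])⟩
  · exact h.exact_succ 0 v (by rw [← key, hv, map_zero])

lemma ext_single_one {X Y : Type*} (f : X → Y) (v : X →₀ S) :
    ext (fun x ↦ Finsupp.single (f x) (1 : S)) v = push f v := by
  induction v using Finsupp.induction_linear with
  | zero => simp
  | add v w hv hw => simp only [map_add, hv, hw]
  | single x q => simp

lemma push_push {X Y Z : Type*} (f : X → Y) (g : Y → Z) (v : X →₀ S) :
    push g (push f v) = push (fun x ↦ g (f x)) v := Finsupp.mapDomain_comp.symm

lemma redCoeff_push {k : Type u} [CommRing k] (g : S →+* k) {X Y : Type u} (f : X → Y) (v : X →₀ S) :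
    redCoeff g Y (push f v) = push f (redCoeff g X v) := by
  induction v using Finsupp.induction_linear with
  | zero => simp
  | add v w hv hw => simp only [map_add, hv, hw]
  | single x q => simp only [push_single, redCoeff_single]

end Truncate

/-! ### The twisted sum inside the bar construction. -/

section TwistWord

variable {Q : Type u} [CommRing Q] {B C : Type u} {wt : B → ℕ} {wtC : C → ℕ}
  {d : B → (B →₀ Q)} {dC : C → (C →₀ Q)} {θ : B → (C →₀ Q)} {δ : B → Q} {c₀ : C}
  {m : List (B ⊕ C) → ((B ⊕ C) →₀ Q)}

/-- The words of the bar construction given by the twisted sum. -/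
def twistWord (c₀ : C) : C ⊕ B → List (B ⊕ C) :=
  Sum.elim (fun c ↦ [Sum.inr c]) fun b ↦ [Sum.inl b, Sum.inr c₀]

lemma twistWord_injective : Function.Injective (twistWord (B := B) c₀) := by
  rintro (c | b) (c' | b') h <;> simp_all [twistWord]

lemma twistWord_mem (hc₀ : wtC c₀ = 1) {p : ℕ} {x : C ⊕ B} (hx : twistWt wtC wt x = p + 1) :
    twistWord c₀ x ∈ Words (sumCl B C) (Sum.elim wt wtC) p := by
  cases x with
  | inl c => exact singleton_mem_Words.2 ⟨by simp, hx⟩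
  | inr b =>
    have hx : wt b + 1 = p + 1 := hx
    have h := concat_mem_Words (wt := wt) hc₀ [b]
    have hb : wordWt wt [b] = p := by simpa using hx
    rwa [hb] at h

lemma coder_pair {L : Type*} {wt : L → ℕ} {m : List L → (L →₀ Q)} (h0 : m [] = 0) (x y : L) :
    coder wt m [x, y] = ins Q [] [y] (m [x]) + ins Q [] [] (m [x, y]) +
      sgn Q wt [x] • ins Q [x] [] (m [y]) := by
  simp [coder, splitSum_cons, splitSum_nil, h0]

variable (H : ExactSystem (sumCl B C) (Sum.elim wt wtC) (Sum.elim δ 0) m)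

include H in
lemma exists_theta (hc₀ : wtC c₀ = 1) : ∃ θ : B → (C →₀ Q),
    (∀ b, m [Sum.inl b, Sum.inr c₀] = push Sum.inr (θ b)) ∧ ∀ b, θ b ∈ Homog Q wtC (wt b) := by
  have h (b : B) : ∃ y ∈ Homog Q wtC (wt b), push Sum.inr y = m [Sum.inl b, Sum.inr c₀] := by
    refine exists_push_inr (wt := wt) fun x hx ↦ ?_
    have h1 := H.adm _ x hx
    refine ⟨?_, h1.2.2 (by simp)⟩
    have h2 := h1.1
    simp [hc₀] at h2
    exact h2
  choose θ hθ hθ' using h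
  exact ⟨θ, fun b ↦ (hθ' b).symm, hθ⟩

variable (h1 : ∀ b, m [Sum.inl b] = push Sum.inl (d b)) (h2 : ∀ c, m [Sum.inr c] = push Sum.inr (dC c))
  (hd₀ : dC c₀ = 0) (hθ : ∀ b, m [Sum.inl b, Sum.inr c₀] = push Sum.inr (θ b))

include H h1 h2 hd₀ hθ

/-- The words c and b c₀ are stable under the coderivation, because `c₀` has zero differential: D(b
c₀) consists of d(b) c₀ and the single letters of θ(b). -/
lemma coder_twistWord (x : C ⊕ B) :
    coder (Sum.elim wt wtC) m (twistWord c₀ x) = push (twistWord c₀) (twistD dC d θ x) := by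
  have h0 : m [] = 0 := H.lowersWt.nil
  cases x with
  | inl c =>
    refine (coder_singleton h0 (Sum.inr c)).trans ?_
    rw [h2]
    exact (push_push _ _ _).trans (push_push Sum.inl (twistWord c₀) (dC c)).symm
  | inr b =>
    refine (coder_pair h0 (Sum.inl b) (Sum.inr c₀)).trans ?_
    rw [h2, hd₀, map_zero, map_zero, smul_zero, add_zero, h1, hθ]
    refine Eq.trans ?_ (map_add _ _ _).symm
    exact congrArg₂ (· + ·)
      ((push_push _ _ _).trans (push_push Sum.inr (twistWord c₀) (d b)).symm)
      ((push_push _ _ _).trans (push_push Sum.inl (twistWord c₀) (θ b)).symm)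

/-- This is the Stasheff relation at the word b c₀, whose curvature is δ(b) c₀. -/
lemma theta_rel (b : B) : ext θ (d b) + ext dC (θ b) = Finsupp.single c₀ (δ b) := by
  have h3 := H.rel [Sum.inl b, Sum.inr c₀] (good_cons (by simp) (good_of_length_le (by simp)))
  have h4 : coder (Sum.elim wt wtC) m [Sum.inl b, Sum.inr c₀] = _ :=
    coder_pair H.lowersWt.nil (Sum.inl b) (Sum.inr c₀)
  rw [Rel, h4, h2, hd₀, map_zero, map_zero, smul_zero, add_zero, h1, hθ, map_add, ext_ins, ext_ins,
    curv_pair] at h3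
  refine push_injective (Q := Q) (f := (Sum.inr : C → B ⊕ C)) Sum.inr_injective ?_
  have h5 : ext (fun x ↦ m ([] ++ x :: [])) (push Sum.inr (θ b)) = push Sum.inr (ext dC (θ b)) :=
    ext_push_inr h2 (θ b)
  have h6 : ext (fun x ↦ m ([] ++ x :: [Sum.inr c₀])) (push Sum.inl (d b)) =
      push Sum.inr (ext θ (d b)) := by
    rw [ext_push, map_ext]
    exact ext_congr fun b _ ↦ hθ b
  rw [h5, h6] at h3
  rw [map_add, h3, push_single]
  simp

end TwistWord

/-! ### The maximal ideal resolved over R by the truncated bar resolution of k. -/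

section MaximalIdeal

open IsLocalRing

variable {Q R : Type u} [CommRing Q] [IsRegularLocalRing Q] [CommRing R] [IsLocalRing R]
  {φ : Q →+* R} (hφ : Function.Surjective φ) {A : MinimalFreeResolution φ}
  {C : Type u} {wtC : C → ℕ} {dC : C → (C →₀ Q)} {c₀ : C}
  {m : List (A.Letter ⊕ C) → ((A.Letter ⊕ C) →₀ Q)}
  (hC : IsKoszulLike (maximalIdeal Q) (maximalIdeal Q) (maximalIdeal Q ^ 2) C wtC dC c₀)

include hC in
lemma IsKoszulLike.d_eq_zero : dC c₀ = 0 := by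
  refine Finsupp.support_eq_empty.1 (Finset.eq_empty_of_forall_notMem fun x hx ↦ ?_)
  have h1 := hC.lowers c₀ x hx
  have h2 := hC.one_le x
  have h3 := (hC.wt_eq_one c₀).2 rfl
  omega

include hC in
lemma IsKoszulLike.d_eq_single {c : C} (hc : wtC c = 2) :
    dC c = Finsupp.single c₀ (dC c c₀) := by
  ext x
  by_cases hx : x = c₀
  · rw [hx, Finsupp.single_eq_same]
  · rw [Finsupp.single_eq_of_ne hx]
    by_contra hne
    have := hC.lowers c x (Finsupp.mem_support_iff.2 hne)
    exact hx ((hC.wt_eq_one x).1 (by omega))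

include hφ in
lemma map_mem_maximalIdeal_iff (q : Q) : φ q ∈ maximalIdeal R ↔ q ∈ maximalIdeal Q := by
  rw [← ker_residue_comp hφ, ← residue_eq_zero_iff]
  rfl

include hφ hC in
/-- The resolution of the maximal ideal over `R`. -/
lemma isBasedRes_maximalIdeal (hmem : ∀ c, φ (dC c c₀) ∈ maximalIdeal R)
    (H : ExactSystem (sumCl A.Letter C) (Sum.elim A.wt wtC) (Sum.elim A.delta 0) m)
    (h2 : ∀ c, m [Sum.inr c] = push Sum.inr (dC c)) :
    ∃ aug : Words (sumCl A.Letter C) (Sum.elim A.wt wtC) 1 → ModuleCat.of R (maximalIdeal R),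
      IsBasedRes (S := R) (M := ModuleCat.of R (maximalIdeal R))
        (fun n ↦ Words (sumCl A.Letter C) (Sum.elim A.wt wtC) (n + 1))
        (fun n ↦ gradedBd (Words (sumCl A.Letter C) (Sum.elim A.wt wtC))
          (barBd φ (Sum.elim A.wt wtC) m) (n + 1)) aug ∧
      ∀ c (hc : [Sum.inr c] ∈ Words (sumCl A.Letter C) (Sum.elim A.wt wtC) 1),
        aug ⟨[Sum.inr c], hc⟩ = (⟨φ (dC c c₀), hmem c⟩ : maximalIdeal R) := by
  have hF := isBasedRes_bar (M := ModuleCat.of R (ResidueField R)) hφ A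
    (hC.isModLetters_residue hφ) H h2
  have hc₀ : wtC c₀ = 1 := (hC.wt_eq_one c₀).2 rfl
  let w₀ : Words (sumCl A.Letter C) (Sum.elim A.wt wtC) 0 :=
    ⟨[Sum.inr c₀], singleton_mem_Words.2 ⟨by simp, hc₀⟩⟩
  -- In degree 0 the bar resolution of k has the single basis word c₀, so it is R there, and the
  -- kernel of its augmentation is 𝔪.
  have hw₀ (w : Words (sumCl A.Letter C) (Sum.elim A.wt wtC) 0) : w = w₀ := by
    obtain ⟨x | c, h, hx, hx'⟩ := eq_singleton_of_mem_Words H.one_le H.two_le zero_le_one w.2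
    · simp at hx
    · exact Subtype.ext (h.trans (by rw [(hC.wt_eq_one c).1 hx']))
  have hv (v : Words (sumCl A.Letter C) (Sum.elim A.wt wtC) 0 →₀ R) :
      v = Finsupp.single w₀ (v w₀) := by
    ext w
    rw [hw₀ w, Finsupp.single_eq_same]
  let j : maximalIdeal R →ₗ[R] (Words (sumCl A.Letter C) (Sum.elim A.wt wtC) 0 →₀ R) :=
    Finsupp.lsingle w₀ ∘ₗ (maximalIdeal R).subtype
  have hj : Function.Injective j :=
    (Finsupp.single_injective w₀).comp Subtype.val_injective
  have hrange (v) : ext (Q := R) (fun w : Words (sumCl A.Letter C) (Sum.elim A.wt wtC) 0 ↦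
      wordAug (Sum.elim 0 (koszulAug φ c₀) : A.Letter ⊕ C → ModuleCat.of R (ResidueField R)) w.1) v
        = 0 ↔ ∃ y, j y = v := by
    have h3 : koszulAug φ c₀ c₀ = (1 : ResidueField R) := if_pos rfl
    have h4 : ext (Q := R) (fun w : Words (sumCl A.Letter C) (Sum.elim A.wt wtC) 0 ↦
      wordAug (Sum.elim 0 (koszulAug φ c₀) : A.Letter ⊕ C → ModuleCat.of R (ResidueField R)) w.1) v
        = residue R (v w₀) := by
      conv_lhs => rw [hv v]
      refine (Finsupp.linearCombination_single ..).trans ?_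
      change v w₀ • koszulAug φ c₀ c₀ = _
      rw [h3]
      exact mul_one (residue R (v w₀))
    rw [h4, residue_eq_zero_iff]
    refine ⟨fun h ↦ ⟨⟨_, h⟩, (hv v).symm⟩, ?_⟩
    rintro ⟨y, rfl⟩
    change (Finsupp.single w₀ y.1) w₀ ∈ _
    rw [Finsupp.single_eq_same]
    exact y.2
  choose aug haug using fun x ↦ (hrange _).1 (hF.aug_bd x)
  refine ⟨aug, hF.truncate j hj hrange aug haug, fun c hc ↦ hj ((haug _).trans ?_)⟩
  refine push_injective Subtype.val_injective ?_
  rw [push_gradedBd H.barBd_mem]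
  change _ = push Subtype.val (Finsupp.single w₀ (φ (dC c c₀)))
  rw [push_single, barBd, coder_singleton H.lowersWt.nil, h2,
    hC.d_eq_single (singleton_mem_Words.1 hc).2, push_single, ins_single, redCoeff_single,
    Finsupp.single_eq_same]
  rfl

end MaximalIdeal

/-! ### The comparison map as an inclusion of bases. -/

section TwistIncl

variable {Q R k : Type u} [CommRing Q] [CommRing R] [Field k] {φ : Q →+* R} {g : R →+* k}
  {B C : Type u} {wt : B → ℕ} {wtC : C → ℕ}
  {d : B → (B →₀ Q)} {dC : C → (C →₀ Q)} {θ : B → (C →₀ Q)} {δ : B → Q} {c₀ : C}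
  {m : List (B ⊕ C) → ((B ⊕ C) →₀ Q)}

/-- The inclusion of the basis of the twisted sum in the basis of the bar construction. -/
def twistIncl (hc₀ : wtC c₀ = 1) (n : ℕ) (x : {x | twistWt wtC wt x = n + 2}) :
    Words (sumCl B C) (Sum.elim wt wtC) (n + 1) :=
  ⟨twistWord c₀ x.1, twistWord_mem hc₀ x.2⟩

lemma twistIncl_injective (hc₀ : wtC c₀ = 1) (n : ℕ) :
    Function.Injective (twistIncl (wt := wt) hc₀ n) := fun _ _ h ↦
  Subtype.ext (twistWord_injective (congrArg Subtype.val h))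

/-- The comparison map from the twisted sum to the bar construction. -/
noncomputable def twistMap (R : Type u) [CommRing R] (hc₀ : wtC c₀ = 1) (n : ℕ)
    (x : {x | twistWt wtC wt x = n + 2}) :
    Words (sumCl B C) (Sum.elim wt wtC) (n + 1) →₀ R :=
  Finsupp.single (twistIncl hc₀ n x) 1

lemma ext_twistMap (hc₀ : wtC c₀ = 1) (n : ℕ) (v : {x | twistWt wtC wt x = n + 2} →₀ R) :
    ext (twistMap (B := B) R hc₀ n) v = push (twistIncl hc₀ n) v := ext_single_one _ _

lemma ext_redBd_twistMap (hc₀ : wtC c₀ = 1) (n : ℕ) (v : {x | twistWt wtC wt x = n + 2} →₀ k) :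
    ext (redBd g (twistMap (B := B) R hc₀ n)) v = push (twistIncl hc₀ n) v := by
  have h : redBd g (twistMap (B := B) (wt := wt) R hc₀ n) =
      fun x ↦ Finsupp.single (twistIncl hc₀ n x) 1 := by
    funext x
    rw [redBd, twistMap, redCoeff_single, map_one]
  rw [h, ext_single_one]

lemma push_val_twistIncl {S : Type u} [CommRing S] (hc₀ : wtC c₀ = 1) (n : ℕ)
    (v : {x | twistWt wtC wt x = n + 2} →₀ S) :
    push Subtype.val (push (twistIncl (B := B) hc₀ n) v) =
      push (twistWord c₀) (push Subtype.val v) :=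
  (push_push _ _ _).trans (push_push Subtype.val (twistWord c₀) v).symm

variable (H : ExactSystem (sumCl B C) (Sum.elim wt wtC) (Sum.elim δ 0) m)
  (h1 : ∀ b, m [Sum.inl b] = push Sum.inl (d b)) (h2 : ∀ c, m [Sum.inr c] = push Sum.inr (dC c))
  (hd₀ : dC c₀ = 0) (hθ : ∀ b, m [Sum.inl b, Sum.inr c₀] = push Sum.inr (θ b))
  (hD : ∀ p, ∀ x : C ⊕ B, twistWt wtC wt x = p + 2 →
    twistD dC d θ x ∈ Finsupp.supported Q Q {x | twistWt wtC wt x = p + 1})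

include H h1 h2 hd₀ hθ hD in
lemma twistMap_comm (hc₀ : wtC c₀ = 1) (n : ℕ) (x : {x | twistWt wtC wt x = n + 1 + 2}) :
    ext (twistMap R hc₀ n)
        (redCoeff φ _ (gradedBd (fun p ↦ {x | twistWt wtC wt x = p + 2}) (twistD dC d θ) n x)) =
      ext (gradedBd (Words (sumCl B C) (Sum.elim wt wtC)) (barBd φ (Sum.elim wt wtC) m) (n + 1))
        (twistMap R hc₀ (n + 1) x) := by
  refine push_injective Subtype.val_injective ?_
  rw [ext_twistMap, push_val_twistIncl, ← redCoeff_push,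
    push_gradedBd (P := fun p ↦ {x | twistWt wtC wt x = p + 2}) (fun n x hx ↦ hD (n + 1) x hx),
    ← redCoeff_push, ← coder_twistWord H h1 h2 hd₀ hθ, twistMap, Finsupp.linearCombination_single,
    one_smul, push_gradedBd H.barBd_mem]
  rfl

end TwistIncl

/-! ### Minimality implies injectivity of the change of rings map. -/

section ChangeOfRings

open IsLocalRing

variable {Q R : Type u} [CommRing Q] [IsRegularLocalRing Q] [CommRing R] [IsLocalRing R]
  {φ : Q →+* R} (hφ : Function.Surjective φ) {A : MinimalFreeResolution φ}
  {mB : List A.Letter → (A.Letter →₀ Q)}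
  {C : Type u} {wtC : C → ℕ} {dC : C → (C →₀ Q)} {c₀ : C} {θ : A.Letter → (C →₀ Q)}
  {m : List (A.Letter ⊕ C) → ((A.Letter ⊕ C) →₀ Q)}
  (hC : IsKoszulLike (maximalIdeal Q) (maximalIdeal Q) (maximalIdeal Q ^ 2) C wtC dC c₀)
  (hc₀ : wtC c₀ = 1)
  (H : ExactSystem (sumCl A.Letter C) (Sum.elim A.wt wtC) (Sum.elim A.delta 0) m)
  (h1 : ∀ b, m [Sum.inl b] = push Sum.inl (A.bd b)) (h2 : ∀ c, m [Sum.inr c] = push Sum.inr (dC c))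
  (hθ : ∀ b, m [Sum.inl b, Sum.inr c₀] = push Sum.inr (θ b))
  (hθ' : ∀ b, θ b ∈ Homog Q wtC (A.wt b))

include hφ hC H h1 h2 hθ hθ' in
/-- The resolutions of the maximal ideal over `Q` and over `R`, and the comparison map. -/
lemma exists_maximalIdeal_comparison :
    ∃ (augG : {x | twistWt wtC A.wt x = 0 + 2} →
        (ModuleCat.restrictScalars φ).obj (ModuleCat.of R (maximalIdeal R)))
      (augF : Words (sumCl A.Letter C) (Sum.elim A.wt wtC) 1 → ModuleCat.of R (maximalIdeal R)),
      IsBasedRes (S := Q)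
        (M := (ModuleCat.restrictScalars φ).obj (ModuleCat.of R (maximalIdeal R)))
        (fun p ↦ {x | twistWt wtC A.wt x = p + 2})
        (gradedBd (fun p ↦ {x | twistWt wtC A.wt x = p + 2}) (twistD dC A.bd θ)) augG ∧
      IsBasedRes (S := R) (M := ModuleCat.of R (maximalIdeal R))
        (fun n ↦ Words (sumCl A.Letter C) (Sum.elim A.wt wtC) (n + 1))
        (fun n ↦ gradedBd (Words (sumCl A.Letter C) (Sum.elim A.wt wtC))
          (barBd φ (Sum.elim A.wt wtC) m) (n + 1)) augF ∧
      ∀ x, ext (Q := R) augF (twistMap R hc₀ 0 x) = augG x := by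
  have hmem (c : C) : φ (dC c c₀) ∈ maximalIdeal R :=
    (map_mem_maximalIdeal_iff hφ _).2 (hC.minimal c c₀)
  obtain ⟨augF, hF, haugF⟩ := isBasedRes_maximalIdeal hφ hC hmem H h2
  refine ⟨_, augF, isBasedRes_twist (theta_rel H h1 h2 hC.d_eq_zero hθ) A.isAlgLetters hC hθ' hmem
    rfl fun r hr ↦ ?_, hF, ?_⟩
  · obtain ⟨q, rfl⟩ := hφ r
    exact ⟨q, (map_mem_maximalIdeal_iff hφ q).1 hr, rfl⟩
  · rintro ⟨c | b, hx⟩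
    · refine (Finsupp.linearCombination_single ..).trans ((one_smul R _).trans ?_)
      exact haugF c _
    · have hx : A.wt b + 1 = 2 := hx
      have := A.isAlgLetters.two_le b
      omega

include hφ in
/-- The change of rings map of the maximal ideal is injective if there is a minimal A-infinity
structure. -/
lemma injective_changeOfRings_of_isMinimal (hI : RingHom.ker φ ≤ maximalIdeal Q ^ 2)
    (s : AInfinityStructure A.complex A.zeroEquiv) (hs : s.IsMinimal) (n : ℕ) :
    Function.Injective
      (changeOfRings φ (residue R) (ModuleCat.of R (maximalIdeal R)) n).hom := by
  have hm := isAInf_wordVal s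
  have hmin := hm.minimal_of_length ((s.isMinimal_iff A.basis).1 hs)
  obtain ⟨C, wtC, dC, c₀, m, hC, H, h1, h2⟩ := exists_koszul_system hφ hm
  have h3 := coder_mem_of_minimal hI hm hmin hC H h1 h2
  have hc₀ : wtC c₀ = 1 := (hC.wt_eq_one c₀).2 rfl
  have h1' (b : A.Letter) : m [Sum.inl b] = push Sum.inl (A.bd b) := by
    rw [← hm.single b, ← h1 [b]]; rfl
  obtain ⟨θ, hθ, hθ'⟩ := exists_theta H hc₀
  obtain ⟨augG, augF, hG, hF, haug⟩ :=
    exists_maximalIdeal_comparison hφ hC hc₀ H h1' h2 hθ hθ'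
  refine injective_changeOfRings φ (residue R) (twistMap R hc₀) hG hF haug
    (twistMap_comm H h1' h2 hC.d_eq_zero hθ (twistD_mem A.isAlgLetters hC hθ') hc₀) n fun x ⟨y, hy⟩ ↦ ?_
  -- The bar differential vanishes after reduction to the residue field, so a vector whose image
  -- bounds has image zero. Reduction keeps the comparison map an inclusion of bases, hence the
  -- vector is zero.
  have h0 : ext (Q := ResidueField R) (redBd (residue R) (gradedBd (Words (sumCl A.Letter C) (Sum.elim A.wt wtC))
      (barBd φ (Sum.elim A.wt wtC) m) (n + 1))) = 0 := by
    refine (ext_eq_zero_iff _).2 fun w ↦ (redCoeff_eq_zero _).2 ?_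
    rw [gradedBd_mem_CoeffIn_iff H.barBd_mem, barBd_mem_CoeffIn_iff, ker_residue_comp hφ]
    exact h3 _ w.2.1
  rw [ext_redBd_twistMap] at hy
  have hy' : push (twistIncl hc₀ n) x = 0 := hy.symm.trans (by rw [h0]; rfl)
  exact push_injective (twistIncl_injective hc₀ n) (hy'.trans (map_zero _).symm)

end ChangeOfRings

/-! ### Injectivity of the change of rings map implies minimality. -/

section Injective

open IsLocalRing

variable {Q R : Type u} [CommRing Q] [IsRegularLocalRing Q] [CommRing R] [IsLocalRing R]
  {φ : Q →+* R}

lemma mem_CoeffIn_of_redCoeff_eq_zero (hφ : Function.Surjective φ) {X : Type u} {v : X →₀ Q}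
    (h : redCoeff ((residue R).comp φ) X v = 0) : v ∈ CoeffIn X (maximalIdeal Q) := by
  rw [← ker_residue_comp hφ]
  exact (redCoeff_eq_zero _).1 h

/-- An A-infinity structure is minimal if the change of rings map of the maximal ideal is
injective. -/
lemma isMinimal_of_injective_changeOfRings (hφ : Function.Surjective φ)
    (hI : RingHom.ker φ ≤ maximalIdeal Q ^ 2) {A : MinimalFreeResolution φ}
    (hinj : ∀ n, Function.Injective
      (changeOfRings φ (residue R) (ModuleCat.of R (maximalIdeal R)) n).hom)
    (s : AInfinityStructure A.complex A.zeroEquiv) : s.IsMinimal := by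
  have hm := isAInf_wordVal s
  obtain ⟨C, wtC, dC, c₀, m, hC, H, h1, h2⟩ := exists_koszul_system hφ hm
  set mB := wordVal s.m A.basis
  have hc₀ : wtC c₀ = 1 := (hC.wt_eq_one c₀).2 rfl
  have h1' (b : A.Letter) : m [Sum.inl b] = push Sum.inl (A.bd b) := by
    rw [← hm.single b, ← h1 [b]]; rfl
  obtain ⟨θ, hθ, hθ'⟩ := exists_theta H hc₀
  obtain ⟨augG, augF, hG, hF, haug⟩ :=
    exists_maximalIdeal_comparison hφ hC hc₀ H h1' h2 hθ hθ'
  have hletter := singleton_mem hm hC h1 h2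
  have hclosed := mem_of_ext_closed_mem (A := A) hC h2
  have hD : ∀ p, ∀ x : C ⊕ A.Letter, twistWt wtC A.wt x = p + 2 →
    twistD dC A.bd θ x ∈ Finsupp.supported Q Q {x | twistWt wtC A.wt x = p + 1} :=
    twistD_mem A.isAlgLetters hC hθ'
  -- Words with one open and one closed letter involve the algebra structure only through its
  -- differential. So θ is minimal without any assumption on the higher operations, and the twisted
  -- sum is a minimal complex.
  have hθmem (b : A.Letter) : θ b ∈ CoeffIn C (maximalIdeal Q) := by
    rw [← push_mem_CoeffIn_iff (Sum.inr_injective (α := A.Letter)), ← hθ]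
    exact H.mem_CoeffIn_pair (delta_mem_sq hI) hletter hclosed _ _ (by simp) (by simp)
  have hDmem (x : C ⊕ A.Letter) : twistD dC A.bd θ x ∈ CoeffIn _ (maximalIdeal Q) := by
    cases x with
    | inl c => exact (push_mem_CoeffIn_iff Sum.inl_injective).2 (hC.minimal c)
    | inr b =>
      exact Submodule.add_mem _ ((push_mem_CoeffIn_iff Sum.inr_injective).2 (A.bd_mem b))
        ((push_mem_CoeffIn_iff Sum.inl_injective).2 (hθmem b))
  have hmin (p : ℕ) (x : {x | twistWt wtC A.wt x = p + 1 + 2}) :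
      redBd ((residue R).comp φ)
        (gradedBd (fun p ↦ {x | twistWt wtC A.wt x = p + 2}) (twistD dC A.bd θ) p) x = 0 := by
    refine (redCoeff_eq_zero _).2 ?_
    rw [ker_residue_comp hφ, gradedBd_mem_CoeffIn_iff (P := fun p ↦ {x | twistWt wtC A.wt x = p + 2})
      (fun n x hx ↦ hD (n + 1) x hx)]
    exact hDmem x
  -- The inductive step on the weight of an open word, for which injectivity is used in a single
  -- degree.
  have key (v : List A.Letter) (hv : ∀ w, wordWt A.wt w < wordWt A.wt v →
      mB w ∈ CoeffIn A.Letter (maximalIdeal Q)) : mB v ∈ CoeffIn A.Letter (maximalIdeal Q) := by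
    rcases v with _ | ⟨b, v⟩
    · rw [(hm.adm []).nil]
      exact Submodule.zero_mem _
    obtain ⟨n, hn⟩ : ∃ n, wordWt A.wt (b :: v) = n + 2 :=
      ⟨b.1 + wordWt A.wt v, by rw [wordWt_cons]; exact Nat.add_right_comm ..⟩
    generalize b :: v = v at *
    have hvm : wordWt (Sum.elim A.wt wtC) (v.map Sum.inl) = wordWt A.wt v :=
      wordWt_map (fun _ ↦ rfl) v
    have hopen (w : List (A.Letter ⊕ C)) (hw : ¬ HasClosed (sumCl A.Letter C) w)
        (hw' : wordWt (Sum.elim A.wt wtC) w < wordWt (Sum.elim A.wt wtC) (v.map Sum.inl)) :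
        m w ∈ CoeffIn _ (maximalIdeal Q) := by
      obtain ⟨u, rfl⟩ := exists_map_inl_of_not_hasClosed hw
      rw [h1, push_mem_CoeffIn_iff Sum.inl_injective]
      rw [hvm, wordWt_map (f := Sum.inl) (wt := A.wt) (wt' := Sum.elim A.wt wtC) (fun _ ↦ rfl)] at hw'
      exact hv u hw'
    -- Minimality of lighter open words gives minimality of closed words up to the weight of `v`.
    -- Modulo 𝔫 the boundary D(v c₀) then consists of m(v) c₀ and of single closed letters.
    have hdiff := H.coder_concat_sub_mem (J := maximalIdeal Q) (not_hasClosed_map_inl v)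
      (c₀ := Sum.inr c₀) (by simp) hc₀ hopen
      (H.mem_CoeffIn_of_wordWt_le (delta_mem_sq hI) hletter hclosed _ hopen)
    have hw := concat_mem_Words (wt := A.wt) hc₀ v
    rw [hn] at hw
    obtain ⟨y, hy, hy'⟩ : ∃ y ∈ Homog Q wtC (n + 2),
        push Sum.inr y = m (v.map Sum.inl ++ [Sum.inr c₀]) := by
      refine exists_push_inr (wt := A.wt) fun x hx ↦ ?_
      have h3 := H.adm _ x hx
      have h4 : wordWt _ _ = n + 2 + 1 := hw.2.2
      exact ⟨by omega, h3.2.2 hw.2.1⟩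
    have hz : mB v ∈ Homog Q A.wt (n + 1) := fun x hx ↦ by
      have := (hm.adm v x hx).1
      change A.wt x = n + 1
      omega
    obtain ⟨u, hu⟩ := exists_push_val (P := fun p ↦ {x | twistWt wtC A.wt x = p + 2}) (n := n)
      (push_add_mem hy hz)
    -- These two remaining terms are the image of a vector `u` of the twisted sum, with m(v) as its
    -- open component.
    have hins : ins Q [] [Sum.inr c₀] (m (v.map Sum.inl)) +
        ins Q [] [] (m (v.map Sum.inl ++ [Sum.inr c₀])) =
          push (twistWord c₀) (push Subtype.val u) := by
      rw [hu, h1, ← hy', add_comm]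
      refine Eq.trans ?_ (map_add _ _ _).symm
      exact congrArg₂ (· + ·)
        ((push_push _ _ _).trans (push_push Sum.inl (twistWord c₀) y).symm)
        ((push_push _ _ _).trans (push_push Sum.inr (twistWord c₀) (mB v)).symm)
    rw [hins, ← ker_residue_comp hφ, ← redCoeff_eq_zero, map_sub, sub_eq_zero] at hdiff
    -- The image of `u` over the residue field is the boundary of the basis word v c₀. Injectivity
    -- therefore makes the reduction of `u` zero, and in particular m(v) has coefficients in 𝔫.
    have hzero := eq_zero_of_injective_changeOfRings φ (residue R) (twistMap R hc₀) hG hF haug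
      (twistMap_comm H h1' h2 hC.d_eq_zero hθ hD hc₀) n hmin (hinj n)
      (redCoeff ((residue R).comp φ) _ u)
      ⟨Finsupp.single ⟨_, hw⟩ 1, push_injective Subtype.val_injective (by
        rw [ext_redBd_twistMap, push_val_twistIncl, ← redCoeff_push, ← redCoeff_push, ← hdiff,
          Finsupp.linearCombination_single, one_smul, redBd, ← redCoeff_push,
          push_gradedBd H.barBd_mem, barBd, redCoeff_comp])⟩
    have hu' := mem_CoeffIn_of_redCoeff_eq_zero hφ hzero
    rw [← push_mem_CoeffIn_iff Subtype.val_injective, hu] at hu'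
    intro x
    rw [← push_add_apply_inr y (mB v) x]
    exact hu' _
  rw [s.isMinimal_iff A.basis]
  refine fun v _ ↦ ?_
  clear * - key
  induction hN : wordWt A.wt v using Nat.strong_induction_on generalizing v with
  | _ N ih =>
    subst hN
    exact key v fun w hw ↦ ih _ hw w rfl

end Injective


end GolodRing

/-! ### The equivalence of the six conditions. -/

theorem mainTheorem6 {Q R : Type u} [CommRing Q] [IsRegularLocalRing Q]
    [CommRing R] [IsLocalRing R] (φ : Q →+* R) (hφ : Function.Surjective φ)
    (hI : RingHom.ker φ ≤ IsLocalRing.maximalIdeal Q ^ 2)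
    (A : GolodRing.MinimalFreeResolution φ) :
    List.TFAE
      [ GolodRing.IsGolodRing φ,
        ∃ M : ModuleCat.{u} R, Nontrivial M ∧ GolodRing.IsGolodModule φ M,
        ∃ s : GolodRing.AInfinityStructure A.complex A.zeroEquiv, s.IsMinimal,
        ∀ s : GolodRing.AInfinityStructure A.complex A.zeroEquiv, s.IsMinimal,
        ∀ n : ℕ, Function.Injective
          (GolodRing.changeOfRings φ (IsLocalRing.residue R)
            (ModuleCat.of R (IsLocalRing.maximalIdeal R)) n).hom,
        ∀ n : ℕ, (n : WithBot ℕ∞) ≤ ringKrullDim Q + 1 →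
          PowerSeries.coeff n
              (GolodRing.poincareOver (ModuleCat.of R (IsLocalRing.ResidueField R))) =
            PowerSeries.coeff n
              (GolodRing.golodBound φ (ModuleCat.of R (IsLocalRing.ResidueField R))) ] := by
  tfae_have 1 → 2 := fun h ↦ ⟨_, inferInstanceAs (Nontrivial (IsLocalRing.ResidueField R)), h⟩
  tfae_have 2 → 4 := fun ⟨_, _, hM⟩ ↦ GolodRing.isMinimal_of_isGolodModule hφ hM
  tfae_have 4 → 3 := fun h ↦ GolodRing.exists_aInfinityStructure.elim fun s ↦ ⟨s, h s⟩
  tfae_have 3 → 1 := fun ⟨s, hs⟩ ↦ GolodRing.isGolodRing_of_isMinimal hφ hI s hs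
  tfae_have 1 → 6 := fun h n _ ↦ congrArg (PowerSeries.coeff n) h.2
  tfae_have 6 → 4 := GolodRing.isMinimal_of_coeff_eq hφ
  tfae_have 3 → 5 := fun ⟨s, hs⟩ ↦ GolodRing.injective_changeOfRings_of_isMinimal hφ hI s hs
  tfae_have 5 → 4 := GolodRing.isMinimal_of_injective_changeOfRings hφ hI
  tfae_finish
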